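/- **Setting.** Let $d\in\{2,3\}$, let $\Omega\subset\mathbb R^d$ be a nonempty open bounded convex polytope, $t_F>0$, $\nu,\mu>0$, $f\in C^0((0,t_F];L^2(\Omega)^d)$ and $g\in C^0((0,t_F];H(\mathrm{div};\Omega))$ with $\nabla\cdot g=0$. Let $(u,b,p,r)\in[C^1([0,t_F];H^1_0(\Omega)^d)]^2\times[C^0((0,t_F];L^2_0(\Omega))]^2$ satisfy $u(0)=u_0$, $b(0)=b_0$ and, for all $t\in(0,t_F]$, all $v,w\in H^1_0(\Omega)^d$ and all $q\in L^2_0(\Omega)$, $$\int_\Omega\partial_tu\cdot v+\nu\!\int_\Omega\!\nabla u:\nabla v+\int_\Omega(u\cdot\nabla)u\cdot v-\int_\Omega(b\cdot\nabla)b\cdot v-\int_\Omega(\nabla\cdot v)\,p=\int_\Omega f\cdot v,$$ $$\int_\Omega\partial_tb\cdot w+\mu\!\int_\Omega\!\nabla b:\nabla w+\int_\Omega(u\cdot\nabla)b\cdot w-\int_\Omega(b\cdot\nabla)u\cdot w-\int_\Omega(\nabla\cdot w)\,r=\int_\Omega g\cdot w,\qquad \int_\Omega(\nabla\cdot u)\,q=\int_\Omega(\nabla\cdot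 b)\,q=0.$$ **Mesh and spaces.** Let $\mathcal T_h$ be a matching simplicial mesh of $\Omega$ with faces $\mathcal F_h$ and regularity parameter $\sigma$ (each element $T$ contains a ball of diameter $\rho>0$ with $h_T\le\sigma\rho$, $h_T$ being the diameter of $T$), let $\mathcal F_T$ be the faces of $T$, and $n_{TF}$ the unit normal to $F\in\mathcal F_T$ pointing out of $T$. Let $k\ge0$, let $\pi^\ell_Y$ be the $L^2$-orthogonal projector onto the space $P^\ell(Y)$ of polynomials of total degree at most $\ell$ on $Y$ ($P^{-1}=\{0\}$), and $\mathcal{RTN}^{k+1}(T)=P^k(T)^d+x\,P^k(T)$, with interpolator $I_T$ onto it defined by $\pi^{k-1}_TI_Tv=\pi^{k-1}_Tv$ and $I_Tv\cdot n_{TF}=\pi^k_F(v\cdot n_{TF})$ for $F\in\mathcal F_T$. Let $\underline U_h$ be the space of families $\underline v_h=((v_T)_T,(v_F)_F)$ with $v_T\in\mathcal{RTN}^{k+1}(T)$ and $v_F\in P^k(F)^d$, $\underline U_{h,0}$ its subspace with $v_F=0$ for $F\subset\partial\Omega$, and $\underline P_{h,0}$ the space of families $\underline q_h=((q_T)_T,(q_F)_F)$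 with $q_T\in P^k(T)$, $q_F\in P^k(F)$, $\sum_T\int_Tq_T=0$. Write $v_h$ for the function equal to $v_T$ on each $T$, and set $\underline I_hv=((I_Tv)_T,(\pi^k_Fv)_F)$ for $v\in H^1(\Omega)^d$, and similarly $\underline I_T$ on one element. **Forms.** Let $(\underline w_h,\underline v_h)_{0,h}=\sum_T\big[\int_Tw_T\cdot v_T+h_T\sum_{F\in\mathcal F_T}\int_F(w_F-w_T)\cdot(v_F-v_T)\big]$, $\|\underline v_h\|_{0,h}^2=(\underline v_h,\underline v_h)_{0,h}$, $\|\underline v_h\|_{1,h}^2=\sum_T\big[\|\nabla v_T\|_{L^2(T)}^2+h_T^{-1}\sum_{F\in\mathcal F_T}\|v_F-v_T\|_{L^2(F)}^2\big]$, $j_{\alpha,h}(\underline w_h,\underline v_h)=\sum_T\alpha_T\sum_{F\in\mathcal F_T}\int_F(w_F-w_T)\cdot(v_F-v_T)$, $|\underline v_h|_{\alpha,h}^2=j_{\alpha,h}(\underline v_h,\underline v_h)$, $t_h(\underline w_h,\underline v_h,\underline z_h)=\sum_T\big[\int_T(w_T\cdot\nabla)v_T\cdot z_T+\frac12\sum_{F\in\mathcal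 F_T}\int_F(w_T\cdot n_{TF})(v_F-v_T)\cdot(z_F+z_T)\big]$, $B_h(\underline v_h,\underline q_h)=\sum_T\big[-\int_T(\nabla\cdot v_T)q_T+\sum_{F\in\mathcal F_T}\int_F(v_T\cdot n_{TF})q_F\big]$. Let $p_T\underline v_T\in P^{k+1}(T)^d$ be defined by $\int_T\nabla p_T\underline v_T:\nabla w=-\int_Tv_T\cdot\Delta w+\sum_{F\in\mathcal F_T}\int_Fv_F\cdot(\nabla w\,n_{TF})$ for all $w\in P^{k+1}(T)^d$ and $\int_Tp_T\underline v_T=\int_Tv_T$ if $k\ge1$, $\int_Tp_T\underline v_T=\sum_{F\in\mathcal F_T}\frac{d_{TF}}d\int_Fv_F$ if $k=0$, where $d_{TF}$ is the distance of the center of mass of $T$ from the hyperplane of $F$. Let $\delta_T\underline v_T=((\delta_T\underline v_T)_T,((\delta_T\underline v_T)_F)_F)=\underline I_Tp_T\underline v_T-\underline v_T$ and $a_h(\underline w_h,\underline v_h)=\sum_T\big[\int_T\nabla p_T\underline w_T:\nabla p_T\underline v_T+s_T(\underline w_T,\underline v_T)\big]$, where $s_T$ is a bilinear form of $(\delta_T\underline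 w_T,\delta_T\underline v_T)$ such that, for some $\eta\ge1$ and all $\underline v_T$, $\eta^{-1}s^0_T(\underline v_T)\le s_T(\underline v_T,\underline v_T)\le\eta\,s^0_T(\underline v_T)$, with $s^0_T(\underline v_T)=\mathrm{card}(\mathcal F_T)\frac{h_T^d}{|T|}h_T^{-2}\|(\delta_T\underline v_T)_T\|_{L^2(T)}^2+h_T^{-1}\sum_{F\in\mathcal F_T}\|(\delta_T\underline v_T)_F\|_{L^2(F)}^2$. **Scheme.** Let $\beta_T,\gamma_T\in C^0((0,t_F];(0,\infty))$ for each $T$, and let $(\underline u_h,\underline b_h,\underline p_h,\underline r_h)\in[C^1([0,t_F];\underline U_{h,0})]^2\times[C^0((0,t_F];\underline P_{h,0})]^2$ satisfy $\underline u_h(0)=\underline I_hu_0$, $\underline b_h(0)=\underline I_hb_0$ and, for all $t\in(0,t_F]$, all $\underline v_h,\underline w_h\in\underline U_{h,0}$ and all $\underline q_h\in\underline P_{h,0}$, $$(\partial_t\underline u_h,\underline v_h)_{0,h}+\nu a_h(\underline u_h,\underline v_h)+t_h(\underline u_h,\underline u_h,\underline v_h)+j_{\beta,h}(\underline u_h,\underline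 v_h)-t_h(\underline b_h,\underline b_h,\underline v_h)+B_h(\underline v_h,\underline p_h)=\int_\Omega f\cdot v_h,$$ $$(\partial_t\underline b_h,\underline w_h)_{0,h}+\mu a_h(\underline b_h,\underline w_h)+t_h(\underline u_h,\underline b_h,\underline w_h)+j_{\gamma,h}(\underline b_h,\underline w_h)-t_h(\underline b_h,\underline u_h,\underline w_h)+B_h(\underline w_h,\underline r_h)=\int_\Omega g\cdot w_h,$$ $$B_h(\underline u_h,\underline q_h)=B_h(\underline b_h,\underline q_h)=0.$$ **Consistency errors.** Set $E_{\rm time}(w,\underline z_h)=\int_\Omega\partial_tw\cdot z_h-(\partial_t\underline I_hw,\underline z_h)_{0,h}$, $E_{\rm diff}(w,\underline z_h)=-\int_\Omega\Delta w\cdot z_h-a_h(\underline I_hw,\underline z_h)$ (with $\Delta$ taken elementwise), $E_{\rm conv}(w,v,\underline z_h)=\int_\Omega(w\cdot\nabla)v\cdot z_h-t_h(\underline I_hw,\underline I_hv,\underline z_h)$ and, at each time, $$\begin{aligned}\mathcal E_h(\underline v_h,\underline w_h)={}&E_{\rm time}(u,\underline v_h)+E_{\rm time}(b,\underline w_h)+\nu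 E_{\rm diff}(u,\underline v_h)+\mu E_{\rm diff}(b,\underline w_h)\\&+E_{\rm conv}(u,u,\underline v_h)-j_{\beta,h}(\underline I_hu,\underline v_h)-E_{\rm conv}(b,b,\underline v_h)\\&+E_{\rm conv}(u,b,\underline w_h)-j_{\gamma,h}(\underline I_hb,\underline w_h)-E_{\rm conv}(b,u,\underline w_h).\end{aligned}$$ **Theorem.** Assume that $u,b\in H^1(0,t_F;H^1_0(\Omega)^d)\cap L^1(0,t_F;W^{1,\infty}(\Omega)^d)\cap L^2(0,t_F;H^2(\mathcal T_h)^d)$, where $H^2(\mathcal T_h)$ is the space of $L^2(\Omega)$ functions whose restriction to each $T$ is in $H^2(T)$, and $p,r\in L^2(0,t_F;L^2_0(\Omega)\cap H^1(\Omega))$. Let $\underline e_{u,h}=\underline u_h-\underline I_hu$ and $\underline e_{b,h}=\underline b_h-\underline I_hb$. Then $$\begin{aligned}&\max_{[0,t_F]}\|\underline e_{u,h}\|_{0,h}^2+\int_0^{t_F}\big(\nu\|\underline e_{u,h}\|_{1,h}^2+|\underline e_{u,h}|_{\beta,h}^2\big)+\max_{[0,t_F]}\|\underline e_{b,h}\|_{0,h}^2+\int_0^{t_F}\big(\mu\|\underline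 e_{b,h}\|_{1,h}^2+|\underline e_{b,h}|_{\gamma,h}^2\big)\\&\qquad\le C\,K(u,b)\int_0^{t_F}\big|\mathcal E_h(\underline e_{u,h}(\tau),\underline e_{b,h}(\tau))\big|\,d\tau,\end{aligned}$$ $$K(u,b)=\exp\Big(C_K\int_0^{t_F}\big(|u(\tau)|_{W^{1,\infty}(\Omega)^d}+|b(\tau)|_{W^{1,\infty}(\Omega)^d}\big)\,d\tau\Big),$$ where $C_K>0$ depends only on $\sigma$ and $k$, and $C>0$ depends only on $d$, $\Omega$, $t_F$, $k$, $\sigma$ and $\eta$ (in particular, neither depends on the mesh size, on $\nu$, $\mu$, $\beta$, $\gamma$, the data or the solutions). Integrals of nonnegative functions of time take values in $[0,\infty]$. -/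

import Mathlib

open scoped ENNReal ContDiff Topology
open MeasureTheory Set Filter

noncomputable section

namespace MHD

/-! ### Function spaces on an open set -/

/-- The ambient Euclidean space. -/
abbrev Pt (d : ℕ) := EuclideanSpace ℝ (Fin d)

/-- The `j`-th vector of the canonical basis. -/
def e {d : ℕ} (j : Fin d) : Pt d := EuclideanSpace.single j (1 : ℝ)

/-- Real-valued `L²(Ω)`. -/
abbrev L2 {d : ℕ} (Ω : Set (Pt d)) := Lp ℝ 2 (volume.restrict Ω)

/-- `φ ∈ C_c^∞(U)`. -/
def IsTest {d : ℕ} (U : Set (Pt d)) (φ : Pt d → ℝ) : Prop :=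
  ContDiff ℝ ∞ φ ∧ HasCompactSupport φ ∧ tsupport φ ⊆ U

/-- Classical partial derivative. -/
def pderiv {d : ℕ} (j : Fin d) (φ : Pt d → ℝ) (x : Pt d) : ℝ := fderiv ℝ φ x (e j)

/-- `g` is the weak `j`-th partial derivative of `f` on `U`. -/
def IsWeakPartial {d : ℕ} (U : Set (Pt d)) (j : Fin d) (f g : Pt d → ℝ) : Prop :=
  ∀ φ : Pt d → ℝ, IsTest U φ → ∫ x in U, f x * pderiv j φ x = - ∫ x in U, g x * φ x

theorem IsTest.memLp {d : ℕ} {U : Set (Pt d)} {φ : Pt d → ℝ} (h : IsTest U φ)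
    (μ : Measure (Pt d)) [IsFiniteMeasureOnCompacts μ] : MemLp φ 2 μ :=
  h.1.continuous.memLp_of_hasCompactSupport h.2.1

theorem IsTest.memLp_pderiv {d : ℕ} {U : Set (Pt d)} {φ : Pt d → ℝ} (h : IsTest U φ)
    (j : Fin d) (μ : Measure (Pt d)) [IsFiniteMeasureOnCompacts μ] :
    MemLp (pderiv j φ) 2 μ := by
  have h1 : Continuous (pderiv j φ) :=
    (h.1.continuous_fderiv (by simp)).clm_apply continuous_const
  exact h1.memLp_of_hasCompactSupport (h.2.1.fderiv_apply (𝕜 := ℝ) (e j))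

/-- `H¹(Ω)` with its Hilbert norm: a function (index `none`) in `L²(Ω)` together with its weak
partial derivatives (indices `some j`) in `L²(Ω)`. -/
def H1 {d : ℕ} (Ω : Set (Pt d)) :
    Submodule ℝ (PiLp 2 (fun _ : Option (Fin d) => L2 Ω)) where
  carrier := {w | ∀ j : Fin d, IsWeakPartial Ω j (w none) (w (some j))}
  zero_mem' := by
    intro j φ _
    have h0 : ((0 : L2 Ω) : Pt d → ℝ) =ᵐ[volume.restrict Ω] 0 := Lp.coeFn_zero _ _ _
    have h1 : ∀ ψ : Pt d → ℝ, ∫ x in Ω, ((0 : L2 Ω) : Pt d → ℝ) x * ψ x = 0 := by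
      intro ψ
      rw [integral_congr_ae (g := fun _ => (0 : ℝ)) (by
        filter_upwards [h0] with x hx
        rw [hx, Pi.zero_apply, zero_mul])]
      simp
    simp only [PiLp.zero_apply, h1, neg_zero]
  add_mem' := by
    intro v w hv hw j φ hφ
    have hadd : ∀ (a b : L2 Ω) (ψ : Pt d → ℝ), MemLp ψ 2 (volume.restrict Ω) →
        ∫ x in Ω, ((a + b : L2 Ω) : Pt d → ℝ) x * ψ x
          = (∫ x in Ω, a x * ψ x) + ∫ x in Ω, b x * ψ x := by
      intro a b ψ hψ
      have ha : Integrable (fun x => a x * ψ x) (volume.restrict Ω) :=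
        (Lp.memLp a).integrable_mul hψ
      have hb : Integrable (fun x => b x * ψ x) (volume.restrict Ω) :=
        (Lp.memLp b).integrable_mul hψ
      rw [← integral_add ha hb]
      refine integral_congr_ae ?_
      filter_upwards [Lp.coeFn_add a b] with x hx
      rw [hx, Pi.add_apply]; ring
    simp only [PiLp.add_apply]
    rw [hadd _ _ _ (hφ.memLp_pderiv j _), hadd _ _ _ (hφ.memLp _), hv j φ hφ, hw j φ hφ]
    ring
  smul_mem' := by
    intro c w hw j φ hφ
    have hsmul : ∀ (a : L2 Ω) (ψ : Pt d → ℝ),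
        ∫ x in Ω, ((c • a : L2 Ω) : Pt d → ℝ) x * ψ x = c * ∫ x in Ω, a x * ψ x := by
      intro a ψ
      rw [← integral_const_mul]
      refine integral_congr_ae ?_
      filter_upwards [Lp.coeFn_smul c a] with x hx
      rw [hx, Pi.smul_apply, smul_eq_mul]; ring
    simp only [PiLp.smul_apply]
    rw [hsmul, hsmul, hw j φ hφ]
    ring

/-- The function underlying an element of `H¹(Ω)`. -/
def val {d : ℕ} {Ω : Set (Pt d)} (w : H1 Ω) : L2 Ω := w.1 none

/-- The weak partial derivatives of an element of `H¹(Ω)`. -/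
def grad {d : ℕ} {Ω : Set (Pt d)} (w : H1 Ω) (j : Fin d) : L2 Ω := w.1 (some j)

/-- `w ∈ H¹₀(Ω)`: `w` is in the closure of `C_c^∞(Ω)` in `H¹(Ω)`. -/
def IsH10 {d : ℕ} {Ω : Set (Pt d)} (w : H1 Ω) : Prop :=
  w ∈ closure {v : H1 Ω | ∃ φ : Pt d → ℝ, IsTest Ω φ ∧
    val v =ᵐ[volume.restrict Ω] φ ∧ ∀ j, grad v j =ᵐ[volume.restrict Ω] pderiv j φ}

/-- Divergence of a field in `H¹(Ω)^d`. -/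
def div {d : ℕ} {Ω : Set (Pt d)} (v : Fin d → H1 Ω) (x : Pt d) : ℝ := ∑ i, grad (v i) i x

/-- The `W^{1,∞}(Ω)^d`-seminorm (infinite if the gradient is not essentially bounded). -/
def semiW1inf {d : ℕ} {Ω : Set (Pt d)} (v : Fin d → H1 Ω) : ℝ≥0∞ :=
  eLpNorm (fun x => Real.sqrt (∑ i, ∑ j, (grad (v i) j x) ^ 2)) ∞ (volume.restrict Ω)

/-- The `W^{1,∞}(Ω)^d`-norm. -/
def normW1inf {d : ℕ} {Ω : Set (Pt d)} (v : Fin d → H1 Ω) : ℝ≥0∞ :=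
  eLpNorm (fun x => Real.sqrt (∑ i, (val (v i) x) ^ 2)) ∞ (volume.restrict Ω) + semiW1inf v

/-- `u ∈ L¹(0,t_F; W^{1,∞}(Ω)^d)`. Only measurability and integrability of the norm are required,
which Bochner integrability with values in `W^{1,∞}(Ω)^d` implies. -/
def MemL1W1inf {d : ℕ} {Ω : Set (Pt d)} (tF : ℝ) (u : ℝ → Fin d → H1 Ω) : Prop :=
  AEMeasurable (fun t => normW1inf (u t)) (volume.restrict (Ioo 0 tF)) ∧
    ∫⁻ t in Ioo 0 tF, normW1inf (u t) < ⊤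

/-- `p ∈ L²(0,t_F; H¹(Ω))`, for a function `p` of time with values in `L²(Ω)`. -/
def MemL2H1 {d : ℕ} {Ω : Set (Pt d)} (tF : ℝ) (p : ℝ → L2 Ω) : Prop :=
  ∃ P : ℝ → H1 Ω, MemLp P 2 (volume.restrict (Ioo 0 tF)) ∧
    ∀ᵐ t ∂(volume.restrict (Ioo 0 tF)), val (P t) = p t

/-! ### Domain and mesh -/

/-- Open bounded convex polytopal domain. -/
structure IsConvexPolytopalDomain {d : ℕ} (Ω : Set (Pt d)) : Prop where
  isOpen : IsOpen Ω
  nonempty : Ω.Nonempty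
  bounded : Bornology.IsBounded Ω
  convex : Convex ℝ Ω
  polytope : ∃ V : Finset (Pt d), closure Ω = convexHull ℝ (V : Set (Pt d))

/-- Matching simplicial mesh of `Ω`. -/
structure Mesh {d : ℕ} (Ω : Set (Pt d)) where
  complex : Geometry.SimplicialComplex ℝ (Pt d)
  finite : complex.faces.Finite
  space_eq : complex.space = closure Ω

/-- The closed simplex with given vertices. Simplices are represented by their vertex sets. -/
def hull {d : ℕ} (Y : Finset (Pt d)) : Set (Pt d) := convexHull ℝ (Y : Set (Pt d))

/-- The set of mesh elements. -/
def Mesh.elems {d : ℕ} {Ω : Set (Pt d)} (M : Mesh Ω) : Finset (Finset (Pt d)) :=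
  M.finite.toFinset.filter (fun s => s.card = d + 1)

/-- The set of simplicial mesh faces, of dimension `d - 1`. -/
def Mesh.faces {d : ℕ} {Ω : Set (Pt d)} (M : Mesh Ω) : Finset (Finset (Pt d)) :=
  M.finite.toFinset.filter (fun s => s.card = d)

/-- The faces of a simplex `T`. -/
def facesOf {d : ℕ} (T : Finset (Pt d)) : Finset (Finset (Pt d)) := T.powersetCard d

/-- The diameter of a simplex. -/
def diam {d : ℕ} (Y : Finset (Pt d)) : ℝ := Metric.diam (hull Y)

/-- Regularity of the mesh: the ratio of the diameter of an element to the diameter of a ball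
inscribed in it is at most `σ`. -/
def Mesh.IsRegular {d : ℕ} {Ω : Set (Pt d)} (M : Mesh Ω) (σ : ℝ) : Prop :=
  ∀ T ∈ M.elems, ∃ (c : Pt d) (ρ : ℝ), 0 < ρ ∧
    Metric.closedBall c (ρ / 2) ⊆ hull T ∧ diam T ≤ σ * ρ

/-- Integral over a mesh element. -/
def intT {d : ℕ} (T : Finset (Pt d)) (f : Pt d → ℝ) : ℝ := ∫ x in hull T, f x

/-- Surface integral over a face (with respect to the normalized `(d-1)`-dimensional Hausdorff
measure). -/
def intF {d : ℕ} (F : Finset (Pt d)) (f : Pt d → ℝ) : ℝ := ∫ x in hull F, f x ∂μHE[d - 1]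

/-- The unit normal vector to the face `F` of `T` pointing out of `T`. -/
def normal {d : ℕ} (T F : Finset (Pt d)) : Pt d :=
  Classical.epsilon fun n => ‖n‖ = 1 ∧ (∀ x ∈ F, ∀ y ∈ F, inner ℝ n (x - y) = 0) ∧
    ∀ x ∈ F, ∀ a ∈ T, a ∉ F → 0 < inner ℝ n (x - a)

/-- Partial derivative, up to the boundary, of a function on the closed simplex `T`. -/
def pd {d : ℕ} (T : Finset (Pt d)) (j : Fin d) (q : Pt d → ℝ) (x : Pt d) : ℝ :=
  fderivWithin ℝ q (hull T) x (e j)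

/-! ### Polynomial spaces -/

/-- Restriction of a polynomial to the simplex `Y`, represented by its extension by zero. -/
def polyOn {d : ℕ} (Y : Finset (Pt d)) : MvPolynomial (Fin d) ℝ →ₗ[ℝ] (Pt d → ℝ) where
  toFun p := (hull Y).indicator fun x => MvPolynomial.eval (fun i => x i) p
  map_add' p q := by
    ext x; by_cases h : x ∈ hull Y <;> simp [h]
  map_smul' c p := by
    ext x; by_cases h : x ∈ hull Y <;> simp [h]

/-- `P^ℓ(Y)`: restrictions to `Y` of polynomials of total degree at most `ℓ`; zero if `ℓ < 0`. -/
def Poly {d : ℕ} (l : ℤ) (Y : Finset (Pt d)) : Submodule ℝ (Pt d → ℝ) :=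
  if l < 0 then ⊥ else (MvPolynomial.restrictTotalDegree (Fin d) ℝ l.toNat).map (polyOn Y)

/-- `P^ℓ(Y)^d`. Vector fields are given by their components. -/
def PolyVec {d : ℕ} (l : ℤ) (Y : Finset (Pt d)) : Submodule ℝ (Fin d → Pt d → ℝ) :=
  Submodule.pi Set.univ fun _ => Poly l Y

/-- The map `q ↦ x q`. -/
def mulX {d : ℕ} : (Pt d → ℝ) →ₗ[ℝ] (Fin d → Pt d → ℝ) where
  toFun q := fun i x => x i * q x
  map_add' p q := by ext i x; simp [mul_add]
  map_smul' c p := by ext i x; simp [mul_left_comm]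

/-- The Raviart--Thomas--Nédélec space of order `ℓ`. -/
def RTN {d : ℕ} (l : ℤ) (T : Finset (Pt d)) : Submodule ℝ (Fin d → Pt d → ℝ) :=
  PolyVec (l - 1) T ⊔ (Poly (l - 1) T).map mulX

/-- `L²`-orthogonal projection on `P^ℓ(T)` for an element `T`. -/
def projT {d : ℕ} (l : ℤ) (T : Finset (Pt d)) (q : Pt d → ℝ) : Pt d → ℝ :=
  Classical.epsilon fun r => r ∈ Poly l T ∧
    ∀ s ∈ Poly l T, intT T (fun x => r x * s x) = intT T (fun x => q x * s x)

/-- `L²`-orthogonal projection on `P^ℓ(F)` for a face `F`. -/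
def projF {d : ℕ} (l : ℤ) (F : Finset (Pt d)) (q : Pt d → ℝ) : Pt d → ℝ :=
  Classical.epsilon fun r => r ∈ Poly l F ∧
    ∀ s ∈ Poly l F, intF F (fun x => r x * s x) = intF F (fun x => q x * s x)

/-- Interpolator on `RTN^ℓ(T)` of a vector field with values `v` in `T` and `g F` on the faces
`F` of `T`. -/
def rtnInterp {d : ℕ} (l : ℤ) (T : Finset (Pt d)) (v : Fin d → Pt d → ℝ)
    (g : Finset (Pt d) → Fin d → Pt d → ℝ) : Fin d → Pt d → ℝ :=
  Classical.epsilon fun r => r ∈ RTN l T ∧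
    (∀ i, projT (l - 2) T (r i) = projT (l - 2) T (v i)) ∧
    ∀ F ∈ facesOf T, ∀ x ∈ hull F, ∑ i, r i x * normal T F i =
      projF (l - 1) F (fun y => ∑ i, g F i y * normal T F i) x

/-! ### Hybrid spaces and interpolators -/

/-- Families of vector fields attached to mesh elements (first component) and to faces
(second component). -/
abbrev HybVec (d : ℕ) :=
  (Finset (Pt d) → Fin d → Pt d → ℝ) × (Finset (Pt d) → Fin d → Pt d → ℝ)

/-- Families of scalar functions attached to mesh elements and to faces. -/
abbrev HybScal (d : ℕ) := (Finset (Pt d) → Pt d → ℝ) × (Finset (Pt d) → Pt d → ℝ)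

/-- `v ∈ U_h^k`. Components attached to simplices that are not in the mesh are zero. -/
structure MemU {d : ℕ} {Ω : Set (Pt d)} (M : Mesh Ω) (k : ℕ) (v : HybVec d) : Prop where
  elem : ∀ T ∈ M.elems, v.1 T ∈ RTN (k + 1) T
  face : ∀ F ∈ M.faces, v.2 F ∈ PolyVec k F
  elem_zero : ∀ T ∉ M.elems, v.1 T = 0
  face_zero : ∀ F ∉ M.faces, v.2 F = 0

/-- `v ∈ U_{h,0}^k`. -/
def MemU0 {d : ℕ} {Ω : Set (Pt d)} (M : Mesh Ω) (k : ℕ) (v : HybVec d) : Prop :=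
  MemU M k v ∧ ∀ F ∈ M.faces, hull F ⊆ frontier Ω → v.2 F = 0

/-- `q ∈ P_h^k`. -/
structure MemP {d : ℕ} {Ω : Set (Pt d)} (M : Mesh Ω) (k : ℕ) (q : HybScal d) : Prop where
  elem : ∀ T ∈ M.elems, q.1 T ∈ Poly k T
  face : ∀ F ∈ M.faces, q.2 F ∈ Poly k F
  elem_zero : ∀ T ∉ M.elems, q.1 T = 0
  face_zero : ∀ F ∉ M.faces, q.2 F = 0

/-- `q ∈ P_{h,0}^k`. -/
def MemP0 {d : ℕ} {Ω : Set (Pt d)} (M : Mesh Ω) (k : ℕ) (q : HybScal d) : Prop :=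
  MemP M k q ∧ ∑ T ∈ M.elems, intT T (q.1 T) = 0

/-- The broken polynomial field `v_h` on `Ω` (element functions vanish outside their element). -/
def broken {d : ℕ} {Ω : Set (Pt d)} (M : Mesh Ω) (v : HybVec d) (i : Fin d) (x : Pt d) : ℝ :=
  ∑ T ∈ M.elems, v.1 T i x

/-- `g` is the trace of `w ∈ H¹(Ω)` on the face `F`: the `L²(F)`-limit of the restrictions to `F`
of smooth functions that converge to `w` in `H¹(Ω)`. -/
def IsTrace {d : ℕ} {Ω : Set (Pt d)} (F : Finset (Pt d)) (w : H1 Ω) (g : Pt d → ℝ) : Prop :=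
  MemLp g 2 (μHE[d - 1].restrict (hull F)) ∧
  ∃ φ : ℕ → Pt d → ℝ, (∀ n, ContDiff ℝ ∞ (φ n)) ∧
    Tendsto (fun n => eLpNorm (fun x => φ n x - val w x) 2 (volume.restrict Ω)) atTop (𝓝 0) ∧
    (∀ j, Tendsto (fun n => eLpNorm (fun x => pderiv j (φ n) x - grad w j x) 2
      (volume.restrict Ω)) atTop (𝓝 0)) ∧
    Tendsto (fun n => eLpNorm (fun x => φ n x - g x) 2 (μHE[d - 1].restrict (hull F)))
      atTop (𝓝 0)

/-- The trace on the face `F` of a function in `H¹(Ω)`. -/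
def trace {d : ℕ} {Ω : Set (Pt d)} (F : Finset (Pt d)) (w : H1 Ω) : Pt d → ℝ :=
  Classical.epsilon fun g => IsTrace F w g

open Classical in
/-- The global interpolator on `U_h^k`. -/
def interp {d : ℕ} {Ω : Set (Pt d)} (M : Mesh Ω) (k : ℕ) (v : Fin d → H1 Ω) : HybVec d :=
  (fun T => if T ∈ M.elems then
      rtnInterp (k + 1) T (fun i => val (v i)) (fun F i => trace F (v i)) else 0,
   fun F => if F ∈ M.faces then fun i => projF k F (trace F (v i)) else 0)

/-! ### Discrete inner products, norms and forms -/

/-- The discrete `L²`-like inner product. -/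
def inner0 {d : ℕ} {Ω : Set (Pt d)} (M : Mesh Ω) (w v : HybVec d) : ℝ :=
  ∑ T ∈ M.elems, (intT T (fun x => ∑ i, w.1 T i x * v.1 T i x) +
    diam T * ∑ F ∈ facesOf T,
      intF F (fun x => ∑ i, (w.2 F i x - w.1 T i x) * (v.2 F i x - v.1 T i x)))

/-- The square of the discrete `H¹`-like seminorm. -/
def norm1sq {d : ℕ} {Ω : Set (Pt d)} (M : Mesh Ω) (v : HybVec d) : ℝ :=
  ∑ T ∈ M.elems, (intT T (fun x => ∑ i, ∑ j, (pd T j (v.1 T i) x) ^ 2) +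
    (diam T)⁻¹ * ∑ F ∈ facesOf T, intF F (fun x => ∑ i, (v.2 F i x - v.1 T i x) ^ 2))

/-- The distance from the center of mass of `T` to the hyperplane containing `F`. -/
def distTF {d : ℕ} (T F : Finset (Pt d)) : ℝ :=
  Metric.infDist (T.centroid ℝ id) (affineSpan ℝ (F : Set (Pt d)) : Set (Pt d))

/-- The velocity reconstruction `p_T^{k+1}`. -/
def recon {d : ℕ} (k : ℕ) (T : Finset (Pt d)) (v : HybVec d) : Fin d → Pt d → ℝ :=
  Classical.epsilon fun P => P ∈ PolyVec (k + 1) T ∧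
    (∀ w ∈ PolyVec (k + 1) T,
      intT T (fun x => ∑ i, ∑ j, pd T j (P i) x * pd T j (w i) x) =
        - intT T (fun x => ∑ i, v.1 T i x * ∑ j, pd T j (pd T j (w i)) x) +
        ∑ F ∈ facesOf T, intF F (fun x => ∑ i, v.2 F i x * ∑ j, pd T j (w i) x * normal T F j)) ∧
    ∀ i, intT T (P i) =
      if k = 0 then ∑ F ∈ facesOf T, distTF T F / d * intF F (v.2 F i) else intT T (v.1 T i)

open Classical in
/-- The difference `I_{U,T}^k p_T^{k+1} v_T - v_T`, supported on `T` and its faces. -/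
def delta {d : ℕ} (k : ℕ) (T : Finset (Pt d)) (v : HybVec d) : HybVec d :=
  (fun T' => if T' = T then
      rtnInterp (k + 1) T (recon k T v) (fun _ => recon k T v) - v.1 T else 0,
   fun F => if F ∈ facesOf T then (fun i => projF k F (recon k T v i)) - v.2 F else 0)

/-- The reference stabilization `s_T(v_T, v_T)`. -/
def refStab {d : ℕ} (k : ℕ) (T : Finset (Pt d)) (v : HybVec d) : ℝ :=
  ((facesOf T).card * diam T ^ d / volume.real (hull T)) * (diam T ^ 2)⁻¹ *
      intT T (fun x => ∑ i, ((delta k T v).1 T i x) ^ 2) +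
    (diam T)⁻¹ * ∑ F ∈ facesOf T, intF F (fun x => ∑ i, ((delta k T v).2 F i x) ^ 2)

/-- Admissible stabilizations: the bilinear forms `s_T(w,v) = S_T(δ_T w, δ_T v)`, with `S_T`
bilinear, that penalize the differences `δ_T` as the reference stabilization does, up to a
factor `η`. The reference stabilization itself is obtained with `η = 1`. Only the values of `S_T`
at fields with polynomial components on `T` and its faces matter; they are extended bilinearly,
in an arbitrary way, to all families of functions. -/
def IsStabilization {d : ℕ} {Ω : Set (Pt d)} (M : Mesh Ω) (k : ℕ) (η : ℝ)
    (S : Finset (Pt d) → LinearMap.BilinForm ℝ (HybVec d)) : Prop :=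
  ∀ T ∈ M.elems, ∀ v : HybVec d, MemU M k v →
    η⁻¹ * refStab k T v ≤ S T (delta k T v) (delta k T v) ∧
    S T (delta k T v) (delta k T v) ≤ η * refStab k T v

/-- The diffusion bilinear form `a_h`. -/
def aForm {d : ℕ} {Ω : Set (Pt d)} (M : Mesh Ω) (k : ℕ)
    (S : Finset (Pt d) → LinearMap.BilinForm ℝ (HybVec d)) (w v : HybVec d) : ℝ :=
  ∑ T ∈ M.elems,
    (intT T (fun x => ∑ i, ∑ j, pd T j (recon k T w i) x * pd T j (recon k T v i) x) +
      S T (delta k T w) (delta k T v))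

/-- The discrete pressure gradient `G_T^k`. -/
def pgrad {d : ℕ} (k : ℕ) (T : Finset (Pt d)) (q : HybScal d) : Fin d → Pt d → ℝ :=
  Classical.epsilon fun G => G ∈ RTN (k + 1) T ∧
    ∀ w ∈ RTN (k + 1) T,
      intT T (fun x => ∑ i, G i x * w i x) =
        - intT T (fun x => q.1 T x * ∑ i, pd T i (w i) x) +
        ∑ F ∈ facesOf T, intF F (fun x => q.2 F x * ∑ i, w i x * normal T F i)

/-- The bilinear form `B_h`. -/
def BForm {d : ℕ} {Ω : Set (Pt d)} (M : Mesh Ω) (k : ℕ) (v : HybVec d) (q : HybScal d) : ℝ :=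
  ∑ T ∈ M.elems, intT T (fun x => ∑ i, v.1 T i x * pgrad k T q i x)

/-- The convective trilinear form `t_h`. -/
def tForm {d : ℕ} {Ω : Set (Pt d)} (M : Mesh Ω) (w v z : HybVec d) : ℝ :=
  ∑ T ∈ M.elems,
    (intT T (fun x => ∑ i, (∑ j, w.1 T j x * pd T j (v.1 T i) x) * z.1 T i x) +
      (1 / 2) * ∑ F ∈ facesOf T, intF F (fun x => (∑ j, w.1 T j x * normal T F j) *
        ∑ i, (v.2 F i x - v.1 T i x) * (z.2 F i x + z.1 T i x)))

/-- The convective stabilization `j_{α,h}`. -/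
def jForm {d : ℕ} {Ω : Set (Pt d)} (M : Mesh Ω) (α : Finset (Pt d) → ℝ) (w v : HybVec d) : ℝ :=
  ∑ T ∈ M.elems, α T * ∑ F ∈ facesOf T,
    intF F (fun x => ∑ i, (w.2 F i x - w.1 T i x) * (v.2 F i x - v.1 T i x))

/-- Families of upwind coefficients in `C⁰((0,t_F]; (0,∞))`. -/
def IsUpwind {d : ℕ} {Ω : Set (Pt d)} (M : Mesh Ω) (tF : ℝ) (α : ℝ → Finset (Pt d) → ℝ) : Prop :=
  ∀ T ∈ M.elems, ContinuousOn (fun t => α t T) (Ioc 0 tF) ∧ ∀ t ∈ Ioc 0 tF, 0 < α t T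

/-- The square of the energy norm, as a number in `[0,∞]` (the coefficients `β`, `γ` may be
unbounded at the initial time). -/
def energySq {d : ℕ} {Ω : Set (Pt d)} (M : Mesh Ω) (tF ν μ : ℝ) (β γ : ℝ → Finset (Pt d) → ℝ)
    (v w : ℝ → HybVec d) : ℝ≥0∞ :=
  (⨆ t ∈ Icc 0 tF, ENNReal.ofReal (inner0 M (v t) (v t))) +
  (∫⁻ t in Ioc 0 tF, ENNReal.ofReal (ν * norm1sq M (v t) + jForm M (β t) (v t) (v t))) +
  (⨆ t ∈ Icc 0 tF, ENNReal.ofReal (inner0 M (w t) (w t))) +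
  ∫⁻ t in Ioc 0 tF, ENNReal.ofReal (μ * norm1sq M (w t) + jForm M (γ t) (w t) (w t))

/-! ### Continuous and discrete problems -/

/-- `a(w,v)`. -/
def aCont {d : ℕ} {Ω : Set (Pt d)} (w v : Fin d → H1 Ω) : ℝ :=
  ∫ x in Ω, ∑ i, ∑ j, grad (w i) j x * grad (v i) j x

/-- `t(v,w,z)`. -/
def tCont {d : ℕ} {Ω : Set (Pt d)} (v w z : Fin d → H1 Ω) : ℝ :=
  ∫ x in Ω, ∑ i, (∑ j, val (v j) x * grad (w i) j x) * val (z i) x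

/-- `B(v,q)`. -/
def BCont {d : ℕ} {Ω : Set (Pt d)} (v : Fin d → H1 Ω) (q : L2 Ω) : ℝ :=
  - ∫ x in Ω, div v x * q x

/-- `q ∈ L²₀(Ω)`. -/
def IsL20 {d : ℕ} {Ω : Set (Pt d)} (q : L2 Ω) : Prop := ∫ x in Ω, q x = 0

/-- The time derivative, on `[0,t_F]`, of a function with values in `H¹(Ω)^d`. -/
def dt {d : ℕ} {Ω : Set (Pt d)} (tF : ℝ) (u : ℝ → Fin d → H1 Ω) (t : ℝ) : Fin d → H1 Ω :=
  derivWithin u (Icc 0 tF) t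

/-- `∇·g = 0` in the sense of distributions. -/
def IsWeakDivFree {d : ℕ} {Ω : Set (Pt d)} (g : Fin d → L2 Ω) : Prop :=
  ∀ φ : Pt d → ℝ, IsTest Ω φ → ∫ x in Ω, ∑ i, g i x * pderiv i φ x = 0

/-- Source terms: `f ∈ C⁰((0,t_F]; L²(Ω)^d)` and `g ∈ C⁰((0,t_F]; H(div;Ω))` with `∇·g = 0`. -/
structure IsSource {d : ℕ} {Ω : Set (Pt d)} (tF : ℝ) (f g : ℝ → Fin d → L2 Ω) : Prop where
  cont_f : ContinuousOn f (Ioc 0 tF)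
  cont_g : ContinuousOn g (Ioc 0 tF)
  div_g : ∀ t ∈ Ioc 0 tF, IsWeakDivFree (g t)

/-- Solutions of the variational formulation of the MHD problem. -/
structure IsWeakSolution {d : ℕ} {Ω : Set (Pt d)} (tF ν μ : ℝ) (f g : ℝ → Fin d → L2 Ω)
    (u₀ b₀ : Fin d → H1 Ω) (u b : ℝ → Fin d → H1 Ω) (p r : ℝ → L2 Ω) : Prop where
  c1_u : ContDiffOn ℝ 1 u (Icc 0 tF)
  c1_b : ContDiffOn ℝ 1 b (Icc 0 tF)
  zero_u : ∀ t ∈ Icc 0 tF, ∀ i, IsH10 (u t i)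
  zero_b : ∀ t ∈ Icc 0 tF, ∀ i, IsH10 (b t i)
  cont_p : ContinuousOn p (Ioc 0 tF)
  cont_r : ContinuousOn r (Ioc 0 tF)
  mean_p : ∀ t ∈ Ioc 0 tF, IsL20 (p t)
  mean_r : ∀ t ∈ Ioc 0 tF, IsL20 (r t)
  init_u : u 0 = u₀
  init_b : b 0 = b₀
  momentum : ∀ t ∈ Ioc 0 tF, ∀ v : Fin d → H1 Ω, (∀ i, IsH10 (v i)) →
    (∫ x in Ω, ∑ i, val (dt tF u t i) x * val (v i) x) + ν * aCont (u t) v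
      + tCont (u t) (u t) v - tCont (b t) (b t) v + BCont v (p t)
      = ∫ x in Ω, ∑ i, f t i x * val (v i) x
  magnetic : ∀ t ∈ Ioc 0 tF, ∀ w : Fin d → H1 Ω, (∀ i, IsH10 (w i)) →
    (∫ x in Ω, ∑ i, val (dt tF b t i) x * val (w i) x) + μ * aCont (b t) w
      + tCont (u t) (b t) w - tCont (b t) (u t) w + BCont w (r t)
      = ∫ x in Ω, ∑ i, g t i x * val (w i) x
  mass : ∀ t ∈ Ioc 0 tF, ∀ q : L2 Ω, IsL20 q → BCont (u t) q = 0
  gauge : ∀ t ∈ Ioc 0 tF, ∀ q : L2 Ω, IsL20 q → BCont (b t) q = 0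

/-- The time derivative, on `[0,t_F]`, of a function with values in the hybrid space. -/
def hdt {d : ℕ} (tF : ℝ) (v : ℝ → HybVec d) (t : ℝ) : HybVec d :=
  (fun T i x => derivWithin (fun s => (v s).1 T i x) (Icc 0 tF) t,
   fun F i x => derivWithin (fun s => (v s).2 F i x) (Icc 0 tF) t)

/-- `v` is of class `C¹` on `[0,t_F]`. For functions with values in the finite-dimensional space
`U_h^k`, this can be expressed through the values at the points of the elements and faces. -/
def IsC1 {d : ℕ} (tF : ℝ) (v : ℝ → HybVec d) : Prop :=
  (∀ T i x, ContDiffOn ℝ 1 (fun s => (v s).1 T i x) (Icc 0 tF)) ∧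
  (∀ F i x, ContDiffOn ℝ 1 (fun s => (v s).2 F i x) (Icc 0 tF))

/-- Solutions of the discrete problem. -/
structure IsDiscreteSolution {d : ℕ} {Ω : Set (Pt d)} (M : Mesh Ω) (k : ℕ)
    (S : Finset (Pt d) → LinearMap.BilinForm ℝ (HybVec d))
    (tF ν μ : ℝ) (β γ : ℝ → Finset (Pt d) → ℝ) (f g : ℝ → Fin d → L2 Ω)
    (u₀ b₀ : Fin d → H1 Ω) (uh bh : ℝ → HybVec d) (ph rh : ℝ → HybScal d) : Prop where
  c1_u : IsC1 tF uh
  c1_b : IsC1 tF bh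
  mem_u : ∀ t ∈ Icc 0 tF, MemU0 M k (uh t)
  mem_b : ∀ t ∈ Icc 0 tF, MemU0 M k (bh t)
  cont_p : ContinuousOn ph (Ioc 0 tF)
  cont_r : ContinuousOn rh (Ioc 0 tF)
  mem_p : ∀ t ∈ Ioc 0 tF, MemP0 M k (ph t)
  mem_r : ∀ t ∈ Ioc 0 tF, MemP0 M k (rh t)
  init_u : uh 0 = interp M k u₀
  init_b : bh 0 = interp M k b₀
  momentum : ∀ t ∈ Ioc 0 tF, ∀ v : HybVec d, MemU0 M k v →
    inner0 M (hdt tF uh t) v + ν * aForm M k S (uh t) v + tForm M (uh t) (uh t) v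
      + jForm M (β t) (uh t) v - tForm M (bh t) (bh t) v + BForm M k v (ph t)
      = ∫ x in Ω, ∑ i, f t i x * broken M v i x
  magnetic : ∀ t ∈ Ioc 0 tF, ∀ w : HybVec d, MemU0 M k w →
    inner0 M (hdt tF bh t) w + μ * aForm M k S (bh t) w + tForm M (uh t) (bh t) w
      + jForm M (γ t) (bh t) w - tForm M (bh t) (uh t) w + BForm M k w (rh t)
      = ∫ x in Ω, ∑ i, g t i x * broken M w i x
  mass : ∀ t ∈ Ioc 0 tF, ∀ q : HybScal d, MemP0 M k q → BForm M k (uh t) q = 0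
  gauge : ∀ t ∈ Ioc 0 tF, ∀ q : HybScal d, MemP0 M k q → BForm M k (bh t) q = 0

/-! ### Consistency errors -/

/-- `H j l` are the broken second derivatives of `w`: the function `w` is in `H²(T)` for every
element `T`, with second derivatives given by `H`. -/
def IsBrokenHess {d : ℕ} {Ω : Set (Pt d)} (M : Mesh Ω) (w : H1 Ω)
    (H : Fin d → Fin d → L2 Ω) : Prop :=
  ∀ T ∈ M.elems, ∀ j l, IsWeakPartial (interior (hull T)) l (grad w j) (H j l)

/-- `u ∈ L²(0,t_F; H²(T_h)^d)`, for `u` already in `L²(0,t_F; H¹(Ω)^d)`. -/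
def MemL2H2 {d : ℕ} {Ω : Set (Pt d)} (M : Mesh Ω) (tF : ℝ) (u : ℝ → Fin d → H1 Ω) : Prop :=
  ∃ H : ℝ → Fin d → Fin d → Fin d → L2 Ω, MemLp H 2 (volume.restrict (Ioo 0 tF)) ∧
    ∀ᵐ t ∂(volume.restrict (Ioo 0 tF)), ∀ i, IsBrokenHess M (u t i) (H t i)

/-- The broken Laplacian. -/
def lap {d : ℕ} {Ω : Set (Pt d)} (M : Mesh Ω) (w : H1 Ω) : L2 Ω :=
  ∑ j, (Classical.epsilon fun H : Fin d → Fin d → L2 Ω => IsBrokenHess M w H) j j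

/-- The time consistency error at time `t`. -/
def errTime {d : ℕ} {Ω : Set (Pt d)} (M : Mesh Ω) (k : ℕ) (tF : ℝ) (w : ℝ → Fin d → H1 Ω)
    (t : ℝ) (z : HybVec d) : ℝ :=
  (∫ x in Ω, ∑ i, val (dt tF w t i) x * broken M z i x)
    - inner0 M (hdt tF (fun s => interp M k (w s)) t) z

/-- The diffusive consistency error. -/
def errDiff {d : ℕ} {Ω : Set (Pt d)} (M : Mesh Ω) (k : ℕ)
    (S : Finset (Pt d) → LinearMap.BilinForm ℝ (HybVec d)) (w : Fin d → H1 Ω)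
    (z : HybVec d) : ℝ :=
  - (∫ x in Ω, ∑ i, lap M (w i) x * broken M z i x) - aForm M k S (interp M k w) z

/-- The convective consistency error. -/
def errConv {d : ℕ} {Ω : Set (Pt d)} (M : Mesh Ω) (k : ℕ) (w v : Fin d → H1 Ω)
    (z : HybVec d) : ℝ :=
  (∫ x in Ω, ∑ i, (∑ j, val (w j) x * grad (v i) j x) * broken M z i x)
    - tForm M (interp M k w) (interp M k v) z

/-- The discrete error `v_h - I_h v`, as a function of time. -/
def err {d : ℕ} {Ω : Set (Pt d)} (M : Mesh Ω) (k : ℕ) (vh : ℝ → HybVec d)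
    (v : ℝ → Fin d → H1 Ω) (t : ℝ) : HybVec d :=
  vh t - interp M k (v t)

/-- The global consistency error at time `t`. -/
def errGlobal {d : ℕ} {Ω : Set (Pt d)} (M : Mesh Ω) (k : ℕ)
    (S : Finset (Pt d) → LinearMap.BilinForm ℝ (HybVec d))
    (tF ν μ : ℝ) (β γ : ℝ → Finset (Pt d) → ℝ) (u b : ℝ → Fin d → H1 Ω)
    (t : ℝ) (v w : HybVec d) : ℝ :=
  errTime M k tF u t v + errTime M k tF b t w
    + ν * errDiff M k S (u t) v + μ * errDiff M k S (b t) w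
    + errConv M k (u t) (u t) v - jForm M (β t) (interp M k (u t)) v
    - errConv M k (b t) (b t) v
    + errConv M k (u t) (b t) w - jForm M (γ t) (interp M k (b t)) w
    - errConv M k (b t) (u t) w

end MHD

end

open MHD

/-!
# Pressure-robust error estimate for the hybrid MHD scheme

The error equation is tested with the error itself. A discrete velocity that is orthogonal to all
discrete pressures is exactly divergence free on each element, with normal components that match
across faces and vanish on the boundary (`isDivFree_of_BForm`). It is therefore `L²`-orthogonal to
gradients (`IsDivFree.integral_grad_mul`), so the pressures drop out, and the weak solution can be
tested with it in strong form (`IsDivFree.weak_form`). The interpolates of `u` and `b` have this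
property (`BForm_interp_eq_zero`), hence so have the errors.

For such transport fields the convective form is antisymmetric (`tForm_antisymm`): terms with two
equal error arguments vanish and the two terms that couple the errors through the discrete magnetic
field cancel. What remains transports an interpolate by an error, and is bounded by its Lipschitz
constant times squared `L²`-like norms (`exists_tForm_bound`), hence by the `W^{1,∞}` seminorm of
the solution (`exists_lipBound_interp`). With coercivity of the diffusion form
(`exists_aForm_coercive`), the estimate follows from a Grönwall inequality with integrable
coefficient (`gronwall`).

Uniformity in the mesh comes from transporting polynomials to a fixed reference simplex and from
equivalence of norms in finite dimension. Time regularity of interpolates rests on `isPullback`: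
every functional on the discrete space pulls back to a bounded functional on `H¹₀`.
-/

noncomputable section

namespace MHD

open Finset (sum_congr sum_add_distrib mul_sum sum_nonneg sum_mul sum_sub_distrib sum_le_sum
  sum_eq_zero sum_comm single_le_sum sum_neg_distrib abs_sum_le_sum_abs sum_eq_single sum_coe_sort
  sum_const sum_const_zero mem_of_mem_erase ne_of_mem_erase sum_eq_zero_iff_of_nonneg card_univ
  mem_powersetCard sum_ite_mem card_pos countable_toSet mem_erase)
open ENNReal (ofReal ofReal_mul ofReal_le_ofReal ofReal_add ofReal_ne_top toReal_nonneg)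
open Real (exp exp_pos exp_le_exp exp_add sqrt norm_eq_abs norm_of_nonneg exp_le_one_iff)

variable {d k : ℕ} {Ω : Set (Pt d)} {M : Mesh Ω} {T F Y : Finset (Pt d)} {m : Measure (Pt d)}
  {f g p q s φ : Pt d → ℝ} {a x : Pt d} {v z : HybVec d}

/-! ### Polynomial functions -/

/-- Evaluation of a polynomial as a function on the whole space. -/
def evalFun : MvPolynomial (Fin d) ℝ →ₗ[ℝ] (Pt d → ℝ) where
  toFun p := fun x => MvPolynomial.eval (fun i => x i) p
  map_add' p q := by ext x; simp
  map_smul' c p := by ext x; simp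

/-- Polynomial functions of total degree at most `m` on the whole space. -/
def PolyFun (d m : ℕ) : Submodule ℝ (Pt d → ℝ) :=
  (MvPolynomial.restrictTotalDegree (Fin d) ℝ m).map evalFun

/-- `f` is a polynomial function of total degree at most `m`. -/
def IsPoly (m : ℕ) (f : Pt d → ℝ) : Prop := f ∈ PolyFun d m

theorem isPoly_iff {m : ℕ} :
    IsPoly m f ↔ ∃ p : MvPolynomial (Fin d) ℝ, p.totalDegree ≤ m ∧ evalFun p = f := by
  simp [IsPoly, PolyFun, Submodule.mem_map, MvPolynomial.mem_restrictTotalDegree]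

instance PolyFun.finite (d m : ℕ) : Module.Finite ℝ (PolyFun d m) :=
  inferInstanceAs (Module.Finite ℝ ((MvPolynomial.restrictTotalDegree (Fin d) ℝ m).map evalFun))

theorem IsPoly.mono {m n : ℕ} (h : m ≤ n) (hf : IsPoly m f) : IsPoly n f := by
  obtain ⟨p, hp, rfl⟩ := isPoly_iff.1 hf
  exact isPoly_iff.2 ⟨p, hp.trans h, rfl⟩

theorem IsPoly.const (m : ℕ) (c : ℝ) : IsPoly m (fun _ : Pt d => c) :=
  isPoly_iff.2 ⟨MvPolynomial.C c, by simp, by ext x; simp [evalFun]⟩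

theorem IsPoly.coord (i : Fin d) : IsPoly 1 (fun x : Pt d => x i) :=
  isPoly_iff.2 ⟨MvPolynomial.X i, by simp, by ext x; simp [evalFun]⟩

theorem IsPoly.mul {m n : ℕ} (hf : IsPoly m f) (hg : IsPoly n g) :
    IsPoly (m + n) (fun x => f x * g x) := by
  obtain ⟨p, hp, rfl⟩ := isPoly_iff.1 hf
  obtain ⟨q, hq, rfl⟩ := isPoly_iff.1 hg
  exact isPoly_iff.2 ⟨p * q, (MvPolynomial.totalDegree_mul _ _).trans (add_le_add hp hq),
    by ext x; simp [evalFun]⟩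

theorem IsPoly.sum {m : ℕ} {ι : Type*} (s : Finset ι) {f : ι → Pt d → ℝ}
    (hf : ∀ i ∈ s, IsPoly m (f i)) : IsPoly m (fun x => ∑ i ∈ s, f i x) := by
  have h : (fun x => ∑ i ∈ s, f i x) = ∑ i ∈ s, f i := by ext x; simp
  rw [h]
  exact Submodule.sum_mem (PolyFun d m) hf

theorem IsPoly.smul {m : ℕ} (c : ℝ) (hf : IsPoly m f) :
    IsPoly m (fun x => c * f x) := Submodule.smul_mem (PolyFun d m) c hf

theorem IsPoly.neg {m : ℕ} (hf : IsPoly m f) :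
    IsPoly m (fun x => - f x) := Submodule.neg_mem (PolyFun d m) hf

theorem IsPoly.add {m : ℕ} (hf : IsPoly m f) (hg : IsPoly m g) :
    IsPoly m (fun x => f x + g x) := Submodule.add_mem (PolyFun d m) hf hg

theorem IsPoly.sub {m : ℕ} (hf : IsPoly m f) (hg : IsPoly m g) :
    IsPoly m (fun x => f x - g x) := Submodule.sub_mem (PolyFun d m) hf hg

/-- Induction on the degree of polynomial functions: they are obtained from constants by sums and
multiplications by coordinates. -/
theorem IsPoly.induction {C : ℕ → (Pt d → ℝ) → Prop} (const : ∀ m c, C m (fun _ => c))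
    (add : ∀ m f g, C m f → C m g → C m (fun x => f x + g x))
    (coord : ∀ m i f, IsPoly m f → C m f → C (m + 1) (fun x => x i * f x))
    {m : ℕ} (hf : IsPoly m f) : C m f := by
  obtain ⟨p, hp, rfl⟩ := isPoly_iff.1 hf
  clear hf
  have mono : ∀ (a : ℝ) (S : Multiset (Fin d)) (m : ℕ), S.card ≤ m →
      IsPoly m (fun x : Pt d => a * (S.map fun i => x i).prod) ∧
        C m (fun x => a * (S.map fun i => x i).prod) := by
    intro a S
    induction S using Multiset.induction_on with
    | empty => intro m _; simpa using ⟨IsPoly.const m a, const m a⟩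
    | cons i S ih =>
      intro m hm
      obtain ⟨m, rfl⟩ : ∃ m', m = m' + 1 := ⟨m - 1, by simp at hm; omega⟩
      obtain ⟨h1, h2⟩ := ih m (by simpa using hm)
      simp only [Multiset.map_cons, Multiset.prod_cons, mul_left_comm a]
      exact ⟨add_comm 1 m ▸ (IsPoly.coord i).mul h1, coord m i _ h1 h2⟩
  rw [p.as_sum, map_sum]
  refine Finset.sum_induction _ (C m) (add m) (const m 0) fun s hs => ?_
  convert (mono (p.coeff s) s.toMultiset m ?_).2 using 1
  · ext x
    simp [evalFun, MvPolynomial.eval_monomial, Finset.prod_multiset_map_count, Finsupp.prod]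
  · rw [Finsupp.card_toMultiset]
    exact (MvPolynomial.le_totalDegree hs).trans hp

theorem IsPoly.contDiff {m : ℕ} (hf : IsPoly m f) : ContDiff ℝ ∞ f := by
  refine IsPoly.induction (C := fun _ f => ContDiff ℝ ∞ f) ?_ ?_ ?_ hf
  exacts [fun _ _ => contDiff_const, fun _ _ _ hf hg => hf.add hg,
    fun _ i _ _ hf => (EuclideanSpace.proj (𝕜 := ℝ) i).contDiff.mul hf]

theorem IsPoly.continuous {m : ℕ} (hf : IsPoly m f) : Continuous f :=
  (IsPoly.contDiff hf).continuous

theorem IsPoly.differentiable {m : ℕ} (hf : IsPoly m f) :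
    Differentiable ℝ f := (IsPoly.contDiff hf).differentiable (by simp)

/-- Affine functions are polynomial functions of degree one. -/
theorem IsPoly.affine (l : Pt d →ᵃ[ℝ] ℝ) : IsPoly 1 (l : Pt d → ℝ) := by
  have h : (l : Pt d → ℝ) = fun x => l 0 + ∑ i, l.linear (e i) * x i := by
    ext x
    have h1 : l x = l.linear (x - 0) + l 0 := by rw [← vsub_eq_sub, AffineMap.linearMap_vsub]; simp
    have h2 : x = ∑ i, x i • e i := by
      have := (EuclideanSpace.basisFun (Fin d) ℝ).sum_repr x
      simpa [e] using this.symm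
    rw [h1, sub_zero]
    conv_lhs => rw [h2]
    simp [map_sum, add_comm, mul_comm]
  rw [h]
  exact IsPoly.add (IsPoly.const _ _) (IsPoly.sum _ fun i _ => IsPoly.smul _ (IsPoly.coord i))

/-- Polynomial functions are stable by composition with affine maps. -/
theorem IsPoly.comp_affine {m : ℕ} (hf : IsPoly m f)
    (Φ : Pt d →ᵃ[ℝ] Pt d) : IsPoly m (fun x => f (Φ x)) := by
  refine IsPoly.induction (C := fun m f => IsPoly m (fun x => f (Φ x))) ?_ ?_ ?_ hf
  exacts [fun _ _ => .const _ _, fun _ _ _ hf hg => hf.add hg, fun m i f _ hf => add_comm 1 m ▸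
    (IsPoly.affine ((EuclideanSpace.proj (𝕜 := ℝ) i).toLinearMap.toAffineMap.comp Φ)).mul hf]

theorem IsPoly.pderiv_coord_mul (i j : Fin d) (hf : Differentiable ℝ f)
    (x : Pt d) : pderiv j (fun x => x i * f x) x = x i * pderiv j f x + e j i * f x := by
  have h : HasFDerivAt (fun x : Pt d => x i * f x) _ x :=
    (EuclideanSpace.proj (𝕜 := ℝ) i).hasFDerivAt.mul (hf x).hasFDerivAt
  rw [pderiv, h.fderiv]
  simp [pderiv]; ring

/-- Derivatives lower the degree of polynomial functions. -/
theorem IsPoly.pderiv_pred {m : ℕ} (hf : IsPoly m f) (j : Fin d) : IsPoly (m - 1) (pderiv j f) := by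
  have := IsPoly.induction (C := fun m f => IsPoly m f ∧
    IsPoly (m - 1) (pderiv j f) ∧ (m = 0 → pderiv j f = 0)) ?_ ?_ ?_ hf
  · exact this.2.1
  · intro m c
    have : pderiv j (fun _ : Pt d => c) = 0 := by ext; simp [pderiv]
    exact ⟨IsPoly.const _ _, by rw [this]; exact Submodule.zero_mem _, fun _ => this⟩
  · rintro m f g ⟨hf, hf', hf0⟩ ⟨hg, hg', hg0⟩
    have : pderiv j (fun x => f x + g x) = fun x => pderiv j f x + pderiv j g x := by
      ext x
      simp only [pderiv]
      rw [fderiv_fun_add (hf.differentiable x) (hg.differentiable x)]; rfl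
    refine ⟨hf.add hg, by rw [this]; exact hf'.add hg', fun h => ?_⟩
    rw [this, hf0 h, hg0 h]; ext; simp
  · rintro m i f - ⟨hf, hf', hf0⟩
    have : pderiv j (fun x => x i * f x) = fun x => x i * pderiv j f x + e j i * f x := by
      ext x; exact IsPoly.pderiv_coord_mul i j hf.differentiable x
    refine ⟨by rw [add_comm]; exact (IsPoly.coord i).mul hf, ?_, by omega⟩
    rw [this]
    refine IsPoly.add ?_ (IsPoly.smul _ hf)
    rcases m with _ | m
    · rw [hf0 rfl]; simpa using IsPoly.const 0 0
    · simpa [add_comm] using (IsPoly.coord i).mul hf'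

theorem IsPoly.pderiv_mem {m : ℕ} (hf : IsPoly m f) (j : Fin d) :
    IsPoly m (pderiv j f) := (hf.pderiv_pred j).mono (by omega)

theorem IsPoly.pderiv_succ {m : ℕ} (hf : IsPoly (m + 1) f) (j : Fin d) :
    IsPoly m (pderiv j f) := hf.pderiv_pred j

/-- Division of a polynomial function by an affine function `l`: the remainder is the value at the
projection on the hyperplane `l = 0` along a direction `v`. A zero degree function has quotient
zero. -/
theorem IsPoly.exists_div {m : ℕ} (hf : IsPoly m f) (l : Pt d →ᵃ[ℝ] ℝ) (v : Pt d) :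
    ∃ t, IsPoly (m - 1) t ∧ (m = 0 → t = 0) ∧ ∀ x, f x = f (x - l x • v) + l x * t x := by
  let Φ : Pt d →ᵃ[ℝ] Pt d := AffineMap.id ℝ (Pt d) -
    ((LinearMap.toSpanSingleton ℝ (Pt d) v).toAffineMap.comp l)
  have hΦ : ∀ x, Φ x = x - l x • v := fun x => by simp [Φ]
  refine IsPoly.induction (C := fun m f => ∃ t, IsPoly (m - 1) t ∧ (m = 0 → t = 0) ∧
    ∀ x, f x = f (x - l x • v) + l x * t x) ?_ ?_ ?_ hf
  · intro m c; exact ⟨0, Submodule.zero_mem _, fun _ => rfl, by simp⟩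
  · rintro m f g ⟨t, ht, ht0, h⟩ ⟨s, hs, hs0, h'⟩
    refine ⟨fun x => t x + s x, ht.add hs, fun h => ?_, fun x => ?_⟩
    · rw [ht0 h, hs0 h]; ext; simp
    · beta_reduce
      rw [h x, h' x]; ring
  · rintro m i f hf ⟨t, ht, ht0, h⟩
    refine ⟨fun x => v i * f (x - l x • v) + x i * t x, ?_, by omega, fun x => ?_⟩
    · refine IsPoly.add (IsPoly.smul _ ?_) ?_
      · simpa [hΦ] using hf.comp_affine Φ
      · rcases m with _ | m
        · rw [ht0 rfl]; simpa using IsPoly.const 0 0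
        · simpa [add_comm] using (IsPoly.coord i).mul ht
    · have := h x
      simp only [PiLp.sub_apply, PiLp.smul_apply, smul_eq_mul]
      rw [this]; ring

theorem mem_Poly {l : ℕ} : f ∈ Poly (l : ℤ) Y ↔ ∃ p ∈ PolyFun d l, f = (hull Y).indicator p := by
  rw [Poly, if_neg (by omega)]
  constructor
  · rintro ⟨p, hp, rfl⟩
    exact ⟨evalFun p, Submodule.mem_map_of_mem (by simpa using hp), rfl⟩
  · rintro ⟨p, ⟨q, hq, rfl⟩, rfl⟩
    exact ⟨q, by simpa using hq, rfl⟩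

theorem mem_Poly_neg {l : ℤ} (hl : l < 0) : f ∈ Poly l Y ↔ f = 0 := by rw [Poly, if_pos hl]; simp

instance Poly.finite (l : ℤ) (Y : Finset (Pt d)) : Module.Finite ℝ (Poly l Y) := by
  by_cases h : l < 0
  · rw [Poly, if_pos h]; infer_instance
  · rw [Poly, if_neg h]; infer_instance

/-! ### Geometry of simplices -/

/-- Nondegenerate simplices of the space, represented by their vertices. -/
structure IsSimplex {d : ℕ} (T : Finset (Pt d)) : Prop where
  card : T.card = d + 1
  indep : AffineIndependent ℝ ((↑) : T → Pt d)

namespace IsSimplex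

theorem nonempty (hT : IsSimplex T) : T.Nonempty := by rw [← card_pos, hT.card]; omega

/-- The affine basis made of the vertices of a simplex. -/
def basis (hT : IsSimplex T) : AffineBasis T ℝ (Pt d) where
  toFun := (↑)
  ind' := hT.indep
  tot' := by
    rw [hT.indep.affineSpan_eq_top_iff_card_eq_finrank_add_one]
    simp [hT.card]

theorem range_basis (hT : IsSimplex T) : Set.range hT.basis = (T : Set (Pt d)) := Subtype.range_coe

/-- The barycentric coordinate associated with a vertex of a simplex (zero for other points). -/
def bary (hT : IsSimplex T) (a : Pt d) : Pt d →ᵃ[ℝ] ℝ :=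
  open Classical in if h : a ∈ T then hT.basis.coord ⟨a, h⟩ else AffineMap.const ℝ _ 0

theorem bary_coe (hT : IsSimplex T) (a : T) : hT.bary a = hT.basis.coord a := by simp [bary]

theorem bary_self (hT : IsSimplex T) (ha : a ∈ T) : hT.bary a a = 1 := by
  lift a to T using ha
  rw [bary_coe]
  exact hT.basis.coord_apply_eq a

theorem bary_ne (hT : IsSimplex T) {b : Pt d} (hb : b ∈ T) (hab : a ≠ b) : hT.bary a b = 0 := by
  by_cases ha : a ∈ T
  · lift a to T using ha
    lift b to T using hb
    rw [bary_coe]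
    exact hT.basis.coord_apply_ne (fun h => hab (congrArg _ h))
  · simp [bary, ha]

theorem sum_bary (hT : IsSimplex T) (x : Pt d) : ∑ a ∈ T, hT.bary a x = 1 := by
  rw [← sum_coe_sort]
  simp_rw [bary_coe]
  exact hT.basis.sum_coord_apply_eq_one x

theorem sum_bary_smul (hT : IsSimplex T) (x : Pt d) : ∑ a ∈ T, hT.bary a x • a = x := by
  rw [← sum_coe_sort T (fun a => hT.bary a x • a)]
  simp_rw [bary_coe]
  exact hT.basis.linear_combination_coord_eq_self x

theorem linear_bary (hT : IsSimplex T) (a z : Pt d) :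
    (hT.bary a).linear z = hT.bary a z - hT.bary a 0 := by
  simpa using (hT.bary a).linearMap_vsub z 0

theorem sum_linear (hT : IsSimplex T) (z : Pt d) : ∑ a ∈ T, (hT.bary a).linear z = 0 := by
  simp_rw [linear_bary]
  rw [sum_sub_distrib, sum_bary, sum_bary, sub_self]

theorem sum_linear_smul (hT : IsSimplex T) (z : Pt d) : ∑ a ∈ T, (hT.bary a).linear z • a = z := by
  simp_rw [linear_bary, sub_smul]
  rw [sum_sub_distrib, sum_bary_smul, sum_bary_smul, sub_zero]

theorem mem_hull (hT : IsSimplex T) : x ∈ hull T ↔ ∀ a ∈ T, 0 ≤ hT.bary a x := by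
  rw [hull, ← hT.range_basis, hT.basis.convexHull_eq_nonneg_coord]
  simp only [mem_ofPred_eq, Subtype.forall]
  exact forall₂_congr fun a ha => by rw [← hT.bary_coe ⟨a, ha⟩]

theorem mem_interior (hT : IsSimplex T) : x ∈ interior (hull T) ↔ ∀ a ∈ T, 0 < hT.bary a x := by
  rw [hull, ← hT.range_basis, hT.basis.interior_convexHull]
  simp only [mem_ofPred_eq, Subtype.forall]
  exact forall₂_congr fun a ha => by rw [← hT.bary_coe ⟨a, ha⟩]

theorem bary_le_one (hT : IsSimplex T) (hx : x ∈ hull T) (ha : a ∈ T) : hT.bary a x ≤ 1 := by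
  rw [← hT.sum_bary x]
  exact single_le_sum (f := fun a => hT.bary a x) (hT.mem_hull.1 hx) ha

theorem mem_face (hT : IsSimplex T) (ha : a ∈ T) :
    x ∈ hull (T.erase a) ↔ x ∈ hull T ∧ hT.bary a x = 0 := by
  constructor
  · intro hx
    refine ⟨convexHull_mono (by simp) hx, ?_⟩
    exact convexHull_min (t := hT.bary a ⁻¹' {0}) (fun b hb => hT.bary_ne
      (mem_of_mem_erase hb) (ne_of_mem_erase hb).symm)
      ((convex_singleton (0 : ℝ)).affine_preimage _) hx
  · rintro ⟨hx, h0⟩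
    have h1 := hT.sum_bary_smul x
    have h2 := hT.sum_bary x
    rw [← Finset.add_sum_erase T _ ha, h0] at h1 h2
    rw [zero_smul, zero_add] at h1
    rw [zero_add] at h2
    rw [hull, ← h1]
    refine (convex_convexHull ℝ _).sum_mem (fun b hb => ?_) h2
      (fun b hb => subset_convexHull ℝ _ hb)
    exact hT.mem_hull.1 hx b (mem_of_mem_erase hb)

/-- The gradient of a barycentric coordinate. -/
def grad (hT : IsSimplex T) (a : Pt d) : Pt d :=
  (InnerProductSpace.toDual ℝ (Pt d)).symm (LinearMap.toContinuousLinearMap (hT.bary a).linear)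

theorem inner_grad (hT : IsSimplex T) (a z : Pt d) :
    inner ℝ (hT.grad a) z = (hT.bary a).linear z := by
  simp [grad]

theorem inner_grad_sub (hT : IsSimplex T) (a x y : Pt d) :
    inner ℝ (hT.grad a) (x - y) = hT.bary a x - hT.bary a y := by
  rw [inner_grad]
  exact (hT.bary a).linearMap_vsub x y

theorem exists_ne (hT : IsSimplex T) (hd : 0 < d) (a : Pt d) : ∃ b ∈ T, b ≠ a :=
  T.exists_mem_ne (by rw [hT.card]; omega) a

theorem grad_ne_zero (hT : IsSimplex T) (hd : 0 < d) (ha : a ∈ T) : hT.grad a ≠ 0 := by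
  intro h
  obtain ⟨b, hb, hab⟩ := hT.exists_ne hd a
  have := hT.inner_grad_sub a a b
  simp [h, hT.bary_self ha, hT.bary_ne hb hab.symm] at this

theorem isPoly_bary (hT : IsSimplex T) (a : Pt d) : IsPoly 1 (hT.bary a) := IsPoly.affine _

theorem continuous_bary (hT : IsSimplex T) (a : Pt d) : Continuous (hT.bary a) :=
  (hT.isPoly_bary a).continuous

theorem isCompact_hull (Y : Finset (Pt d)) : IsCompact (hull Y) :=
  Y.finite_toSet.isCompact_convexHull ℝ

theorem measurableSet_hull (Y : Finset (Pt d)) : MeasurableSet (hull Y) :=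
  (isCompact_hull Y).measurableSet

theorem nonempty_interior (hT : IsSimplex T) : (interior (hull T)).Nonempty := by
  rw [hull, ← hT.range_basis]
  exact ⟨_, hT.basis.centroid_mem_interior_convexHull⟩

theorem convex_hull (Y : Finset (Pt d)) : Convex ℝ (hull Y) := convex_convexHull ℝ _

theorem closure_interior (hT : IsSimplex T) : closure (interior (hull T)) = hull T := by
  rw [(convex_hull T).closure_interior_eq_closure_of_nonempty_interior hT.nonempty_interior]
  exact (isCompact_hull T).isClosed.closure_eq

theorem volume_pos (hT : IsSimplex T) : 0 < volume.real (hull T) := by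
  refine ENNReal.toReal_pos ?_ (isCompact_hull T).measure_lt_top.ne
  exact (isOpen_interior.measure_pos volume hT.nonempty_interior).ne' ∘ fun h => measure_mono_null interior_subset h

theorem uniqueDiffOn (hT : IsSimplex T) : UniqueDiffOn ℝ (hull T) :=
  uniqueDiffOn_convex (convex_hull T) hT.nonempty_interior

theorem facesOf_eq (hT : IsSimplex T) : facesOf T = T.image (fun a => T.erase a) := by
  ext F
  simp only [facesOf, mem_powersetCard, Finset.mem_image]
  constructor
  · rintro ⟨hF, hc⟩
    obtain ⟨a, ha, rfl⟩ := Finset.exists_eq_insert_iff.2 ⟨hF, by rw [hc, hT.card]⟩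
    exact ⟨a, by simp, Finset.erase_insert ha⟩
  · rintro ⟨a, ha, rfl⟩
    exact ⟨Finset.erase_subset _ _, by rw [Finset.card_erase_of_mem ha, hT.card]; omega⟩

theorem sum_facesOf (hT : IsSimplex T) (f : Finset (Pt d) → ℝ) :
    ∑ F ∈ facesOf T, f F = ∑ a ∈ T, f (T.erase a) := by
  rw [hT.facesOf_eq, Finset.sum_image (Finset.erase_injOn T)]

theorem erase_mem_facesOf (hT : IsSimplex T) (ha : a ∈ T) : T.erase a ∈ facesOf T := by
  rw [hT.facesOf_eq]; exact Finset.mem_image_of_mem _ ha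

theorem exists_erase (hT : IsSimplex T) (hF : F ∈ facesOf T) : ∃ a ∈ T, T.erase a = F := by
  rw [hT.facesOf_eq] at hF; simpa using hF

theorem card_facesOf (hT : IsSimplex T) : (facesOf T).card = d + 1 := by
  rw [facesOf, Finset.card_powersetCard, hT.card]; simp

theorem hull_face_subset (hF : F ∈ facesOf T) : hull F ⊆ hull T :=
  convexHull_mono (by exact_mod_cast (mem_powersetCard.1 hF).1)

/-- The outer normal to the face opposite to a vertex. -/
theorem normal_eq (hT : IsSimplex T) (hd : 0 < d) (ha : a ∈ T) :
    normal T (T.erase a) = -(‖hT.grad a‖⁻¹ • hT.grad a) := by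
  have hg := hT.grad_ne_zero hd ha
  have hg' : 0 < ‖hT.grad a‖ := norm_pos_iff.2 hg
  have hex : ∃ n : Pt d, ‖n‖ = 1 ∧ (∀ x ∈ T.erase a, ∀ y ∈ T.erase a, inner ℝ n (x - y) = 0) ∧
      ∀ x ∈ T.erase a, ∀ b ∈ T, b ∉ T.erase a → 0 < inner ℝ n (x - b) := by
    refine ⟨-(‖hT.grad a‖⁻¹ • hT.grad a), ?_, ?_, ?_⟩
    · rw [norm_neg, norm_smul, norm_inv, norm_norm, inv_mul_cancel₀ hg'.ne']
    · intro x hx y hy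
      rw [inner_neg_left, real_inner_smul_left, inner_grad_sub,
        hT.bary_ne (mem_of_mem_erase hx) (ne_of_mem_erase hx).symm,
        hT.bary_ne (mem_of_mem_erase hy) (ne_of_mem_erase hy).symm]
      simp
    · intro x hx b hb hb'
      have : b = a := by by_contra h; exact hb' (mem_erase.2 ⟨h, hb⟩)
      subst this
      rw [inner_neg_left, real_inner_smul_left, inner_grad_sub, hT.bary_self hb,
        hT.bary_ne (mem_of_mem_erase hx) (ne_of_mem_erase hx).symm]
      simpa using hg
  obtain ⟨h1, h2, h3⟩ : ‖normal T (T.erase a)‖ = 1 ∧ _ := Classical.epsilon_spec hex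
  obtain ⟨b, hb, hab⟩ := hT.exists_ne hd a
  have hbF : b ∈ T.erase a := mem_erase.2 ⟨hab, hb⟩
  have hs := h3 b hbF a ha (by simp)
  change 0 < inner ℝ (normal T (T.erase a)) (b - a) at hs
  change ∀ x ∈ T.erase a, ∀ y ∈ T.erase a, inner ℝ (normal T (T.erase a)) (x - y) = 0 at h2
  set n := normal T (T.erase a)
  have key : n = -((inner ℝ n (b - a)) • hT.grad a) := by
    refine ext_inner_right ℝ fun z => ?_
    have hz : z = ∑ c ∈ T, (hT.bary c).linear z • (c - b) := by
      simp_rw [smul_sub]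
      rw [sum_sub_distrib, hT.sum_linear_smul, ← Finset.sum_smul, hT.sum_linear]; simp
    conv_lhs => rw [hz]
    rw [inner_sum, ← Finset.add_sum_erase T _ ha, sum_eq_zero (fun c hc => by
      rw [real_inner_smul_right, h2 c hc b hbF, mul_zero]), inner_neg_left, real_inner_smul_left,
      inner_grad, real_inner_smul_right, ← neg_sub b a, inner_neg_right]
    ring
  have hs2 : inner ℝ n (b - a) = ‖hT.grad a‖⁻¹ := by
    have := congrArg norm key
    rw [h1, norm_neg, norm_smul, norm_of_nonneg hs.le] at this
    field_simp; linarith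
  rw [key, hs2]

theorem inner_normal (hT : IsSimplex T) (hd : 0 < d) (ha : a ∈ T) (z : Pt d) :
    inner ℝ (normal T (T.erase a)) z = -(‖hT.grad a‖⁻¹ * (hT.bary a).linear z) := by
  rw [hT.normal_eq hd ha, inner_neg_left, real_inner_smul_left, inner_grad]

theorem norm_normal (hT : IsSimplex T) (hd : 0 < d) (ha : a ∈ T) : ‖normal T (T.erase a)‖ = 1 := by
  rw [hT.normal_eq hd ha, norm_neg, norm_smul, norm_inv, norm_norm,
    inv_mul_cancel₀ (norm_ne_zero_iff.2 (hT.grad_ne_zero hd ha))]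

theorem dist_le_diam {y : Pt d} (hx : x ∈ hull Y) (hy : y ∈ hull Y) : ‖x - y‖ ≤ diam Y := by
  rw [← dist_eq_norm]
  exact Metric.dist_le_diam_of_mem (isCompact_hull Y).isBounded hx hy

theorem vertex_mem_hull (ha : a ∈ Y) : a ∈ hull Y := subset_convexHull ℝ _ ha

theorem one_le_norm_grad_mul_diam (hT : IsSimplex T) (hd : 0 < d) (ha : a ∈ T) :
    1 ≤ ‖hT.grad a‖ * diam T := by
  obtain ⟨b, hb, hab⟩ := hT.exists_ne hd a
  have := hT.inner_grad_sub a a b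
  rw [hT.bary_self ha, hT.bary_ne hb hab.symm, sub_zero] at this
  rw [← this]
  refine (real_inner_le_norm _ _).trans ?_
  gcongr
  exact dist_le_diam (vertex_mem_hull ha) (vertex_mem_hull hb)

theorem diam_pos (hT : IsSimplex T) (hd : 0 < d) : 0 < diam T := by
  obtain ⟨a, ha⟩ := hT.nonempty
  exact pos_of_mul_pos_right (one_pos.trans_le (hT.one_le_norm_grad_mul_diam hd ha)) (norm_nonneg _)

/-- The inradius bounds the heights from below. -/
theorem norm_grad_mul_le_one (hT : IsSimplex T) {c : Pt d} (ha : a ∈ T) {ρ : ℝ} (hρ : 0 < ρ)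
    (hb : Metric.closedBall c (ρ / 2) ⊆ hull T) : ‖hT.grad a‖ * ρ ≤ 1 := by
  rcases eq_or_ne (hT.grad a) 0 with h0 | h0
  · simp [h0]
  have hg : 0 < ‖hT.grad a‖ := norm_pos_iff.2 h0
  set z := ((ρ / 2) * ‖hT.grad a‖⁻¹) • hT.grad a with hz
  have hnz : ‖z‖ = ρ / 2 := by rw [hz, norm_smul, norm_of_nonneg (by positivity)]; field_simp
  have h1 : c + z ∈ hull T := hb (by simp [hnz])
  have h2 : c - z ∈ hull T := hb (by simp [hnz])
  have h3 := hT.inner_grad_sub a (c + z) (c - z)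
  have h4 : c + z - (c - z) = (ρ * ‖hT.grad a‖⁻¹) • hT.grad a := by rw [hz]; module
  rw [h4, real_inner_smul_right, real_inner_self_eq_norm_sq] at h3
  have h5 := hT.bary_le_one h1 ha
  have h6 := hT.mem_hull.1 h2 a ha
  have : ρ * ‖hT.grad a‖⁻¹ * ‖hT.grad a‖ ^ 2 = ‖hT.grad a‖ * ρ := by field_simp
  linarith

theorem norm_grad_le (hT : IsSimplex T) {c : Pt d} (ha : a ∈ T) {ρ : ℝ} (hρ : 0 < ρ)
    (hb : Metric.closedBall c (ρ / 2) ⊆ hull T) : ‖hT.grad a‖ ≤ ρ⁻¹ := by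
  rw [← one_div, le_div_iff₀ hρ]
  exact hT.norm_grad_mul_le_one ha hρ hb

end IsSimplex

/-! ### Divergence theorem on simplices -/

/-- Lines in the direction `n` and their orthogonal hyperplane: the product measure is the volume. -/
theorem measurePreserving_normal_line {n : Pt d} (hn : ‖n‖ = 1) :
    MeasurePreserving (fun p : ℝ × (ℝ ∙ n)ᗮ => (p.2 : Pt d) + p.1 • n)
      (volume.prod volume) volume := by
  have h1 := ((ℝ ∙ n).measurePreserving_measurableEquivProd (0 : Pt d)).symm
  have h2 : MeasurePreserving (LinearIsometryEquiv.toSpanUnitSingleton n hn) volume volume :=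
    LinearIsometryEquiv.measurePreserving _
  have h3 := h2.prod (MeasurePreserving.id (volume : Measure (ℝ ∙ n)ᗮ))
  rw [InnerProductSpace.euclideanHausdorffMeasure_eq_volume] at h1
  have h4 := h1.comp h3
  have h5 : (fun p : ℝ × (ℝ ∙ n)ᗮ => (p.2 : Pt d) + p.1 • n) =
      ((ℝ ∙ n).measurableEquivProd (0 : Pt d)).symm ∘
        Prod.map (LinearIsometryEquiv.toSpanUnitSingleton n hn) id := by
    funext p
    simp [add_comm]
  rw [h5]
  exact h4

theorem integral_normal_line {n v : Pt d} (x0 : Pt d) (hn : ‖n‖ = 1) (hv : 0 < inner ℝ n v)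
    (hf : Integrable f) :
    ∫ x, f x = inner ℝ n v * ∫ y : (ℝ ∙ n)ᗮ, ∫ s : ℝ, f (x0 + y + s • v) := by
  set A : Pt d →ₗ[ℝ] Pt d := LinearMap.transvection ((innerₗ (Pt d)) n) (v - n) with hA
  have hAapp : ∀ z, A z = z + (inner ℝ n z) • (v - n) := fun z => by
    simp [hA, LinearMap.transvection.apply]
  have hdet : LinearMap.det A = inner ℝ n v := by
    rw [hA, LinearMap.transvection.det]
    simp [inner_sub_right, hn]
  have hdet0 : LinearMap.det A ≠ 0 := by rw [hdet]; exact hv.ne'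
  have hmap := Measure.map_linearMap_addHaar_eq_smul_addHaar (volume : Measure (Pt d)) hdet0
  set f0 : Pt d → ℝ := fun x => f (x0 + x)
  have hf0 : Integrable f0 := hf.comp_add_left x0
  have hAm : MeasurableEmbedding A :=
    (LinearMap.equivOfDetNeZero A hdet0).toContinuousLinearEquiv.toHomeomorph.measurableEmbedding
  have hint : Integrable (fun z => f0 (A z)) := by
    have : Integrable f0 (Measure.map A volume) := by
      rw [hmap]; exact hf0.smul_measure ofReal_ne_top
    exact (hAm.integrable_map_iff).1 this
  have h1 : ∫ z, f0 (A z) = (inner ℝ n v)⁻¹ * ∫ x, f x := by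
    rw [← hAm.integral_map, hmap, integral_smul_measure, hdet,
      ENNReal.toReal_ofReal (abs_nonneg _), abs_of_pos (inv_pos.2 hv), smul_eq_mul]
    congr 1
    exact integral_add_left_eq_self f x0
  have hQ := measurePreserving_normal_line hn
  have hQm : MeasurableEmbedding (fun p : ℝ × (ℝ ∙ n)ᗮ => (p.2 : Pt d) + p.1 • n) := by
    have e1 := (((LinearIsometryEquiv.toSpanUnitSingleton n hn).toHomeomorph.toMeasurableEquiv.prodCongr
      (MeasurableEquiv.refl _)).trans ((ℝ ∙ n).measurableEquivProd
        (0 : Pt d)).symm).measurableEmbedding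
    have h5 : (fun p : ℝ × (ℝ ∙ n)ᗮ => (p.2 : Pt d) + p.1 • n) =
      ((ℝ ∙ n).measurableEquivProd (0 : Pt d)).symm ∘
        Prod.map (LinearIsometryEquiv.toSpanUnitSingleton n hn) id := by
      funext p
      simp [add_comm]
    rw [h5]
    exact e1
  have h2 := hQ.integral_comp hQm (fun z => f0 (A z))
  have hint2 := (hQ.integrable_comp_emb hQm).2 hint
  have hint3 : Integrable (fun p : ℝ × (ℝ ∙ n)ᗮ => f0 (A ((p.2 : Pt d) + p.1 • n)))
      (volume.prod volume) := hint2
  rw [h1, integral_prod_symm _ hint3] at h2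
  have h3 : ∀ (y : (ℝ ∙ n)ᗮ) (s : ℝ), f0 (A (y + s • n)) = f (x0 + y + s • v) := by
    intro y s
    have hy : inner ℝ n (y : Pt d) = 0 := Submodule.mem_orthogonal_singleton_iff_inner_right.1 y.2
    simp only [f0]
    rw [hAapp, inner_add_right, hy, real_inner_smul_right, real_inner_self_eq_norm_sq, hn]
    congr 1
    module
  simp only [h3] at h2
  rw [h2]
  field_simp

theorem finrank_orthogonal_unit {n : Pt d} (hn : ‖n‖ = 1) : Module.finrank ℝ (ℝ ∙ n)ᗮ = d - 1 := by
  have h0 : n ≠ 0 := by rintro rfl; simp at hn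
  have h1 := (ℝ ∙ n).finrank_add_finrank_orthogonal
  rw [finrank_span_singleton h0, finrank_euclideanSpace_fin] at h1
  omega

/-- Surface integrals over a hyperplane as integrals over its direction. -/
theorem integral_hyperplane {n : Pt d} (x0 : Pt d) (hn : ‖n‖ = 1) (f : Pt d → ℝ) :
    ∫ y : (ℝ ∙ n)ᗮ, f (x0 + y) =
      ∫ x in {x | inner ℝ n (x - x0) = 0}, f x ∂μHE[d - 1] := by
  have hiso : Isometry (fun y : (ℝ ∙ n)ᗮ => x0 + (y : Pt d)) :=
    (IsometryEquiv.addLeft x0).isometry.comp isometry_subtype_coe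
  have h1 := hiso.map_euclideanHausdorffMeasure (d := d - 1)
  have h2 : Set.range (fun y : (ℝ ∙ n)ᗮ => x0 + (y : Pt d)) = {x | inner ℝ n (x - x0) = 0} := by
    ext x
    simp only [mem_range, mem_ofPred_eq]
    constructor
    · rintro ⟨y, rfl⟩
      simpa using Submodule.mem_orthogonal_singleton_iff_inner_right.1 y.2
    · intro h
      exact ⟨⟨x - x0, Submodule.mem_orthogonal_singleton_iff_inner_right.2 h⟩, by simp⟩
  rw [h2] at h1
  rw [← h1, (hiso.isClosedEmbedding.measurableEmbedding).integral_map]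
  have h3 : (volume : Measure (ℝ ∙ n)ᗮ) = μHE[d - 1] := by
    rw [← finrank_orthogonal_unit hn]
    exact InnerProductSpace.euclideanHausdorffMeasure_eq_volume.symm
  rw [h3]

/-- The fundamental theorem of calculus along the lines of direction `v`, on the part of a
`v`-invariant set located below a hyperplane. -/
theorem integral_halfspace {n v : Pt d} (x0 : Pt d) (hn : ‖n‖ = 1) (hv : 0 < inner ℝ n v)
    {P : Set (Pt d)} (hP : MeasurableSet P) (hPv : ∀ x (s : ℝ), x + s • v ∈ P ↔ x ∈ P)
    (hφ : ContDiff ℝ 1 φ) (hc : HasCompactSupport φ) :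
    ∫ x in P ∩ {x | inner ℝ n (x - x0) ≤ 0}, fderiv ℝ φ x v =
      inner ℝ n v * ∫ x in P ∩ {x | inner ℝ n (x - x0) = 0}, φ x ∂μHE[d - 1] := by
  have hcont : Continuous (fun x => fderiv ℝ φ x v) :=
    (hφ.continuous_fderiv (by simp)).clm_apply continuous_const
  have hcs : HasCompactSupport (fun x => fderiv ℝ φ x v) := hc.fderiv_apply (𝕜 := ℝ) v
  have hm : MeasurableSet (P ∩ {x | inner ℝ n (x - x0) ≤ 0}) :=
    hP.inter (isClosed_le (by fun_prop) continuous_const).measurableSet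
  have hint : Integrable (fun x => fderiv ℝ φ x v) := hcont.integrable_of_hasCompactSupport hcs
  rw [← integral_indicator hm, integral_normal_line x0 hn hv (hint.indicator hm)]
  congr 1
  have h0 : ∫ x in P ∩ {x | inner ℝ n (x - x0) = 0}, φ x ∂μHE[d - 1] =
      ∫ x in {x | inner ℝ n (x - x0) = 0}, P.indicator φ x ∂μHE[d - 1] := by
    rw [setIntegral_indicator hP, inter_comm]
  rw [h0, ← integral_hyperplane x0 hn]
  refine integral_congr_ae (Eventually.of_forall fun y => ?_)
  have hy : inner ℝ n (y : Pt d) = 0 := Submodule.mem_orthogonal_singleton_iff_inner_right.1 y.2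
  beta_reduce
  have h1 : ∀ s : ℝ, (P ∩ {x | inner ℝ n (x - x0) ≤ 0}).indicator (fun x => fderiv ℝ φ x v)
      (x0 + y + s • v) = (Iic (0 : ℝ)).indicator
        (fun s => P.indicator (fun _ => fderiv ℝ φ (x0 + y + s • v) v) (x0 + y)) s := by
    intro s
    have e1 : (x0 + y + s • v ∈ {x | inner ℝ n (x - x0) ≤ 0}) ↔ s ∈ Iic (0 : ℝ) := by
      have : x0 + (y : Pt d) + s • v - x0 = y + s • v := by abel
      simp only [mem_ofPred_eq, mem_Iic, this, inner_add_right, hy, zero_add, real_inner_smul_right]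
      constructor
      · intro h; by_contra hs; push Not at hs; nlinarith
      · intro h; nlinarith
    have e2 := hPv (x0 + y) s
    by_cases hs : s ∈ Iic (0 : ℝ) <;> by_cases hp : x0 + (y : Pt d) ∈ P <;>
      simp only [indicator, mem_inter_iff, e1, e2, hs, hp] <;> simp
  simp_rw [h1]
  rw [integral_indicator measurableSet_Iic]
  by_cases hp : x0 + (y : Pt d) ∈ P
  · simp only [indicator_of_mem hp]
    set ψ : ℝ → ℝ := fun s => φ (x0 + y + s • v) with hψ
    have hv0 : v ≠ 0 := by rintro rfl; simp at hv
    have hd : ∀ s, deriv ψ s = fderiv ℝ φ (x0 + y + s • v) v := by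
      intro s
      have h1 : HasDerivAt (fun s : ℝ => x0 + (y : Pt d) + s • v) v s := by
        simpa using ((hasDerivAt_id s).smul_const v).const_add (x0 + (y : Pt d))
      exact (((hφ.differentiable (by simp)) _).hasFDerivAt.comp_hasDerivAt s h1).deriv
    have hψc : HasCompactSupport ψ := by
      refine hc.comp_isClosedEmbedding ?_
      have : (fun s : ℝ => x0 + (y : Pt d) + s • v) =
        (Homeomorph.addLeft (x0 + (y : Pt d))) ∘ fun s : ℝ => s • v := rfl
      rw [this]
      exact (Homeomorph.isClosedEmbedding _).comp (isClosedEmbedding_smul_left hv0)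
    have hψ1 : ContDiff ℝ 1 ψ := hφ.comp (by fun_prop)
    have := hψc.integral_Iic_deriv_eq hψ1 0
    simp_rw [hd] at this
    rw [this]
    simp [hψ]
  · simp [indicator_of_notMem hp]

theorem volume_hyperplane {n : Pt d} (x0 : Pt d) (hn : n ≠ 0) :
    volume {x | inner ℝ n (x - x0) = 0} = 0 := by
  set s : AffineSubspace ℝ (Pt d) := AffineSubspace.mk' x0 (ℝ ∙ n)ᗮ
  have hs : {x | inner ℝ n (x - x0) = 0} = (s : Set (Pt d)) := by
    ext x
    simp [s, AffineSubspace.mem_mk', Submodule.mem_orthogonal_singleton_iff_inner_right]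
  rw [hs]
  refine Measure.addHaar_affineSubspace volume s fun h => ?_
  have : x0 + n ∈ s := by rw [h]; trivial
  have h2 : x0 + n ∈ {x | inner ℝ n (x - x0) = 0} := by rw [hs]; exact this
  simp only [mem_ofPred_eq, add_sub_cancel_left, inner_self_eq_zero] at h2
  exact hn h2

namespace IsSimplex

/-- The divergence theorem in the direction of an edge, along which only two faces are crossed. -/
theorem integral_edge (hT : IsSimplex T) (hd : 0 < d) {b : Pt d} (ha : a ∈ T) (hb : b ∈ T)
    (hab : a ≠ b) (hφ : ContDiff ℝ 1 φ) (hc : HasCompactSupport φ) :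
    intT T (fun x => fderiv ℝ φ x (b - a)) =
      ‖hT.grad a‖⁻¹ * intF (T.erase a) φ - ‖hT.grad b‖⁻¹ * intF (T.erase b) φ := by
  have hga := norm_pos_iff.2 (hT.grad_ne_zero hd ha)
  have hgb := norm_pos_iff.2 (hT.grad_ne_zero hd hb)
  have hbary : ∀ (c x : Pt d) (s : ℝ), hT.bary c (x + s • (b - a)) =
      hT.bary c x + s * (hT.bary c b - hT.bary c a) := by
    intro c x s
    have h1 := hT.inner_grad_sub c (x + s • (b - a)) x
    have h2 := hT.inner_grad_sub c b a
    rw [add_sub_cancel_left, real_inner_smul_right, h2] at h1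
    linarith
  -- the prism generated by `T` in the direction of the edge
  set P : Set (Pt d) := {x | (∀ c ∈ T, c ≠ a → c ≠ b → 0 ≤ hT.bary c x) ∧
    0 ≤ hT.bary a x + hT.bary b x} with hPdef
  have hPm : MeasurableSet P := by
    have : P = (⋂ c ∈ T, {x | c ≠ a → c ≠ b → 0 ≤ hT.bary c x}) ∩
        {x | 0 ≤ hT.bary a x + hT.bary b x} := by
      ext x; simp [hPdef]
    rw [this]
    refine MeasurableSet.inter (Finset.measurableSet_biInter _ fun c _ => ?_) ?_
    · by_cases h1 : c = a
      · simp [h1]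
      by_cases h2 : c = b
      · simp [h2]
      simp only [ne_eq, h1, not_false_eq_true, h2, forall_const]
      exact (isClosed_le continuous_const (hT.continuous_bary c)).measurableSet
    · exact (isClosed_le continuous_const
        ((hT.continuous_bary a).add (hT.continuous_bary b))).measurableSet
  have hPv : ∀ x (s : ℝ), x + s • (b - a) ∈ P ↔ x ∈ P := by
    intro x s
    simp only [hPdef, mem_ofPred_eq]
    refine and_congr (forall₂_congr fun c hc => forall₂_congr fun h1 h2 => ?_) ?_
    · rw [hbary, hT.bary_ne hb h2, hT.bary_ne ha h1]; simp
    · rw [hbary, hbary, hT.bary_self ha, hT.bary_self hb, hT.bary_ne hb hab, hT.bary_ne ha hab.symm]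
      ring_nf
  have hna : ‖normal T (T.erase a)‖ = 1 := hT.norm_normal hd ha
  have hnb : ‖-normal T (T.erase b)‖ = 1 := by rw [norm_neg]; exact hT.norm_normal hd hb
  have hla : ∀ x, inner ℝ (normal T (T.erase a)) (x - b) = -(‖hT.grad a‖⁻¹ * hT.bary a x) := by
    intro x
    rw [hT.inner_normal hd ha, ← hT.inner_grad, hT.inner_grad_sub, hT.bary_ne hb hab, sub_zero]
  have hlb : ∀ x, inner ℝ (-normal T (T.erase b)) (x - a) = ‖hT.grad b‖⁻¹ * hT.bary b x := by
    intro x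
    rw [inner_neg_left, hT.inner_normal hd hb, ← hT.inner_grad, hT.inner_grad_sub,
      hT.bary_ne ha hab.symm, sub_zero, neg_neg]
  have hva : inner ℝ (normal T (T.erase a)) (b - a) = ‖hT.grad a‖⁻¹ := by
    rw [← neg_sub a b, inner_neg_right, hla, hT.bary_self ha]; simp
  have hvb : inner ℝ (-normal T (T.erase b)) (b - a) = ‖hT.grad b‖⁻¹ := by
    rw [hlb, hT.bary_self hb]; simp
  have Ha := integral_halfspace b hna (by rw [hva]; positivity) hPm hPv hφ hc
  have Hb := integral_halfspace a hnb (by rw [hvb]; positivity) hPm hPv hφ hc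
  rw [hva] at Ha
  rw [hvb] at Hb
  simp only [hla] at Ha
  simp only [hlb] at Hb
  have ea : ∀ x, -(‖hT.grad a‖⁻¹ * hT.bary a x) ≤ 0 ↔ 0 ≤ hT.bary a x := fun x => by
    rw [neg_nonpos, mul_nonneg_iff_of_pos_left (by positivity)]
  have ea0 : ∀ x, -(‖hT.grad a‖⁻¹ * hT.bary a x) = 0 ↔ hT.bary a x = 0 := fun x => by simp [hga.ne']
  have eb : ∀ x, ‖hT.grad b‖⁻¹ * hT.bary b x ≤ 0 ↔ hT.bary b x ≤ 0 := fun x => by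
    rw [← not_lt, mul_pos_iff_of_pos_left (by positivity), not_lt]
  have eb0 : ∀ x, ‖hT.grad b‖⁻¹ * hT.bary b x = 0 ↔ hT.bary b x = 0 := fun x => by simp [hgb.ne']
  simp only [ea, ea0] at Ha
  simp only [eb, eb0] at Hb
  have memT : ∀ x, x ∈ hull T ↔ x ∈ P ∧ 0 ≤ hT.bary a x ∧ 0 ≤ hT.bary b x := by
    intro x
    rw [hT.mem_hull]
    constructor
    · intro h
      exact ⟨⟨fun c hc _ _ => h c hc, add_nonneg (h a ha) (h b hb)⟩, h a ha, h b hb⟩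
    · rintro ⟨⟨h1, -⟩, h2, h3⟩ c hc
      by_cases hca : c = a
      · rw [hca]; exact h2
      by_cases hcb : c = b
      · rw [hcb]; exact h3
      exact h1 c hc hca hcb
  have fa : P ∩ {x | hT.bary a x = 0} = hull (T.erase a) := by
    ext x
    rw [hT.mem_face ha, memT]
    simp only [mem_inter_iff, mem_ofPred_eq]
    constructor
    · rintro ⟨h1, h2⟩
      have := h1.2
      rw [h2] at this
      exact ⟨⟨h1, h2.ge, by linarith⟩, h2⟩
    · rintro ⟨⟨h1, -, -⟩, h2⟩; exact ⟨h1, h2⟩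
  have fb : P ∩ {x | hT.bary b x = 0} = hull (T.erase b) := by
    ext x
    rw [hT.mem_face hb, memT]
    simp only [mem_inter_iff, mem_ofPred_eq]
    constructor
    · rintro ⟨h1, h2⟩
      have := h1.2
      rw [h2] at this
      exact ⟨⟨h1, by linarith, h2.ge⟩, h2⟩
    · rintro ⟨⟨h1, -, -⟩, h2⟩; exact ⟨h1, h2⟩
  rw [fa] at Ha
  rw [fb] at Hb
  have hcont : Continuous (fun x => fderiv ℝ φ x (b - a)) :=
    (hφ.continuous_fderiv (by simp)).clm_apply continuous_const
  have hcs : HasCompactSupport (fun x => fderiv ℝ φ x (b - a)) := hc.fderiv_apply (𝕜 := ℝ) _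
  have hint : Integrable
    (fun x => fderiv ℝ φ x (b - a)) := hcont.integrable_of_hasCompactSupport hcs
  have hun : P ∩ {x | 0 ≤ hT.bary a x} = hull T ∪ (P ∩ {x | hT.bary b x ≤ 0}) := by
    ext x
    simp only [mem_union, memT, mem_inter_iff, mem_ofPred_eq]
    constructor
    · rintro ⟨h1, h2⟩
      rcases le_total (hT.bary b x) 0 with h | h
      · exact Or.inr ⟨h1, h⟩
      · exact Or.inl ⟨h1, h2, h⟩
    · rintro (⟨h1, h2, -⟩ | ⟨h1, h2⟩)
      · exact ⟨h1, h2⟩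
      · exact ⟨h1, by have := h1.2; linarith⟩
  have hdis : AEDisjoint volume (hull T) (P ∩ {x | hT.bary b x ≤ 0}) := by
    have hnull := volume_hyperplane (d := d) (n := -normal T (T.erase b)) a
      (by rw [← norm_ne_zero_iff, hnb]; norm_num)
    refine measure_mono_null ?_ hnull
    rintro x ⟨h1, h2⟩
    have h3 := ((memT x).1 h1).2.2
    simp only [mem_ofPred_eq, hlb, eb0]
    exact le_antisymm h2.2 h3
  have hsplit := setIntegral_union₀ hdis
    (hPm.inter (isClosed_le (hT.continuous_bary b) continuous_const).measurableSet).nullMeasurableSet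
    hint.integrableOn hint.integrableOn
  rw [← hun, Ha, Hb] at hsplit
  simp only [intT, intF]
  linarith

end IsSimplex

/-- Smooth functions can be replaced by compactly supported ones near a bounded set. -/
theorem exists_cutoff {K : Set (Pt d)} (hK : IsCompact K) {n : ℕ∞} (hφ : ContDiff ℝ n φ) :
    ∃ ψ : Pt d → ℝ, ContDiff ℝ n ψ ∧ HasCompactSupport ψ ∧ ∀ x ∈ K, ψ =ᶠ[𝓝 x] φ := by
  obtain ⟨R, hR⟩ := hK.isBounded.subset_ball (0 : Pt d)
  let f : ContDiffBump (0 : Pt d) := ⟨max R 1, max R 1 + 1, by positivity, by linarith⟩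
  refine ⟨fun x => f x * φ x, f.contDiff.mul hφ, f.hasCompactSupport.mul_right, fun x hx => ?_⟩
  have hx' : x ∈ Metric.ball (0 : Pt d) (max R 1) :=
    Metric.ball_subset_ball (le_max_left _ _) (hR hx)
  filter_upwards [Metric.isOpen_ball.mem_nhds hx'] with y hy
  rw [f.one_of_mem_closedBall (Metric.ball_subset_closedBall hy), one_mul]

namespace IsSimplex

/-- The divergence theorem on a simplex, for the field with constant direction `v`. -/
theorem integral_fderiv (hT : IsSimplex T) (hd : 0 < d) (v : Pt d) (hφ : ContDiff ℝ 1 φ) :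
    intT T (fun x => fderiv ℝ φ x v) =
      ∑ a ∈ T, inner ℝ (normal T (T.erase a)) v * intF (T.erase a) φ := by
  wlog hc : HasCompactSupport φ generalizing φ
  · obtain ⟨ψ, hψ, hψc, hψφ⟩ := exists_cutoff (n := 1) (isCompact_hull T) hφ
    have h := this hψ hψc
    have h1 : intT T (fun x => fderiv ℝ φ x v) = intT T (fun x => fderiv ℝ ψ x v) :=
      setIntegral_congr_fun (measurableSet_hull T) fun x hx => by
        beta_reduce; rw [(hψφ x hx).fderiv_eq]
    rw [h1, h]
    refine sum_congr rfl fun a ha => ?_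
    congr 1
    exact setIntegral_congr_fun (measurableSet_hull _) fun x hx =>
      (hψφ x (hull_face_subset (hT.erase_mem_facesOf ha) hx)).self_of_nhds
  obtain ⟨b, hb⟩ := hT.nonempty
  have hcont : ∀ w : Pt d, Continuous (fun x => fderiv ℝ φ x w) := fun w =>
    (hφ.continuous_fderiv (by simp)).clm_apply continuous_const
  have hint : ∀ w : Pt d, IntegrableOn (fun x => fderiv ℝ φ x w) (hull T) := fun w =>
    (hcont w).continuousOn.integrableOn_compact (isCompact_hull T)
  have hv : v = ∑ c ∈ T, -((hT.bary c).linear v) • (b - c) := by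
    have : ∀ c, -((hT.bary c).linear v) • (b - c) =
      (hT.bary c).linear v • c - (hT.bary c).linear v • b := fun c => by module
    simp_rw [this]
    rw [sum_sub_distrib, hT.sum_linear_smul, ← Finset.sum_smul, hT.sum_linear]; simp
  have h1 : ∀ x, fderiv ℝ φ x v = ∑ c ∈ T, -((hT.bary c).linear v) * fderiv ℝ φ x (b - c) := by
    intro x
    conv_lhs => rw [hv]
    simp [map_sum]
  have h2 : ∀ c ∈ T, intT T (fun x => fderiv ℝ φ x (b - c)) =
      ‖hT.grad c‖⁻¹ * intF (T.erase c) φ - ‖hT.grad b‖⁻¹ * intF (T.erase b) φ := by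
    intro c hc'
    rcases eq_or_ne c b with rfl | h
    · simp [intT]
    · exact hT.integral_edge hd hc' hb h hφ hc
  have h3 : intT T (fun x => fderiv ℝ φ x v) = ∑ c ∈ T, -((hT.bary c).linear v) *
      intT T (fun x => fderiv ℝ φ x (b - c)) := by
    simp only [intT]
    simp_rw [h1]
    rw [integral_finsetSum _ fun c _ => (hint _).const_mul _]
    simp_rw [integral_const_mul]
  rw [h3, sum_congr rfl fun c hc' => by rw [h2 c hc']]
  simp_rw [mul_sub]
  rw [sum_sub_distrib, ← sum_mul, sum_neg_distrib, hT.sum_linear]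
  rw [neg_zero, zero_mul, sub_zero]
  refine sum_congr rfl fun c hc' => ?_
  rw [hT.inner_normal hd hc']; ring

end IsSimplex

/-! ### Surface measures of faces -/

/-- A nonnegative function that is continuous on a set whose relatively open subsets have positive
measure vanishes if its integral does. -/
theorem eq_zero_of_setIntegral_eq_zero {X : Type*} [TopologicalSpace X] [MeasurableSpace X]
    [BorelSpace X] {μ : Measure X}
      {K : Set X} (hK : MeasurableSet K) (hpos : ∀ U, IsOpen U → (U ∩ K).Nonempty → μ (U ∩ K) ≠ 0)
        {f : X → ℝ} (hf : ContinuousOn f K) (h0 : ∀ x ∈ K, 0 ≤ f x) (hint : IntegrableOn f K μ)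
          (hI : ∫ x in K, f x ∂μ = 0) : ∀ x ∈ K, f x = 0 := by
  intro x hx
  by_contra hne
  have hfx : 0 < f x := lt_of_le_of_ne (h0 x hx) (Ne.symm hne)
  have hae := (setIntegral_eq_zero_iff_of_nonneg_ae
    ((ae_restrict_iff' hK).2 (Eventually.of_forall h0)) hint).1 hI
  have h1 : {y ∈ K | 0 < f y} ∈ 𝓝[K] x :=
    inter_mem self_mem_nhdsWithin ((hf x hx).eventually (lt_mem_nhds hfx))
  obtain ⟨U, hU, hxU, hUK⟩ := mem_nhdsWithin.1 h1
  refine hpos U hU ⟨x, hxU, hx⟩ ?_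
  rw [Filter.EventuallyEq, ae_restrict_iff' hK] at hae
  refine measure_mono_null ?_ hae
  intro y hy
  have := (hUK hy).2
  simp only [mem_compl_iff]
  exact fun h => absurd (h hy.2) (by simpa using this.ne')

namespace IsSimplex

theorem volume_inter_ne_zero (hT : IsSimplex T) {U : Set (Pt d)} (hU : IsOpen U)
    (h : (U ∩ hull T).Nonempty) : volume (U ∩ hull T) ≠ 0 := by
  obtain ⟨x, hxU, hx⟩ := h
  rw [← hT.closure_interior] at hx
  have h1 : (U ∩ interior (hull T)).Nonempty := mem_closure_iff.1 hx U hU hxU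
  have h2 := (hU.inter isOpen_interior).measure_pos volume h1
  exact fun h => h2.ne' (measure_mono_null (inter_subset_inter_right _ interior_subset) h)

theorem map_face (hT : IsSimplex T) (hd : 0 < d) {b : Pt d} (ha : a ∈ T) :
    (volume : Measure (ℝ ∙ normal T (T.erase a))ᗮ).map
        (fun y : (ℝ ∙ normal T (T.erase a))ᗮ => b + (y : Pt d)) =
      μHE[d - 1].restrict {x | inner ℝ (normal T (T.erase a)) (x - b) = 0} := by
  have hn := hT.norm_normal hd ha
  set n := normal T (T.erase a)
  have hiso : Isometry (fun y : (ℝ ∙ n)ᗮ => b + (y : Pt d)) :=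
    (IsometryEquiv.addLeft b).isometry.comp isometry_subtype_coe
  have h1 := hiso.map_euclideanHausdorffMeasure (d := d - 1)
  have h3 : (volume : Measure (ℝ ∙ n)ᗮ) = μHE[d - 1] := by
    rw [← finrank_orthogonal_unit hn]
    exact InnerProductSpace.euclideanHausdorffMeasure_eq_volume.symm
  rw [h3, h1]
  congr 1
  ext x
  simp only [mem_range, mem_ofPred_eq]
  constructor
  · rintro ⟨y, rfl⟩
    simpa using Submodule.mem_orthogonal_singleton_iff_inner_right.1 y.2
  · intro h
    exact ⟨⟨x - b, Submodule.mem_orthogonal_singleton_iff_inner_right.2 h⟩, by simp⟩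

theorem inner_normal_sub (hT : IsSimplex T) (hd : 0 < d) {b : Pt d} (ha : a ∈ T)
    (hb : b ∈ T.erase a) (x : Pt d) :
    inner ℝ (normal T (T.erase a)) (x - b) = -(‖hT.grad a‖⁻¹ * hT.bary a x) := by
  rw [hT.inner_normal hd ha, ← hT.inner_grad, hT.inner_grad_sub,
    hT.bary_ne (mem_of_mem_erase hb) (ne_of_mem_erase hb).symm, sub_zero]

theorem exists_mem_erase (hT : IsSimplex T) (hd : 0 < d) (a : Pt d) : ∃ b, b ∈ T.erase a := by
  obtain ⟨b, hb, hab⟩ : ∃ b ∈ T, b ≠ a := hT.exists_ne hd a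
  exact ⟨b, mem_erase.2 ⟨hab, hb⟩⟩

theorem hull_face_subset_plane (hT : IsSimplex T) (hd : 0 < d) {b : Pt d} (ha : a ∈ T)
    (hb : b ∈ T.erase a) :
    hull (T.erase a) ⊆ {x | inner ℝ (normal T (T.erase a)) (x - b) = 0} := by
  intro x hx
  rw [mem_ofPred_eq, hT.inner_normal_sub hd ha hb, ((hT.mem_face ha).1 hx).2]
  simp

theorem face_lt_top (hT : IsSimplex T) (hd : 0 < d) (ha : a ∈ T) :
    (μHE[d - 1] : Measure (Pt d)) (hull (T.erase a)) < ⊤ := by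
  obtain ⟨b, hb⟩ := hT.exists_mem_erase hd a
  have h := hT.map_face hd (b := b) ha
  have h1 : (μHE[d - 1] : Measure (Pt d)) (hull (T.erase a)) =
      μHE[d - 1].restrict {x | inner ℝ (normal T (T.erase a)) (x - b) = 0} (hull (T.erase a)) := by
    rw [Measure.restrict_apply (measurableSet_hull _),
      inter_eq_left.2 (hT.hull_face_subset_plane hd ha hb)]
  rw [h1, ← h, Measure.map_apply (by fun_prop) (measurableSet_hull _)]
  have hiso : Isometry (fun y : (ℝ ∙ normal T (T.erase a))ᗮ => b + (y : Pt d)) :=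
    (IsometryEquiv.addLeft b).isometry.comp isometry_subtype_coe
  exact (hiso.isClosedEmbedding.isCompact_preimage (isCompact_hull _)).measure_lt_top

theorem face_inter_ne_zero (hT : IsSimplex T) (hd : 0 < d) (ha : a ∈ T)
    {U : Set (Pt d)} (hU : IsOpen U) (h : (U ∩ hull (T.erase a)).Nonempty) :
    (μHE[d - 1] : Measure (Pt d)) (U ∩ hull (T.erase a)) ≠ 0 := by
  obtain ⟨b, hb⟩ := hT.exists_mem_erase hd a
  obtain ⟨x, hxU, hx⟩ := h
  -- a point of the relative interior of the face that belongs to `U`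
  set z : Pt d := (T.erase a).centroid ℝ id with hz
  have hcard : (0 : ℝ) < (T.erase a).card := by
    rw [Finset.card_erase_of_mem ha, hT.card]; simpa using hd
  have hzc : ∀ c ∈ T.erase a, hT.bary c z = ((T.erase a).card : ℝ)⁻¹ := by
    intro c hc
    rw [hz, Finset.centroid_def, Finset.map_affineCombination _ _ _
      ((T.erase a).sum_centroidWeights_eq_one_of_nonempty ℝ ⟨b, hb⟩),
      Finset.affineCombination_eq_linear_combination _ _ _
      ((T.erase a).sum_centroidWeights_eq_one_of_nonempty ℝ ⟨b, hb⟩), sum_eq_single c]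
    · simp [hT.bary_self (mem_of_mem_erase hc)]
    · intro c' hc' hne
      simp [hT.bary_ne (mem_of_mem_erase hc') hne.symm]
    · intro h; exact absurd hc h
  have hza : hT.bary a z = 0 := by
    rw [hz, Finset.centroid_def, Finset.map_affineCombination _ _ _
      ((T.erase a).sum_centroidWeights_eq_one_of_nonempty ℝ ⟨b, hb⟩),
      Finset.affineCombination_eq_linear_combination _ _ _
      ((T.erase a).sum_centroidWeights_eq_one_of_nonempty ℝ ⟨b, hb⟩), sum_eq_zero]
    intro c' hc'
    simp [hT.bary_ne (mem_of_mem_erase hc') (ne_of_mem_erase hc').symm]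
  obtain ⟨hxT, hxa⟩ := (hT.mem_face ha).1 hx
  have hcont : Continuous (fun t : ℝ => AffineMap.lineMap x z t) := AffineMap.lineMap_continuous
  have hev : ∀ᶠ t in 𝓝[>] (0 : ℝ), AffineMap.lineMap x z t ∈ U := by
    refine nhdsWithin_le_nhds (hcont.continuousAt.eventually_mem ?_)
    simpa using hU.mem_nhds hxU
  obtain ⟨t, htU, ht⟩ := (hev.and (Ioo_mem_nhdsGT (zero_lt_one' ℝ))).exists
  set y := AffineMap.lineMap x z t with hy
  have hyb : ∀ c, hT.bary c y = (1 - t) * hT.bary c x + t * hT.bary c z := by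
    intro c
    rw [hy, AffineMap.apply_lineMap, AffineMap.lineMap_apply_module]; simp
  have hyc : ∀ c ∈ T.erase a, 0 < hT.bary c y := by
    intro c hc
    rw [hyb, hzc c hc]
    have := hT.mem_hull.1 hxT c (mem_of_mem_erase hc)
    have h1 : 0 < t * ((T.erase a).card : ℝ)⁻¹ := by have := ht.1; positivity
    have h2 : 0 ≤ (1 - t) * hT.bary c x := mul_nonneg (by linarith [ht.2]) this
    linarith
  have hya : hT.bary a y = 0 := by rw [hyb, hxa, hza]; simp
  set W : Set (Pt d) := U ∩ ⋂ c ∈ T.erase a, {w | 0 < hT.bary c w} with hW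
  have hWo : IsOpen W := hU.inter (isOpen_biInter_finset fun c _ =>
    isOpen_lt continuous_const (hT.continuous_bary c))
  have h := hT.map_face hd (b := b) ha
  set H : Set (Pt d) := {x | inner ℝ (normal T (T.erase a)) (x - b) = 0} with hH
  have hsub : W ∩ H ⊆ U ∩ hull (T.erase a) := by
    rintro w ⟨⟨hwU, hw⟩, hwH⟩
    simp only [mem_iInter, mem_ofPred_eq] at hw
    rw [hH, mem_ofPred_eq, hT.inner_normal_sub hd ha hb] at hwH
    have hg := norm_ne_zero_iff.2 (hT.grad_ne_zero hd ha)
    have hwa : hT.bary a w = 0 := by simpa [hg] using hwH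
    refine ⟨hwU, (hT.mem_face ha).2 ⟨hT.mem_hull.2 fun c hc => ?_, hwa⟩⟩
    by_cases hca : c = a
    · rw [hca, hwa]
    · exact (hw c (mem_erase.2 ⟨hca, hc⟩)).le
  refine fun h0 => ?_
  have h1 := measure_mono_null hsub h0
  rw [← Measure.restrict_apply hWo.measurableSet, ← h,
    Measure.map_apply (by fun_prop) hWo.measurableSet] at h1
  have ho : IsOpen ((fun w : (ℝ ∙ normal T (T.erase a))ᗮ => b + (w : Pt d)) ⁻¹' W) :=
    hWo.preimage (by fun_prop)
  refine (ho.measure_pos volume ?_).ne' h1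
  have hyH : inner ℝ (normal T (T.erase a)) (y - b) = 0 := by
    rw [hT.inner_normal_sub hd ha hb, hya]; simp
  refine ⟨⟨y - b, Submodule.mem_orthogonal_singleton_iff_inner_right.2 hyH⟩, ?_⟩
  simp only [mem_preimage, add_sub_cancel]
  refine ⟨htU, ?_⟩
  simp only [mem_iInter]
  exact hyc

theorem integrableOn_face (hT : IsSimplex T) (hd : 0 < d) (ha : a ∈ T)
    (hf : ContinuousOn f (hull (T.erase a))) : IntegrableOn f (hull (T.erase a)) μHE[d - 1] :=
  hf.integrableOn_of_subset_isCompact (isCompact_hull _) (measurableSet_hull _) subset_rfl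
    (hT.face_lt_top hd ha).ne

theorem integrableOn_hull (hf : ContinuousOn f (hull Y)) :
    IntegrableOn f (hull Y) := hf.integrableOn_compact (isCompact_hull _)

theorem eq_zero_of_intT (hT : IsSimplex T) (hf : ContinuousOn f (hull T))
    (h0 : ∀ x ∈ hull T, 0 ≤ f x) (hI : intT T f = 0) : ∀ x ∈ hull T, f x = 0 :=
  eq_zero_of_setIntegral_eq_zero (measurableSet_hull T) (fun _ hU h => hT.volume_inter_ne_zero hU h)
    hf h0 (integrableOn_hull hf) hI

theorem eq_zero_of_intF (hT : IsSimplex T) (hd : 0 < d) (ha : a ∈ T)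
    (hf : ContinuousOn f (hull (T.erase a)))
    (h0 : ∀ x ∈ hull (T.erase a), 0 ≤ f x) (hI : intF (T.erase a) f = 0) :
    ∀ x ∈ hull (T.erase a), f x = 0 :=
  eq_zero_of_setIntegral_eq_zero (measurableSet_hull _)
    (fun _ hU h => hT.face_inter_ne_zero hd ha hU h) hf h0 (hT.integrableOn_face hd ha hf) hI

/-! ### Divergence theorem for vector fields and cone formula -/

theorem inner_e (n : Pt d) (i : Fin d) : inner ℝ n (e i) = n i := by
  simp [e, EuclideanSpace.inner_single_right]

/-- The divergence theorem on a simplex. -/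
theorem integral_div (hT : IsSimplex T) (hd : 0 < d) {V : Fin d → Pt d → ℝ}
    (hV : ∀ i, ContDiff ℝ 1 (V i)) :
    intT T (fun x => ∑ i, pderiv i (V i) x) =
      ∑ a ∈ T, intF (T.erase a) (fun x => ∑ i, V i x * normal T (T.erase a) i) := by
  have hc : ∀ i, Continuous (pderiv i (V i)) := fun i =>
    ((hV i).continuous_fderiv (by simp)).clm_apply continuous_const
  have h1 : intT T (fun x => ∑ i, pderiv i (V i) x) = ∑ i, intT T (pderiv i (V i)) := by
    simp only [intT]
    exact integral_finsetSum _ fun i _ => integrableOn_hull (hc i).continuousOn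
  rw [h1]
  have h2 : ∀ i, intT T (pderiv i (V i)) =
      ∑ a ∈ T, inner ℝ (normal T (T.erase a)) (e i) * intF (T.erase a) (V i) := fun i =>
    hT.integral_fderiv hd (e i) (hV i)
  simp_rw [h2]
  rw [sum_comm]
  refine sum_congr rfl fun a ha => ?_
  simp only [intF]
  rw [integral_finsetSum _ fun i _ => ?_]
  · refine sum_congr rfl fun i _ => ?_
    rw [integral_mul_const, inner_e, mul_comm]
  · exact (hT.integrableOn_face hd ha (hV i).continuous.continuousOn).mul_const _

theorem sum_mul_e (φ : Pt d → ℝ) (x z : Pt d) : fderiv ℝ φ x z = ∑ i, z i * pderiv i φ x := by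
  have h2 : z = ∑ i, z i • e i := by
    have := (EuclideanSpace.basisFun (Fin d) ℝ).sum_repr z
    simpa [e] using this.symm
  conv_lhs => rw [h2]
  simp [map_sum, pderiv]

theorem sum_mul_eq_inner (n z : Pt d) : ∑ i, z i * n i = inner ℝ n z := by
  simp [PiLp.inner_apply, mul_comm]

/-- Averages on the face opposite to `a`, expressed by an integral over the simplex, which is
affine invariant. -/
def cone (T : Finset (Pt d)) (a : Pt d) (φ : Pt d → ℝ) : ℝ :=
  (volume.real (hull T))⁻¹ * intT T (fun x => d * φ x + fderiv ℝ φ x (x - a))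

theorem intF_eq_cone (hT : IsSimplex T) (hd : 0 < d) (ha : a ∈ T) (hφ : ContDiff ℝ 1 φ) :
    intF (T.erase a) φ = ‖hT.grad a‖ * volume.real (hull T) * cone T a φ := by
  have hco : ∀ i : Fin d, ContDiff ℝ 1 (fun x : Pt d => x i) := fun i =>
    (EuclideanSpace.proj (𝕜 := ℝ) i).contDiff
  have h := hT.integral_div hd (V := fun i x => (x i - a i) * φ x)
    (fun i => ((hco i).sub contDiff_const).mul hφ)
  have h1 : ∀ x, ∑ i, pderiv i (fun x => (x i - a i) * φ x) x = d * φ x + fderiv ℝ φ x (x - a) := by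
    intro x
    have : ∀ i, pderiv i (fun x => (x i - a i) * φ x) x = φ x + (x - a) i * pderiv i φ x := by
      intro i
      have e1 : HasFDerivAt (fun x : Pt d => x i - a i) (EuclideanSpace.proj (𝕜 := ℝ) i) x :=
        (EuclideanSpace.proj (𝕜 := ℝ) i).hasFDerivAt.sub_const _
      have e2 := (e1.mul (hφ.differentiable (by simp) x).hasFDerivAt).fderiv
      simp only [pderiv]
      rw [show (fun x : Pt d => (x i - a i) * φ x) = (fun x : Pt d => x i - a i) * φ from rfl, e2]
      simp [e]; ring
    simp_rw [this]
    rw [sum_add_distrib, sum_mul_e φ x (x - a)]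
    simp
  have h2 : ∀ c ∈ T, c ≠ a → intF (T.erase c) (fun x => ∑ i, (x i - a i) * φ x *
      normal T (T.erase c) i) = 0 := by
    intro c hc hca
    refine (setIntegral_congr_fun (measurableSet_hull _) fun x hx => ?_).trans (integral_zero _ _)
    have e1 : inner ℝ (normal T (T.erase c)) (x - a) = 0 :=
      hT.hull_face_subset_plane hd hc (mem_erase.2 ⟨hca.symm, ha⟩) hx
    rw [← sum_mul_eq_inner] at e1
    have : ∑ i, (x i - a i) * φ x * normal T (T.erase c) i =
        φ x * ∑ i, (x - a) i * normal T (T.erase c) i := by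
      rw [mul_sum]
      exact sum_congr rfl fun i _ => by simp; ring
    beta_reduce
    rw [this, e1, mul_zero]
  have h3 : intF (T.erase a) (fun x => ∑ i, (x i - a i) * φ x * normal T (T.erase a) i) =
      ‖hT.grad a‖⁻¹ * intF (T.erase a) φ := by
    simp only [intF]
    rw [← integral_const_mul]
    refine setIntegral_congr_fun (measurableSet_hull _) fun x hx => ?_
    have e1 : inner ℝ (normal T (T.erase a)) (x - a) = ‖hT.grad a‖⁻¹ := by
      rw [hT.inner_normal hd ha, ← hT.inner_grad, hT.inner_grad_sub, hT.bary_self ha,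
        ((hT.mem_face ha).1 hx).2]
      ring
    rw [← sum_mul_eq_inner] at e1
    have : ∑ i, (x i - a i) * φ x * normal T (T.erase a) i =
        φ x * ∑ i, (x - a) i * normal T (T.erase a) i := by
      rw [mul_sum]
      exact sum_congr rfl fun i _ => by simp; ring
    beta_reduce
    rw [this, e1, mul_comm]
  rw [sum_eq_single a (fun c hc hca => h2 c hc hca) (fun h => absurd ha h), h3] at h
  simp_rw [h1] at h
  have hg := norm_ne_zero_iff.2 (hT.grad_ne_zero hd ha)
  have hv := hT.volume_pos.ne'
  rw [cone, h]
  field_simp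

theorem face_real_eq (hT : IsSimplex T) (hd : 0 < d) (ha : a ∈ T) :
    (μHE[d - 1] : Measure (Pt d)).real (hull (T.erase a)) =
      ‖hT.grad a‖ * volume.real (hull T) * d := by
  have h := hT.intF_eq_cone hd ha (φ := fun _ => 1) contDiff_const
  have hv := hT.volume_pos.ne'
  simp only [intF, cone, intT, integral_const, fderiv_fun_const, Pi.zero_apply,
    _root_.zero_apply, add_zero, mul_one, measureReal_restrict_apply_univ,
    smul_eq_mul] at h
  rw [h]
  field_simp

theorem face_pos (hT : IsSimplex T) (hd : 0 < d) (ha : a ∈ T) :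
    0 < (μHE[d - 1] : Measure (Pt d)).real (hull (T.erase a)) := by
  rw [hT.face_real_eq hd ha]
  have := norm_pos_iff.2 (hT.grad_ne_zero hd ha)
  have := hT.volume_pos
  positivity

end IsSimplex

/-! ### Affine transport between simplices -/

/-- A correspondence between the vertices of two simplices. -/
structure VertexMap {d : ℕ} (T₀ T : Finset (Pt d)) where
  toFun : Pt d → Pt d
  invFun : Pt d → Pt d
  mapsTo : ∀ a ∈ T₀, toFun a ∈ T
  invMapsTo : ∀ b ∈ T, invFun b ∈ T₀
  left_inv : ∀ a ∈ T₀, invFun (toFun a) = a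
  right_inv : ∀ b ∈ T, toFun (invFun b) = b

namespace VertexMap

variable {T₀ : Finset (Pt d)}

/-- The inverse correspondence. -/
def symm (E : VertexMap T₀ T) : VertexMap T T₀ :=
  ⟨E.invFun, E.toFun, E.invMapsTo, E.mapsTo, E.right_inv, E.left_inv⟩

theorem exists_of_card_eq (h : T₀.card = T.card) : Nonempty (VertexMap T₀ T) := by
  classical
  let f := Finset.equivOfCardEq h
  refine ⟨⟨fun x => if hx : x ∈ T₀ then f ⟨x, hx⟩ else x,
    fun x => if hx : x ∈ T then f.symm ⟨x, hx⟩ else x, ?_, ?_, ?_, ?_⟩⟩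
  · intro a ha; simp [ha]
  · intro b hb; simp [hb]
  · intro a ha; simp [ha]
  · intro b hb; simp [hb]

theorem sum_eq (E : VertexMap T₀ T) {M : Type*} [AddCommMonoid M] (f : Pt d → M) :
    ∑ a ∈ T₀, f (E.toFun a) = ∑ b ∈ T, f b :=
  Finset.sum_nbij' E.toFun E.invFun E.mapsTo E.invMapsTo E.left_inv E.right_inv (fun _ _ => rfl)

/-- The affine map that sends vertices to vertices. -/
def aff (E : VertexMap T₀ T) (h₀ : IsSimplex T₀) : Pt d →ᵃ[ℝ] Pt d :=
  ∑ a ∈ T₀, (LinearMap.toSpanSingleton ℝ (Pt d) (E.toFun a)).toAffineMap.comp (h₀.bary a)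

theorem aff_apply (E : VertexMap T₀ T) (h₀ : IsSimplex T₀) (x : Pt d) :
    E.aff h₀ x = ∑ a ∈ T₀, h₀.bary a x • E.toFun a := by
  have : ∀ s : Finset (Pt d), (∑ a ∈ s, (LinearMap.toSpanSingleton ℝ (Pt d)
      (E.toFun a)).toAffineMap.comp (h₀.bary a)) x = ∑ a ∈ s, h₀.bary a x • E.toFun a := by
    intro s
    induction s using Finset.induction_on with
    | empty => simp
    | insert a s ha ih => rw [Finset.sum_insert ha, Finset.sum_insert ha, AffineMap.coe_add,
        Pi.add_apply, ih]; simp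
  exact this T₀

theorem bary_aff (E : VertexMap T₀ T) (h₀ : IsSimplex T₀) (hT : IsSimplex T)
    (ha : a ∈ T₀) (x : Pt d) : hT.bary (E.toFun a) (E.aff h₀ x) = h₀.bary a x := by
  have hlin : ∀ y, hT.bary (E.toFun a) y =
      (hT.bary (E.toFun a)).linear y + hT.bary (E.toFun a) 0 := fun y => by
    rw [hT.linear_bary]; ring
  rw [hlin, aff_apply, map_sum]
  have h1 : ∀ b, (hT.bary (E.toFun a)).linear (h₀.bary b x • E.toFun b) =
      h₀.bary b x * hT.bary (E.toFun a) (E.toFun b) - h₀.bary b x * hT.bary (E.toFun a) 0 := by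
    intro b
    rw [map_smul, smul_eq_mul, hlin (E.toFun b)]; ring
  simp_rw [h1]
  rw [sum_sub_distrib, ← sum_mul, h₀.sum_bary, sum_eq_single a]
  · rw [hT.bary_self (E.mapsTo a ha)]; ring
  · intro b hb hba
    rw [hT.bary_ne (E.mapsTo b hb) (fun h => hba ?_), mul_zero]
    rw [← E.left_inv b hb, ← h, E.left_inv a ha]
  · intro h; exact absurd ha h

theorem aff_symm (E : VertexMap T₀ T) (h₀ : IsSimplex T₀) (hT : IsSimplex T) (y : Pt d) :
    E.aff h₀ (E.symm.aff hT y) = y := by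
  rw [aff_apply]
  conv_rhs => rw [← hT.sum_bary_smul y, ← E.sum_eq]
  refine sum_congr rfl fun a ha => ?_
  have := E.symm.bary_aff hT h₀ (E.mapsTo a ha) y
  rw [show E.symm.toFun (E.toFun a) = a from E.left_inv a ha] at this
  rw [this]

theorem symm_aff (E : VertexMap T₀ T) (h₀ : IsSimplex T₀) (hT : IsSimplex T) (x : Pt d) :
    E.symm.aff hT (E.aff h₀ x) = x := E.symm.aff_symm hT h₀ x

theorem aff_vertex (E : VertexMap T₀ T) (h₀ : IsSimplex T₀) (ha : a ∈ T₀) :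
    E.aff h₀ a = E.toFun a := by
  rw [aff_apply, sum_eq_single a]
  · rw [h₀.bary_self ha, one_smul]
  · intro b _ hba; rw [h₀.bary_ne ha hba, zero_smul]
  · intro h; exact absurd ha h

theorem aff_mem_hull (E : VertexMap T₀ T) (h₀ : IsSimplex T₀) (hT : IsSimplex T) :
    E.aff h₀ x ∈ hull T ↔ x ∈ hull T₀ := by
  rw [hT.mem_hull, h₀.mem_hull]
  constructor
  · intro h a ha
    rw [← E.bary_aff h₀ hT ha]; exact h _ (E.mapsTo a ha)
  · intro h b hb
    rw [← E.right_inv b hb, E.bary_aff h₀ hT (E.invMapsTo b hb)]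
    exact h _ (E.invMapsTo b hb)

theorem aff_mem_face (E : VertexMap T₀ T) (h₀ : IsSimplex T₀) (hT : IsSimplex T)
    (ha : a ∈ T₀) : E.aff h₀ x ∈ hull (T.erase (E.toFun a)) ↔ x ∈ hull (T₀.erase a) := by
  rw [hT.mem_face (E.mapsTo a ha), h₀.mem_face ha, E.aff_mem_hull h₀ hT, E.bary_aff h₀ hT ha]

theorem aff_sub (E : VertexMap T₀ T) (h₀ : IsSimplex T₀) (x y : Pt d) :
    (E.aff h₀).linear (x - y) = E.aff h₀ x - E.aff h₀ y := (E.aff h₀).linearMap_vsub x y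

theorem hasFDerivAt (E : VertexMap T₀ T) (h₀ : IsSimplex T₀) (x : Pt d) :
    HasFDerivAt (E.aff h₀) (LinearMap.toContinuousLinearMap (E.aff h₀).linear) x := by
  have h : (E.aff h₀ : Pt d → Pt d) =
      fun x => LinearMap.toContinuousLinearMap (E.aff h₀).linear x + E.aff h₀ 0 := by
    ext1 x
    have := E.aff_sub h₀ x 0
    rw [sub_zero] at this
    simp [this]
  rw [h]
  exact (LinearMap.toContinuousLinearMap (E.aff h₀).linear).hasFDerivAt.add_const _

theorem fderiv_comp (E : VertexMap T₀ T) (h₀ : IsSimplex T₀)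
    (hf : Differentiable ℝ f) (x z : Pt d) :
    fderiv ℝ (fun x => f (E.aff h₀ x)) x z = fderiv ℝ f (E.aff h₀ x) ((E.aff h₀).linear z) := by
  rw [show (fun x => f (E.aff h₀ x)) = f ∘ E.aff h₀ from rfl,
    ((hf (E.aff h₀ x)).hasFDerivAt.comp x (E.hasFDerivAt h₀ x)).fderiv]
  rfl

end VertexMap

/-- Average over an element or a face, for its measure. -/
def avg (m : Measure (Pt d)) (Y : Finset (Pt d)) (f : Pt d → ℝ) : ℝ :=
  (m.real (hull Y))⁻¹ * ∫ x in hull Y, f x ∂m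

notation "avgT" => avg volume

namespace VertexMap

variable {T₀ : Finset (Pt d)}

/-- Averages are affine invariant. -/
theorem avgT_eq (E : VertexMap T₀ T) (h₀ : IsSimplex T₀) (hT : IsSimplex T) (f : Pt d → ℝ) :
    avgT T f = avgT T₀ (fun x => f (E.aff h₀ x)) := by
  have him : E.aff h₀ '' hull T₀ = hull T := by
    ext y
    exact ⟨fun ⟨x, hx, h⟩ => h ▸ (E.aff_mem_hull h₀ hT).2 hx, fun hy =>
      ⟨_, (E.symm.aff_mem_hull hT h₀).2 hy, E.aff_symm h₀ hT y⟩⟩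
  set J := |(LinearMap.toContinuousLinearMap (E.aff h₀).linear).det|
  have key : ∀ f : Pt d → ℝ, ∫ y in hull T, f y = J * ∫ x in hull T₀, f (E.aff h₀ x) := fun f => by
    rw [← him, integral_image_eq_integral_abs_det_fderiv_smul volume (IsSimplex.measurableSet_hull T₀)
      (fun x _ => (E.hasFDerivAt h₀ x).hasFDerivWithinAt)
      (Function.LeftInverse.injective (E.symm_aff h₀ hT)).injOn, ← integral_const_mul]
    rfl
  have hvol : volume.real (hull T) = J * volume.real (hull T₀) := by simpa using key fun _ => 1
  have h := hT.volume_pos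
  rw [hvol] at h
  have h1 := left_ne_zero_of_mul h.ne'
  have h2 := right_ne_zero_of_mul h.ne'
  rw [avg, avg, key, hvol]
  field_simp

theorem cone_eq (E : VertexMap T₀ T) (h₀ : IsSimplex T₀) (hT : IsSimplex T)
    (ha : a ∈ T₀) (hφ : Differentiable ℝ φ) :
    IsSimplex.cone T (E.toFun a) φ = IsSimplex.cone T₀ a (fun x => φ (E.aff h₀ x)) := by
  have := E.avgT_eq h₀ hT (fun x => d * φ x + fderiv ℝ φ x (x - E.toFun a))
  rw [IsSimplex.cone, IsSimplex.cone]
  refine this.trans ?_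
  rw [avg, intT]
  congr 2
  ext1 x
  rw [E.fderiv_comp h₀ hφ, E.aff_sub, E.aff_vertex h₀ ha]

end VertexMap

/-- There are nondegenerate simplices in every dimension. -/
theorem exists_isSimplex (d : ℕ) : ∃ T : Finset (Pt d), IsSimplex T := by
  obtain ⟨s, b, hb⟩ := AffineBasis.exists_affineBasis ℝ (Pt d) (Pt d)
  have h1 : AffineIndependent ℝ ((↑) : s → Pt d) := hb ▸ b.ind
  have hfin : s.Finite := finite_set_of_fin_dim_affineIndependent ℝ h1
  obtain ⟨t, rfl⟩ := hfin.exists_finset_coe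
  refine ⟨t, ?_, h1⟩
  have h2 := b.card_eq_finrank_add_one
  rw [finrank_euclideanSpace_fin] at h2
  rw [← h2]
  simp

/-- A fixed reference simplex. -/
def refSimplex (d : ℕ) : Finset (Pt d) := Classical.choose (exists_isSimplex d)

theorem refSimplex_isSimplex (d : ℕ) : IsSimplex (refSimplex d) :=
  Classical.choose_spec (exists_isSimplex d)

theorem IsSimplex.exists_vertexMap (hT : IsSimplex T) : Nonempty (VertexMap (refSimplex d) T) :=
  VertexMap.exists_of_card_eq (by rw [hT.card, (refSimplex_isSimplex d).card])

/-! ### Norm equivalence -/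

/-- Equivalence of norms in finite dimension: if finitely many linear functionals `L j` control the
nullity of a pointwise bounded family of functionals, they control the family uniformly. -/
theorem exists_uniform_bound {V : Type*} [AddCommGroup V] [Module ℝ V] {J : Type*} [Fintype J]
    (L : V →ₗ[ℝ] (J → ℝ)) {X : Type*} (f : X → V →ₗ[ℝ] ℝ)
    (hb : ∀ v, ∃ B, ∀ x, |f x v| ≤ B) (hker : ∀ v, L v = 0 → ∀ x, f x v = 0) :
    ∃ C, 0 ≤ C ∧ ∀ x v, |f x v| ≤ C * ∑ j, |L v j| := by
  classical
  obtain ⟨g₀, hg₀⟩ := L.rangeRestrict.exists_rightInverse_of_surjective L.range_rangeRestrict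
  obtain ⟨g, hg⟩ := LinearMap.exists_extend g₀
  have hLg : ∀ v, L (g (L v)) = L v := fun v =>
    (congrArg L (DFunLike.congr_fun hg (L.rangeRestrict v))).trans
      (congrArg Subtype.val (DFunLike.congr_fun hg₀ (L.rangeRestrict v)))
  choose B hB using fun j : J => hb (g (Pi.single j 1))
  refine ⟨∑ j, |B j|, sum_nonneg fun _ _ => abs_nonneg _, fun x v => ?_⟩
  have h1 : f x v = f x (g (L v)) := by
    simpa [sub_eq_zero] using hker (v - g (L v)) (by rw [map_sub, hLg, sub_self]) x
  have h2 : L v = ∑ j, L v j • (Pi.single j 1 : J → ℝ) := by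
    ext i; simp [Finset.sum_apply, Pi.single_apply]
  rw [h1, h2, map_sum, map_sum, ← h2]
  refine (abs_sum_le_sum_abs _ _).trans ?_
  rw [mul_sum]
  refine sum_le_sum fun j _ => ?_
  rw [map_smul, map_smul, smul_eq_mul, abs_mul, mul_comm]
  gcongr
  exact ((hB j x).trans (le_abs_self _)).trans
    (single_le_sum (f := fun j => |B j|) (fun _ _ => abs_nonneg _) (Finset.mem_univ j))

/-- The same for arbitrary families of functionals `L j`, since finitely many of them span the
others. -/
theorem exists_bound_of_functionals {V : Type*} [AddCommGroup V] [Module ℝ V] [Module.Finite ℝ V]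
    {J X : Type*} (L : J → V →ₗ[ℝ] ℝ) (B : J → ℝ) (f : X → V →ₗ[ℝ] ℝ)
    (hb : ∀ v, ∃ B, ∀ x, |f x v| ≤ B) (hker : ∀ v, (∀ j, L j v = 0) → ∀ x, f x v = 0) :
    ∃ C, 0 ≤ C ∧ ∀ v m, 0 ≤ m → (∀ j, |L j v| ≤ m * B j) → ∀ x, |f x v| ≤ C * m := by
  obtain ⟨b, hbL, hsp, hli⟩ := exists_linearIndependent ℝ (Set.range L)
  have := hli.finite
  have := Fintype.ofFinite b
  choose i hi using fun φ : b => hbL φ.2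
  obtain ⟨C, hC0, hC⟩ := exists_uniform_bound (LinearMap.pi fun φ : b => φ.1) f hb fun v hv =>
    hker v fun j => (Submodule.span_le (p := LinearMap.ker (LinearMap.applyₗ (R := ℝ) v))).2
      (fun φ h => congrFun hv ⟨φ, h⟩) (hsp.ge (Submodule.subset_span ⟨j, rfl⟩))
  refine ⟨C * ∑ φ : b, |B (i φ)|, by positivity, fun v m hm hv x => (hC x v).trans ?_⟩
  rw [mul_assoc, sum_mul]
  gcongr with φ
  rw [LinearMap.pi_apply, ← hi φ, mul_comm]
  exact (hv (i φ)).trans (by gcongr; exact le_abs_self _)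

/-! ### Uniform polynomial estimates -/

section Averages

variable {z : Pt d → ℝ} {B : ℝ}

theorem PolyFun.continuous {n : ℕ} (p : PolyFun d n) : Continuous p.1 :=
  IsPoly.continuous (m := n) p.2

theorem PolyFun.differentiable {n : ℕ} (p : PolyFun d n) : Differentiable ℝ p.1 :=
  IsPoly.differentiable (m := n) p.2

/-- Evaluation at a point. -/
def PolyFun.evalAt (n : ℕ) (x : Pt d) : PolyFun d n →ₗ[ℝ] ℝ :=
  (LinearMap.proj x).comp (PolyFun d n).subtype

@[simp]
theorem PolyFun.evalAt_apply {n : ℕ} (x : Pt d) (p : PolyFun d n) : evalAt n x p = p.1 x := rfl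

/-- Faces and elements carry definite `L²` products on continuous functions. -/
structure IsDefinite (m : Measure (Pt d)) (Y : Finset (Pt d)) : Prop where
  finite : m (hull Y) ≠ ⊤
  pos : 0 < m.real (hull Y)
  eq_zero : ∀ f : Pt d → ℝ, ContinuousOn f (hull Y) → (∀ x ∈ hull Y, 0 ≤ f x) →
    ∫ x in hull Y, f x ∂m = 0 → ∀ x ∈ hull Y, f x = 0

theorem IsSimplex.isDefinite (hT : IsSimplex T) : IsDefinite volume T :=
  ⟨(isCompact_hull T).measure_lt_top.ne, hT.volume_pos, fun _ h1 h2 h3 => hT.eq_zero_of_intT h1 h2 h3⟩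

theorem IsSimplex.isDefinite_face (hT : IsSimplex T) (hd : 0 < d)
    (hF : F ∈ facesOf T) : IsDefinite μHE[d - 1] F := by
  obtain ⟨a, ha, rfl⟩ := hT.exists_erase hF
  exact ⟨(hT.face_lt_top hd ha).ne, hT.face_pos hd ha,
    fun _ h1 h2 h3 => hT.eq_zero_of_intF hd ha h1 h2 h3⟩

theorem avg_smul (c : ℝ) (f : Pt d → ℝ) : avg m Y (fun x => c * f x) = c * avg m Y f := by
  rw [avg, avg, integral_const_mul, mul_left_comm]

theorem avg_congr (h : ∀ x ∈ hull Y, f x = g x) : avg m Y f = avg m Y g := by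
  rw [avg, avg, setIntegral_congr_fun (IsSimplex.measurableSet_hull Y) h]

theorem avg_nonneg (h : ∀ x, 0 ≤ f x) : 0 ≤ avg m Y f :=
  mul_nonneg (inv_nonneg.2 measureReal_nonneg) (integral_nonneg h)

namespace IsDefinite

theorem integrableOn (h : IsDefinite m Y) (hf : ContinuousOn f (hull Y)) :
    IntegrableOn f (hull Y) m :=
  hf.integrableOn_of_subset_isCompact (IsSimplex.isCompact_hull _)
    (IsSimplex.measurableSet_hull _) subset_rfl h.1

theorem avg_add (h : IsDefinite m Y) (hf : Continuous f) (hz : Continuous z) :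
    avg m Y (fun x => f x + z x) = avg m Y f + avg m Y z := by
  rw [avg, integral_add (h.integrableOn hf.continuousOn) (h.integrableOn hz.continuousOn), mul_add]
  rfl

theorem avg_sum (h : IsDefinite m Y) {ι : Type*} (s : Finset ι) {f : ι → Pt d → ℝ}
    (hf : ∀ i ∈ s, Continuous (f i)) :
    avg m Y (fun x => ∑ i ∈ s, f i x) = ∑ i ∈ s, avg m Y (f i) := by
  rw [avg, integral_finsetSum _ fun i hi => h.integrableOn (hf i hi).continuousOn, mul_sum]
  rfl

theorem eq_zero_of_avg (h : IsDefinite m Y) (hf : Continuous f) (h0 : ∀ x ∈ hull Y, 0 ≤ f x)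
    (h1 : avg m Y f = 0) : ∀ x ∈ hull Y, f x = 0 :=
  h.eq_zero f hf.continuousOn h0 ((mul_eq_zero.1 h1).resolve_left (inv_ne_zero h.pos.ne'))

theorem eq_zero_of_avg_sq (h : IsDefinite m Y) (hf : Continuous f)
    (h1 : avg m Y (fun x => f x * f x) = 0) (x : Pt d) (hx : x ∈ hull Y) : f x = 0 :=
  mul_self_eq_zero.1 (h.eq_zero_of_avg (hf.mul hf) (fun _ _ => mul_self_nonneg _) h1 x hx)

theorem nonneg_of_abs_le (h : IsDefinite m Y) (hB : ∀ x ∈ hull Y, |z x| ≤ B) : 0 ≤ B := by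
  obtain ⟨x, hx⟩ := nonempty_of_measureReal_ne_zero h.pos.ne'
  exact (abs_nonneg _).trans (hB x hx)

theorem integral_le (h : IsDefinite m Y) (hf : IntegrableOn f (hull Y) m)
    (hB : ∀ x ∈ hull Y, f x ≤ B) : ∫ x in hull Y, f x ∂m ≤ m.real (hull Y) * B := by
  simpa using setIntegral_mono_on hf (integrableOn_const (C := B) h.1)
    (IsSimplex.measurableSet_hull Y) hB

theorem avg_le (h : IsDefinite m Y) (hf : IntegrableOn f (hull Y) m)
    (hB : ∀ x ∈ hull Y, f x ≤ B) : avg m Y f ≤ B :=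
  (inv_mul_le_iff₀ h.pos).2 (h.integral_le hf hB)

theorem abs_avg_mul_le (h : IsDefinite m Y) (hf : Continuous f) (hB : ∀ x ∈ hull Y, |z x| ≤ B) :
    |avg m Y (fun x => f x * z x)| ≤ B * avg m Y (fun x => |f x|) := by
  rw [avg, avg, abs_mul, abs_of_nonneg (inv_nonneg.2 measureReal_nonneg), mul_left_comm]
  gcongr
  rw [← integral_const_mul, ← norm_eq_abs]
  refine norm_integral_le_of_norm_le ((h.integrableOn hf.abs.continuousOn).const_mul B) ?_
  filter_upwards [ae_restrict_mem (IsSimplex.measurableSet_hull Y)] with x hx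
  rw [norm_eq_abs, abs_mul, mul_comm]
  gcongr
  exact hB x hx

theorem avg_sub_mul (h : IsDefinite m Y) (c : ℝ)
    (hf : IntegrableOn (fun x => f x * z x) (hull Y) m) (hz : Continuous z) :
    avg m Y (fun x => (f x - c) * z x) = avg m Y (fun x => f x * z x) - c * avg m Y z := by
  simp_rw [sub_mul]
  rw [avg, integral_sub hf ((h.integrableOn hz.continuousOn).const_mul c), integral_const_mul,
    mul_sub, mul_left_comm]
  rfl

/-- Functions that are uniformly close to a constant have moments close to those of the
constant. -/
theorem moments_close (h : IsDefinite m Y) (hf : Continuous f) {c D : ℝ}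
    (hc : ∀ x ∈ hull Y, |f x - c| ≤ D) (hz : Continuous z) (hB : ∀ x ∈ hull Y, |z x| ≤ B) :
    |avg m Y (fun x => f x * z x) - c * avg m Y z| ≤ D * B := by
  have hfc : Continuous fun x => f x - c := hf.sub continuous_const
  rw [← h.avg_sub_mul c (h.integrableOn (hf.mul hz).continuousOn) hz, mul_comm]
  have := h.nonneg_of_abs_le hB
  exact (h.abs_avg_mul_le hfc hB).trans (by
    gcongr; exact h.avg_le (h.integrableOn hfc.abs.continuousOn) hc)

/-- Average of the product with a fixed continuous function, as a linear functional of
polynomial functions. -/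
def avgMul (h : IsDefinite m Y) (n : ℕ) (hz : Continuous z) : PolyFun d n →ₗ[ℝ] ℝ where
  toFun p := avg m Y (fun x => p.1 x * z x)
  map_add' p q := by
    rw [← h.avg_add ((PolyFun.continuous p).fun_mul hz) ((PolyFun.continuous q).fun_mul hz)]
    congr 1; ext x; simp [add_mul]
  map_smul' c p := by
    rw [RingHom.id_apply, smul_eq_mul, ← avg_smul]
    congr 1; ext x; simp [mul_assoc]

/-- Families of functionals of polynomials that only depend on the restriction to an element or a
face are bounded by the moments. -/
theorem exists_bound (h : IsDefinite m Y) (n : ℕ) {X : Type*} (f : X → PolyFun d n →ₗ[ℝ] ℝ)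
    (hb : ∀ v, ∃ B, ∀ x, |f x v| ≤ B)
    (hker : ∀ v : PolyFun d n, (∀ y ∈ hull Y, v.1 y = 0) → ∀ x, f x v = 0) :
    ∃ C, 0 ≤ C ∧ ∀ (v : PolyFun d n) (D : ℝ), 0 ≤ D → (∀ z, IsPoly n z → ∀ B,
      (∀ x ∈ hull Y, |z x| ≤ B) → |avg m Y (fun x => v.1 x * z x)| ≤ D * B) →
      ∀ x, |f x v| ≤ C * D := by
  choose B hB using fun z : PolyFun d n =>
    (IsSimplex.isCompact_hull Y).exists_bound_of_continuousOn (PolyFun.continuous z).continuousOn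
  obtain ⟨C, hC0, hC⟩ := exists_bound_of_functionals
    (fun z : PolyFun d n => h.avgMul n (PolyFun.continuous z)) B f hb
    fun v hv => hker v (h.eq_zero_of_avg_sq (PolyFun.continuous v) (hv v))
  exact ⟨C, hC0, fun v D hD hv x => hC v D hD (fun z => hv z.1 z.2 _ (hB z)) x⟩

theorem exists_sup_bound (h : IsDefinite m Y) (n : ℕ) :
    ∃ C, 0 ≤ C ∧ ∀ (v : PolyFun d n) (D : ℝ), 0 ≤ D → (∀ z, IsPoly n z → ∀ B,
      (∀ x ∈ hull Y, |z x| ≤ B) → |avg m Y (fun x => v.1 x * z x)| ≤ D * B) →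
      ∀ x ∈ hull Y, |v.1 x| ≤ C * D := by
  obtain ⟨C, hC0, hC⟩ := h.exists_bound n (fun x : hull Y => PolyFun.evalAt n x.1) (fun v => by
    obtain ⟨B, hB⟩ := (IsSimplex.isCompact_hull Y).exists_bound_of_continuousOn
      (PolyFun.continuous v).continuousOn
    exact ⟨B, fun x => hB x.1 x.2⟩) fun v hv x => hv x.1 x.2
  exact ⟨C, hC0, fun v D hD hv x hx => hC v D hD hv ⟨x, hx⟩⟩

end IsDefinite

theorem IsSimplex.avgF_eq_cone (hT : IsSimplex T) (hd : 0 < d) (ha : a ∈ T)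
    (hf : ContDiff ℝ 1 f) : avg μHE[d - 1] (T.erase a) f = (d : ℝ)⁻¹ * cone T a f := by
  have hg := norm_ne_zero_iff.2 (hT.grad_ne_zero hd ha)
  have hv := hT.volume_pos.ne'
  have : (d : ℝ) ≠ 0 := by exact_mod_cast hd.ne'
  rw [avg, hT.face_real_eq hd ha]
  change _ * intF (T.erase a) f = _
  rw [hT.intF_eq_cone hd ha hf]
  field_simp

theorem VertexMap.avgF_eq {T₀ : Finset (Pt d)} (E : VertexMap T₀ T) (h₀ : IsSimplex T₀)
    (hT : IsSimplex T) (hd : 0 < d) (ha : a ∈ T₀)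
    (hf : ContDiff ℝ ∞ f) (hf' : ContDiff ℝ ∞ (fun x => f (E.aff h₀ x))) :
    avg μHE[d - 1] (T.erase (E.toFun a)) f =
      avg μHE[d - 1] (T₀.erase a) (fun x => f (E.aff h₀ x)) := by
  rw [hT.avgF_eq_cone hd (E.mapsTo a ha) (hf.of_le (by simp)),
    h₀.avgF_eq_cone hd ha (hf'.of_le (by simp)), E.cone_eq h₀ hT ha (hf.differentiable (by simp))]

/-- Inverse inequality between the `L^∞` and `L¹` norms of polynomials on simplices. -/
theorem exists_sup_bound (d n : ℕ) : ∃ C, 0 ≤ C ∧ ∀ T : Finset (Pt d), IsSimplex T →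
    ∀ p, IsPoly n p → ∀ x ∈ hull T, |p x| ≤ C * avgT T (fun y => |p y|) := by
  have h₀ := refSimplex_isSimplex d
  obtain ⟨C, hC0, hC⟩ := h₀.isDefinite.exists_sup_bound n
  refine ⟨C, hC0, fun T hT p hp x hx => ?_⟩
  obtain ⟨E⟩ := hT.exists_vertexMap
  have hp' := hp.comp_affine (E.aff h₀)
  rw [E.avgT_eq h₀ hT]
  simpa [E.aff_symm h₀ hT] using hC ⟨_, hp'⟩ _ (avg_nonneg fun _ => abs_nonneg _)
    (fun z _ B hB => (h₀.isDefinite.abs_avg_mul_le hp'.continuous hB).trans_eq (mul_comm _ _))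
    _ ((E.symm.aff_mem_hull hT h₀).2 hx)

theorem IsSimplex.fderiv_eq_zero (hT : IsSimplex T) (hf : Differentiable ℝ f)
    (h : ∀ y ∈ hull T, f y = 0) (hx : x ∈ hull T) : fderiv ℝ f x = 0 := by
  rw [← fderivWithin_eq_fderiv (hT.uniqueDiffOn x hx) (hf x),
    fderivWithin_congr (f := fun _ => (0 : ℝ)) h (h x hx)]
  simp

theorem norm_e (j : Fin d) : ‖(e j : Pt d)‖ = 1 := by simp [e]

/-- Inverse inequality for the derivatives of polynomials on simplices. -/
theorem exists_pderiv_bound (d n : ℕ) : ∃ C, 0 ≤ C ∧ ∀ T : Finset (Pt d), IsSimplex T →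
    ∀ c ρ, 0 < ρ → Metric.closedBall c (ρ / 2) ⊆ hull T →
    ∀ p, IsPoly n p → ∀ x ∈ hull T, ∀ j,
      |pderiv j p x| ≤ C * ρ⁻¹ * avgT T (fun y => |p y|) := by
  have h₀ := refSimplex_isSimplex d
  obtain ⟨C, hC0, hC⟩ := h₀.isDefinite.exists_bound n
    (fun x : hull (refSimplex d) × refSimplex d × refSimplex d =>
      { toFun := fun p : PolyFun d n => fderiv ℝ p.1 x.1.1 (x.2.1.1 - x.2.2.1)
        map_add' := fun p q => by
          simp [fderiv_add (PolyFun.differentiable p x.1.1) (PolyFun.differentiable q x.1.1)]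
        map_smul' := fun c p => by
          simp [fderiv_const_smul (PolyFun.differentiable p x.1.1) c] }) (fun v => by
      obtain ⟨B, hB⟩ := (IsSimplex.isCompact_hull (refSimplex d)).exists_bound_of_continuousOn
        ((IsPoly.contDiff (m := n) v.2).continuous_fderiv (by simp)).continuousOn
      refine ⟨B * diam (refSimplex d), fun x => ((fderiv ℝ v.1 x.1.1).le_opNorm _).trans ?_⟩
      have h1 := IsSimplex.dist_le_diam (IsSimplex.vertex_mem_hull x.2.1.2)
        (IsSimplex.vertex_mem_hull x.2.2.2)
      have h2 := hB x.1.1 x.1.2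
      have := (norm_nonneg _).trans h2
      gcongr) (fun v hv x => by simp [h₀.fderiv_eq_zero (PolyFun.differentiable v) hv x.1.2])
  refine ⟨(d + 1) * C, by positivity, fun T hT c ρ hρ hball p hp x hx j => ?_⟩
  obtain ⟨E⟩ := hT.exists_vertexMap
  have hp' := hp.comp_affine (E.aff h₀)
  obtain ⟨b₀, hb₀⟩ := h₀.nonempty
  have hz : e j = ∑ a ∈ T, (hT.bary a).linear (e j) • (a - E.toFun b₀) := by
    simp_rw [smul_sub]
    rw [sum_sub_distrib, hT.sum_linear_smul, ← Finset.sum_smul, hT.sum_linear]; simp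
  rw [pderiv, hz, map_sum]
  have hterm : ∀ a ∈ T, |fderiv ℝ p x ((hT.bary a).linear (e j) • (a - E.toFun b₀))| ≤
      ρ⁻¹ * (C * avgT T (fun y => |p y|)) := by
    intro a ha
    rw [map_smul, smul_eq_mul, abs_mul]
    gcongr
    · rw [← hT.inner_grad]
      refine (abs_real_inner_le_norm _ _).trans ?_
      rw [norm_e, mul_one]
      exact hT.norm_grad_le ha hρ hball
    · rw [E.avgT_eq h₀ hT]
      refine le_trans (le_of_eq ?_) (hC ⟨_, hp'⟩ _ (avg_nonneg fun _ => abs_nonneg _)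
        (fun z _ B hB => (h₀.isDefinite.abs_avg_mul_le hp'.continuous hB).trans_eq (mul_comm _ _))
        ⟨⟨E.symm.aff hT x, (E.symm.aff_mem_hull hT h₀).2 hx⟩, ⟨E.invFun a, E.invMapsTo a ha⟩,
          ⟨b₀, hb₀⟩⟩)
      simp only [LinearMap.coe_mk, AddHom.coe_mk]
      rw [E.fderiv_comp h₀ hp.differentiable, E.aff_sub, E.aff_vertex h₀ (E.invMapsTo a ha),
        E.aff_vertex h₀ hb₀, E.right_inv a ha, E.aff_symm h₀ hT]
  refine (abs_sum_le_sum_abs _ _).trans ((sum_le_sum hterm).trans (le_of_eq ?_))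
  rw [sum_const, hT.card]
  simp; ring

/-- Polynomials on faces are bounded by their moments. -/
theorem exists_sup_face_bound (d n : ℕ) (hd : 0 < d) : ∃ C, 0 ≤ C ∧ ∀ T : Finset (Pt d),
    IsSimplex T → ∀ F ∈ facesOf T, ∀ p, IsPoly n p → ∀ D, 0 ≤ D → (∀ z, IsPoly n z → ∀ B,
      (∀ x ∈ hull F, |z x| ≤ B) → |avg μHE[d - 1] F (fun x => p x * z x)| ≤ D * B) →
      ∀ x ∈ hull F, |p x| ≤ C * D := by
  have h₀ := refSimplex_isSimplex d
  choose C hC0 hC using fun a : refSimplex d =>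
    (h₀.isDefinite_face hd (h₀.erase_mem_facesOf a.2)).exists_sup_bound n
  refine ⟨∑ a, C a, sum_nonneg fun a _ => hC0 a, fun T hT F hF p hp D hD hpD x hx => ?_⟩
  obtain ⟨b, hb, rfl⟩ := hT.exists_erase hF
  obtain ⟨E⟩ := hT.exists_vertexMap
  obtain ⟨a, ha, rfl⟩ : ∃ a ∈ refSimplex d, E.toFun a = b := ⟨_, E.invMapsTo b hb, E.right_inv b hb⟩
  have hp' := hp.comp_affine (E.aff h₀)
  have hx' : E.symm.aff hT x ∈ hull ((refSimplex d).erase a) := by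
    rwa [← E.aff_mem_face h₀ hT ha, E.aff_symm h₀ hT]
  have h1 := hC ⟨a, ha⟩ ⟨_, hp'⟩ D hD (fun z hz B hB => ?_) _ hx'
  · simp only [E.aff_symm h₀ hT] at h1
    exact h1.trans (by gcongr; exact single_le_sum (fun a _ => hC0 a) (Finset.mem_univ _))
  · have hz' := hz.comp_affine (E.symm.aff hT)
    have e := E.avgF_eq h₀ hT hd ha (f := fun y => p y * z (E.symm.aff hT y))
      (hp.contDiff.mul hz'.contDiff) (by
        simp only [E.symm_aff h₀ hT]
        exact hp'.contDiff.mul hz.contDiff)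
    simp only [E.symm_aff h₀ hT] at e
    rw [← e]
    exact hpD _ hz' B fun y hy => hB _ (by rwa [← E.aff_mem_face h₀ hT ha, E.aff_symm h₀ hT])

end Averages

/-! ### Unisolvence and stability of Raviart–Thomas degrees of freedom -/

/-- Polynomial functions of degree less than `k`. -/
def PolyPred (d k : ℕ) : Submodule ℝ (Pt d → ℝ) := if k = 0 then ⊥ else PolyFun d (k - 1)

instance PolyPred.finite (d k : ℕ) : Module.Finite ℝ (PolyPred d k) := by
  by_cases h : k = 0
  · rw [PolyPred, if_pos h]; infer_instance
  · rw [PolyPred, if_neg h]; infer_instance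

theorem mem_polyPred : f ∈ PolyPred d k ↔ IsPoly (k - 1) f ∧ (k = 0 → f = 0) := by
  by_cases h : k = 0
  · simp only [PolyPred, if_pos h, Submodule.mem_bot]
    refine ⟨fun h' => ⟨?_, fun _ => h'⟩, fun h' => h'.2 h⟩
    rw [h']
    exact Submodule.zero_mem (PolyFun d (k - 1))
  · simp only [PolyPred, if_neg h]
    exact ⟨fun h' => ⟨h', fun h'' => absurd h'' h⟩, fun h' => h'.1⟩

theorem IsPoly.of_pred (h : f ∈ PolyPred d k) : IsPoly k f := (mem_polyPred.1 h).1.mono (by omega)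

theorem comp_affine_mem_polyPred (h : f ∈ PolyPred d k)
    (A : Pt d →ᵃ[ℝ] Pt d) : (fun x => f (A x)) ∈ PolyPred d k := by
  obtain ⟨h1, h2⟩ := mem_polyPred.1 h
  exact mem_polyPred.2 ⟨h1.comp_affine A, fun h => by rw [h2 h]; rfl⟩

theorem IsPoly.mul_pred {l : Pt d → ℝ} (hl : IsPoly 1 l) (h : f ∈ PolyPred d k) :
    IsPoly k (fun x => l x * f x) := by
  obtain ⟨h1, h2⟩ := mem_polyPred.1 h
  rcases Nat.eq_zero_or_pos k with rfl | hk
  · rw [h2 rfl]; simpa using IsPoly.const 0 0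
  · have := hl.mul h1
    rwa [show 1 + (k - 1) = k by omega] at this

/-- Coordinates of Raviart–Thomas fields: the component along the gradient of the barycentric
coordinate `l` is `λ_l q + p_l`. -/
abbrev RTCoord (d k : ℕ) (T : Finset (Pt d)) := PolyFun d k × (T → PolyFun d k)

namespace IsSimplex

/-- A polynomial that vanishes on a face is divisible by the barycentric coordinate. -/
theorem exists_eq_bary_mul (hT : IsSimplex T) (hd : 0 < d) (ha : a ∈ T) (hp : IsPoly k p)
    (h0 : ∀ x ∈ hull (T.erase a), p x = 0) :
    ∃ t ∈ PolyPred d k, ∀ x ∈ hull T, p x = hT.bary a x * t x := by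
  obtain ⟨b, hb, hab⟩ : ∃ b ∈ T, b ≠ a := hT.exists_ne hd a
  obtain ⟨t, ht, ht0, h⟩ := hp.exists_div (hT.bary a) (a - b)
  refine ⟨t, mem_polyPred.2 ⟨ht, ht0⟩, fun x hx => ?_⟩
  rw [h x, h0, zero_add]
  have hbary : ∀ c, hT.bary c (x - hT.bary a x • (a - b)) =
      hT.bary c x - hT.bary a x * (hT.bary c a - hT.bary c b) := by
    intro c
    have h1 := hT.inner_grad_sub c (x - hT.bary a x • (a - b)) x
    have h2 := hT.inner_grad_sub c a b
    rw [show x - hT.bary a x • (a - b) - x = -(hT.bary a x • (a - b)) by abel,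
      inner_neg_right, real_inner_smul_right, h2] at h1
    linarith
  have hx' := hT.mem_hull.1 hx
  refine (hT.mem_face ha).2 ⟨hT.mem_hull.2 fun c hc => ?_, ?_⟩
  · rw [hbary]
    by_cases hca : c = a
    · rw [hca, hT.bary_self ha, hT.bary_ne hb hab.symm]; simp
    by_cases hcb : c = b
    · rw [hcb, hT.bary_self hb, hT.bary_ne ha hab]
      have := hx' a ha
      have := hx' b hb
      linarith
    · rw [hT.bary_ne ha hca, hT.bary_ne hb hcb]
      have := hx' c hc
      linarith
  · rw [hbary, hT.bary_self ha, hT.bary_ne hb hab.symm]; ring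

/-- The component with index `l`. -/
def rtComp (hT : IsSimplex T) (k : ℕ) (l : T) : RTCoord d k T →ₗ[ℝ] PolyFun d (k + 1) where
  toFun v := ⟨fun x => hT.bary l x * v.1.1 x + (v.2 l).1 x,
    add_comm k 1 ▸ ((hT.isPoly_bary l).mul v.1.2).add (IsPoly.mono (by omega) (v.2 l).2)⟩
  map_add' v w := by ext x; simp; ring
  map_smul' c v := by ext x; simp; ring

/-- Unisolvence: a Raviart–Thomas field vanishes if its normal moments on the faces and its interior
moments do. Since the components vanish on faces, they are `λ_l (q + t_l)`, and the field is tested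
with `t_l - t_m`. -/
theorem rt_unique (hT : IsSimplex T) (hd : 0 < d) (v : RTCoord d k T)
    (hin : ∀ l, ∀ z ∈ PolyPred d k, avgT T (fun x => (hT.rtComp k l v).1 x * z x) = 0)
    (hface : ∀ l : T, ∀ z, IsPoly k z →
      avg μHE[d - 1] (T.erase l) (fun x => (hT.rtComp k l v).1 x * z x) = 0)
        (hsum : ∀ x ∈ hull T, ∑ l, (hT.rtComp k l v).1 x = 0) (l : T) (x : Pt d) (hx : x ∈ hull T) :
          (hT.rtComp k l v).1 x = 0 := by
  have happ : ∀ l x, (hT.rtComp k l v).1 x = hT.bary l x * v.1.1 x + (v.2 l).1 x := fun _ _ => rfl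
  have hp0 : ∀ l : T, ∀ x ∈ hull (T.erase l), (v.2 l).1 x = 0 := fun l =>
    (hT.isDefinite_face hd (hT.erase_mem_facesOf l.2)).eq_zero_of_avg_sq (PolyFun.continuous _) (by
      rw [← hface l _ (v.2 l).2]
      exact avg_congr fun y hy => by rw [happ, ((hT.mem_face l.2).1 hy).2]; ring)
  choose t ht htp using fun l : T => hT.exists_eq_bary_mul hd l.2 (v.2 l).2 (hp0 l)
  obtain ⟨m, hm⟩ := hT.nonempty
  have hr : ∀ l, ∀ x ∈ hull T, (hT.rtComp k l v).1 x = hT.bary l x * (v.1.1 x + t l x) :=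
    fun l x hx => by rw [happ, htp l x hx]; ring
  have htc : ∀ l, Continuous (t l) := fun l => (IsPoly.of_pred (ht l)).continuous
  have h1 : avgT T (fun x => ∑ l, (hT.rtComp k l v).1 x * (t l x - t ⟨m, hm⟩ x)) = 0 := by
    rw [hT.isDefinite.avg_sum _ fun l _ =>
      (PolyFun.continuous _).fun_mul ((htc l).fun_sub (htc ⟨m, hm⟩))]
    exact sum_eq_zero fun l _ => hin l _ (Submodule.sub_mem _ (ht l) (ht ⟨m, hm⟩))
  have h2 : avgT T (fun x => ∑ l : T, hT.bary l x * (v.1.1 x + t l x) ^ 2) = 0 := by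
    rw [← h1]
    refine avg_congr fun x hx => ?_
    have e1 := congrArg (· * (v.1.1 x + t ⟨m, hm⟩ x)) (hsum x hx)
    rw [zero_mul, sum_mul] at e1
    rw [← sub_eq_zero, ← sum_sub_distrib, ← e1]
    exact sum_congr rfl fun l _ => by rw [hr l x hx]; ring
  have hpos : ∀ x ∈ hull T, ∀ l ∈ (Finset.univ : Finset T), 0 ≤ hT.bary l x *
    (v.1.1 x + t l x) ^ 2 :=
    fun x hx l _ => mul_nonneg (hT.mem_hull.1 hx l l.2) (sq_nonneg _)
  have h3 := hT.isDefinite.eq_zero_of_avg (continuous_finsetSum _ fun (l : T) _ =>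
    (hT.continuous_bary l).mul (((PolyFun.continuous v.1).add (htc l)).pow 2))
    (fun x hx => sum_nonneg (hpos x hx)) h2
  have h4 := (sum_eq_zero_iff_of_nonneg (hpos x hx)).1 (h3 x hx) l (Finset.mem_univ l)
  rw [hr l x hx, mul_eq_zero]
  simpa using h4

/-- The components are bounded by the moments. -/
theorem exists_rt_bound (hT : IsSimplex T) (hd : 0 < d) (k : ℕ) : ∃ C, 0 ≤ C ∧
    ∀ (v : RTCoord d k T) (m : ℝ), 0 ≤ m → (∀ x ∈ hull T, ∑ l, (hT.rtComp k l v).1 x = 0) →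
      (∀ l, ∀ z ∈ PolyPred d k, ∀ B, (∀ x ∈ hull T, |z x| ≤ B) →
      |avgT T (fun x => (hT.rtComp k l v).1 x * z x)| ≤ m * B) →
        (∀ l : T, ∀ z, IsPoly k z → ∀ B, (∀ x ∈ hull (T.erase l), |z x| ≤ B) →
      |avg μHE[d - 1] (T.erase l) (fun x => (hT.rtComp k l v).1 x * z x)| ≤ m * B) →
    ∀ l, ∀ x ∈ hull T, |(hT.rtComp k l v).1 x| ≤ C * m := by
  have hb := fun {z : Pt d → ℝ} (hz : Continuous z) =>
    (isCompact_hull T).exists_bound_of_continuousOn hz.continuousOn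
  have h₁ := fun z : PolyPred d k => (IsPoly.of_pred z.2).continuous
  choose B₁ hB₁ using fun z => hb (h₁ z)
  choose B₂ hB₂ using fun z : PolyFun d k => hb (PolyFun.continuous z)
  have hF := fun l : T => hT.isDefinite_face hd (hT.erase_mem_facesOf l.2)
  obtain ⟨C, hC0, hC⟩ := exists_bound_of_functionals (Sum.elim (fun j : T × PolyPred d k =>
        (hT.isDefinite.avgMul (k + 1) (h₁ j.2)).comp (hT.rtComp k j.1))
      (Sum.elim (fun j : T × PolyFun d k =>
          ((hF j.1).avgMul (k + 1) (PolyFun.continuous j.2)).comp (hT.rtComp k j.1))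
        fun x : hull T => ∑ l, (PolyFun.evalAt (k + 1) x.1).comp (hT.rtComp k l)))
          (Sum.elim (fun j => B₁ j.2) (Sum.elim (fun j => B₂ j.2) fun _ => 0))
            (fun j : T × hull T => (PolyFun.evalAt (k + 1) j.2.1).comp (hT.rtComp k j.1))
              (fun v => by
      choose B hB using fun l => hb (PolyFun.continuous (hT.rtComp k l v))
      obtain ⟨M, hM⟩ := Finite.exists_le B
      exact ⟨M, fun j => (hB j.1 _ j.2.2).trans (hM j.1)⟩)
    fun v hv j => hT.rt_unique hd v (fun l z hz => hv (.inl (l, ⟨z, hz⟩)))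
      (fun l z hz => hv (.inr (.inl (l, ⟨z, hz⟩))))
      (fun x hx => by simpa using hv (.inr (.inr ⟨x, hx⟩))) _ _ j.2.2
  refine ⟨C, hC0, fun v m hm hs h1 h2 l x hx => hC v m hm ?_ (l, ⟨x, hx⟩)⟩
  rintro (j | j | x)
  · exact h1 j.1 _ j.2.2 _ (hB₁ j.2)
  · exact h2 j.1 _ j.2.2 _ fun x hx => hB₂ j.2 x (hull_face_subset (hT.erase_mem_facesOf j.1.2) hx)
  · simpa using (congrArg abs (hs x x.2)).le

end IsSimplex

/-! ### Orthogonal projections on polynomials -/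

/-- A definite bilinear form on a finite-dimensional space represents all linear functionals. -/
theorem exists_riesz {V : Type*} [AddCommGroup V] [Module ℝ V] [Module.Finite ℝ V]
    (B : V →ₗ[ℝ] V →ₗ[ℝ] ℝ) (hB : ∀ v, B v v = 0 → v = 0) (φ : V →ₗ[ℝ] ℝ) :
    ∃ v, ∀ w, B v w = φ w := by
  have hinj : Function.Injective B := by
    refine (injective_iff_map_eq_zero B).2 fun v hv => hB v ?_
    rw [hv]; rfl
  have hfr : Module.finrank ℝ V = Module.finrank ℝ (V →ₗ[ℝ] ℝ) :=
    (Subspace.dual_finrank_eq (K := ℝ) (V := V)).symm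
  obtain ⟨v, hv⟩ := (LinearMap.injective_iff_surjective_of_finrank_eq_finrank hfr).1 hinj φ
  exact ⟨v, fun w => by rw [hv]⟩

theorem exists_of_mem_Poly {l : ℤ} (hf : f ∈ Poly l Y) :
    ∃ p, Continuous p ∧ f = (hull Y).indicator p := by
  rcases lt_or_ge l 0 with h | h
  · exact ⟨0, continuous_zero, by rw [(mem_Poly_neg h).1 hf]; simp⟩
  · lift l to ℕ using h
    obtain ⟨p, hp, rfl⟩ := mem_Poly.1 hf
    exact ⟨p, IsPoly.continuous (m := l) hp, rfl⟩

theorem continuousOn_of_mem_Poly {l : ℤ} (hf : f ∈ Poly l Y) : ContinuousOn f (hull Y) := by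
  obtain ⟨p, hp, rfl⟩ := exists_of_mem_Poly hf
  exact hp.continuousOn.congr fun x hx => by simp [hx]

theorem eq_zero_of_mem_Poly {l : ℤ} (hf : f ∈ Poly l Y) (h : ∀ x ∈ hull Y, f x = 0) : f = 0 := by
  obtain ⟨p, hp, rfl⟩ := exists_of_mem_Poly hf
  ext x
  by_cases hx : x ∈ hull Y
  · exact h x hx
  · simp [hx]

theorem integral_add_mul {z : Pt d → ℝ}
    (hf : IntegrableOn f (hull Y) m) (hg : IntegrableOn g (hull Y) m)
    (hz : ContinuousOn z (hull Y)) : ∫ x in hull Y, (f x + g x) * z x ∂m =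
      (∫ x in hull Y, f x * z x ∂m) + ∫ x in hull Y, g x * z x ∂m := by
  simp_rw [add_mul]
  exact integral_add (hf.mul_continuousOn hz (IsSimplex.isCompact_hull Y))
    (hg.mul_continuousOn hz (IsSimplex.isCompact_hull Y))

/-- The `L²` product with a fixed integrable function, on a space of continuous functions. -/
def pairing {S : Submodule ℝ (Pt d → ℝ)}
    (hS : ∀ s ∈ S, ContinuousOn s (hull Y)) (hq : IntegrableOn q (hull Y) m) : S →ₗ[ℝ] ℝ where
  toFun s := ∫ x in hull Y, q x * s.1 x ∂m
  map_add' s s' := by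
    have h := fun s : S => hq.mul_continuousOn (hS s.1 s.2) (IsSimplex.isCompact_hull Y)
    rw [← integral_add (h s) (h s')]
    congr 1; ext x; simp [mul_add]
  map_smul' c s := by
    rw [RingHom.id_apply, smul_eq_mul, ← integral_const_mul]
    congr 1; ext x; simp; ring

namespace IsDefinite

/-- The `L²` product on a space of continuous functions. -/
def form (h : IsDefinite m Y) {S : Submodule ℝ (Pt d → ℝ)}
    (hS : ∀ s ∈ S, ContinuousOn s (hull Y)) : S →ₗ[ℝ] S →ₗ[ℝ] ℝ :=
  .mk₂ ℝ (fun r => pairing hS (h.integrableOn (hS r.1 r.2)))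
    (fun r r' s => integral_add_mul (h.integrableOn (hS r.1 r.2)) (h.integrableOn (hS r'.1 r'.2))
      (hS s.1 s.2))
        (fun c r s => by simp [pairing, mul_assoc, integral_const_mul])
          (fun r => map_add _) fun c r => map_smul _ c

theorem form_definite (h : IsDefinite m Y) (l : ℤ) (r : Poly l Y)
    (h0 : h.form (fun _ => continuousOn_of_mem_Poly) r r = 0) : r = 0 := by
  have hc := continuousOn_of_mem_Poly r.2
  have := h.eq_zero _ (hc.mul hc) (fun x _ => mul_self_nonneg _) h0
  exact Subtype.ext (eq_zero_of_mem_Poly r.2 fun x hx => mul_self_eq_zero.1 (this x hx))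

theorem exists_proj (h : IsDefinite m Y) (l : ℤ) (hq : IntegrableOn q (hull Y) m) :
    ∃ r, r ∈ Poly l Y ∧ ∀ s ∈ Poly l Y,
      ∫ x in hull Y, r x * s x ∂m = ∫ x in hull Y, q x * s x ∂m := by
  obtain ⟨r, hr⟩ := exists_riesz (h.form fun _ => continuousOn_of_mem_Poly) (h.form_definite l) 
    (pairing (fun _ => continuousOn_of_mem_Poly) hq)
  exact ⟨r.1, r.2, fun s hs => hr ⟨s, hs⟩⟩

theorem proj_unique (h : IsDefinite m Y) {l : ℤ} {r r' : Pt d → ℝ} (hr : r ∈ Poly l Y)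
    (hr' : r' ∈ Poly l Y)
    (he : ∀ s ∈ Poly l Y, ∫ x in hull Y, r x * s x ∂m = ∫ x in hull Y, r' x * s x ∂m) :
    r = r' := by
  have h0 : (⟨r, hr⟩ - ⟨r', hr'⟩ : Poly l Y) = 0 := by
    refine h.form_definite l _ ?_
    rw [map_sub (h.form _), LinearMap.sub_apply, sub_eq_zero]
    exact he _ (Submodule.sub_mem _ hr hr')
  exact congrArg Subtype.val (sub_eq_zero.1 h0)

end IsDefinite

variable {l : ℤ} {q' : Pt d → ℝ}

theorem IsSimplex.projT_spec (hT : IsSimplex T) (l : ℤ) (hq : IntegrableOn q (hull T)) :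
    projT l T q ∈ Poly l T ∧
      ∀ s ∈ Poly l T, intT T (fun x => projT l T q x * s x) = intT T (fun x => q x * s x) :=
  Classical.epsilon_spec (hT.isDefinite.exists_proj l hq)

theorem IsDefinite.projF_spec (hF : IsDefinite μHE[d - 1] F) (l : ℤ)
    (hq : IntegrableOn q (hull F) μHE[d - 1]) :
    projF l F q ∈ Poly l F ∧
      ∀ s ∈ Poly l F, intF F (fun x => projF l F q x * s x) = intF F (fun x => q x * s x) :=
  Classical.epsilon_spec (hF.exists_proj l hq)

theorem IsSimplex.projT_eq_iff (hT : IsSimplex T) (hq : IntegrableOn q (hull T))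
    (hq' : IntegrableOn q' (hull T)) : projT l T q = projT l T q' ↔
      ∀ s ∈ Poly l T, intT T (fun x => q x * s x) = intT T (fun x => q' x * s x) := by
  obtain ⟨h1, h2⟩ := hT.projT_spec l hq
  obtain ⟨h1', h2'⟩ := hT.projT_spec l hq'
  constructor
  · intro h s hs
    rw [← h2 s hs, ← h2' s hs, h]
  · intro h
    refine hT.isDefinite.proj_unique h1 h1' fun s hs => ?_
    exact (h2 s hs).trans ((h s hs).trans (h2' s hs).symm)

theorem IsDefinite.eq_projF (hF : IsDefinite μHE[d - 1] F)
    (hq : IntegrableOn q (hull F) μHE[d - 1]) {r : Pt d → ℝ} (hr : r ∈ Poly l F)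
    (h : ∀ s ∈ Poly l F, intF F (fun x => r x * s x) = intF F (fun x => q x * s x)) :
    r = projF l F q := by
  obtain ⟨h1', h2'⟩ := hF.projF_spec l hq
  exact hF.proj_unique hr h1' fun s hs => (h s hs).trans (h2' s hs).symm

theorem mem_Poly_pred :
    f ∈ Poly ((k : ℤ) + 1 - 2) Y ↔ ∃ p ∈ PolyPred d k, f = (hull Y).indicator p := by
  rcases k with _ | k
  · rw [mem_Poly_neg (by norm_num)]
    simp only [PolyPred, if_true, Submodule.mem_bot, exists_eq_left]
    simp
  · rw [show ((k + 1 : ℕ) : ℤ) + 1 - 2 = (k : ℕ) by push_cast; ring, mem_Poly]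
    simp [PolyPred]

theorem setIntegral_mul_indicator (f z : Pt d → ℝ) :
    ∫ x in hull Y, f x * (hull Y).indicator z x ∂m = ∫ x in hull Y, f x * z x ∂m :=
  setIntegral_congr_fun (IsSimplex.measurableSet_hull Y) fun x hx => by simp [hx]

/-- The face projection as a polynomial. -/
theorem IsDefinite.exists_projF (hF : IsDefinite μHE[d - 1] F) (k : ℕ)
    (hq : IntegrableOn q (hull F) μHE[d - 1]) :
    ∃ p, IsPoly k p ∧ projF k F q = (hull F).indicator p ∧
      ∀ z, IsPoly k z → intF F (fun x => p x * z x) = intF F (fun x => q x * z x) := by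
  obtain ⟨h1, h2⟩ := hF.projF_spec (k : ℤ) hq
  obtain ⟨p, hp, hpe⟩ := mem_Poly.1 h1
  refine ⟨p, hp, hpe, fun z hz => ?_⟩
  have h3 := h2 _ (mem_Poly.2 ⟨z, hz, rfl⟩)
  rw [hpe] at h3
  rw [intF, intF, setIntegral_mul_indicator, setIntegral_mul_indicator] at h3
  rw [intF, intF, ← h3]
  exact setIntegral_congr_fun (IsSimplex.measurableSet_hull F) fun x hx => by simp [hx]

/-! ### Raviart–Thomas fields -/

/-- Global polynomial fields of the form `P + x q`, with `P` and `q` of degree at most `k`. -/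
def RTField (d k : ℕ) (R : Fin d → Pt d → ℝ) : Prop :=
  ∃ (P : Fin d → Pt d → ℝ) (q : Pt d → ℝ), (∀ i, IsPoly k (P i)) ∧ IsPoly k q ∧
    R = fun i x => P i x + x i * q x

variable {R R' : Fin d → Pt d → ℝ}

theorem mem_PolyVec {l : ℕ} {f : Fin d → Pt d → ℝ} :
    f ∈ PolyVec (l : ℤ) Y ↔ ∃ P : Fin d → Pt d → ℝ, (∀ i, IsPoly l (P i)) ∧
      f = fun i => (hull Y).indicator (P i) := by
  simp only [PolyVec, Submodule.mem_pi, Set.mem_univ, true_implies, mem_Poly]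
  constructor
  · intro h
    choose P hP hP' using h
    exact ⟨P, hP, funext hP'⟩
  · rintro ⟨P, hP, rfl⟩ i
    exact ⟨P i, hP i, rfl⟩

theorem mem_RTN {r : Fin d → Pt d → ℝ} :
    r ∈ RTN ((k : ℤ) + 1) T ↔ ∃ R, RTField d k R ∧ r = fun i => (hull T).indicator (R i) := by
  rw [RTN, add_sub_cancel_right, Submodule.mem_sup]
  constructor
  · rintro ⟨y, hy, z, hz, rfl⟩
    obtain ⟨P, hP, rfl⟩ := mem_PolyVec.1 hy
    obtain ⟨q', hq', rfl⟩ := hz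
    obtain ⟨q, hq, rfl⟩ := mem_Poly.1 hq'
    refine ⟨_, ⟨P, q, hP, hq, rfl⟩, ?_⟩
    ext i x
    by_cases hx : x ∈ hull T <;> simp [hx, mulX]
  · rintro ⟨R, ⟨P, q, hP, hq, rfl⟩, rfl⟩
    refine ⟨_, mem_PolyVec.2 ⟨P, hP, rfl⟩, _, ⟨_, mem_Poly.2 ⟨q, hq, rfl⟩, rfl⟩, ?_⟩
    ext i x
    by_cases hx : x ∈ hull T <;> simp [hx, mulX]

namespace RTField

theorem add (h : RTField d k R) (h' : RTField d k R') :
    RTField d k (fun i x => R i x + R' i x) := by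
  obtain ⟨P, q, hP, hq, rfl⟩ := h
  obtain ⟨P', q', hP', hq', rfl⟩ := h'
  exact ⟨_, _, fun i => (hP i).add (hP' i), hq.add hq', by ext i x; simp; ring⟩

theorem smul (c : ℝ) (h : RTField d k R) : RTField d k (fun i x => c * R i x) := by
  obtain ⟨P, q, hP, hq, rfl⟩ := h
  exact ⟨_, _, fun i => (hP i).smul c, hq.smul c, by ext i x; simp; ring⟩

theorem sub (h : RTField d k R) (h' : RTField d k R') :
    RTField d k (fun i x => R i x - R' i x) := by
  simpa [sub_eq_add_neg] using h.add (h'.smul (-1))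

theorem sum {ι : Type*} (s : Finset ι) {R : ι → Fin d → Pt d → ℝ}
    (h : ∀ j ∈ s, RTField d k (R j)) : RTField d k (fun i x => ∑ j ∈ s, R j i x) := by
  classical
  induction s using Finset.induction_on with
  | empty => exact ⟨_, _, fun _ => IsPoly.const k 0, IsPoly.const k 0, by simp⟩
  | insert a s ha ih =>
    have := (h a (Finset.mem_insert_self _ _)).add
      (ih fun j hj => h j (Finset.mem_insert_of_mem hj))
    simpa [Finset.sum_insert ha] using this

theorem const (c : Fin d → ℝ) : RTField d k (fun i _ => c i) :=
  ⟨_, _, fun i => IsPoly.const k (c i), IsPoly.const k 0, by simp⟩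

theorem isPoly (h : RTField d k R) (i : Fin d) : IsPoly (k + 1) (R i) := by
  obtain ⟨P, q, hP, hq, rfl⟩ := h
  refine ((hP i).mono (Nat.le_succ k)).add ?_
  have := (IsPoly.coord i).mul hq
  rwa [add_comm] at this

theorem continuous (h : RTField d k R) (i : Fin d) : Continuous (R i) := (h.isPoly i).continuous

/-- Fields `(x - b) q`. -/
theorem radial (b : Pt d) (hq : IsPoly k q) : RTField d k (fun i x => (x i - b i) * q x) :=
  ⟨_, _, fun i => hq.smul (-b i), hq, by ext i x; simp; ring⟩

theorem div_poly (h : RTField d k R) : IsPoly k (fun x => ∑ i, pderiv i (R i) x) :=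
  IsPoly.sum _ fun i _ => (h.isPoly i).pderiv_succ i

end RTField

/-- The normal component of a Raviart–Thomas field on a face has degree at most `k`. -/
theorem IsSimplex.exists_normal_poly (hT : IsSimplex T) (hd : 0 < d) (ha : a ∈ T)
    (h : RTField d k R) : ∃ p, IsPoly k p ∧ ∀ x ∈ hull (T.erase a),
      ∑ i, R i x * normal T (T.erase a) i = p x := by
  obtain ⟨P, q, hP, hq, rfl⟩ := h
  obtain ⟨b, hb⟩ := hT.exists_mem_erase hd a
  refine ⟨fun x => ∑ i, normal T (T.erase a) i * P i x + (∑ i, b i * normal T (T.erase a) i) * q x,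
    (IsPoly.sum _ fun i _ => (hP i).smul _).add (hq.smul _), fun x hx => ?_⟩
  have h1 : inner ℝ (normal T (T.erase a)) (x - b) = 0 := hT.hull_face_subset_plane hd ha hb hx
  rw [← sum_mul_eq_inner] at h1
  simp only [PiLp.sub_apply, sub_mul, sum_sub_distrib] at h1
  have h2 : ∑ i, x i * normal T (T.erase a) i = ∑ i, b i * normal T (T.erase a) i := by linarith
  beta_reduce
  rw [← h2, sum_mul, ← sum_add_distrib]
  exact sum_congr rfl fun i _ => by ring

/-- Components along the gradients of the barycentric coordinates. -/
theorem IsSimplex.exists_bary_comp (hT : IsSimplex T) (h : RTField d k R) :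
    ∃ v : RTCoord d k T, ∀ (l : T) x, ∑ i, R i x * hT.grad l i = (hT.rtComp k l v).1 x := by
  obtain ⟨P, q, hP, hq, rfl⟩ := h
  refine ⟨⟨⟨q, hq⟩, fun l => ⟨fun x => ∑ i, hT.grad l i * P i x - hT.bary l 0 * q x,
    (IsPoly.sum _ fun i _ => (hP i).smul _).sub (hq.smul _)⟩⟩, fun l x => ?_⟩
  have h1 := hT.inner_grad_sub l x 0
  rw [sub_zero, ← sum_mul_eq_inner, eq_sub_iff_add_eq] at h1
  change _ = hT.bary l x * q x + (∑ i, hT.grad l i * P i x - hT.bary l 0 * q x)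
  rw [← h1, add_mul, sum_mul, add_add_sub_cancel, ← sum_add_distrib]
  exact sum_congr rfl fun i _ => by ring

theorem IsSimplex.sum_mul_grad (hT : IsSimplex T) (z : Fin d → ℝ) (l : Pt d) :
    ∑ j, z j * hT.grad l j = (hT.bary l).linear (WithLp.toLp 2 z) := by
  rw [← hT.inner_grad, ← sum_mul_eq_inner]

theorem IsSimplex.sum_comp (hT : IsSimplex T) (z : Fin d → ℝ) :
    ∑ l ∈ T, ∑ j, z j * hT.grad l j = 0 := by
  simp_rw [hT.sum_mul_grad, hT.sum_linear]

/-- A vector is recovered from its components along the gradients. -/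
theorem IsSimplex.sum_comp_mul (hT : IsSimplex T) (z : Fin d → ℝ) (b : Pt d) (i : Fin d) :
    z i = ∑ l ∈ T, (∑ j, z j * hT.grad l j) * (l i - b i) := by
  have h2 := congrArg (fun y : Pt d => y i) (hT.sum_linear_smul (WithLp.toLp 2 z))
  simp only [WithLp.ofLp_sum, Finset.sum_apply, WithLp.ofLp_smul, Pi.smul_apply, smul_eq_mul] at h2
  simp_rw [mul_sub, sum_sub_distrib, ← sum_mul, hT.sum_comp, hT.sum_mul_grad, h2]
  simp

/-! ### Existence and stability of the Raviart–Thomas interpolator -/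

variable {R R' : Fin d → Pt d → ℝ}

theorem IsPoly.analyticOnNhd {m : ℕ} (hf : IsPoly m f) : AnalyticOnNhd ℝ f univ := by
  refine IsPoly.induction (C := fun _ f => AnalyticOnNhd ℝ f univ) ?_ ?_ ?_ hf
  · exact fun _ c => analyticOnNhd_const
  · exact fun _ f g hf hg => hf.add hg
  · exact fun _ i f _ hf => ((EuclideanSpace.proj (𝕜 := ℝ) i).analyticOnNhd univ).mul hf

theorem IsSimplex.eq_zero_of_isPoly (hT : IsSimplex T) {m : ℕ} (hf : IsPoly m f)
    (h : ∀ y ∈ interior (hull T), f y = 0) (x : Pt d) : f x = 0 := by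
  obtain ⟨c, hc⟩ := hT.nonempty_interior
  refine congrFun (hf.analyticOnNhd.eq_of_eventuallyEq (g := 0) (z₀ := c) analyticOnNhd_const ?_) x
  filter_upwards [isOpen_interior.mem_nhds hc] with y hy using h y hy

open IsSimplex

namespace IsSimplex

/-- Values of affine coordinates against the fields `x - l`. -/
theorem sum_sub_mul_grad (hT : IsSimplex T) {l m : Pt d} (x : Pt d) :
    ∑ i, (x i - l i) * hT.grad m i = hT.bary m x - hT.bary m l := by
  rw [← hT.inner_grad_sub, ← sum_mul_eq_inner]; simp

theorem sum_mul_normal (hT : IsSimplex T) (hd : 0 < d) {m : Pt d} (hm : m ∈ T) (z : Fin d → ℝ) :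
    ∑ i, z i * normal T (T.erase m) i = -(‖hT.grad m‖⁻¹ * ∑ i, z i * hT.grad m i) := by
  rw [hT.normal_eq hd hm, mul_sum, ← sum_neg_distrib]
  refine sum_congr rfl fun i _ => ?_
  simp; ring

theorem sum_mul_grad_eq (hT : IsSimplex T) (hd : 0 < d) {m : Pt d} (hm : m ∈ T) (z : Fin d → ℝ) :
    ∑ i, z i * hT.grad m i = -(‖hT.grad m‖ * ∑ i, z i * normal T (T.erase m) i) := by
  have := norm_ne_zero_iff.2 (hT.grad_ne_zero hd hm)
  rw [hT.sum_mul_normal hd hm]; field_simp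

/-- Normal components on faces of the fields that are radial from a vertex. -/
theorem radial_normal (hT : IsSimplex T) (hd : 0 < d) {l m : Pt d} (hl : l ∈ T)
    (hm : m ∈ T) (hx : x ∈ hull (T.erase m)) :
    ∑ i, (x i - l i) * normal T (T.erase m) i = if l = m then ‖hT.grad m‖⁻¹ else 0 := by
  rw [hT.sum_mul_normal hd hm (fun i => x i - l i), hT.sum_sub_mul_grad, ((hT.mem_face hm).1 hx).2]
  split_ifs with h
  · rw [h, hT.bary_self hm]; ring
  · rw [hT.bary_ne hl (Ne.symm h)]; ring

theorem sum_radial_normal (hT : IsSimplex T) (hd : 0 < d) (f : Pt d → ℝ) {m : Pt d}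
    (hm : m ∈ T) (hx : x ∈ hull (T.erase m)) :
    ∑ i, (∑ l ∈ T, (x i - l i) * f l) * normal T (T.erase m) i = ‖hT.grad m‖⁻¹ * f m := by
  simp_rw [sum_mul]
  rw [sum_comm]
  have h : ∀ l ∈ T, ∑ i, (x i - l i) * f l * normal T (T.erase m) i =
      (if l = m then ‖hT.grad m‖⁻¹ else 0) * f l := fun l hl => by
    rw [← hT.radial_normal hd hl hm hx, sum_mul]
    exact sum_congr rfl fun i _ => by ring
  rw [sum_congr rfl h]
  simp [hm]

/-- The linear combination of radial fields with prescribed normal components. -/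
theorem exists_normal (hT : IsSimplex T) (hd : 0 < d) {p : Pt d → Pt d → ℝ}
    (hp : ∀ l ∈ T, IsPoly k (p l)) : ∃ R, RTField d k R ∧ ∀ m ∈ T, ∀ x ∈ hull (T.erase m),
      ∑ i, R i x * normal T (T.erase m) i = p m x :=
  ⟨fun i x => ∑ l ∈ T, (x i - l i) * (‖hT.grad l‖ * p l x),
    RTField.sum T fun l hl => RTField.radial l ((hp l hl).smul _), fun m hm x hx => by
      rw [hT.sum_radial_normal hd _ hm hx,
        inv_mul_cancel_left₀ (norm_ne_zero_iff.2 (hT.grad_ne_zero hd hm))]⟩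

end IsSimplex

/-- Fields of polynomials of degree less than `k`. -/
abbrev PredVec (d k : ℕ) := Fin d → PolyPred d k

/-- The component of a field along the position vector of a vertex. -/
def PredVec.comp (l : Pt d) : PredVec d k →ₗ[ℝ] PolyPred d k := ∑ i, l i • LinearMap.proj i

theorem PredVec.comp_apply (l : Pt d) (w : PredVec d k) (x : Pt d) :
    (comp l w).1 x = ∑ i, (w i).1 x * l i := by
  simp [comp, mul_comm]

/-- The bubble field of `w`: its normal components vanish on the faces. -/
def IsSimplex.bubble (hT : IsSimplex T) (w : PredVec d k) (i : Fin d) (x : Pt d) : ℝ :=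
  ∑ l ∈ T, (x i - l i) * (hT.bary l x * (PredVec.comp l w).1 x)

theorem IsSimplex.bubble_mem (hT : IsSimplex T) (w : PredVec d k) : RTField d k (hT.bubble w) :=
  RTField.sum T fun l _ => RTField.radial l ((hT.isPoly_bary l).mul_pred (PredVec.comp l w).2)

/-- Bubble fields are definite. -/
theorem IsSimplex.sum_bubble_mul (hT : IsSimplex T) (w : PredVec d k) (x : Pt d) :
    ∑ i, hT.bubble w i x * (w i).1 x =
      -∑ l ∈ T, hT.bary l x * (∑ i, (w i).1 x * (l i - x i)) ^ 2 := by
  set A := ∑ i, (w i).1 x * x i with hA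
  have hx : ∀ i, ∑ l ∈ T, hT.bary l x * l i = x i := fun i => by
    simpa using congrArg (fun y : Pt d => y i) (hT.sum_bary_smul x)
  have h1 : ∑ l ∈ T, hT.bary l x * (PredVec.comp l w).1 x = A := by
    simp_rw [hA, PredVec.comp_apply, ← hx, mul_sum]
    rw [sum_comm]
    exact sum_congr rfl fun _ _ => sum_congr rfl fun _ _ => by ring
  have h3 : ∀ l : Pt d, ∑ i, (w i).1 x * (l i - x i) = (PredVec.comp l w).1 x - A := fun l => by
    simp_rw [PredVec.comp_apply, hA, mul_sub, sum_sub_distrib]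
  have h2 : ∑ i, hT.bubble w i x * (w i).1 x = ∑ l ∈ T,
      hT.bary l x * (PredVec.comp l w).1 x * (A - (PredVec.comp l w).1 x) := by
    simp_rw [bubble, sum_mul]
    rw [sum_comm]
    refine sum_congr rfl fun l _ => ?_
    rw [← neg_sub _ A, ← h3, ← sum_neg_distrib, mul_sum]
    exact sum_congr rfl fun i _ => by ring
  rw [h2, eq_neg_iff_add_eq_zero, ← sum_add_distrib]
  calc _ = ∑ l ∈ T, (A * A * hT.bary l x - A * (hT.bary l x * (PredVec.comp l w).1 x)) :=
        sum_congr rfl fun l _ => by rw [h3]; ring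
    _ = 0 := by rw [sum_sub_distrib, ← mul_sum, ← mul_sum, h1, hT.sum_bary]; ring

/-- Bubble fields realize all moments against polynomials of degree less than `k`, since the form
`(w, w') ↦ ∫ bubble w · w'` is definite. -/
theorem IsSimplex.exists_bubble (hT : IsSimplex T) (φ : Fin d → PolyPred d k →ₗ[ℝ] ℝ) :
    ∃ w : PredVec d k, ∀ i (z : PolyPred d k),
      intT T (fun x => hT.bubble w i x * z.1 x) = φ i z := by
  have hS : ∀ s ∈ PolyPred d k, ContinuousOn s (hull T) := fun s hs =>
    (IsPoly.of_pred hs).continuous.continuousOn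
  have hi : ∀ (w : PredVec d k) i, IntegrableOn (hT.bubble w i) (hull T) := fun w i =>
    integrableOn_hull ((hT.bubble_mem w).continuous i).continuousOn
  have hi' : ∀ (w : PredVec d k) i (z : PolyPred d k),
      IntegrableOn (fun x => hT.bubble w i x * z.1 x) (hull T) := fun w i z =>
        (hi w i).mul_continuousOn (hS z.1 z.2) (isCompact_hull T)
  let B : PredVec d k →ₗ[ℝ] PredVec d k →ₗ[ℝ] ℝ := .mk₂ ℝ
    (fun w => LinearMap.lsum ℝ (fun _ => PolyPred d k) ℝ fun i => pairing hS (hi w i))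
    (fun w w' z => by
      simp only [LinearMap.lsum_apply, LinearMap.sum_apply, ← sum_add_distrib]
      refine sum_congr rfl fun i _ => Eq.trans ?_ (integral_add (hi' w i (z i)) (hi' w' i (z i)))
      simp [pairing, bubble, mul_add, add_mul, sum_add_distrib])
        (fun c w z => by
      simp only [LinearMap.lsum_apply, LinearMap.sum_apply, smul_eq_mul, mul_sum]
      refine sum_congr rfl fun i _ => Eq.trans ?_ (integral_const_mul c _)
      simp [pairing, bubble, mul_left_comm _ c, ← mul_sum, mul_assoc])
        (fun w => map_add _) fun c w => map_smul _ c
  have hdef : ∀ w, B w w = 0 → w = 0 := fun w hw => by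
    have h1 : intT T (fun x => ∑ l ∈ T, hT.bary l x * (∑ i, (w i).1 x * (l i - x i)) ^ 2) = 0 := by
      rw [← neg_eq_zero, intT, ← integral_neg]
      simp_rw [← hT.sum_bubble_mul]
      rw [integral_finsetSum _ fun i _ => hi' w i (w i)]
      simpa [B, pairing] using hw
    have hnn : ∀ x ∈ hull T, ∀ l ∈ T, 0 ≤ hT.bary l x * (∑ i, (w i).1 x * (l i - x i)) ^ 2 :=
      fun x hx l hl => mul_nonneg (hT.mem_hull.1 hx l hl) (sq_nonneg _)
    have hwc : ∀ i, Continuous (w i).1 := fun i => (IsPoly.of_pred (w i).2).continuous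
    have h2 := hT.eq_zero_of_intT (Continuous.continuousOn (continuous_finsetSum _ fun l _ =>
      (hT.continuous_bary l).mul ((continuous_finsetSum _ fun i _ => (hwc i).mul
        (continuous_const.sub (IsPoly.coord i).continuous)).pow 2)))
      (fun x hx => sum_nonneg (hnn x hx)) h1
    -- at interior points all weights are positive
    have h3 : ∀ i, ∀ x ∈ interior (hull T), (w i).1 x = 0 := fun i x hx => by
      have h4 : ∀ l ∈ T, ∑ i, (w i).1 x * (l i - x i) = 0 := fun l hl => by
        simpa [(hT.mem_interior.1 hx l hl).ne'] using
          (sum_eq_zero_iff_of_nonneg (hnn x (interior_subset hx))).1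
            (h2 x (interior_subset hx)) l hl
      have h5 : ∑ i, (w i).1 x * (w i).1 x = 0 := by
        simp_rw [fun i => congrArg ((w i).1 x * ·) (hT.sum_comp_mul (fun i => (w i).1 x) x i), mul_sum]
        rw [sum_comm]
        refine sum_eq_zero fun l hl => ?_
        rw [← mul_zero (∑ j, (w j).1 x * hT.grad l j), ← h4 l hl, mul_sum]
        exact sum_congr rfl fun _ _ => by ring
      exact mul_self_eq_zero.1 ((sum_eq_zero_iff_of_nonneg fun _ _ =>
        mul_self_nonneg _).1 h5 i (Finset.mem_univ i))
    ext i x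
    exact hT.eq_zero_of_isPoly (IsPoly.of_pred (w i).2) (h3 i) x
  obtain ⟨w, hw⟩ := exists_riesz B hdef (LinearMap.lsum ℝ (fun _ => PolyPred d k) ℝ φ)
  refine ⟨w, fun i z => ?_⟩
  have h := hw (Pi.single i z)
  rw [LinearMap.lsum_piSingle] at h
  exact (LinearMap.lsum_piSingle ℝ _ ℝ (fun i => pairing hS (hi w i)) i z).symm.trans h

/-- `R` has the same Raviart–Thomas moments as the field with values `v` in the element and `g` on
its faces. -/
structure HasMoments (k : ℕ) (T : Finset (Pt d)) (R : Fin d → Pt d → ℝ) (v : Fin d → Pt d → ℝ)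
    (g : Finset (Pt d) → Fin d → Pt d → ℝ) : Prop where
  elem : ∀ i, ∀ z ∈ PolyPred d k, intT T (fun x => R i x * z x) = intT T (fun x => v i x * z x)
  face : ∀ F ∈ facesOf T, ∀ z, IsPoly k z → intF F (fun x => (∑ i, R i x * normal T F i) * z x) =
      intF F (fun x => (∑ i, g F i x * normal T F i) * z x)

/-- Integrability of the data of interpolators on an element and its faces. -/
structure IsData (T : Finset (Pt d)) (v : Fin d → Pt d → ℝ)
    (g : Finset (Pt d) → Fin d → Pt d → ℝ) : Prop where
  elem : ∀ i, IntegrableOn (v i) (hull T)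
  face : ∀ F ∈ facesOf T, ∀ i, IntegrableOn (g F i) (hull F) μHE[d - 1]

theorem IsData.normal {v : Fin d → Pt d → ℝ} {g : Finset (Pt d) → Fin d → Pt d → ℝ}
    (h : IsData T v g) (hF : F ∈ facesOf T) :
    IntegrableOn (fun y => ∑ i, g F i y * MHD.normal T F i) (hull F) μHE[d - 1] :=
  integrable_finsetSum _ fun i _ => (h.face F hF i).mul_const _

theorem IsSimplex.exists_hasMoments (hT : IsSimplex T) (hd : 0 < d) {v : Fin d → Pt d → ℝ}
    {g : Finset (Pt d) → Fin d → Pt d → ℝ} (h : IsData T v g) :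
    ∃ R, RTField d k R ∧ HasMoments k T R v g := by
  have h1 : ∀ m, ∃ p, m ∈ T → IsPoly k p ∧ ∀ z, IsPoly k z → intF (T.erase m) (fun x => p x * z x) =
        intF (T.erase m) (fun x => (∑ i, g (T.erase m) i x * normal T (T.erase m) i) * z x) := by
    intro m
    by_cases hm : m ∈ T
    · obtain ⟨p, hp, -, hp'⟩ := (hT.isDefinite_face hd (hT.erase_mem_facesOf hm)).exists_projF k
        (h.normal (hT.erase_mem_facesOf hm))
      exact ⟨p, fun _ => ⟨hp, hp'⟩⟩
    · exact ⟨0, fun h => absurd h hm⟩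
  choose p hp using h1
  obtain ⟨R₁, hR₁, hR₁n⟩ := hT.exists_normal hd fun l hl => (hp l hl).1
  have hR₁i := fun i => integrableOn_hull (Y := T) (hR₁.continuous i).continuousOn
  obtain ⟨w, hw⟩ := hT.exists_bubble fun i => pairing (S := PolyPred d k)
    (fun z hz => (IsPoly.of_pred hz).continuous.continuousOn) ((h.elem i).sub (hR₁i i))
  refine ⟨_, hR₁.add (hT.bubble_mem w), fun i z hz => ?_, ?_⟩
  · have hi : ∀ {f : Pt d → ℝ}, IntegrableOn f (hull T) →
        IntegrableOn (fun x => f x * z x) (hull T) := fun hf =>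
      hf.mul_continuousOn (IsPoly.of_pred hz).continuous.continuousOn (isCompact_hull T)
    have h2 := hw i ⟨z, hz⟩
    simp only [intT, pairing, LinearMap.coe_mk, AddHom.coe_mk, Pi.sub_apply] at h2 ⊢
    simp_rw [add_mul]
    rw [integral_add (hi (hR₁i i))
      (hi (integrableOn_hull ((hT.bubble_mem w).continuous i).continuousOn)), h2]
    simp_rw [sub_mul]
    rw [integral_sub (hi (h.elem i)) (hi (hR₁i i))]; ring
  · intro F hF z hz
    obtain ⟨m, hm, rfl⟩ := hT.exists_erase hF
    rw [← (hp m hm).2 z hz]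
    refine setIntegral_congr_fun (measurableSet_hull _) fun x hx => ?_
    beta_reduce
    simp_rw [add_mul, sum_add_distrib]
    simp only [bubble]
    rw [hR₁n m hm x hx, hT.sum_radial_normal hd _ hm hx, ((hT.mem_face hm).1 hx).2]; ring

/-- Stability of the Raviart–Thomas moments. -/
theorem exists_moments_bound (d k : ℕ) (hd : 0 < d) : ∃ C, 0 ≤ C ∧
    ∀ (T : Finset (Pt d)), IsSimplex T → ∀ c ρ, 0 < ρ → Metric.closedBall c (ρ / 2) ⊆ hull T →
    ∀ R, RTField d k R → ∀ m, 0 ≤ m → (∀ i, ∀ z ∈ PolyPred d k, ∀ B, (∀ x ∈ hull T, |z x| ≤ B) →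
      |avgT T (fun x => R i x * z x)| ≤ m * B) →
        (∀ F ∈ facesOf T, ∀ z, IsPoly k z → ∀ B, (∀ x ∈ hull F, |z x| ≤ B) →
      |avg μHE[d - 1] F (fun x => (∑ i, R i x * normal T F i) * z x)| ≤ m * B) →
    ∀ i, ∀ x ∈ hull T, |R i x| ≤ C * (diam T / ρ) * m := by
  have h₀ := refSimplex_isSimplex d
  obtain ⟨C, hC0, hC⟩ := h₀.exists_rt_bound hd k
  refine ⟨(d + 1) * (C * (d + 1)), by positivity, fun T hT c ρ hρ hball R hR m hm hel hfa i x hx => ?_⟩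
  obtain ⟨E⟩ := hT.exists_vertexMap
  obtain ⟨v, hv⟩ := hT.exists_bary_comp hR
  let w : RTCoord d k (refSimplex d) := ⟨⟨_, IsPoly.comp_affine v.1.2 (E.aff h₀)⟩,
    fun a => ⟨_, IsPoly.comp_affine (v.2 ⟨_, E.mapsTo a a.2⟩).2 (E.aff h₀)⟩⟩
  have hw : ∀ a y, (h₀.rtComp k a w).1 y = ∑ i, R i (E.aff h₀ y) * hT.grad (E.toFun a) i :=
    fun a y => by
      rw [hv ⟨_, E.mapsTo a a.2⟩]
      change h₀.bary a y * _ + _ = hT.bary (E.toFun a) (E.aff h₀ y) * _ + _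
      rw [E.bary_aff h₀ hT a.2]
  have key := hC w ((d + 1) * ρ⁻¹ * m) (by positivity) (fun x _ => by
    simp_rw [hw]
    rw [sum_coe_sort (refSimplex d) (fun a => ∑ i, R i (E.aff h₀ x) * hT.grad (E.toFun a) i),
      E.sum_eq fun b => ∑ i, R i (E.aff h₀ x) * hT.grad b i, hT.sum_comp]) (by
    intro l z hz B hB
    have hB0 := h₀.isDefinite.nonneg_of_abs_le hB
    have hz' := comp_affine_mem_polyPred hz (E.symm.aff hT)
    have h1 := E.avgT_eq h₀ hT (fun x => ∑ i, hT.grad (E.toFun l) i * (R i x * z (E.symm.aff hT x)))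
    simp only [E.symm_aff h₀ hT] at h1
    rw [hT.isDefinite.avg_sum _ fun i _ => ((hR.continuous i).fun_mul
      (IsPoly.of_pred hz').continuous).const_mul _] at h1
    simp_rw [hw, sum_mul, mul_comm (R _ _), mul_assoc]
    rw [← h1]
    refine (abs_sum_le_sum_abs _ _).trans
      ((sum_le_sum (g := fun _ => ρ⁻¹ * (m * B)) fun i _ => ?_).trans ?_)
    · rw [avg_smul, abs_mul]
      gcongr
      · exact (PiLp.norm_apply_le _ i).trans (hT.norm_grad_le (E.mapsTo l l.2) hρ hball)
      · exact hel i _ hz' B fun y hy => hB _ ((E.symm.aff_mem_hull hT h₀).2 hy)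
    · simp only [sum_const, card_univ, Fintype.card_fin, nsmul_eq_mul]
      have : 0 ≤ ρ⁻¹ * (m * B) := by positivity
      linarith) (by
    intro l z hz B hB
    have hl := E.mapsTo l l.2
    have hB0 := (h₀.isDefinite_face hd (h₀.erase_mem_facesOf l.2)).nonneg_of_abs_le hB
    have hz' := hz.comp_affine (E.symm.aff hT)
    have h1 := E.avgF_eq h₀ hT hd l.2 (f := fun x =>
      (∑ i, R i x * hT.grad (E.toFun l) i) * z (E.symm.aff hT x))
      ((ContDiff.sum fun i _ => (hR.isPoly i).contDiff.mul contDiff_const).mul hz'.contDiff) (by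
        simp only [E.symm_aff h₀ hT, ← hw]
        exact (IsPoly.contDiff (m := k + 1) (h₀.rtComp k l w).2).mul hz.contDiff)
    simp only [E.symm_aff h₀ hT] at h1
    simp_rw [hw]
    rw [← h1]
    simp_rw [hT.sum_mul_grad_eq hd hl, neg_mul_eq_neg_mul, mul_assoc]
    rw [avg_smul, abs_mul, abs_neg, abs_norm]
    calc _ ≤ ρ⁻¹ * (m * B) := by
          gcongr
          · exact hT.norm_grad_le hl hρ hball
          · exact hfa _ (hT.erase_mem_facesOf hl) _ hz' B fun y hy => hB _ (by
              rwa [← E.aff_mem_face h₀ hT l.2, E.aff_symm h₀ hT])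
      _ ≤ _ := by
        have : 0 ≤ d * (ρ⁻¹ * (m * B)) := by positivity
        linarith)
  obtain ⟨b, hb⟩ := hT.nonempty
  rw [hT.sum_comp_mul (fun i => R i x) b i]
  refine (abs_sum_le_sum_abs _ _).trans
    ((sum_le_sum (g := fun _ => C * ((d + 1) * ρ⁻¹ * m) * diam T) fun l hl => ?_).trans ?_)
  · rw [abs_mul]
    gcongr
    · have h := key ⟨_, E.invMapsTo l hl⟩ _ ((E.symm.aff_mem_hull hT h₀).2 hx)
      simpa only [hw, E.right_inv l hl, E.aff_symm h₀ hT] using h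
    · simpa using (PiLp.norm_apply_le (l - b) i).trans
        (dist_le_diam (vertex_mem_hull hl) (vertex_mem_hull hb))
  · rw [sum_const, hT.card, nsmul_eq_mul]
    push_cast
    rw [div_eq_mul_inv]
    exact le_of_eq (by ring)

/-- Raviart–Thomas fields are determined by their moments. -/
theorem HasMoments.unique (hT : IsSimplex T) (hd : 0 < d) (hR : RTField d k R)
    (hR' : RTField d k R') {v : Fin d → Pt d → ℝ} {g : Finset (Pt d) → Fin d → Pt d → ℝ}
    (h : HasMoments k T R v g) (h' : HasMoments k T R' v g) :
    ∀ i, ∀ x ∈ hull T, R i x = R' i x := by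
  obtain ⟨c, hc⟩ := hT.nonempty_interior
  obtain ⟨r, hr, hball⟩ := Metric.nhds_basis_closedBall.mem_iff.1 (mem_interior_iff_mem_nhds.1 hc)
  obtain ⟨C, hC0, hC⟩ := exists_moments_bound d k hd
  intro i x hx
  have := hC T hT c (2 * r) (by linarith) (by rwa [mul_div_cancel_left₀ _ two_ne_zero]) _
    (hR.sub hR') 0 le_rfl (fun i z hz B _ => ?_) (fun F hF z hz B _ => ?_) i x hx
  · rw [mul_zero] at this
    exact sub_eq_zero.1 (abs_nonpos_iff.1 this)
  · have hi := fun {R} (hR : RTField d k R) => integrableOn_hull (Y := T)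
      ((hR.continuous i).fun_mul (IsPoly.of_pred hz).continuous).continuousOn
    have e := sub_eq_zero.2 ((h.elem i z hz).trans (h'.elem i z hz).symm)
    simp_rw [sub_mul]
    rw [intT, intT, ← integral_sub (hi hR) (hi hR')] at e
    rw [avg, e]; simp
  · have hi := fun {R} (hR : RTField d k R) => (hT.isDefinite_face hd hF).integrableOn
      ((continuous_finsetSum Finset.univ fun i _ => (hR.continuous i).fun_mul
        (continuous_const (y := normal T F i))).fun_mul hz.continuous).continuousOn
    have e := sub_eq_zero.2 ((h.face F hF z hz).trans (h'.face F hF z hz).symm)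
    simp_rw [sub_mul, sum_sub_distrib, sub_mul]
    rw [intF, intF, ← integral_sub (hi hR) (hi hR')] at e
    rw [avg, e]; simp

/-- The interpolator is the restriction of a Raviart–Thomas field with the moments of the data. -/
theorem IsSimplex.rtnInterp_spec (hT : IsSimplex T) (hd : 0 < d) {v : Fin d → Pt d → ℝ}
    {g : Finset (Pt d) → Fin d → Pt d → ℝ} (h : IsData T v g) :
    ∃ R, RTField d k R ∧ HasMoments k T R v g ∧
      rtnInterp (k + 1) T v g = fun i => (hull T).indicator (R i) := by
  have hint : ∀ {R}, RTField d k R → ∀ i, IntegrableOn ((hull T).indicator (R i)) (hull T) :=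
    fun hR i => (integrableOn_hull (hR.continuous i).continuousOn).indicator (measurableSet_hull T)
  have hind : ∀ {R : Fin d → Pt d → ℝ} (i : Fin d) (s : Pt d → ℝ),
      intT T (fun x => (hull T).indicator (R i) x * s x) = intT T (fun x => R i x * s x) :=
    fun i s => setIntegral_congr_fun (measurableSet_hull T) fun x hx => by simp [hx]
  have hex : ∃ r, r ∈ RTN ((k : ℤ) + 1) T ∧
      (∀ i, projT ((k : ℤ) + 1 - 2) T (r i) = projT ((k : ℤ) + 1 - 2) T (v i)) ∧
      ∀ F ∈ facesOf T, ∀ x ∈ hull F, ∑ i, r i x * normal T F i =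
        projF ((k : ℤ) + 1 - 1) F (fun y => ∑ i, g F i y * normal T F i) x := by
    obtain ⟨R, hR, hm⟩ := hT.exists_hasMoments (k := k) hd h
    refine ⟨_, mem_RTN.2 ⟨R, hR, rfl⟩, fun i => ?_, fun F hF x hx => ?_⟩
    · rw [hT.projT_eq_iff (hint hR i) (h.elem i)]
      intro s hs
      obtain ⟨z, hz, rfl⟩ := mem_Poly_pred.1 hs
      rw [hind, intT, intT, setIntegral_mul_indicator, setIntegral_mul_indicator]
      exact hm.elem i z hz
    · rw [add_sub_cancel_right]
      have hF' := hT.isDefinite_face hd hF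
      obtain ⟨a, ha, rfl⟩ := hT.exists_erase hF
      obtain ⟨p, hp, hpn⟩ := hT.exists_normal_poly hd ha hR
      have e1 : (hull (T.erase a)).indicator p = projF k (T.erase a)
          (fun y => ∑ i, g (T.erase a) i y * normal T (T.erase a) i) := by
        refine hF'.eq_projF (h.normal hF) (mem_Poly.2 ⟨p, hp, rfl⟩) fun s hs => ?_
        obtain ⟨z, hz, rfl⟩ := mem_Poly.1 hs
        rw [intF, intF, setIntegral_mul_indicator, setIntegral_mul_indicator]
        refine Eq.trans ?_ (hm.face _ hF z hz)
        refine setIntegral_congr_fun (measurableSet_hull _) fun x hx => ?_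
        simp [hx, hpn x hx]
      rw [← e1]
      simp [hx, hull_face_subset hF hx, hpn x hx]
  obtain ⟨h1, h2, h3⟩ := Classical.epsilon_spec hex
  change rtnInterp ((k : ℤ) + 1) T v g ∈ RTN ((k : ℤ) + 1) T at h1
  obtain ⟨R, hR, hr⟩ := mem_RTN.1 h1
  change ∀ i, projT ((k : ℤ) + 1 - 2) T (rtnInterp ((k : ℤ) + 1) T v g i) = _ at h2
  change ∀ F ∈ facesOf T, ∀ x ∈ hull F, ∑ i, rtnInterp ((k : ℤ) + 1) T v g i x * normal T F i =
    _ at h3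
  rw [hr] at h2 h3
  refine ⟨R, hR, ⟨fun i z hz => ?_, fun F hF z hz => ?_⟩, hr⟩
  · have := (hT.projT_eq_iff (hint hR i) (h.elem i)).1 (h2 i) _ (mem_Poly_pred.2 ⟨z, hz, rfl⟩)
    rwa [hind, intT, intT, setIntegral_mul_indicator, setIntegral_mul_indicator] at this
  · have hF' := hT.isDefinite_face hd hF
    obtain ⟨p, hp, hpe, hpm⟩ := hF'.exists_projF k (h.normal hF)
    rw [← hpm z hz]
    refine setIntegral_congr_fun (measurableSet_hull _) fun x hx => ?_
    have h4 := h3 F hF x hx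
    rw [add_sub_cancel_right, hpe] at h4
    simp only [hx, hull_face_subset hF hx, indicator_of_mem] at h4
    simp [h4]

/-! ### Uniform estimates for polynomials and interpolators -/

theorem IsDefinite.sq_avg_le (h : IsDefinite m Y) (hf : Continuous f) :
    (avg m Y fun x => |f x|) ^ 2 ≤ avg m Y fun x => f x ^ 2 := by
  set A := avg m Y fun x => |f x| with hA
  have h1 := h.integrableOn hf.abs.continuousOn
  have h2 := h.integrableOn (hf.fun_pow 2).continuousOn
  have h6 : IntegrableOn (fun x => f x ^ 2 - 2 * A * |f x|) (hull Y) m := h2.sub (h1.const_mul _)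
  have h3 : ∫ x in hull Y, (f x ^ 2 - 2 * A * |f x| + A ^ 2) ∂m = (∫ x in hull Y, f x ^ 2 ∂m) -
      2 * A * (∫ x in hull Y, |f x| ∂m) + m.real (hull Y) * A ^ 2 := by
    rw [integral_add h6 (integrableOn_const h.finite),
      integral_sub h2 (h1.const_mul _), integral_const_mul, setIntegral_const, smul_eq_mul]
  have h4 : 0 ≤ ∫ x in hull Y, (f x ^ 2 - 2 * A * |f x| + A ^ 2) ∂m := integral_nonneg fun x => by
    simp only [Pi.zero_apply]
    nlinarith [sq_abs (f x), sq_nonneg (|f x| - A)]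
  have h5 : ∫ x in hull Y, |f x| ∂m = m.real (hull Y) * A := by
    rw [hA, avg, mul_inv_cancel_left₀ h.pos.ne']
  rw [h3, h5] at h4
  rw [avg, le_inv_mul_iff₀ h.pos]
  linarith

theorem exists_sq_bound (d m : ℕ) : ∃ C, 0 ≤ C ∧ ∀ T : Finset (Pt d), IsSimplex T →
    ∀ p, IsPoly m p → ∀ x ∈ hull T, p x ^ 2 ≤ C * avgT T (fun y => p y ^ 2) := by
  obtain ⟨C, hC0, hC⟩ := exists_sup_bound d m
  refine ⟨C ^ 2, by positivity, fun T hT p hp x hx => ?_⟩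
  have h1 := hC T hT p hp x hx
  calc p x ^ 2 = |p x| ^ 2 := (sq_abs _).symm
    _ ≤ (C * avgT T (fun y => |p y|)) ^ 2 := by gcongr
    _ = C ^ 2 * (avgT T (fun y => |p y|)) ^ 2 := by ring
    _ ≤ _ := by gcongr; exact hT.isDefinite.sq_avg_le hp.continuous

theorem exists_pderiv_sq_bound (d m : ℕ) : ∃ C, 0 ≤ C ∧ ∀ T : Finset (Pt d), IsSimplex T →
    ∀ c ρ, 0 < ρ → Metric.closedBall c (ρ / 2) ⊆ hull T →
    ∀ p, IsPoly m p → ∀ x ∈ hull T, ∀ j,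
      (pderiv j p x) ^ 2 ≤ C * (ρ⁻¹) ^ 2 * avgT T (fun y => p y ^ 2) := by
  obtain ⟨C, hC0, hC⟩ := exists_pderiv_bound d m
  refine ⟨C ^ 2, by positivity, fun T hT c ρ hρ hb p hp x hx j => ?_⟩
  have h1 := hC T hT c ρ hρ hb p hp x hx j
  calc (pderiv j p x) ^ 2 = |pderiv j p x| ^ 2 := (sq_abs _).symm
    _ ≤ (C * ρ⁻¹ * avgT T (fun y => |p y|)) ^ 2 := by gcongr
    _ = C ^ 2 * (ρ⁻¹) ^ 2 * (avgT T (fun y => |p y|)) ^ 2 := by ring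
    _ ≤ _ := by gcongr; exact hT.isDefinite.sq_avg_le hp.continuous

theorem IsSimplex.face_real_le (hT : IsSimplex T) (hd : 0 < d)
    (hF : F ∈ facesOf T) {c : Pt d} {ρ : ℝ} (hρ : 0 < ρ)
    (hb : Metric.closedBall c (ρ / 2) ⊆ hull T) :
    (μHE[d - 1] : Measure (Pt d)).real (hull F) ≤ d * ρ⁻¹ * volume.real (hull T) := by
  obtain ⟨a, ha, rfl⟩ := hT.exists_erase hF
  rw [hT.face_real_eq hd ha]
  have h1 := hT.norm_grad_le ha hρ hb
  calc _ = d * ‖hT.grad a‖ * volume.real (hull T) := by ring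
    _ ≤ _ := by gcongr

/-- Discrete trace inequality. -/
theorem exists_trace_bound (d m : ℕ) (hd : 0 < d) : ∃ C, 0 ≤ C ∧ ∀ T : Finset (Pt d),
    IsSimplex T → ∀ c ρ, 0 < ρ → Metric.closedBall c (ρ / 2) ⊆ hull T →
    ∀ F ∈ facesOf T, ∀ p, IsPoly m p →
      intF F (fun x => p x ^ 2) ≤ C * ρ⁻¹ * intT T (fun x => p x ^ 2) := by
  obtain ⟨C, hC0, hC⟩ := exists_sq_bound d m
  refine ⟨C * d, by positivity, fun T hT c ρ hρ hb F hF p hp => ?_⟩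
  have hF' := hT.isDefinite_face hd hF
  have h1 := hF'.integral_le
    (hF'.integrableOn (hp.continuous.pow 2).continuousOn) fun x hx => hC T hT p hp x
    (hull_face_subset hF hx)
  have h2 : 0 ≤ intT T (fun x => p x ^ 2) := integral_nonneg fun x => sq_nonneg _
  have hv := hT.volume_pos
  calc _ ≤ _ := h1
    _ ≤ (d * ρ⁻¹ * volume.real (hull T)) * (C * avgT T (fun y => p y ^ 2)) := by
      gcongr
      · exact mul_nonneg hC0 (avg_nonneg fun _ => sq_nonneg _)
      · exact hT.face_real_le hd hF hρ hb
    _ = _ := by rw [avg, intT]; field_simp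

/-- Estimates of interpolators of data that are close to a constant `c`, as measured by their
moments. -/
theorem exists_interp_stab (d k : ℕ) (hd : 0 < d) : ∃ C, 0 ≤ C ∧
    ∀ T : Finset (Pt d), IsSimplex T → ∀ b ρ, 0 < ρ → Metric.closedBall b (ρ / 2) ⊆ hull T →
    ∀ R v g, RTField d k R → IsData T v g → HasMoments k T R v g →
    ∀ (c : Fin d → ℝ) (m : ℝ), 0 ≤ m → (∀ i, ∀ z ∈ PolyPred d k, ∀ B, (∀ x ∈ hull T, |z x| ≤ B) →
      |avgT T (fun x => v i x * z x) - c i * avgT T z| ≤ m * B) →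
        (∀ F ∈ facesOf T, ∀ i, ∀ z, IsPoly k z → ∀ B, (∀ x ∈ hull F, |z x| ≤ B) →
      |avg μHE[d - 1] F (fun x => g F i x * z x) - c i * avg μHE[d - 1] F z| ≤ m * B) →
        (∀ i, ∀ x ∈ hull T, |R i x - c i| ≤ C * (diam T / ρ) * m) ∧
          (∀ i j, ∀ x ∈ hull T, |pderiv j (R i) x| ≤ C * (diam T / ρ) * ρ⁻¹ * m) ∧
    ∀ F ∈ facesOf T, ∀ i p, IsPoly k p →
      (∀ z, IsPoly k z → intF F (fun x => p x * z x) = intF F (fun x => g F i x * z x)) →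
      ∀ x ∈ hull F, |p x - c i| ≤ C * m := by
  obtain ⟨C₁, hC₁0, hC₁⟩ := exists_moments_bound d k hd
  obtain ⟨C₂, hC₂0, hC₂⟩ := exists_pderiv_bound d (k + 1)
  obtain ⟨C₃, hC₃0, hC₃⟩ := exists_sup_face_bound d k hd
  set C := C₁ * d + C₂ * (C₁ * d) + C₃ with hC
  have h₁ : 0 ≤ C₁ * d := by positivity
  have h₂ : 0 ≤ C₂ * (C₁ * d) := by positivity
  have hCC₁ : C₁ * d ≤ C := by linarith
  have hCC₂ : C₂ * (C₁ * d) ≤ C := by linarith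
  have hCC₃ : C₃ ≤ C := by linarith
  refine ⟨C, by positivity, fun T hT b ρ hρ hb R v g hR hdata hmom c m hm hv hg => ?_⟩
  have hh := hT.diam_pos hd
  have hbound : ∀ i, ∀ x ∈ hull T, |R i x - c i| ≤ C₁ * (diam T / ρ) * (d * m) := by
    refine hC₁ T hT b ρ hρ hb (fun i x => R i x - c i) (hR.sub (RTField.const c)) (d * m)
      (by positivity) (fun i z hz B hB => ?_) fun F hF z hz B hB => ?_
    · have hzc := (IsPoly.of_pred hz).continuous
      have e : avgT T (fun x => R i x * z x) = avgT T (fun x => v i x * z x) :=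
        congrArg (_ * ·) (hmom.elem i z hz)
      rw [hT.isDefinite.avg_sub_mul _
        (integrableOn_hull ((hR.continuous i).mul hzc).continuousOn) hzc, e]
      refine (hv i z hz B hB).trans ?_
      have : (1 : ℝ) ≤ d := by exact_mod_cast hd
      have := mul_nonneg hm (hT.isDefinite.nonneg_of_abs_le hB)
      nlinarith
    · have hdef := hT.isDefinite_face hd hF
      have hzc := hz.continuous
      have e : avg μHE[d - 1] F (fun x => (∑ i, (R i x - c i) * normal T F i) * z x) =
          ∑ i, normal T F i *
            (avg μHE[d - 1] F (fun x => g F i x * z x) - c i * avg μHE[d - 1] F z) := by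
        have h1 : avg μHE[d - 1] F (fun x => (∑ i, R i x * normal T F i) * z x) =
            avg μHE[d - 1] F (fun x => (∑ i, g F i x * normal T F i) * z x) :=
          congrArg (_ * ·) (hmom.face F hF z hz)
        have h2 : avg μHE[d - 1] F (fun x => (∑ i, g F i x * normal T F i) * z x) =
            ∑ i, normal T F i * avg μHE[d - 1] F (fun x => g F i x * z x) := by
          simp_rw [← avg_smul, avg, ← mul_sum]
          rw [← integral_finsetSum _ fun i _ => ((hdata.face F hF i).mul_continuousOn
            hzc.continuousOn (isCompact_hull F)).const_mul (normal T F i)]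
          congr 2; ext x
          rw [sum_mul]
          exact sum_congr rfl fun i _ => by ring
        simp_rw [sub_mul, sum_sub_distrib, mul_sub]
        rw [hdef.avg_sub_mul _ (hdef.integrableOn ((continuous_finsetSum _ fun i _ =>
          (hR.continuous i).fun_mul
            (continuous_const (y := normal T F i))).fun_mul hzc).continuousOn)
          hzc, h1, h2,
          sum_sub_distrib, sum_mul]
        congr 1
        exact sum_congr rfl fun i _ => by ring
      rw [e]
      refine (abs_sum_le_sum_abs _ _).trans
        ((sum_le_sum (g := fun _ => m * B) fun i _ => ?_).trans ?_)
      · rw [abs_mul]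
        have h1 : |normal T F i| ≤ 1 := by
          obtain ⟨a, ha, rfl⟩ := hT.exists_erase hF
          exact (PiLp.norm_apply_le _ i).trans (hT.norm_normal hd ha).le
        exact (mul_le_mul h1 (hg _ hF i z hz B hB) (abs_nonneg _) zero_le_one).trans_eq (one_mul _)
      · simp [mul_assoc]
  refine ⟨fun i x hx => ?_, fun i j x hx => ?_, fun F hF i p hp hpm x hx => ?_⟩
  · refine (hbound i x hx).trans ?_
    calc C₁ * (diam T / ρ) * (d * m) = C₁ * d * (diam T / ρ) * m := by ring
      _ ≤ _ := by gcongr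
  · have hp : IsPoly (k + 1) (fun x => R i x - c i) := (hR.isPoly i).sub (IsPoly.const _ _)
    have h1 := hC₂ T hT b ρ hρ hb _ hp x hx j
    have e1 : pderiv j (fun x => R i x - c i) x = pderiv j (R i) x := by
      simp only [pderiv]; rw [fderiv_sub_const]
    rw [e1] at h1
    refine h1.trans ?_
    calc C₂ * ρ⁻¹ * avgT T (fun y => |R i y - c i|)
        ≤ C₂ * ρ⁻¹ * (C₁ * (diam T / ρ) * (d * m)) := by
          gcongr
          exact hT.isDefinite.avg_le (integrableOn_hull hp.continuous.abs.continuousOn) (hbound i)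
      _ = C₂ * (C₁ * d) * (diam T / ρ) * ρ⁻¹ * m := by ring
      _ ≤ _ := by gcongr
  · have hF' := hT.isDefinite_face hd hF
    refine (hC₃ T hT F hF _ (hp.sub (IsPoly.const _ (c i))) m hm (fun z hz B hB => ?_) x hx).trans
      (by gcongr)
    have e : avg μHE[d - 1] F (fun x => p x * z x) = avg μHE[d - 1] F (fun x => g F i x * z x) :=
      congrArg (_ * ·) (hpm z hz)
    rw [hF'.avg_sub_mul _ (hF'.integrableOn (hp.continuous.mul hz.continuous).continuousOn)
      hz.continuous, e]
    exact hg F hF i z hz B hB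

/-! ### Velocity reconstruction -/

theorem pd_indicator (hT : IsSimplex T) (hp : Differentiable ℝ p) (j : Fin d)
    (hx : x ∈ hull T) : pd T j ((hull T).indicator p) x = pderiv j p x := by
  rw [pd, pderiv, ← fderivWithin_eq_fderiv (hT.uniqueDiffOn x hx) (hp x)]
  exact congrArg (fun L : Pt d →L[ℝ] ℝ => L (e j))
    (fderivWithin_congr (fun y hy => by simp [hy]) (by simp [hx]))

theorem pd_congr (h : ∀ x ∈ hull T, p x = q x) (j : Fin d)
    (hx : x ∈ hull T) : pd T j p x = pd T j q x :=
  congrArg (fun L : Pt d →L[ℝ] ℝ => L (e j)) (fderivWithin_congr h (h x hx))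

theorem pd_pd_indicator (hT : IsSimplex T) {m : ℕ} (hp : IsPoly m p) (i j : Fin d)
    (hx : x ∈ hull T) :
    pd T i (pd T j ((hull T).indicator p)) x = pderiv i (pderiv j p) x := by
  rw [pd_congr (q := (hull T).indicator (pderiv j p))
    (fun y hy => by rw [pd_indicator hT hp.differentiable j hy]; simp [hy]) i hx]
  exact pd_indicator hT (hp.pderiv_mem j).differentiable i hx

theorem intT_congr (h : ∀ x ∈ hull T, f x = g x) : intT T f = intT T g :=
  setIntegral_congr_fun (measurableSet_hull T) h

theorem intF_congr (h : ∀ x ∈ hull F, f x = g x) : intF F f = intF F g :=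
  setIntegral_congr_fun (measurableSet_hull F) h

theorem pderiv_add (hf : Differentiable ℝ f) (hg : Differentiable ℝ g)
    (j : Fin d) (x : Pt d) : pderiv j (fun y => f y + g y) x = pderiv j f x + pderiv j g x := by
  simp only [pderiv]
  rw [fderiv_fun_add (hf x) (hg x)]; rfl

theorem pderiv_const_mul (hf : Differentiable ℝ f) (c : ℝ)
    (j : Fin d) (x : Pt d) : pderiv j (fun y => c * f y) x = c * pderiv j f x := by
  simp only [pderiv]
  rw [fderiv_const_mul (hf x)]; rfl

theorem pderiv_const (c : ℝ) (j : Fin d) (x : Pt d) : pderiv j (fun _ => c) x = 0 := by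
  simp [pderiv]

/-- Partial derivative of polynomials, as a linear map. -/
def derivL (d l : ℕ) (j : Fin d) : PolyFun d l →ₗ[ℝ] PolyFun d l where
  toFun p := ⟨pderiv j p.1, IsPoly.pderiv_mem (m := l) p.2 j⟩
  map_add' p q := by
    ext x
    exact pderiv_add (IsPoly.differentiable (m := l) p.2) (IsPoly.differentiable (m := l) q.2) j x
  map_smul' c p := by
    ext x
    exact pderiv_const_mul (IsPoly.differentiable (m := l) p.2) c j x

/-- The right-hand side of the reconstruction problem for one component. -/
def potRHS (T : Finset (Pt d)) (v : Pt d → ℝ) (g : Finset (Pt d) → Pt d → ℝ) (q : Pt d → ℝ) : ℝ :=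
  - intT T (fun x => v x * ∑ j, pderiv j (pderiv j q) x) +
    ∑ F ∈ facesOf T, intF F (fun x => g F x * ∑ j, pderiv j q x * normal T F j)

/-- `p` solves the reconstruction problem for one component, with mean value prescribed
by `m`. -/
def IsPot (k : ℕ) (T : Finset (Pt d)) (v : Pt d → ℝ) (g : Finset (Pt d) → Pt d → ℝ) (m : ℝ)
    (p : Pt d → ℝ) : Prop :=
  (∀ q, IsPoly (k + 1) q → ∑ j, intT T (fun x => pderiv j p x * pderiv j q x) = potRHS T v g q) ∧
    intT T p = m

theorem integrableOn_pderiv_mul {l : ℕ} (hp : IsPoly l p) (hq : IsPoly l q)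
    (j : Fin d) : IntegrableOn (fun x => pderiv j p x * pderiv j q x) (hull T) :=
  integrableOn_hull ((hp.pderiv_mem j).continuous.mul (hq.pderiv_mem j).continuous).continuousOn

theorem IsSimplex.eq_zero_of_grad (hT : IsSimplex T) {l : ℕ} (hp : IsPoly l p)
    (h : ∑ j, intT T (fun x => pderiv j p x * pderiv j p x) = 0) (h0 : intT T p = 0) :
    ∀ x, p x = 0 := by
  have h1 : ∀ j x, pderiv j p x = 0 := by
    intro j
    have h2 := (sum_eq_zero_iff_of_nonneg (fun j _ =>
      integral_nonneg fun x => mul_self_nonneg _)).1 h j (Finset.mem_univ _)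
    have hc := (hp.pderiv_mem j).continuous
    have h3 := hT.eq_zero_of_intT (hc.mul hc).continuousOn (fun x _ => mul_self_nonneg _) h2
    exact hT.eq_zero_of_isPoly (hp.pderiv_mem j) fun x hx =>
      mul_self_eq_zero.1 (h3 x (interior_subset hx))
  have h2 : ∀ x, fderiv ℝ p x = 0 := fun x => by
    ext z
    rw [sum_mul_e]
    simp [h1]
  have h3 := is_const_of_fderiv_eq_zero hp.differentiable h2
  intro x
  have h4 : intT T p = volume.real (hull T) * p x := by
    rw [show p = fun _ => p x from funext fun y => h3 y x, intT, setIntegral_const, smul_eq_mul]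
  rw [h0] at h4
  exact (mul_eq_zero.1 h4.symm).resolve_left hT.volume_pos.ne'

theorem IsSimplex.exists_isPot (hT : IsSimplex T) {v : Pt d → ℝ}
    {g : Finset (Pt d) → Pt d → ℝ} (hv : IntegrableOn v (hull T))
    (hg : ∀ F ∈ facesOf T, IntegrableOn (g F) (hull F) μHE[d - 1]) (m : ℝ) :
    ∃ p, IsPoly (k + 1) p ∧ IsPot k T v g m p := by
  have hS : ∀ s ∈ PolyFun d (k + 1), ContinuousOn s (hull T) := fun s hs =>
    (PolyFun.continuous ⟨s, hs⟩).continuousOn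
  let I : PolyFun d (k + 1) →ₗ[ℝ] ℝ := pairing hS (integrableOn_hull (continuousOn_const (c := 1)))
  have hI : ∀ p, I p = intT T p.1 := fun p => by
    simp only [I, pairing, LinearMap.coe_mk, AddHom.coe_mk, one_mul]; rfl
  let G := hT.isDefinite.form hS
  let D := derivL d (k + 1)
  let B : PolyFun d (k + 1) →ₗ[ℝ] PolyFun d (k + 1) →ₗ[ℝ] ℝ :=
    (∑ j, G.compl₁₂ (D j) (D j)) + (LinearMap.mul ℝ ℝ).compl₁₂ I I
  have hB : ∀ p q, B p q = ∑ j, intT T (fun x => pderiv j p.1 x * pderiv j q.1 x) +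
      intT T p.1 * intT T q.1 := by
    intro p q
    simp only [B, LinearMap.add_apply, LinearMap.sum_apply, LinearMap.compl₁₂_apply,
      LinearMap.mul_apply', hI]
    rfl
  let φ : PolyFun d (k + 1) →ₗ[ℝ] ℝ := -((pairing hS hv).comp (∑ j, (D j).comp (D j))) +
    ∑ F : facesOf T, (pairing (fun s hs => (hS s hs).mono (hull_face_subset F.2)) (hg F.1 F.2)).comp
        (∑ j, normal T F.1 j • D j)
  have hφ : ∀ q, φ q = potRHS T v g q.1 := by
    intro q
    simp only [φ, LinearMap.add_apply, LinearMap.neg_apply, LinearMap.sum_apply,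
      LinearMap.comp_apply, potRHS]
    congr 1
    · congr 1
      simp only [pairing, LinearMap.coe_mk, AddHom.coe_mk]
      refine intT_congr fun x _ => ?_
      rw [Submodule.coe_sum, Finset.sum_apply]; rfl
    · rw [← sum_coe_sort (facesOf T)]
      refine sum_congr rfl fun F _ => ?_
      simp only [pairing, LinearMap.coe_mk, AddHom.coe_mk]
      refine intF_congr fun x _ => ?_
      rw [Submodule.coe_sum, Finset.sum_apply]
      congr 1
      exact sum_congr rfl fun j _ => mul_comm _ _
  obtain ⟨p, hp⟩ := exists_riesz B (fun p hp => by
    rw [hB] at hp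
    have h1 : 0 ≤ ∑ j, intT T (fun x => pderiv j p.1 x * pderiv j p.1 x) :=
      sum_nonneg fun j _ => integral_nonneg fun x => mul_self_nonneg _
    have h2 := mul_self_nonneg (intT T p.1)
    exact Subtype.ext (funext (hT.eq_zero_of_grad (l := k + 1) p.2 (by linarith)
      (mul_self_eq_zero.1 (by linarith))))) (φ + m • I)
  simp only [hB, LinearMap.add_apply, hφ, LinearMap.smul_apply, hI, smul_eq_mul] at hp
  have h1 : intT T p.1 = m := by
    have h2 := hp ⟨fun _ => 1, IsPoly.const (k + 1) 1⟩
    have e1 : ∀ j : Fin d, pderiv j (fun _ : Pt d => (1 : ℝ)) = fun _ => 0 := fun j =>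
      funext fun x => pderiv_const 1 j x
    have e2 : intT T (fun _ : Pt d => (1 : ℝ)) ≠ 0 := by
      rw [intT, setIntegral_const, smul_eq_mul, mul_one]; exact hT.volume_pos.ne'
    simp only [potRHS, e1, mul_zero, sum_const_zero, zero_mul, intT, integral_zero, intF,
      neg_zero, zero_add, pderiv_const] at h2
    exact mul_right_cancel₀ e2 h2
  refine ⟨p.1, p.2, fun q hq => ?_, h1⟩
  have h2 := hp ⟨q, hq⟩
  rw [h1] at h2
  simpa using h2

theorem IsPot.unique (hT : IsSimplex T) {v : Pt d → ℝ}
    {g : Finset (Pt d) → Pt d → ℝ} {m : ℝ} {p' : Pt d → ℝ} (hp : IsPoly (k + 1) p)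
    (hp' : IsPoly (k + 1) p') (h : IsPot k T v g m p) (h' : IsPot k T v g m p') : p = p' := by
  have hs : IsPoly (k + 1) (fun x => p x - p' x) := hp.sub hp'
  have e1 : ∀ j, pderiv j (fun x => p x - p' x) = fun x => pderiv j p x - pderiv j p' x := by
    intro j; ext x
    simp only [pderiv]
    rw [fderiv_fun_sub (hp.differentiable x) (hp'.differentiable x)]; rfl
  have h1 := hT.eq_zero_of_grad hs (by
    have h2 := h.1 _ hs
    have h3 := h'.1 _ hs
    rw [← h3, ← sub_eq_zero, ← sum_sub_distrib] at h2
    rw [← h2]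
    refine sum_congr rfl fun j _ => ?_
    rw [intT, intT, intT, ← integral_sub (integrableOn_pderiv_mul hp hs j)
      (integrableOn_pderiv_mul hp' hs j)]
    congr 1; ext x; rw [e1]; ring) (by
    rw [intT, integral_sub (integrableOn_hull hp.continuous.continuousOn)
      (integrableOn_hull hp'.continuous.continuousOn)]
    exact sub_eq_zero.2 (h.2.trans h'.2.symm))
  exact funext fun x => sub_eq_zero.1 (h1 x)

theorem potRHS_add {v v' : Pt d → ℝ} {g g' : Finset (Pt d) → Pt d → ℝ}
    (hv : IntegrableOn v (hull T)) (hv' : IntegrableOn v' (hull T))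
    (hg : ∀ F ∈ facesOf T, IntegrableOn (g F) (hull F) μHE[d - 1])
    (hg' : ∀ F ∈ facesOf T, IntegrableOn (g' F) (hull F) μHE[d - 1]) {l : ℕ}
    (hq : IsPoly l q) : potRHS T (fun x => v x + v' x) (fun F x => g F x + g' F x) q =
      potRHS T v g q + potRHS T v' g' q := by
  have hc : Continuous fun x => ∑ j, pderiv j (pderiv j q) x := continuous_finsetSum _ fun j _ =>
    ((hq.pderiv_mem j).pderiv_mem j).continuous
  have hcF : ∀ F, Continuous fun x => ∑ j, pderiv j q x * normal T F j := fun F =>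
    continuous_finsetSum _ fun j _ => (hq.pderiv_mem j).continuous.mul continuous_const
  simp only [potRHS, intT, intF]
  rw [integral_add_mul hv hv' hc.continuousOn, sum_congr rfl fun F hF =>
    integral_add_mul (hg F hF) (hg' F hF) (hcF F).continuousOn, sum_add_distrib]
  ring

/-- Local unknowns of the scheme. -/
structure IsLocal (k : ℕ) (T : Finset (Pt d)) (v : HybVec d) : Prop where
  elem : v.1 T ∈ RTN (k + 1) T
  face : ∀ F ∈ facesOf T, v.2 F ∈ PolyVec k F

theorem IsLocal.add {v' : HybVec d} (h : IsLocal k T v) (h' : IsLocal k T v') :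
    IsLocal k T (v + v') :=
  ⟨Submodule.add_mem _ h.elem h'.elem, fun F hF => Submodule.add_mem _ (h.face F hF) (h'.face F hF)⟩

theorem IsLocal.continuousOn (h : IsLocal k T v) (i : Fin d) : ContinuousOn (v.1 T i) (hull T) := by
  obtain ⟨R, hR, hr⟩ := mem_RTN.1 h.elem
  rw [hr]
  exact (hR.continuous i).continuousOn.congr fun x hx => by simp [hx]

theorem IsLocal.continuousOn_face (h : IsLocal k T v)
    (hF : F ∈ facesOf T) (i : Fin d) : ContinuousOn (v.2 F i) (hull F) := by
  obtain ⟨P, hP, hp⟩ := mem_PolyVec.1 (h.face F hF)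
  rw [hp]
  exact (hP i).continuous.continuousOn.congr fun x hx => by simp [hx]

theorem IsLocal.isData (hT : IsSimplex T) (hd : 0 < d) (h : IsLocal k T v) : IsData T (v.1 T) v.2 :=
  ⟨fun i => integrableOn_hull (h.continuousOn i), fun _ hF i =>
    (hT.isDefinite_face hd hF).integrableOn (h.continuousOn_face hF i)⟩

/-- The prescribed mean value of the reconstruction. -/
def reconMean (k : ℕ) (T : Finset (Pt d)) (v : HybVec d) (i : Fin d) : ℝ :=
  if k = 0 then ∑ F ∈ facesOf T, distTF T F / d * intF F (v.2 F i) else intT T (v.1 T i)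

theorem mem_PolyVec_succ {f : Fin d → Pt d → ℝ} :
    f ∈ PolyVec ((k : ℤ) + 1) Y ↔ ∃ P : Fin d → Pt d → ℝ, (∀ i, IsPoly (k + 1) (P i)) ∧
      f = fun i => (hull Y).indicator (P i) := by
  exact_mod_cast mem_PolyVec (l := k + 1)

/-- The reconstruction is obtained componentwise. -/
theorem IsSimplex.recon_spec (hT : IsSimplex T) (hd : 0 < d) (hv : IsLocal k T v) :
    ∃ p : Fin d → Pt d → ℝ, (∀ i, IsPoly (k + 1) (p i)) ∧
      recon k T v = (fun i => (hull T).indicator (p i)) ∧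
      ∀ i, IsPot k T (v.1 T i) (fun F => v.2 F i) (reconMean k T v i) (p i) := by
  have hdat := hv.isData hT hd
  have hL : ∀ p w : Fin d → Pt d → ℝ, (∀ i, IsPoly (k + 1) (p i)) → (∀ i, IsPoly (k + 1) (w i)) →
      intT T (fun x => ∑ i, ∑ j, pd T j ((hull T).indicator (p i)) x *
        pd T j ((hull T).indicator (w i)) x) =
      ∑ i, ∑ j, intT T (fun x => pderiv j (p i) x * pderiv j (w i) x) := by
    intro p w hp hw
    rw [intT_congr (g := fun x => ∑ i, ∑ j, pderiv j (p i) x * pderiv j (w i) x) fun x hx =>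
      sum_congr rfl fun i _ => sum_congr rfl fun j _ => by
        rw [pd_indicator hT (hp i).differentiable j hx, pd_indicator hT (hw i).differentiable j hx]]
    simp only [intT]
    rw [integral_finsetSum _ fun i _ => integrable_finsetSum _ fun j _ =>
      integrableOn_pderiv_mul (hp i) (hw i) j]
    exact sum_congr rfl fun i _ => integral_finsetSum _ fun j _ =>
      integrableOn_pderiv_mul (hp i) (hw i) j
  have hRr : ∀ w : Fin d → Pt d → ℝ, (∀ i, IsPoly (k + 1) (w i)) →
      - intT T (fun x => ∑ i, v.1 T i x * ∑ j, pd T j (pd T j ((hull T).indicator (w i))) x) +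
        ∑ F ∈ facesOf T, intF F (fun x => ∑ i, v.2 F i x *
          ∑ j, pd T j ((hull T).indicator (w i)) x * normal T F j) =
      ∑ i, potRHS T (v.1 T i) (fun F => v.2 F i) (w i) := by
    intro w hw
    have hc : ∀ i, Continuous fun x => ∑ j, pderiv j (pderiv j (w i)) x := fun i =>
      continuous_finsetSum _ fun j _ => (((hw i).pderiv_mem j).pderiv_mem j).continuous
    have hcF : ∀ i F, Continuous fun x => ∑ j, pderiv j (w i) x * normal T F j := fun i F =>
      continuous_finsetSum _ fun j _ => ((hw i).pderiv_mem j).continuous.mul continuous_const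
    simp only [potRHS]
    rw [sum_add_distrib, sum_neg_distrib, sum_comm]
    congr 1
    · congr 1
      rw [intT_congr (g := fun x => ∑ i, v.1 T i x * ∑ j, pderiv j (pderiv j (w i)) x)
        fun x hx => sum_congr rfl fun i _ => by
          rw [sum_congr rfl fun j _ => pd_pd_indicator hT (hw i) j j hx]]
      exact integral_finsetSum _ fun i _ =>
        (hdat.elem i).mul_continuousOn (hc i).continuousOn (isCompact_hull T)
    · refine sum_congr rfl fun F hF => ?_
      rw [intF_congr (g := fun x => ∑ i, v.2 F i x * ∑ j, pderiv j (w i) x * normal T F j)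
        fun x hx => sum_congr rfl fun i _ => by
          rw [sum_congr rfl fun j _ => by
            rw [pd_indicator hT (hw i).differentiable j (hull_face_subset hF hx)]]]
      exact integral_finsetSum _ fun i _ =>
        (hdat.face F hF i).mul_continuousOn (hcF i F).continuousOn (isCompact_hull F)
  have hex : ∃ P, P ∈ PolyVec ((k : ℤ) + 1) T ∧ (∀ w ∈ PolyVec ((k : ℤ) + 1) T,
      intT T (fun x => ∑ i, ∑ j, pd T j (P i) x * pd T j (w i) x) =
        - intT T (fun x => ∑ i, v.1 T i x * ∑ j, pd T j (pd T j (w i)) x) +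
        ∑ F ∈ facesOf T, intF F (fun x => ∑ i, v.2 F i x * ∑ j, pd T j (w i) x * normal T F j)) ∧
      ∀ i, intT T (P i) = reconMean k T v i := by
    choose p hp hpot using fun i => hT.exists_isPot (k := k) (hdat.elem i)
      (fun F hF => hdat.face F hF i) (reconMean k T v i)
    refine ⟨_, mem_PolyVec_succ.2 ⟨p, hp, rfl⟩, fun w hw => ?_, fun i => ?_⟩
    · obtain ⟨W, hW, rfl⟩ := mem_PolyVec_succ.1 hw
      rw [hL p W hp hW, hRr W hW]
      exact sum_congr rfl fun i _ => (hpot i).1 _ (hW i)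
    · rw [← (hpot i).2]
      exact intT_congr fun x hx => by simp [hx]
  obtain ⟨h1, h2, h3⟩ := Classical.epsilon_spec hex
  change recon k T v ∈ PolyVec ((k : ℤ) + 1) T at h1
  change ∀ w ∈ PolyVec ((k : ℤ) + 1) T,
      intT T (fun x => ∑ i, ∑ j, pd T j (recon k T v i) x * pd T j (w i) x) = _ at h2
  change ∀ i, intT T (recon k T v i) = reconMean k T v i at h3
  obtain ⟨p, hp, hpe⟩ := mem_PolyVec_succ.1 h1
  refine ⟨p, hp, hpe, fun i => ⟨fun q hq => ?_, ?_⟩⟩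
  · classical
    have hW : ∀ l, IsPoly (k + 1) ((Pi.single i q : Fin d → Pt d → ℝ) l) := by
      intro l
      by_cases h : l = i
      · subst h; simpa using hq
      · rw [Pi.single_eq_of_ne h]; exact Submodule.zero_mem (PolyFun d (k + 1))
    have h4 := h2 _ (mem_PolyVec_succ.2 ⟨_, hW, rfl⟩)
    rw [hpe] at h4
    rw [hL p _ hp hW, hRr _ hW] at h4
    have ez : ∀ j : Fin d, pderiv j (0 : Pt d → ℝ) = fun _ => 0 := fun j =>
      funext fun x => pderiv_const 0 j x
    have e1 : ∀ l ∈ Finset.univ, l ≠ i → ∑ j, intT T (fun x => pderiv j (p l) x *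
        pderiv j ((Pi.single i q : Fin d → Pt d → ℝ) l) x) = 0 := by
      intro l _ h
      rw [Pi.single_eq_of_ne h]
      simp [ez, intT]
    have e2 : ∀ l ∈ Finset.univ, l ≠ i →
        potRHS T (v.1 T l) (fun F => v.2 F l) ((Pi.single i q : Fin d → Pt d → ℝ) l) = 0 := by
      intro l _ h
      rw [Pi.single_eq_of_ne h]
      simp [potRHS, ez, pderiv_const, intT, intF]
    rw [sum_eq_single i e1 (by simp), sum_eq_single i e2 (by simp)] at h4
    simpa using h4
  · rw [← h3 i, hpe]
    exact intT_congr fun x hx => by simp [hx]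

theorem reconMean_add (hT : IsSimplex T) (hd : 0 < d) {v' : HybVec d} (hv : IsLocal k T v)
    (hv' : IsLocal k T v') (i : Fin d) :
    reconMean k T (v + v') i = reconMean k T v i + reconMean k T v' i := by
  have h := hv.isData hT hd
  have h' := hv'.isData hT hd
  simp only [reconMean]
  split_ifs
  · rw [← sum_add_distrib]
    refine sum_congr rfl fun F hF => ?_
    rw [← mul_add, intF, intF, intF, ← integral_add (h.face F hF i) (h'.face F hF i)]
    rfl
  · rw [intT, intT, intT, ← integral_add (h.elem i) (h'.elem i)]
    rfl

theorem IsSimplex.recon_add (hT : IsSimplex T) (hd : 0 < d) {v' : HybVec d}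
    (hv : IsLocal k T v) (hv' : IsLocal k T v') :
    recon k T (v + v') = recon k T v + recon k T v' := by
  obtain ⟨p, hp, hpe, hpot⟩ := hT.recon_spec hd hv
  obtain ⟨p', hp', hpe', hpot'⟩ := hT.recon_spec hd hv'
  obtain ⟨q, hq, hqe, hqot⟩ := hT.recon_spec hd (hv.add hv')
  have h := hv.isData hT hd
  have h' := hv'.isData hT hd
  have key : ∀ i, q i = fun x => p i x + p' i x := by
    intro i
    refine IsPot.unique hT (hq i) ((hp i).add (hp' i)) (hqot i) ⟨fun w hw => ?_, ?_⟩
    · have e1 := potRHS_add (h.elem i) (h'.elem i) (fun F hF => h.face F hF i)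
        (fun F hF => h'.face F hF i) hw
      change _ = potRHS T (fun x => v.1 T i x + v'.1 T i x) (fun F x => v.2 F i x + v'.2 F i x) w
      rw [e1, ← (hpot i).1 w hw, ← (hpot' i).1 w hw, ← sum_add_distrib]
      refine sum_congr rfl fun j _ => ?_
      rw [intT, intT, intT, ← integral_add (integrableOn_pderiv_mul (hp i) hw j)
        (integrableOn_pderiv_mul (hp' i) hw j)]
      congr 1; ext x
      rw [pderiv_add (hp i).differentiable (hp' i).differentiable]; ring
    · rw [reconMean_add hT hd hv hv', ← (hpot i).2, ← (hpot' i).2, intT,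
        integral_add (integrableOn_hull (hp i).continuous.continuousOn)
        (integrableOn_hull (hp' i).continuous.continuousOn)]
      rfl
  rw [hqe, hpe, hpe']
  ext i x
  by_cases hx : x ∈ hull T <;> simp [hx, key]

/-! ### Linearity of the local operators and coercivity of the diffusion form -/

theorem IsData.add {v v' : Fin d → Pt d → ℝ} {g g' : Finset (Pt d) → Fin d → Pt d → ℝ}
    (h : IsData T v g) (h' : IsData T v' g') :
    IsData T (fun i x => v i x + v' i x) (fun F i x => g F i x + g' F i x) :=
  ⟨fun i => (h.elem i).add (h'.elem i), fun F hF i => (h.face F hF i).add (h'.face F hF i)⟩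

theorem IsSimplex.rtnInterp_congr (hT : IsSimplex T) (hd : 0 < d) {v : Fin d → Pt d → ℝ}
    {g : Finset (Pt d) → Fin d → Pt d → ℝ} (h : IsData T v g) {R : Fin d → Pt d → ℝ}
    (hR : RTField d k R) (hm : HasMoments k T R v g) :
    rtnInterp (k + 1) T v g = fun i => (hull T).indicator (R i) := by
  obtain ⟨R', hR', hm', he⟩ := hT.rtnInterp_spec (k := k) hd h
  rw [he]
  ext i x
  by_cases hx : x ∈ hull T
  · simp [hx, hm'.unique hT hd hR' hR hm i x hx]
  · simp [hx]

theorem IsSimplex.rtnInterp_add (hT : IsSimplex T) (hd : 0 < d) {v v' : Fin d → Pt d → ℝ}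
    {g g' : Finset (Pt d) → Fin d → Pt d → ℝ} (h : IsData T v g) (h' : IsData T v' g') :
    rtnInterp (k + 1) T (fun i x => v i x + v' i x) (fun F i x => g F i x + g' F i x) =
      rtnInterp (k + 1) T v g + rtnInterp (k + 1) T v' g' := by
  obtain ⟨R, hR, hm, he⟩ := hT.rtnInterp_spec (k := k) hd h
  obtain ⟨R', hR', hm', he'⟩ := hT.rtnInterp_spec (k := k) hd h'
  rw [hT.rtnInterp_congr hd (h.add h') (hR.add hR')
    ⟨fun i z hz => ?_, fun F hF z hz => ?_⟩, he, he']
  · ext i x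
    by_cases hx : x ∈ hull T <;> simp [hx]
  · have hzc := (IsPoly.of_pred hz).continuous.continuousOn (s := hull T)
    exact (integral_add_mul (integrableOn_hull (hR.continuous i).continuousOn)
      (integrableOn_hull (hR'.continuous i).continuousOn) hzc).trans
      ((congrArg₂ (· + ·) (hm.elem i z hz) (hm'.elem i z hz)).trans
        (integral_add_mul (h.elem i) (h'.elem i) hzc).symm)
  · have hzc := hz.continuous.continuousOn (s := hull F)
    have hi := fun {R} (hR : RTField d k R) => (hT.isDefinite_face hd hF).integrableOn
      (continuous_finsetSum Finset.univ fun i _ => (hR.continuous i).fun_mul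
        (continuous_const (y := normal T F i))).continuousOn
    simp_rw [add_mul, sum_add_distrib]
    exact (integral_add_mul (hi hR) (hi hR') hzc).trans
      ((congrArg₂ (· + ·) (hm.face F hF z hz) (hm'.face F hF z hz)).trans
        (integral_add_mul (h.normal hF) (h'.normal hF) hzc).symm)

theorem IsDefinite.projF_add (hF : IsDefinite μHE[d - 1] F) (l : ℤ)
    {q' : Pt d → ℝ} (hq : IntegrableOn q (hull F) μHE[d - 1])
    (hq' : IntegrableOn q' (hull F) μHE[d - 1]) :
    projF l F (fun x => q x + q' x) = projF l F q + projF l F q' := by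
  obtain ⟨h1, h2⟩ := hF.projF_spec l hq
  obtain ⟨h1', h2'⟩ := hF.projF_spec l hq'
  refine (hF.eq_projF (hq.add hq') (Submodule.add_mem _ h1 h1') fun s hs => ?_).symm
  have hc := @continuousOn_of_mem_Poly
  exact (integral_add_mul (hF.integrableOn (hc h1)) (hF.integrableOn (hc h1')) (hc hs)).trans
    ((congrArg₂ (· + ·) (h2 s hs) (h2' s hs)).trans (integral_add_mul hq hq' (hc hs)).symm)

theorem IsSimplex.recon_isData (hT : IsSimplex T) (hd : 0 < d)
    (hv : IsLocal k T v) : IsData T (recon k T v) (fun _ => recon k T v) := by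
  obtain ⟨p, hp, hpe, -⟩ := hT.recon_spec hd hv
  rw [hpe]
  have hc : ∀ i, ContinuousOn ((hull T).indicator (p i)) (hull T) := fun i =>
    (hp i).continuous.continuousOn.congr fun x hx => by simp [hx]
  exact ⟨fun i => integrableOn_hull (hc i), fun F hF i =>
    (hT.isDefinite_face hd hF).integrableOn ((hc i).mono (hull_face_subset hF))⟩

theorem IsSimplex.delta_add (hT : IsSimplex T) (hd : 0 < d) {v' : HybVec d}
    (hv : IsLocal k T v) (hv' : IsLocal k T v') :
    delta k T (v + v') = delta k T v + delta k T v' := by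
  have h := hT.recon_isData hd hv
  have h' := hT.recon_isData hd hv'
  refine Prod.ext ?_ ?_
  · funext T'
    simp only [delta, Prod.fst_add, Pi.add_apply]
    split_ifs
    · rw [hT.recon_add hd hv hv']
      have := hT.rtnInterp_add (k := k) hd h h'
      change rtnInterp (k + 1) T (recon k T v + recon k T v')
        (fun _ => recon k T v + recon k T v') = _ at this
      rw [this]; abel
    · simp
  · funext F
    simp only [delta, Prod.snd_add, Pi.add_apply]
    split_ifs with hF
    · rw [hT.recon_add hd hv hv']
      have : ∀ i, projF k F ((recon k T v + recon k T v') i) =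
          projF k F (recon k T v i) + projF k F (recon k T v' i) := fun i =>
        (hT.isDefinite_face hd hF).projF_add k (h.face F hF i) (h'.face F hF i)
      simp_rw [this]
      ext i x
      simp; ring
    · simp

theorem IsSimplex.volume_le (hT : IsSimplex T) :
    volume.real (hull T) ≤ diam T ^ d * volume.real (Metric.closedBall (0 : Pt d) 1) := by
  obtain ⟨a, ha⟩ := hT.nonempty
  have h0 : 0 ≤ diam T := Metric.diam_nonneg
  have h1 : hull T ⊆ Metric.closedBall a (diam T) := fun x hx => by
    rw [Metric.mem_closedBall, dist_eq_norm]
    exact dist_le_diam hx (vertex_mem_hull ha)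
  have h2 := measureReal_mono (μ := volume) h1 (isCompact_closedBall a _).measure_lt_top.ne
  refine h2.trans ?_
  have h3 := Measure.addHaar_closedBall (volume : Measure (Pt d)) a h0
  have h4 := Measure.addHaar_closedBall (volume : Measure (Pt d)) 0 zero_le_one
  rw [measureReal_def, h3, measureReal_def, h4, ENNReal.toReal_mul, ENNReal.toReal_mul,
    finrank_euclideanSpace_fin, ENNReal.toReal_ofReal (by positivity)]
  simp

theorem IsLocal.elem_eq (hv : IsLocal k T v) :
    ∃ R, RTField d k R ∧ v.1 T = fun i => (hull T).indicator (R i) := mem_RTN.1 hv.elem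

theorem sq_add_le_four (a b c e : ℝ) : (a + b + c + e) ^ 2 ≤ 4 *
    (a ^ 2 + b ^ 2 + c ^ 2 + e ^ 2) := by
  nlinarith [sq_nonneg (a - b), sq_nonneg (a - c), sq_nonneg (a - e), sq_nonneg (b - c),
    sq_nonneg (b - e), sq_nonneg (c - e)]

theorem Convex.abs_sub_le_of_pderiv {s : Set (Pt d)} (hs : Convex ℝ s)
    (hp : Differentiable ℝ p) {L : ℝ} (hL : ∀ x ∈ s, ∀ j, |pderiv j p x| ≤ L) {y : Pt d}
    (hx : x ∈ s) (hy : y ∈ s) : |p x - p y| ≤ d * L * ‖x - y‖ := by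
  rw [← norm_eq_abs]
  rcases isEmpty_or_nonempty (Fin d) with h | ⟨⟨j₀⟩⟩
  · rw [show x = y from by ext i; exact h.elim i]; simp
  have hL0 : 0 ≤ L := (abs_nonneg _).trans (hL x hx j₀)
  refine hs.norm_image_sub_le_of_norm_fderiv_le (fun z _ => hp z) (fun z hz => ?_) hy hx
  refine ContinuousLinearMap.opNorm_le_bound _ (by positivity) fun w => ?_
  rw [sum_mul_e, norm_eq_abs]
  refine (abs_sum_le_sum_abs _ _).trans ?_
  have : ∀ i ∈ Finset.univ, |w i * pderiv i p z| ≤ ‖w‖ * L := fun i _ => by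
    rw [abs_mul]
    gcongr
    · exact PiLp.norm_apply_le w i
    · exact hL z hz i
  refine (sum_le_sum this).trans ?_
  simp only [sum_const, card_univ, Fintype.card_fin, nsmul_eq_mul]
  exact le_of_eq (by ring)

theorem IsLocal.continuousOn_pd (hv : IsLocal k T v) (hT : IsSimplex T) (i j : Fin d) :
    ContinuousOn (pd T j (v.1 T i)) (hull T) := by
  obtain ⟨V, hV, hVe⟩ := hv.elem_eq
  refine ((hV.isPoly i).pderiv_mem j).continuous.continuousOn.congr fun x hx => ?_
  rw [hVe, pd_indicator hT (hV.isPoly i).differentiable j hx]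

theorem IsLocal.integrableOn_grad_sq (hv : IsLocal k T v) (hT : IsSimplex T) :
    IntegrableOn (fun x => ∑ i, ∑ j, (pd T j (v.1 T i) x) ^ 2) (hull T) := by
  refine IsSimplex.integrableOn_hull ?_
  exact continuousOn_finsetSum _ fun i _ => continuousOn_finsetSum _ fun j _ =>
    (hv.continuousOn_pd hT i j).pow 2

set_option maxHeartbeats 800000 in
/-- Local coercivity: the reconstruction and the reference stabilization control the discrete
`H¹` seminorm. -/
theorem exists_coercive (d k : ℕ) (hd : 0 < d) (σ : ℝ) (hσ : 0 < σ) : ∃ C, 0 ≤ C ∧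
    ∀ T : Finset (Pt d), IsSimplex T → ∀ b ρ, 0 < ρ → Metric.closedBall b (ρ / 2) ⊆ hull T →
    diam T ≤ σ * ρ → ∀ v : HybVec d, IsLocal k T v →
    intT T (fun x => ∑ i, ∑ j, (pd T j (v.1 T i) x) ^ 2) +
      (diam T)⁻¹ * ∑ F ∈ facesOf T, intF F (fun x => ∑ i, (v.2 F i x - v.1 T i x) ^ 2) ≤
    C * (intT T (fun x => ∑ i, ∑ j, pd T j (recon k T v i) x * pd T j (recon k T v i) x) +
      refStab k T v) := by
  obtain ⟨C₁, hC₁0, hC₁⟩ := exists_sq_bound d (k + 1)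
  obtain ⟨C₂, hC₂0, hC₂⟩ := exists_interp_stab d k hd
  obtain ⟨C₃, hC₃0, hC₃⟩ := exists_pderiv_sq_bound d (k + 1)
  set cb := volume.real (Metric.closedBall (0 : Pt d) 1) with hcb
  have hcb0 : 0 ≤ cb := measureReal_nonneg
  set K₁ := 2 * d ^ 2 * C₂ ^ 2 * σ ^ 4 * d ^ 2 * C₁ with hK₁
  set K₂ := 2 * d ^ 2 * C₃ * σ ^ 2 with hK₂
  set K₃ := 4 * d * d * C₂ ^ 2 * (1 + σ ^ 2) * d ^ 2 * C₁ * σ with hK₃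
  set K₄ := 4 * d * d * C₁ * σ with hK₄
  refine ⟨(K₁ + (d + 1) * K₃) + (K₂ + (d + 1) * K₄) * cb + 4, by positivity,
    fun T hT b ρ hρ hb hhρ v hv => ?_⟩
  obtain ⟨V, hV, hVe⟩ := hv.elem_eq
  obtain ⟨p, hp, hpe, -⟩ := hT.recon_spec hd hv
  have hdata := hT.recon_isData hd hv
  obtain ⟨R, hR, hm, hRe⟩ := hT.rtnInterp_spec (k := k) hd hdata
  have hh := hT.diam_pos hd
  have hτ := hT.volume_pos
  set h := diam T with hhdef
  set τ := volume.real (hull T) with hτdef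
  -- integrals that appear in the estimate
  set g2 := intT T (fun x => ∑ i, ∑ j, pderiv j (p i) x ^ 2) with hg2
  set D : Fin d → Pt d → ℝ := fun i x => R i x - V i x with hD
  have hDp : RTField d k D := hR.sub hV
  set D2 := intT T (fun x => ∑ i, D i x ^ 2) with hD2
  have hg20 : 0 ≤ g2 := integral_nonneg fun x =>
    sum_nonneg fun i _ => sum_nonneg fun j _ => sq_nonneg _
  have hD20 : 0 ≤ D2 := integral_nonneg fun x => sum_nonneg fun i _ => sq_nonneg _
  have hgc : ∀ i j, Continuous fun x => pderiv j (p i) x ^ 2 := fun i j =>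
    ((hp i).pderiv_mem j).continuous.pow 2
  have hDc : ∀ i, Continuous fun x => D i x ^ 2 := fun i => (hDp.continuous i).pow 2
  have hDle : ∀ i, avgT T (fun x => D i x ^ 2) ≤ τ⁻¹ * D2 := by
    intro i
    rw [avg]
    gcongr
    refine setIntegral_mono_on (integrableOn_hull (hDc i).continuousOn)
      (integrableOn_hull (continuous_finsetSum _ fun i _ => hDc i).continuousOn)
      (measurableSet_hull T) fun x _ => ?_
    exact single_le_sum (f := fun i => D i x ^ 2) (fun _ _ => sq_nonneg _) (Finset.mem_univ i)
  have hgle : ∀ i j, avgT T (fun x => pderiv j (p i) x ^ 2) ≤ τ⁻¹ * g2 := by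
    intro i j
    rw [avg]
    gcongr
    refine setIntegral_mono_on (integrableOn_hull (hgc i j).continuousOn)
      (integrableOn_hull (continuous_finsetSum _ fun i _ => continuous_finsetSum _ fun j _ =>
        hgc i j).continuousOn) (measurableSet_hull T) fun x _ => ?_
    refine (single_le_sum (f := fun j => pderiv j (p i) x ^ 2) (fun _ _ => sq_nonneg _)
      (Finset.mem_univ j)).trans ?_
    exact single_le_sum (f := fun i => ∑ j, pderiv j (p i) x ^ 2)
      (fun _ _ => sum_nonneg fun _ _ => sq_nonneg _) (Finset.mem_univ i)
  set L := sqrt (C₁ * (τ⁻¹ * g2)) with hL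
  have hL2 : L ^ 2 = C₁ * (τ⁻¹ * g2) := Real.sq_sqrt (by positivity)
  have hpL : ∀ i, ∀ x ∈ hull T, ∀ j, |pderiv j (p i) x| ≤ L := by
    intro i x hx j
    refine Real.abs_le_sqrt ((hC₁ T hT _ ((hp i).pderiv_mem j) x hx).trans ?_)
    gcongr
    exact hgle i j
  obtain ⟨a, ha⟩ := hT.nonempty
  set m := d * L * h with hmdef
  have hm0 : 0 ≤ m := by positivity
  have hclose : ∀ i, ∀ x ∈ hull T, |p i x - p i a| ≤ m := by
    intro i x hx
    refine (Convex.abs_sub_le_of_pderiv (convex_hull T) (hp i).differentiable (hpL i) hx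
      (vertex_mem_hull ha)).trans ?_
    rw [hmdef]
    gcongr
    exact dist_le_diam hx (vertex_mem_hull ha)
  have hm2 : m ^ 2 = d ^ 2 * C₁ * (τ⁻¹ * g2) * h ^ 2 := by rw [hmdef, mul_pow, mul_pow, hL2]; ring
  obtain ⟨hs1, hs2, hs3⟩ := hC₂ T hT b ρ hρ hb R _ _ hR hdata hm (fun i => p i a) m hm0
    (fun i z hz B hB => by
      have := hT.isDefinite.moments_close (hp i).continuous (hclose i)
        (IsPoly.of_pred hz).continuous hB
      rw [avg_congr (g := fun x => p i x * z x) fun x hx => by simp [hpe, hx]]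
      exact this)
        (fun F hF i z hz B hB => by
      have := (hT.isDefinite_face hd hF).moments_close (hp i).continuous
        (fun x hx => hclose i x (hull_face_subset hF hx)) hz.continuous hB
      rw [avg_congr (g := fun x => p i x * z x) fun x hx => by simp [hpe, hull_face_subset hF hx]]
      exact this)
  have hhρ' : h / ρ ≤ σ := (div_le_iff₀ hρ).2 hhρ
  have hρh : ρ⁻¹ ≤ σ * h⁻¹ := by
    rw [← div_eq_mul_inv, le_div_iff₀ hh, mul_comm, ← div_eq_mul_inv]; exact hhρ'
  -- the volume term
  have A1 : intT T (fun x => ∑ i, ∑ j, (pd T j (v.1 T i) x) ^ 2) ≤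
      K₁ * g2 + K₂ * (h⁻¹ ^ 2 * D2) := by
    have hpt : ∀ i j, ∀ x ∈ hull T, (pd T j (v.1 T i) x) ^ 2 ≤
        2 * (C₂ * σ * ρ⁻¹ * m) ^ 2 + 2 * (C₃ * ρ⁻¹ ^ 2 * (τ⁻¹ * D2)) := by
      intro i j x hx
      rw [hVe, pd_indicator hT (hV.isPoly i).differentiable j hx]
      have e1 : pderiv j (V i) x = pderiv j (R i) x - pderiv j (D i) x := by
        have : pderiv j (D i) x = pderiv j (R i) x - pderiv j (V i) x := by
          simp only [pderiv, hD]
          rw [fderiv_fun_sub ((hR.isPoly i).differentiable x) ((hV.isPoly i).differentiable x)]; rfl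
        rw [this]; ring
      have h1 : pderiv j (R i) x ^ 2 ≤ (C₂ * σ * ρ⁻¹ * m) ^ 2 := by
        rw [← sq_abs]
        have := hs2 i j x hx
        gcongr
        refine this.trans ?_
        gcongr
      have h2 : pderiv j (D i) x ^ 2 ≤ C₃ * ρ⁻¹ ^ 2 * (τ⁻¹ * D2) := by
        refine (hC₃ T hT b ρ hρ hb _ (hDp.isPoly i) x hx j).trans ?_
        gcongr
        exact hDle i
      rw [e1]
      nlinarith [sq_nonneg (pderiv j (R i) x + pderiv j (D i) x)]
    have h1 : intT T (fun x => ∑ i, ∑ j, (pd T j (v.1 T i) x) ^ 2) ≤ τ *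
        (d ^ 2 * (2 * (C₂ * σ * ρ⁻¹ * m) ^ 2 + 2 * (C₃ * ρ⁻¹ ^ 2 * (τ⁻¹ * D2)))) := by
      refine hT.isDefinite.integral_le ?_ fun x hx => ?_
      · exact hv.integrableOn_grad_sq hT
      · refine (sum_le_sum fun i _ => sum_le_sum fun j _ => hpt i j x hx).trans ?_
        simp only [sum_const, card_univ, Fintype.card_fin, nsmul_eq_mul]
        exact le_of_eq (by ring)
    refine h1.trans ?_
    have e1 : τ * (d ^ 2 * (2 * (C₂ * σ * ρ⁻¹ * m) ^ 2 + 2 * (C₃ * ρ⁻¹ ^ 2 * (τ⁻¹ * D2)))) =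
        2 * d ^ 2 * C₂ ^ 2 * σ ^ 2 * d ^ 2 * C₁ * g2 * (h / ρ) ^ 2 +
          2 * d ^ 2 * C₃ * D2 * ρ⁻¹ ^ 2 := by
      rw [mul_pow _ m, hm2]
      field_simp
    rw [e1]
    calc _ ≤ 2 * d ^ 2 * C₂ ^ 2 * σ ^ 2 * d ^ 2 * C₁ * g2 * σ ^ 2 +
          2 * d ^ 2 * C₃ * D2 * (σ * h⁻¹) ^ 2 := by gcongr
      _ = _ := by rw [hK₁, hK₂]; ring
  -- the face terms
  set SF : Finset (Pt d) → ℝ := fun F => intF F (fun x => ∑ i, ((delta k T v).2 F i x) ^ 2) with hSF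
  have A2 : ∀ F ∈ facesOf T, h⁻¹ * intF F (fun x => ∑ i, (v.2 F i x - v.1 T i x) ^ 2) ≤
      4 * (h⁻¹ * SF F) + (K₃ * g2 + K₄ * (h⁻¹ ^ 2 * D2)) := by
    intro F hF
    have hdef := hT.isDefinite_face hd hF
    choose π hπ hπe hπm using fun i => hdef.exists_projF k (hdata.face F hF i)
    have hδ : ∀ i, ∀ x ∈ hull F, (delta k T v).2 F i x = π i x - v.2 F i x := by
      intro i x hx
      simp only [delta, if_pos hF, Pi.sub_apply, hπe, indicator_of_mem hx]
    have hδc : ∀ i, ContinuousOn (fun x => (delta k T v).2 F i x) (hull F) := fun i =>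
      ((hπ i).continuous.continuousOn.sub (hv.continuousOn_face hF i)).congr fun x hx => hδ i x hx
    have hVc : ∀ i, ContinuousOn (v.1 T i) (hull F) := fun i =>
      (hv.continuousOn i).mono (hull_face_subset hF)
    set Q := 4 * d * ((C₂ * m) ^ 2 + (C₂ * σ * m) ^ 2 + C₁ * (τ⁻¹ * D2)) with hQ
    have hpt : ∀ x ∈ hull F, ∑ i, (v.2 F i x - v.1 T i x) ^ 2 ≤
        4 * ∑ i, ((delta k T v).2 F i x) ^ 2 + Q := by
      intro x hx
      have hxT := hull_face_subset hF hx
      have h1 : ∀ i ∈ Finset.univ, (v.2 F i x - v.1 T i x) ^ 2 ≤ 4 * ((delta k T v).2 F i x) ^ 2 +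
          4 * ((C₂ * m) ^ 2 + (C₂ * σ * m) ^ 2 + C₁ * (τ⁻¹ * D2)) := by
        intro i _
        have e1 : v.2 F i x - v.1 T i x = -((delta k T v).2 F i x) + (π i x - p i a) +
            (-(R i x - p i a)) + D i x := by
          rw [hδ i x hx, hVe]
          simp only [hD, indicator_of_mem hxT]; ring
        rw [e1]
        refine (sq_add_le_four _ _ _ _).trans ?_
        have b1 : (π i x - p i a) ^ 2 ≤ (C₂ * m) ^ 2 := by
          rw [← sq_abs]
          have := hs3 F hF i (π i) (hπ i) (hπm i) x hx
          gcongr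
        have b2 : (-(R i x - p i a)) ^ 2 ≤ (C₂ * σ * m) ^ 2 := by
          rw [neg_sq, ← sq_abs]
          have := hs1 i x hxT
          gcongr
          refine this.trans ?_
          gcongr
        have b3 : D i x ^ 2 ≤ C₁ * (τ⁻¹ * D2) := by
          refine (hC₁ T hT _ (hDp.isPoly i) x hxT).trans ?_
          gcongr
          exact hDle i
        rw [neg_sq]
        linarith
      refine (sum_le_sum h1).trans ?_
      rw [sum_add_distrib, ← mul_sum]
      simp only [sum_const, card_univ, Fintype.card_fin, nsmul_eq_mul]
      rw [hQ]
      exact le_of_eq (by ring)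
    have hδi : IntegrableOn (fun x => ∑ i, ((delta k T v).2 F i x) ^ 2) (hull F) μHE[d - 1] :=
      hdef.integrableOn (continuousOn_finsetSum _ fun i _ => (hδc i).pow 2)
    have h1 : intF F (fun x => ∑ i, (v.2 F i x - v.1 T i x) ^ 2) ≤
        4 * SF F + (μHE[d - 1] : Measure (Pt d)).real (hull F) * Q := by
      have hc : IntegrableOn (fun _ => Q) (hull F) μHE[d - 1] := integrableOn_const hdef.1
      have h2 : intF F (fun x => ∑ i, (v.2 F i x - v.1 T i x) ^ 2) ≤
          intF F (fun x => 4 * ∑ i, ((delta k T v).2 F i x) ^ 2 + Q) :=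
        setIntegral_mono_on (hdef.integrableOn (continuousOn_finsetSum _ fun i _ =>
          ((hv.continuousOn_face hF i).sub (hVc i)).pow 2))
          ((hδi.const_mul 4).add hc) (measurableSet_hull F) hpt
      refine h2.trans (le_of_eq ?_)
      rw [intF, integral_add (hδi.const_mul 4) hc, integral_const_mul, setIntegral_const,
        smul_eq_mul]
      rfl
    have hQ0 : 0 ≤ Q := by positivity
    have hF' := hT.face_real_le hd hF hρ hb
    calc h⁻¹ * intF F (fun x => ∑ i, (v.2 F i x - v.1 T i x) ^ 2)
        ≤ h⁻¹ * (4 * SF F + (d * ρ⁻¹ * τ) * Q) := by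
          gcongr
          exact h1.trans (by gcongr)
      _ = 4 * (h⁻¹ * SF F) + (4 * d * d * C₂ ^ 2 * (1 + σ ^ 2) * d ^ 2 * C₁ * g2 * (h / ρ) +
            4 * d * d * C₁ * D2 * h⁻¹ * ρ⁻¹) := by
          rw [hQ, mul_pow _ m, mul_pow _ m, hm2]
          field_simp
      _ ≤ 4 * (h⁻¹ * SF F) + (4 * d * d * C₂ ^ 2 * (1 + σ ^ 2) * d ^ 2 * C₁ * g2 * σ +
            4 * d * d * C₁ * D2 * h⁻¹ * (σ * h⁻¹)) := by gcongr
      _ = _ := by rw [hK₃, hK₄]; ring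
  -- the reference stabilization
  set t1 := ((facesOf T).card * h ^ d / τ) * (h ^ 2)⁻¹ *
    intT T (fun x => ∑ i, ((delta k T v).1 T i x) ^ 2) with ht1
  have hδD : intT T (fun x => ∑ i, ((delta k T v).1 T i x) ^ 2) = D2 := by
    refine intT_congr fun x hx => sum_congr rfl fun i _ => ?_
    simp only [delta, if_true, Pi.sub_apply, hRe, hVe, indicator_of_mem hx, hD]
  have A3 : h⁻¹ ^ 2 * D2 ≤ cb * t1 := by
    have h1 : 1 ≤ cb * ((facesOf T).card * h ^ d / τ) := by
      rw [hT.card_facesOf, ← mul_div_assoc, one_le_div hτ]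
      refine hT.volume_le.trans ?_
      rw [← hcb, ← hhdef]
      push_cast
      have : 0 ≤ d * (h ^ d * cb) := by positivity
      linarith
    calc h⁻¹ ^ 2 * D2 = 1 * (h⁻¹ ^ 2 * D2) := (one_mul _).symm
      _ ≤ (cb * ((facesOf T).card * h ^ d / τ)) * (h⁻¹ ^ 2 * D2) := by gcongr
      _ = cb * t1 := by rw [ht1, hδD, inv_pow]; ring
  have A4 : h⁻¹ * ∑ F ∈ facesOf T, intF F (fun x => ∑ i, (v.2 F i x - v.1 T i x) ^ 2) ≤
      4 * (h⁻¹ * ∑ F ∈ facesOf T, SF F) + (d + 1) * (K₃ * g2 + K₄ * (h⁻¹ ^ 2 * D2)) := by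
    rw [mul_sum]
    refine (sum_le_sum A2).trans (le_of_eq ?_)
    rw [sum_add_distrib, sum_const, hT.card_facesOf, nsmul_eq_mul, ← mul_sum, ← mul_sum]
    push_cast; ring
  have hSF0 : 0 ≤ h⁻¹ * ∑ F ∈ facesOf T, SF F :=
    mul_nonneg (by positivity) (sum_nonneg fun F _ =>
      integral_nonneg fun x => sum_nonneg fun i _ => sq_nonneg _)
  have ht10 : 0 ≤ t1 := by rw [ht1, hδD]; positivity
  have hg2e : intT T (fun x => ∑ i, ∑ j, pd T j (recon k T v i) x * pd T j (recon k T v i) x) =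
      g2 := by
    refine intT_congr fun x hx => sum_congr rfl fun i _ => sum_congr rfl fun j _ => ?_
    rw [hpe, pd_indicator hT (hp i).differentiable j hx, sq]
  have hrs : refStab k T v = t1 + h⁻¹ * ∑ F ∈ facesOf T, SF F := rfl
  rw [hg2e, hrs]
  have ha1 : 0 ≤ K₁ + (d + 1) * K₃ := by positivity
  have ha2 : 0 ≤ K₂ + (d + 1) * K₄ := by positivity
  have ha3 := mul_nonneg ha2 hcb0
  linarith [mul_le_mul_of_nonneg_left A3 ha2, mul_nonneg ha1 ht10, mul_nonneg ha1 hSF0,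
    mul_nonneg ha3 hg20, mul_nonneg ha3 hSF0]

/-! ### Discrete spaces and linearity of the forms -/

variable {g' : Pt d → ℝ}

theorem IsDefinite.integral_eq_add (hY : IsDefinite m Y) (hg : ContinuousOn g (hull Y))
    (hg' : ContinuousOn g' (hull Y)) (h : ∀ x ∈ hull Y, f x = g x + g' x) :
    ∫ x in hull Y, f x ∂m = (∫ x in hull Y, g x ∂m) + ∫ x in hull Y, g' x ∂m := by
  rw [← integral_add (hY.integrableOn hg) (hY.integrableOn hg')]
  exact setIntegral_congr_fun (measurableSet_hull Y) h

theorem integral_eq_smul {c : ℝ} (h : ∀ x ∈ hull Y, f x = c * g x) :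
    ∫ x in hull Y, f x ∂m = c * ∫ x in hull Y, g x ∂m := by
  rw [← integral_const_mul]
  exact setIntegral_congr_fun (measurableSet_hull Y) h

theorem IsSimplex.intT_eq_add (hT : IsSimplex T) (hg : ContinuousOn g (hull T))
    (hg' : ContinuousOn g' (hull T)) (h : ∀ x ∈ hull T, f x = g x + g' x) :
    intT T f = intT T g + intT T g' := hT.isDefinite.integral_eq_add hg hg' h

theorem IsSimplex.intF_eq_add (hT : IsSimplex T) (hd : 0 < d) (hF : F ∈ facesOf T)
    (hg : ContinuousOn g (hull F)) (hg' : ContinuousOn g' (hull F))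
    (h : ∀ x ∈ hull F, f x = g x + g' x) : intF F f = intF F g + intF F g' :=
  (hT.isDefinite_face hd hF).integral_eq_add hg hg' h

theorem IsSimplex.sum_intF_eq_add (hT : IsSimplex T) (hd : 0 < d)
    {f g g' : Finset (Pt d) → Pt d → ℝ} (hg : ∀ F ∈ facesOf T, ContinuousOn (g F) (hull F))
    (hg' : ∀ F ∈ facesOf T, ContinuousOn (g' F) (hull F))
    (h : ∀ F ∈ facesOf T, ∀ x ∈ hull F, f F x = g F x + g' F x) :
    ∑ F ∈ facesOf T, intF F (f F) =
      ∑ F ∈ facesOf T, intF F (g F) + ∑ F ∈ facesOf T, intF F (g' F) := by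
  rw [← sum_add_distrib]
  exact sum_congr rfl fun F hF => hT.intF_eq_add hd hF (hg F hF) (hg' F hF) (h F hF)

theorem sum_intF_eq_smul {f g : Finset (Pt d) → Pt d → ℝ} {c : ℝ}
    (h : ∀ F ∈ facesOf T, ∀ x ∈ hull F, f F x = c * g F x) :
    ∑ F ∈ facesOf T, intF F (f F) = c * ∑ F ∈ facesOf T, intF F (g F) := by
  rw [mul_sum]
  exact sum_congr rfl fun F hF => integral_eq_smul (h F hF)

variable {r r' : Fin d → Pt d → ℝ}

theorem continuousOn_of_mem_RTN (hr : r ∈ RTN ((k : ℤ) + 1) T) (i : Fin d) :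
    ContinuousOn (r i) (hull T) := by
  obtain ⟨R, hR, rfl⟩ := mem_RTN.1 hr
  exact (hR.continuous i).continuousOn.congr fun x hx => by simp [hx]

theorem differentiableOn_of_mem_RTN (hr : r ∈ RTN ((k : ℤ) + 1) T) (i : Fin d) :
    DifferentiableOn ℝ (r i) (hull T) := by
  obtain ⟨R, hR, rfl⟩ := mem_RTN.1 hr
  exact (hR.isPoly i).differentiable.differentiableOn.congr fun x hx => by simp [hx]

theorem continuousOn_pd_of_mem_RTN (hT : IsSimplex T) (hr : r ∈ RTN ((k : ℤ) + 1) T)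
    (i j : Fin d) : ContinuousOn (pd T j (r i)) (hull T) := by
  obtain ⟨R, hR, rfl⟩ := mem_RTN.1 hr
  exact ((hR.isPoly i).pderiv_mem j).continuous.continuousOn.congr fun x hx =>
    pd_indicator hT (hR.isPoly i).differentiable j hx

theorem continuousOn_div_of_mem_RTN (hT : IsSimplex T) (hr : r ∈ RTN ((k : ℤ) + 1) T) :
    ContinuousOn (fun x => ∑ i, pd T i (r i) x) (hull T) :=
  continuousOn_finsetSum _ fun i _ => continuousOn_pd_of_mem_RTN hT hr i i

theorem pd_add (hT : IsSimplex T) (hf : DifferentiableOn ℝ f (hull T))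
    (hg : DifferentiableOn ℝ g (hull T)) (j : Fin d) (hx : x ∈ hull T) :
    pd T j (f + g) x = pd T j f x + pd T j g x := by
  simp only [pd]
  rw [fderivWithin_add (hT.uniqueDiffOn x hx) (hf x hx) (hg x hx)]; rfl

theorem pd_smul (hT : IsSimplex T) (c : ℝ) (hf : DifferentiableOn ℝ f (hull T))
    (j : Fin d) (hx : x ∈ hull T) : pd T j (c • f) x = c * pd T j f x := by
  simp only [pd]
  rw [fderivWithin_const_smul (hT.uniqueDiffOn x hx) (hf x hx)]; rfl

instance PolyVec.finite (l : ℤ) (Y : Finset (Pt d)) : Module.Finite ℝ (PolyVec l Y) :=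
  Module.Finite.iff_fg.2 (Submodule.fg_pi fun _ => Module.Finite.iff_fg.1 inferInstance)

instance RTN.finite (l : ℤ) (Y : Finset (Pt d)) : Module.Finite ℝ (RTN l Y) := by
  unfold RTN; infer_instance

/-- The right-hand side of the definition of the pressure gradient. -/
def pgradRHS (hT : IsSimplex T) (hd : 0 < d) (k : ℕ) {q : HybScal d} (hq : q.1 T ∈ Poly k T)
    (hqF : ∀ F ∈ facesOf T, q.2 F ∈ Poly k F) : RTN ((k : ℤ) + 1) T →ₗ[ℝ] ℝ where
  toFun w := - intT T (fun x => q.1 T x * ∑ i, pd T i (w.1 i) x) +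
    ∑ F ∈ facesOf T, intF F (fun x => q.2 F x * ∑ i, w.1 i x * normal T F i)
  map_add' w w' := by
    have h1 := continuousOn_of_mem_Poly hq
    have h2 : ∀ (w : RTN ((k : ℤ) + 1) T), ∀ F ∈ facesOf T,
        ContinuousOn (fun x => q.2 F x * ∑ i, w.1 i x * normal T F i) (hull F) := fun w F hF =>
      (continuousOn_of_mem_Poly (hqF F hF)).mul (continuousOn_finsetSum _ fun i _ =>
        ((continuousOn_of_mem_RTN w.2 i).mono (hull_face_subset hF)).mul continuousOn_const)
    have e1 : intT T (fun x => q.1 T x * ∑ i, pd T i ((w + w').1 i) x) = _ :=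
      hT.intT_eq_add (h1.mul (continuousOn_div_of_mem_RTN hT w.2))
        (h1.mul (continuousOn_div_of_mem_RTN hT w'.2)) fun x hx => by
          simp only [Pi.mul_apply, ← mul_add, ← sum_add_distrib]
          exact congrArg (_ * ·) (sum_congr rfl fun i _ => pd_add hT
            (differentiableOn_of_mem_RTN w.2 i) (differentiableOn_of_mem_RTN w'.2 i) i hx)
    have e2 : ∑ F ∈ facesOf T, intF F (fun x => q.2 F x * ∑ i, (w + w').1 i x * normal T F i) = _ :=
      hT.sum_intF_eq_add hd (h2 w) (h2 w') fun F hF x hx => by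
        simp only [← mul_add, ← sum_add_distrib, Submodule.coe_add, Pi.add_apply, add_mul]
    rw [e1, e2, neg_add]
    exact add_add_add_comm _ _ _ _
  map_smul' c w := by
    have e1 : intT T (fun x => q.1 T x * ∑ i, pd T i ((c • w).1 i) x) =
        c * intT T (fun x => q.1 T x * ∑ i, pd T i (w.1 i) x) := by
      refine integral_eq_smul fun x hx => ?_
      rw [mul_left_comm, mul_sum _ _ c]
      congr 1
      exact sum_congr rfl fun i _ => pd_smul hT c (differentiableOn_of_mem_RTN w.2 i) i hx
    have e2 : ∑ F ∈ facesOf T, intF F (fun x => q.2 F x * ∑ i, (c • w).1 i x * normal T F i) =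
        c * ∑ F ∈ facesOf T, intF F (fun x => q.2 F x * ∑ i, w.1 i x * normal T F i) := by
      refine sum_intF_eq_smul fun F _ x _ => ?_
      rw [mul_left_comm, mul_sum _ _ c]
      simp only [Submodule.coe_smul, Pi.smul_apply, smul_eq_mul, mul_assoc]
    rw [e1, e2, RingHom.id_apply, smul_eq_mul]; ring

theorem IsSimplex.pgrad_spec (hT : IsSimplex T) (hd : 0 < d) {q : HybScal d}
    (hq : q.1 T ∈ Poly k T) (hqF : ∀ F ∈ facesOf T, q.2 F ∈ Poly k F) {w : Fin d → Pt d → ℝ}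
    (hw : w ∈ RTN ((k : ℤ) + 1) T) : intT T (fun x => ∑ i, w i x * pgrad k T q i x) =
      - intT T (fun x => q.1 T x * ∑ i, pd T i (w i) x) +
      ∑ F ∈ facesOf T, intF F (fun x => q.2 F x * ∑ i, w i x * normal T F i) := by
  have hc : ∀ v w : RTN ((k : ℤ) + 1) T, ContinuousOn (fun x => ∑ i, v.1 i x * w.1 i x) (hull T) :=
    fun v w => continuousOn_finsetSum _ fun i _ =>
      (continuousOn_of_mem_RTN v.2 i).mul (continuousOn_of_mem_RTN w.2 i)
  let B : RTN ((k : ℤ) + 1) T →ₗ[ℝ] RTN ((k : ℤ) + 1) T →ₗ[ℝ] ℝ := LinearMap.mk₂ ℝ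
    (fun v w => intT T (fun x => ∑ i, v.1 i x * w.1 i x))
    (fun v v' w => hT.intT_eq_add (hc v w) (hc v' w) fun x _ => by simp [add_mul, sum_add_distrib])
    (fun c v w => integral_eq_smul fun x _ => by simp [mul_sum, mul_assoc])
    (fun v w w' => hT.intT_eq_add (hc v w) (hc v w') fun x _ => by simp [mul_add, sum_add_distrib])
    (fun c v w => integral_eq_smul fun x _ => by simp [mul_sum, mul_left_comm])
  have hB : ∀ v, B v v = 0 → v = 0 := by
    intro v hv
    obtain ⟨R, -, hr⟩ := mem_RTN.1 v.2
    refine Subtype.ext (funext fun i => funext fun x => ?_)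
    by_cases hx : x ∈ hull T
    · have := hT.eq_zero_of_intT (hc v v)
        (fun x _ => sum_nonneg fun i _ => mul_self_nonneg _) hv x hx
      exact mul_self_eq_zero.1 ((sum_eq_zero_iff_of_nonneg
        fun i _ => mul_self_nonneg _).1 this i (Finset.mem_univ i))
    · simp [hr, hx]
  obtain ⟨G, hG⟩ := exists_riesz B hB (pgradRHS hT hd k hq hqF)
  have := Classical.epsilon_spec (p := fun G => G ∈ RTN ((k : ℤ) + 1) T ∧
    ∀ w ∈ RTN ((k : ℤ) + 1) T, intT T (fun x => ∑ i, G i x * w i x) =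
        - intT T (fun x => q.1 T x * ∑ i, pd T i (w i) x) +
        ∑ F ∈ facesOf T, intF F (fun x => q.2 F x * ∑ i, w i x * normal T F i))
    ⟨G.1, G.2, fun w hw => hG ⟨w, hw⟩⟩
  rw [← this.2 w hw]
  exact intT_congr fun x _ => sum_congr rfl fun i _ => mul_comm _ _

theorem Mesh.mem_elems : T ∈ M.elems ↔ T ∈ M.complex.faces ∧ T.card = d + 1 := by simp [Mesh.elems]

theorem Mesh.mem_faces : F ∈ M.faces ↔ F ∈ M.complex.faces ∧ F.card = d := by simp [Mesh.faces]

theorem Mesh.isSimplex (hT : T ∈ M.elems) : IsSimplex T :=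
  ⟨(Mesh.mem_elems.1 hT).2, M.complex.indep (Mesh.mem_elems.1 hT).1⟩

theorem Mesh.mem_faces_of_facesOf (hd : 0 < d) (hT : T ∈ M.elems) (hF : F ∈ facesOf T) :
    F ∈ M.faces := by
  obtain ⟨h1, h2⟩ := mem_powersetCard.1 hF
  exact Mesh.mem_faces.2 ⟨M.complex.down_closed (Mesh.mem_elems.1 hT).1 h1
    (card_pos.1 (by omega)), h2⟩

theorem MemU.isLocal (hd : 0 < d) (hv : MemU M k v) (hT : T ∈ M.elems) : IsLocal k T v :=
  ⟨hv.elem T hT, fun F hF => hv.face F (Mesh.mem_faces_of_facesOf hd hT hF)⟩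

/-- The space of discrete velocities vanishing on the boundary. -/
def U0 (M : Mesh Ω) (k : ℕ) : Submodule ℝ (HybVec d) where
  carrier := {v | MemU0 M k v}
  zero_mem' := ⟨⟨fun _ _ => Submodule.zero_mem _, fun _ _ => Submodule.zero_mem _,
    fun _ _ => rfl, fun _ _ => rfl⟩, fun _ _ _ => rfl⟩
  add_mem' := fun {v w} hv hw => ⟨⟨fun T hT => Submodule.add_mem _ (hv.1.1 T hT) (hw.1.1 T hT),
    fun T hT => Submodule.add_mem _ (hv.1.2 T hT) (hw.1.2 T hT),
    fun T hT => by simp [hv.1.3 T hT, hw.1.3 T hT], fun T hT => by simp [hv.1.4 T hT, hw.1.4 T hT]⟩,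
    fun F hF h => by simp [hv.2 F hF h, hw.2 F hF h]⟩
  smul_mem' := fun c v hv => ⟨⟨fun T hT => Submodule.smul_mem _ c (hv.1.1 T hT),
    fun T hT => Submodule.smul_mem _ c (hv.1.2 T hT),
    fun T hT => by simp [hv.1.3 T hT], fun T hT => by simp [hv.1.4 T hT]⟩,
    fun F hF h => by simp [hv.2 F hF h]⟩

instance U0.finite : Module.Finite ℝ (U0 M k) := by
  let φ : U0 M k →ₗ[ℝ] ((T : M.elems) → RTN ((k : ℤ) + 1) T.1) ×
    ((F : M.faces) → PolyVec (k : ℤ) F.1) :=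
    { toFun := fun v => (fun T => ⟨v.1.1 T, v.2.1.1 T T.2⟩, fun F => ⟨v.1.2 F, v.2.1.2 F F.2⟩)
      map_add' := fun _ _ => rfl
      map_smul' := fun _ _ => rfl }
  refine Module.Finite.of_injective φ fun v w h => Subtype.ext (Prod.ext ?_ ?_)
  · funext T
    by_cases hT : T ∈ M.elems
    · exact congrArg Subtype.val (congrFun (congrArg Prod.fst h) ⟨T, hT⟩)
    · rw [v.2.1.3 T hT, w.2.1.3 T hT]
  · funext F
    by_cases hF : F ∈ M.faces
    · exact congrArg Subtype.val (congrFun (congrArg Prod.snd h) ⟨F, hF⟩)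
    · rw [v.2.1.4 F hF, w.2.1.4 F hF]

theorem BForm_eq (hd : 0 < d) (hv : MemU M k v) {q : HybScal d} (hq : MemP M k q) :
    BForm M k v q = ∑ T ∈ M.elems, (- intT T (fun x => q.1 T x * ∑ i, pd T i (v.1 T i) x) +
      ∑ F ∈ facesOf T, intF F (fun x => q.2 F x * ∑ i, v.1 T i x * normal T F i)) :=
  sum_congr rfl fun T hT => (Mesh.isSimplex hT).pgrad_spec hd (hq.elem T hT)
    (fun F hF => hq.face F (Mesh.mem_faces_of_facesOf hd hT hF)) (hv.elem T hT)

/-! #### Quadratic forms -/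

/-- Bilinear form that combines, on each element, the `L²` product, the product of the gradients
and the penalty of the face unknowns, with coefficients `α`, `β`, `γ`. -/
def genForm (M : Mesh Ω) (α β γ : Finset (Pt d) → ℝ) (w v : HybVec d) : ℝ :=
  ∑ T ∈ M.elems, (α T * intT T (fun x => ∑ i, w.1 T i x * v.1 T i x) +
    β T * intT T (fun x => ∑ i, ∑ j, pd T j (w.1 T i) x * pd T j (v.1 T i) x) +
    γ T * ∑ F ∈ facesOf T, intF F (fun x => ∑ i, (w.2 F i x - w.1 T i x) * (v.2 F i x - v.1 T i x)))

theorem inner0_eq_genForm (w v : HybVec d) :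
    inner0 M w v = genForm M (fun _ => 1) (fun _ => 0) diam w v := by
  simp [inner0, genForm]

theorem jForm_eq_genForm (α : Finset (Pt d) → ℝ) (w v : HybVec d) :
    jForm M α w v = genForm M (fun _ => 0) (fun _ => 0) α w v := by
  simp [jForm, genForm]

theorem norm1sq_eq_genForm (v : HybVec d) :
    norm1sq M v = genForm M (fun _ => 0) (fun _ => 1) (fun T => (diam T)⁻¹) v v := by
  simp [norm1sq, genForm, sq]

variable {α β γ : Finset (Pt d) → ℝ} {u w : HybVec d}

theorem genForm_comm (w v : HybVec d) : genForm M α β γ w v = genForm M α β γ v w := by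
  simp only [genForm, mul_comm]

theorem IsLocal.continuousOn_jump (hv : IsLocal k T v) (hF : F ∈ facesOf T) (i : Fin d) :
    ContinuousOn (fun x => v.2 F i x - v.1 T i x) (hull F) :=
  (hv.continuousOn_face hF i).sub ((hv.continuousOn i).mono (hull_face_subset hF))

theorem genForm_add (hd : 0 < d) (hu : MemU M k u) (hw : MemU M k w) (hv : MemU M k v) :
    genForm M α β γ (u + w) v = genForm M α β γ u v + genForm M α β γ w v := by
  rw [genForm, genForm, genForm, ← sum_add_distrib]
  refine sum_congr rfl fun T hT => ?_
  have hs := Mesh.isSimplex hT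
  have hu' := hu.isLocal hd hT
  have hw' := hw.isLocal hd hT
  have hv' := hv.isLocal hd hT
  have c1 : ∀ {u}, IsLocal k T u → ContinuousOn (fun x => ∑ i, u.1 T i x * v.1 T i x) (hull T) :=
    fun hu => continuousOn_finsetSum _ fun i _ => (hu.continuousOn i).mul (hv'.continuousOn i)
  have c2 : ∀ {u}, IsLocal k T u → ContinuousOn
      (fun x => ∑ i, ∑ j, pd T j (u.1 T i) x * pd T j (v.1 T i) x) (hull T) :=
    fun hu => continuousOn_finsetSum _ fun i _ => continuousOn_finsetSum _ fun j _ =>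
      (hu.continuousOn_pd hs i j).mul (hv'.continuousOn_pd hs i j)
  have c3 : ∀ {u}, IsLocal k T u → ∀ {F}, F ∈ facesOf T → ContinuousOn
      (fun x => ∑ i, (u.2 F i x - u.1 T i x) * (v.2 F i x - v.1 T i x)) (hull F) :=
    fun hu F hF => continuousOn_finsetSum _ fun i _ =>
      (hu.continuousOn_jump hF i).mul (hv'.continuousOn_jump hF i)
  have key : ∀ {a b e a₁ b₁ e₁ a₂ b₂ e₂ : ℝ}, a = a₁ + a₂ → b = b₁ + b₂ → e = e₁ + e₂ →
      α T * a + β T * b + γ T * e = α T * a₁ + β T * b₁ + γ T * e₁ +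
        (α T * a₂ + β T * b₂ + γ T * e₂) := by
    intros; subst_vars; ring
  refine key (hs.intT_eq_add (c1 hu') (c1 hw') fun x _ => ?_)
    (hs.intT_eq_add (c2 hu') (c2 hw') fun x hx => ?_)
    (hs.sum_intF_eq_add hd (fun F hF => c3 hu' hF) (fun F hF => c3 hw' hF) fun F hF x _ => ?_)
  · simp [add_mul, sum_add_distrib]
  · simp only [← sum_add_distrib]
    refine sum_congr rfl fun i _ => sum_congr rfl fun j _ => ?_
    rw [← add_mul, ← pd_add hs (differentiableOn_of_mem_RTN hu'.elem i)
      (differentiableOn_of_mem_RTN hw'.elem i) j hx]; rfl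
  · rw [← sum_add_distrib]
    refine sum_congr rfl fun i _ => ?_
    simp only [Prod.fst_add, Prod.snd_add, Pi.add_apply]; ring

theorem genForm_smul (hd : 0 < d) (c : ℝ) (hu : MemU M k u) :
    genForm M α β γ (c • u) v = c * genForm M α β γ u v := by
  rw [genForm, genForm, mul_sum]
  refine sum_congr rfl fun T hT => ?_
  have hu' := hu.isLocal hd hT
  have key : ∀ {a b e a₁ b₁ e₁ : ℝ}, a = c * a₁ → b = c * b₁ → e = c * e₁ →
      α T * a + β T * b + γ T * e = c * (α T * a₁ + β T * b₁ + γ T * e₁) := by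
    intros; subst_vars; ring
  refine key (integral_eq_smul fun x hx => by simp [mul_sum, mul_assoc])
    (integral_eq_smul fun x hx => ?_) (sum_intF_eq_smul fun F hF x _ => ?_)
  · simp only [mul_sum, ← mul_assoc]
    refine sum_congr rfl fun i _ => sum_congr rfl fun j _ => ?_
    rw [← pd_smul (Mesh.isSimplex hT) c (differentiableOn_of_mem_RTN hu'.elem i) j hx]; rfl
  · rw [mul_sum]
    refine sum_congr rfl fun i _ => ?_
    simp only [Prod.smul_fst, Prod.smul_snd, Pi.smul_apply, smul_eq_mul]; ring

/-- The form `genForm` as a bilinear map on the discrete space. -/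
def genBilin (M : Mesh Ω) (k : ℕ) (α β γ : Finset (Pt d) → ℝ)
    (hd : 0 < d) : U0 M k →ₗ[ℝ] U0 M k →ₗ[ℝ] ℝ :=
  LinearMap.mk₂ ℝ (fun w v => genForm M α β γ w.1 v.1)
    (fun u w v => genForm_add hd u.2.1 w.2.1 v.2.1)
    (fun c u _ => genForm_smul hd c u.2.1)
    (fun v u w => by
      rw [genForm_comm, genForm_comm v.1 u.1, genForm_comm v.1 w.1]
      exact genForm_add hd u.2.1 w.2.1 v.2.1)
        (fun c v u => by
      rw [genForm_comm, genForm_comm v.1 u.1]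
      exact genForm_smul hd c u.2.1)

theorem genForm_nonneg (hα : ∀ T ∈ M.elems, 0 ≤ α T) (hβ : ∀ T ∈ M.elems, 0 ≤ β T)
    (hγ : ∀ T ∈ M.elems, 0 ≤ γ T) (v : HybVec d) : 0 ≤ genForm M α β γ v v := by
  refine sum_nonneg fun T hT => add_nonneg (add_nonneg ?_ ?_) ?_
  · exact mul_nonneg (hα T hT) (integral_nonneg fun x => sum_nonneg fun i _ => mul_self_nonneg _)
  · exact mul_nonneg (hβ T hT) (integral_nonneg fun x => sum_nonneg fun i _ =>
      sum_nonneg fun j _ => mul_self_nonneg _)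
  · exact mul_nonneg (hγ T hT) (sum_nonneg fun F _ => integral_nonneg fun x =>
      sum_nonneg fun i _ => mul_self_nonneg _)

/-! #### Diffusion and convection -/

theorem aForm_add (hd : 0 < d) (S : Finset (Pt d) → LinearMap.BilinForm ℝ (HybVec d))
    (hu : MemU M k u) (hw : MemU M k w) (hv : MemU M k v) :
    aForm M k S (u + w) v = aForm M k S u v + aForm M k S w v := by
  rw [aForm, aForm, aForm, ← sum_add_distrib]
  refine sum_congr rfl fun T hT => ?_
  have hs := Mesh.isSimplex hT
  have hu' := hu.isLocal hd hT
  have hw' := hw.isLocal hd hT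
  have hmem : ∀ {u}, IsLocal k T u → recon k T u ∈ RTN (((k + 1 : ℕ) : ℤ) + 1) T := fun hu => by
    obtain ⟨p, hp, hpe, -⟩ := hs.recon_spec hd hu
    rw [hpe]
    exact mem_RTN.2 ⟨p, ⟨p, 0, hp, Submodule.zero_mem (PolyFun d (k + 1)), by simp⟩, rfl⟩
  have hpq : ∀ {u}, IsLocal k T u → ContinuousOn (fun x => ∑ i, ∑ j, pd T j (recon k T u i) x *
      pd T j (recon k T v i) x) (hull T) := fun hu =>
    continuousOn_finsetSum _ fun i _ => continuousOn_finsetSum _ fun j _ =>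
      (continuousOn_pd_of_mem_RTN hs (hmem hu) i j).mul
        (continuousOn_pd_of_mem_RTN hs (hmem (hv.isLocal hd hT)) i j)
  rw [hs.delta_add hd hu' hw', map_add, LinearMap.add_apply, hs.recon_add hd hu' hw',
    hs.intT_eq_add (hpq hu') (hpq hw') fun x hx => ?_]
  · ring
  · simp only [← sum_add_distrib]
    refine sum_congr rfl fun i _ => sum_congr rfl fun j _ => ?_
    rw [← add_mul, ← pd_add hs (differentiableOn_of_mem_RTN (hmem hu') i)
      (differentiableOn_of_mem_RTN (hmem hw') i) j hx]; rfl

/-- Coercivity of the diffusion form. -/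
theorem exists_aForm_coercive (d k : ℕ) (hd : 0 < d) (σ : ℝ) (hσ : 0 < σ) (η : ℝ) (hη : 1 ≤ η) :
    ∃ C, 0 < C ∧ ∀ (Ω : Set (Pt d)) (M : Mesh Ω), M.IsRegular σ → ∀ S, IsStabilization M k η S →
    ∀ v, MemU M k v → norm1sq M v ≤ C * aForm M k S v v := by
  obtain ⟨C, hC, h⟩ := exists_coercive d k hd σ hσ
  refine ⟨C * η + 1, by positivity, fun Ω M hM S hS v hv => ?_⟩
  rw [norm1sq, aForm, mul_sum]
  refine sum_le_sum fun T hT => ?_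
  obtain ⟨c, ρ, hρ, hb, hdiam⟩ := hM T hT
  refine (h T (Mesh.isSimplex hT) c ρ hρ hb hdiam v (hv.isLocal hd hT)).trans ?_
  have h1 := (hS T hT v hv).1
  have h2 : refStab k T v ≤ η * S T (delta k T v) (delta k T v) := by
    rwa [inv_mul_le_iff₀ (by linarith)] at h1
  have h0 : 0 ≤ refStab k T v := by
    refine add_nonneg (mul_nonneg ?_ (integral_nonneg fun x => sum_nonneg fun i _ =>
      sq_nonneg _)) (mul_nonneg (inv_nonneg.2 Metric.diam_nonneg) (sum_nonneg fun F _ =>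
        integral_nonneg fun x => sum_nonneg fun i _ => sq_nonneg _))
    have : 0 ≤ diam T := Metric.diam_nonneg
    positivity
  have hg : 0 ≤ intT T (fun x => ∑ i, ∑ j, pd T j (recon k T v i) x * pd T j (recon k T v i) x) :=
    integral_nonneg fun x => sum_nonneg fun i _ => sum_nonneg fun j _ => mul_self_nonneg _
  set g := intT T (fun x => ∑ i, ∑ j, pd T j (recon k T v i) x * pd T j (recon k T v i) x)
  have hS0 : 0 ≤ S T (delta k T v) (delta k T v) := by
    by_contra! hneg
    nlinarith
  have h3 := mul_le_mul_of_nonneg_left h2 hC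
  nlinarith [mul_nonneg (mul_nonneg hC (by linarith : 0 ≤ η - 1)) hg]

theorem IsLocal.continuousOn_conv (hT : IsSimplex T) (hu : IsLocal k T u) (hv : IsLocal k T v)
    (hz : IsLocal k T z) : ContinuousOn
    (fun x => ∑ i, (∑ j, u.1 T j x * pd T j (v.1 T i) x) * z.1 T i x) (hull T) :=
  continuousOn_finsetSum _ fun i _ => (continuousOn_finsetSum _ fun j _ =>
    (hu.continuousOn j).mul (hv.continuousOn_pd hT i j)).mul (hz.continuousOn i)

theorem IsLocal.continuousOn_flux (hu : IsLocal k T u) (hF : F ∈ facesOf T) :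
    ContinuousOn (fun x => ∑ j, u.1 T j x * normal T F j) (hull F) :=
  continuousOn_finsetSum _ fun j _ =>
    ((hu.continuousOn j).mono (hull_face_subset hF)).mul continuousOn_const

theorem IsLocal.continuousOn_conv_face (hu : IsLocal k T u) (hv : IsLocal k T v)
    (hz : IsLocal k T z) (hF : F ∈ facesOf T) : ContinuousOn
    (fun x => (∑ j, u.1 T j x * normal T F j) *
      ∑ i, (v.2 F i x - v.1 T i x) * (z.2 F i x + z.1 T i x)) (hull F) :=
  (hu.continuousOn_flux hF).mul (continuousOn_finsetSum _ fun i _ =>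
    (hv.continuousOn_jump hF i).mul ((hz.continuousOn_face hF i).add
      ((hz.continuousOn i).mono (hull_face_subset hF))))

theorem tForm_add_left (hd : 0 < d) (hu : MemU M k u) (hw : MemU M k w) (hv : MemU M k v)
    (hz : MemU M k z) : tForm M (u + w) v z = tForm M u v z + tForm M w v z := by
  rw [tForm, tForm, tForm, ← sum_add_distrib]
  refine sum_congr rfl fun T hT => ?_
  have hs := Mesh.isSimplex hT
  have hu' := hu.isLocal hd hT
  have hw' := hw.isLocal hd hT
  have hv' := hv.isLocal hd hT
  have hz' := hz.isLocal hd hT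
  rw [hs.intT_eq_add (hu'.continuousOn_conv hs hv' hz') (hw'.continuousOn_conv hs hv' hz')
      fun x _ => by simp [add_mul, sum_add_distrib],
    sum_congr rfl fun F hF => hs.intF_eq_add hd hF (hu'.continuousOn_conv_face hv' hz' hF)
      (hw'.continuousOn_conv_face hv' hz' hF) fun x _ => by
        simp [add_mul, sum_add_distrib], sum_add_distrib]
  ring

theorem tForm_add_mid (hd : 0 < d) (hu : MemU M k u) (hv : MemU M k v) (hw : MemU M k w)
    (hz : MemU M k z) : tForm M u (v + w) z = tForm M u v z + tForm M u w z := by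
  rw [tForm, tForm, tForm, ← sum_add_distrib]
  refine sum_congr rfl fun T hT => ?_
  have hs := Mesh.isSimplex hT
  have hu' := hu.isLocal hd hT
  have hw' := hw.isLocal hd hT
  have hv' := hv.isLocal hd hT
  have hz' := hz.isLocal hd hT
  rw [hs.intT_eq_add (hu'.continuousOn_conv hs hv' hz') (hu'.continuousOn_conv hs hw' hz')
      fun x hx => ?_,
    sum_congr rfl fun F hF => hs.intF_eq_add hd hF (hu'.continuousOn_conv_face hv' hz' hF)
      (hu'.continuousOn_conv_face hw' hz' hF) fun x _ => ?_, sum_add_distrib]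
  · ring
  · rw [← mul_add, ← sum_add_distrib]
    congr 1
    refine sum_congr rfl fun i _ => ?_
    simp only [Prod.fst_add, Prod.snd_add, Pi.add_apply]; ring
  · rw [← sum_add_distrib]
    refine sum_congr rfl fun i _ => ?_
    rw [← add_mul, ← sum_add_distrib]
    congr 1
    refine sum_congr rfl fun j _ => ?_
    rw [← mul_add, ← pd_add hs (differentiableOn_of_mem_RTN hv'.elem i)
      (differentiableOn_of_mem_RTN hw'.elem i) j hx]; rfl

/-! ### Discretely divergence-free fields and antisymmetry of the convective form -/

variable {w : HybVec d}

open Mesh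

theorem pderiv_mul (hf : Differentiable ℝ f) (hg : Differentiable ℝ g) (j : Fin d) (x : Pt d) :
    pderiv j (fun y => f y * g y) x = f x * pderiv j g x + g x * pderiv j f x := by
  simp only [pderiv]
  rw [fderiv_fun_mul (hf x) (hg x)]; rfl

theorem contDiff_one (hf : ContDiff ℝ ∞ f) : ContDiff ℝ 1 f := hf.of_le (by exact_mod_cast le_top)

/-- Integration by parts on a simplex. -/
theorem IsSimplex.intT_div_mul (hT : IsSimplex T) (hd : 0 < d) {V : Fin d → Pt d → ℝ}
    (hV : ∀ i, ContDiff ℝ 1 (V i)) (hg : ContDiff ℝ 1 g) :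
    intT T (fun x => ∑ i, V i x * pderiv i g x) = - intT T (fun x => g x * ∑ i, pderiv i (V i) x) +
      ∑ F ∈ facesOf T, intF F (fun x => g x * ∑ i, V i x * normal T F i) := by
  have h1 := hT.integral_div hd (V := fun i x => g x * V i x) fun i => hg.mul (hV i)
  have hc : ∀ {f : Pt d → ℝ}, ContDiff ℝ 1 f → ∀ i, Continuous (pderiv i f) := fun hf i =>
    (hf.continuous_fderiv one_ne_zero).clm_apply continuous_const
  rw [hT.intT_eq_add (g := fun x => g x * ∑ i, pderiv i (V i) x)
    (g' := fun x => ∑ i, V i x * pderiv i g x)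
    (hg.continuous.mul (continuous_finsetSum _ fun i _ => hc (hV i) i)).continuousOn
    (continuous_finsetSum _ fun i _ => (hV i).continuous.mul (hc hg i)).continuousOn
    fun x _ => ?_] at h1
  · rw [hT.sum_facesOf, ← sub_eq_iff_eq_add', sub_neg_eq_add, add_comm, h1]
    refine sum_congr rfl fun a _ => intF_congr fun x _ => ?_
    rw [mul_sum]
    exact sum_congr rfl fun i _ => mul_assoc _ _ _
  · rw [mul_sum, ← sum_add_distrib]
    refine sum_congr rfl fun i _ => ?_
    exact pderiv_mul (hg.differentiable one_ne_zero) ((hV i).differentiable one_ne_zero) i x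

open Classical in
/-- The sum of the normal components, on the face `F`, of the element components of `w`. -/
def fluxJump (M : Mesh Ω) (w : HybVec d) (F : Finset (Pt d)) (x : Pt d) : ℝ :=
  ∑ T ∈ M.elems, if F ∈ facesOf T then ∑ i, w.1 T i x * normal T F i else 0

/-- Fields with zero divergence in the elements, and whose normal components are continuous across
interior faces and zero on the boundary. -/
structure IsDivFree (M : Mesh Ω) (w : HybVec d) : Prop where
  elem : ∀ T ∈ M.elems, ∀ x ∈ hull T, ∑ i, pd T i (w.1 T i) x = 0
  face : ∀ F ∈ M.faces, ∀ x ∈ hull F, fluxJump M w F x = 0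

open Classical in
theorem sum_facesOf_elems (hd : 0 < d) (f : Finset (Pt d) → Finset (Pt d) → ℝ) :
    ∑ T ∈ M.elems, ∑ F ∈ facesOf T, f T F =
      ∑ F ∈ M.faces, ∑ T ∈ M.elems, if F ∈ facesOf T then f T F else 0 := by
  rw [sum_comm]
  refine sum_congr rfl fun T hT => ?_
  rw [sum_ite_mem, Finset.inter_eq_right.2 fun F hF => mem_faces_of_facesOf hd hT hF]

theorem sum_intF_flux (hd : 0 < d) (hw : MemU M k w) {g : Finset (Pt d) → Pt d → ℝ}
    (hg : ∀ F ∈ M.faces, ContinuousOn (g F) (hull F)) :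
    ∑ T ∈ M.elems, ∑ F ∈ facesOf T, intF F (fun x => g F x * ∑ i, w.1 T i x * normal T F i) =
      ∑ F ∈ M.faces, intF F (fun x => g F x * fluxJump M w F x) := by
  classical
  rw [sum_facesOf_elems hd]
  refine sum_congr rfl fun F hF => ?_
  simp only [fluxJump, mul_sum]
  rw [intF, integral_finsetSum]
  · refine sum_congr rfl fun T _ => ?_
    split_ifs
    · simp only [intF, mul_sum]
    · simp
  · intro T hT
    split_ifs with h
    · exact ((isSimplex hT).isDefinite_face hd h).integrableOn
        ((hg F hF).mul ((hw.isLocal hd hT).continuousOn_flux h))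
    · simp

theorem sum_intF_flux_eq_zero (hd : 0 < d) (hw : MemU M k w) (h : IsDivFree M w)
    {g : Finset (Pt d) → Pt d → ℝ} (hg : ∀ F ∈ M.faces, ContinuousOn (g F) (hull F)) :
    ∑ T ∈ M.elems, ∑ F ∈ facesOf T, intF F
      (fun x => g F x * ∑ i, w.1 T i x * normal T F i) = 0 := by
  rw [sum_intF_flux hd hw hg]
  refine sum_eq_zero fun F hF => ?_
  rw [intF_congr (g := fun _ => 0) fun x hx => by rw [h.face F hF x hx, mul_zero]]
  simp [intF]

theorem MemU.intT_mul_grad (hd : 0 < d) (hw : MemU M k w) (hT : T ∈ M.elems) (hg : ContDiff ℝ 1 g) :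
    intT T (fun x => ∑ i, w.1 T i x * pderiv i g x) =
      - intT T (fun x => g x * ∑ i, pd T i (w.1 T i) x) +
      ∑ F ∈ facesOf T, intF F (fun x => g x * ∑ i, w.1 T i x * normal T F i) := by
  have hs := isSimplex hT
  obtain ⟨R, hR, hRe⟩ := (hw.isLocal hd hT).elem_eq
  have := hs.intT_div_mul hd (fun i => contDiff_one (hR.isPoly i).contDiff) hg
  rw [intT_congr (g := fun x => ∑ i, R i x * pderiv i g x) fun x hx => by simp [hRe, hx], this]
  congr 1
  · congr 1
    exact intT_congr fun x hx => by
      simp only [hRe, pd_indicator hs (hR.isPoly _).differentiable _ hx]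
  · exact sum_congr rfl fun F hF => intF_congr fun x hx => by simp [hRe, hull_face_subset hF hx]

/-- A discrete velocity that is orthogonal to all discrete pressures is divergence free. -/
theorem isDivFree_of_BForm (hd : 0 < d) (hw : MemU M k w)
    (h : ∀ q, MemP0 M k q → BForm M k w q = 0) : IsDivFree M w := by
  classical
  have hD : ∀ T, ∃ D, IsPoly k D ∧ (T ∈ M.elems → ∀ x ∈ hull T, ∑ i, pd T i (w.1 T i) x = D x) := by
    intro T
    by_cases hT : T ∈ M.elems
    · have hs := isSimplex hT
      obtain ⟨R, hR, hRe⟩ := (hw.isLocal hd hT).elem_eq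
      exact ⟨_, hR.div_poly, fun _ x hx => by
        simp only [hRe, pd_indicator hs (hR.isPoly _).differentiable _ hx]⟩
    · exact ⟨_, IsPoly.const k 0, fun h => absurd h hT⟩
  choose D hDp hDe using hD
  have hN : ∀ F, ∃ N, IsPoly k N ∧ ∀ x ∈ hull F, fluxJump M w F x = N x := by
    intro F
    have : ∀ T, ∃ N, IsPoly k N ∧ (T ∈ M.elems → F ∈ facesOf T → ∀ x ∈ hull F,
        ∑ i, w.1 T i x * normal T F i = N x) := by
      intro T
      by_cases hT : T ∈ M.elems ∧ F ∈ facesOf T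
      · have hs := isSimplex hT.1
        obtain ⟨a, ha, rfl⟩ := hs.exists_erase hT.2
        obtain ⟨R, hR, hRe⟩ := (hw.isLocal hd hT.1).elem_eq
        obtain ⟨p, hp, hpe⟩ := hs.exists_normal_poly hd ha hR
        exact ⟨p, hp, fun _ hF x hx => by rw [← hpe x hx]; simp [hRe, hull_face_subset hF hx]⟩
      · exact ⟨_, IsPoly.const k 0, fun h1 h2 => absurd ⟨h1, h2⟩ hT⟩
    choose N hN hNe using this
    refine ⟨fun x => ∑ T ∈ M.elems, (if F ∈ facesOf T then N T else fun _ => 0) x,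
      IsPoly.sum _ fun T _ => ?_, fun x hx => sum_congr rfl fun T hT => ?_⟩
    · split_ifs
      exacts [hN T, IsPoly.const k 0]
    · split_ifs with hF
      exacts [hNe T hT hF x hx, rfl]
  choose N hNp hNe using hN
  have hDi : ∀ T, IntegrableOn (D T) (hull T) := fun T => integrableOn_hull
    (hDp T).continuous.continuousOn
  have hDD : ∀ T, Continuous fun x => D T x * D T x := fun T =>
    (hDp T).continuous.mul (hDp T).continuous
  -- the constant that makes the mean value of the test pressure vanish
  obtain ⟨c, hc⟩ : ∃ c : ℝ, ∑ T ∈ M.elems, (intT T (D T) + volume.real (hull T) * c) = 0 := by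
    refine ⟨-(∑ T ∈ M.elems, intT T (D T)) / ∑ T ∈ M.elems, volume.real (hull T), ?_⟩
    rw [sum_add_distrib, ← sum_mul]
    rcases M.elems.eq_empty_or_nonempty with h0 | h0
    · simp [h0]
    · have : 0 < ∑ T ∈ M.elems, volume.real (hull T) :=
        Finset.sum_pos (fun T hT => (isSimplex hT).volume_pos) h0
      field_simp; ring
  have hqp : ∀ T, IsPoly k fun x => -D T x - c := fun T => (hDp T).neg.sub (IsPoly.const k c)
  have hqF : ∀ F, IsPoly k fun x => N F x - c := fun F => (hNp F).sub (IsPoly.const k c)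
  set q : HybScal d :=
    (fun T => if T ∈ M.elems then (hull T).indicator (fun x => -D T x - c) else 0,
     fun F => if F ∈ M.faces then (hull F).indicator (fun x => N F x - c) else 0) with hq
  have q1 : ∀ T ∈ M.elems, ∀ x ∈ hull T, q.1 T x = -D T x - c := fun T hT x hx => by simp [hq, hT, hx]
  have q2 : ∀ F ∈ M.faces, ∀ x ∈ hull F, q.2 F x = N F x - c := fun F hF x hx => by simp [hq, hF, hx]
  have hqM : MemP M k q := ⟨fun T hT => by
      simp only [hq, if_pos hT]; exact mem_Poly.2 ⟨_, hqp T, rfl⟩,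
    fun F hF => by simp only [hq, if_pos hF]; exact mem_Poly.2 ⟨_, hqF F, rfl⟩,
    fun T hT => by simp [hq, hT], fun F hF => by simp [hq, hF]⟩
  have hq0 : MemP0 M k q := by
    refine ⟨hqM, ?_⟩
    rw [← neg_eq_zero, ← sum_neg_distrib, ← hc]
    refine sum_congr rfl fun T hT => ?_
    rw [intT_congr (q1 T hT), intT, ← integral_neg, (isSimplex hT).isDefinite.integral_eq_add
      (g := D T) (g' := fun _ => c) (hDp T).continuous.continuousOn continuousOn_const
      fun x _ => by ring, setIntegral_const, smul_eq_mul]; rfl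
  have hB := h q hq0
  rw [BForm_eq hd hw hqM, sum_add_distrib, sum_intF_flux hd hw
    fun F hF => continuousOn_of_mem_Poly (hqM.face F hF)] at hB
  -- the constant does not contribute, by the divergence theorem
  have hcD : ∑ T ∈ M.elems, intT T (fun x => c * D T x) =
      ∑ F ∈ M.faces, intF F (fun x => c * N F x) := by
    rw [sum_congr rfl fun F _ => intF_congr (g := fun x => c * fluxJump M w F x)
      fun x hx => by rw [hNe F x hx], ← sum_intF_flux hd hw fun _ _ => continuousOn_const]
    refine sum_congr rfl fun T hT => ?_
    have := hw.intT_mul_grad hd hT (contDiff_const (c := c))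
    simp only [pderiv_const, mul_zero, sum_const_zero] at this
    rw [intT_congr (f := fun x => c * D T x) (g := fun x => c * ∑ i, pd T i (w.1 T i) x)
      fun x hx => by rw [hDe T hT x hx]]
    simp only [intT, intF, integral_zero] at this ⊢
    linarith
  have hFi : ∀ F {g : Pt d → ℝ}, Continuous g →
      IntegrableOn (fun x => g x * N F x) (hull F) μHE[d - 1] := by
    intro F g hg
    by_cases hex : ∃ T ∈ M.elems, F ∈ facesOf T
    · obtain ⟨T, hT, hFT⟩ := hex
      exact ((isSimplex hT).isDefinite_face hd hFT).integrableOn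
        (hg.mul (hNp F).continuous).continuousOn
    · refine (integrableOn_congr_fun (g := fun _ => 0) (fun x hx => ?_) (measurableSet_hull F)).2
        integrableOn_zero
      rw [← hNe F x hx, fluxJump, sum_eq_zero fun T hT => if_neg fun h => hex ⟨T, hT, h⟩, mul_zero]
  have e1 : ∀ T ∈ M.elems, - intT T (fun x => q.1 T x * ∑ i, pd T i (w.1 T i) x) =
      intT T (fun x => D T x * D T x) + intT T (fun x => c * D T x) := by
    intro T hT
    rw [intT, ← integral_neg]
    refine (isSimplex hT).isDefinite.integral_eq_add (hDD T).continuousOn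
      ((hDp T).continuous.const_mul c).continuousOn fun x hx => ?_
    rw [q1 T hT x hx, hDe T hT x hx]; ring
  have e2 : ∀ F ∈ M.faces, intF F (fun x => q.2 F x * fluxJump M w F x) =
      intF F (fun x => N F x * N F x) - intF F (fun x => c * N F x) := by
    intro F hF
    rw [intF, intF, intF, ← integral_sub (hFi F (hNp F).continuous) (hFi F continuous_const)]
    exact setIntegral_congr_fun (measurableSet_hull F) fun x hx => by
      simp only [q2 F hF x hx, hNe F x hx]; ring
  rw [sum_congr rfl e1, sum_congr rfl e2, sum_add_distrib,
    sum_sub_distrib, hcD, add_assoc, add_sub_cancel] at hB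
  have p1 : ∀ T ∈ M.elems, 0 ≤ intT T (fun x => D T x * D T x) := fun T _ =>
    integral_nonneg fun x => mul_self_nonneg _
  have p2 : ∀ F ∈ M.faces, 0 ≤ intF F (fun x => N F x * N F x) := fun T _ =>
    integral_nonneg fun x => mul_self_nonneg _
  obtain ⟨z1, z2⟩ := (add_eq_zero_iff_of_nonneg (sum_nonneg p1) (sum_nonneg p2)).1 hB
  refine ⟨fun T hT x hx => ?_, fun F hF x hx => ?_⟩
  · rw [hDe T hT x hx]
    exact mul_self_eq_zero.1 ((isSimplex hT).eq_zero_of_intT (hDD T).continuousOn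
      (fun _ _ => mul_self_nonneg _) ((sum_eq_zero_iff_of_nonneg p1).1 z1 T hT) x hx)
  · by_cases hex : ∃ T ∈ M.elems, F ∈ facesOf T
    · obtain ⟨T, hT, hFT⟩ := hex
      obtain ⟨a, ha, rfl⟩ := (isSimplex hT).exists_erase hFT
      rw [hNe _ x hx]
      exact mul_self_eq_zero.1 ((isSimplex hT).eq_zero_of_intF hd ha
        ((hNp _).continuous.mul (hNp _).continuous).continuousOn (fun _ _ => mul_self_nonneg _)
        ((sum_eq_zero_iff_of_nonneg p2).1 z2 _ hF) x hx)
    · exact sum_eq_zero fun T hT => if_neg fun h => hex ⟨T, hT, h⟩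

/-- Antisymmetry of the convective form for divergence-free advection. -/
theorem tForm_antisymm (hd : 0 < d) (hw : MemU M k w) (h : IsDivFree M w) (hv : MemU M k v)
    (hz : MemU M k z) : tForm M w v z + tForm M w z v = 0 := by
  rw [tForm, tForm, ← sum_add_distrib]
  have hg : ∀ F ∈ M.faces, ContinuousOn (fun x => ∑ i, v.2 F i x * z.2 F i x) (hull F) := by
    intro F hF
    obtain ⟨P, hP, hPe⟩ := mem_PolyVec.1 (hv.face F hF)
    obtain ⟨Q, hQ, hQe⟩ := mem_PolyVec.1 (hz.face F hF)
    refine ContinuousOn.congr (f := fun x => ∑ i, P i x * Q i x) (continuous_finsetSum _ fun i _ =>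
      (hP i).continuous.mul (hQ i).continuous).continuousOn fun x hx => ?_
    simp [hPe, hQe, hx]
  rw [← sum_intF_flux_eq_zero hd hw h hg]
  refine sum_congr rfl fun T hT => ?_
  have hs := isSimplex hT
  have hw' := hw.isLocal hd hT
  have hv' := hv.isLocal hd hT
  have hz' := hz.isLocal hd hT
  obtain ⟨V, hV, hVe⟩ := hv'.elem_eq
  obtain ⟨Z, hZ, hZe⟩ := hz'.elem_eq
  have hVd := fun i => (hV.isPoly i).differentiable
  have hZd := fun i => (hZ.isPoly i).differentiable
  have hgr := hw.intT_mul_grad hd hT (g := fun x => ∑ i, V i x * Z i x)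
    (ContDiff.sum fun i _ => (contDiff_one (hV.isPoly i).contDiff).mul
      (contDiff_one (hZ.isPoly i).contDiff))
  rw [intT_congr (f := fun x => (∑ i, V i x * Z i x) * ∑ i, pd T i (w.1 T i) x) (g := fun _ => 0)
    fun x hx => by rw [h.elem T hT x hx, mul_zero]] at hgr
  have e1 : intT T (fun x => ∑ j, w.1 T j x * pderiv j (fun x => ∑ i, V i x * Z i x) x) =
      intT T (fun x => ∑ i, (∑ j, w.1 T j x * pd T j (v.1 T i) x) * z.1 T i x) +
      intT T (fun x => ∑ i, (∑ j, w.1 T j x * pd T j (z.1 T i) x) * v.1 T i x) := by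
    refine hs.intT_eq_add (hw'.continuousOn_conv hs hv' hz') (hw'.continuousOn_conv hs hz' hv')
      fun x hx => ?_
    rw [← sum_add_distrib]
    simp only [sum_mul, ← sum_add_distrib]
    rw [sum_comm]
    refine sum_congr rfl fun j _ => ?_
    have : pderiv j (fun x => ∑ i, V i x * Z i x) x =
        ∑ i, (V i x * pderiv j (Z i) x + Z i x * pderiv j (V i) x) := by
      rw [pderiv, fderiv_fun_sum fun i _ => ((hVd i).fun_mul (hZd i)) x, sum_apply]
      exact sum_congr rfl fun i _ => pderiv_mul (hVd i) (hZd i) j x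
    rw [this, mul_sum]
    refine sum_congr rfl fun i _ => ?_
    rw [hVe, hZe, pd_indicator hs (hVd i) j hx, pd_indicator hs (hZd i) j hx]
    simp only [indicator_of_mem hx]; ring
  have e2 : ∀ F ∈ facesOf T, intF F (fun x => (∑ i, v.2 F i x * z.2 F i x) *
        ∑ i, w.1 T i x * normal T F i) -
      intF F (fun x => (∑ i, V i x * Z i x) * ∑ i, w.1 T i x * normal T F i) =
      (1 / 2) * (intF F (fun x => (∑ j, w.1 T j x * normal T F j) *
        ∑ i, (v.2 F i x - v.1 T i x) * (z.2 F i x + z.1 T i x)) +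
      intF F (fun x => (∑ j, w.1 T j x * normal T F j) *
        ∑ i, (z.2 F i x - z.1 T i x) * (v.2 F i x + v.1 T i x))) := by
    intro F hF
    have hdef := hs.isDefinite_face hd hF
    have hVZ : Continuous fun x => ∑ i, V i x * Z i x := continuous_finsetSum _ fun i _ =>
      (hV.isPoly i).continuous.mul (hZ.isPoly i).continuous
    have i1 : IntegrableOn (fun x => (∑ i, v.2 F i x * z.2 F i x) * ∑ i, w.1 T i x * normal T F i)
        (hull F) μHE[d - 1] := hdef.integrableOn ((hg F (mem_faces_of_facesOf hd hT hF)).mul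
      (hw'.continuousOn_flux hF))
    have i2 : IntegrableOn (fun x => (∑ i, V i x * Z i x) * ∑ i, w.1 T i x * normal T F i)
        (hull F) μHE[d - 1] := hdef.integrableOn (hVZ.continuousOn.mul (hw'.continuousOn_flux hF))
    have i3 := hdef.integrableOn (hw'.continuousOn_conv_face hv' hz' hF)
    have i4 := hdef.integrableOn (hw'.continuousOn_conv_face hz' hv' hF)
    rw [intF, intF, intF, intF, ← integral_sub i1 i2, ← integral_add i3 i4, ← integral_const_mul]
    refine setIntegral_congr_fun (measurableSet_hull F) fun x hx => ?_
    have hx' := hull_face_subset hF hx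
    simp only [hVe, hZe, indicator_of_mem hx']
    rw [mul_comm _ (∑ i, _ * _), mul_comm (∑ i, V i x * Z i x), ← mul_sub, ← mul_add, mul_left_comm,
      ← sum_sub_distrib, ← sum_add_distrib, mul_sum _ _ (1 / 2 : ℝ)]
    congr 1
    exact sum_congr rfl fun i _ => by ring
  have e3 := sum_congr rfl e2
  rw [sum_sub_distrib, ← mul_sum, sum_add_distrib] at e3
  have h0 : intT T (fun _ : Pt d => (0 : ℝ)) = 0 := by simp [intT]
  rw [e1, h0] at hgr
  linarith

/-! ### Bound of the convective form by the Lipschitz constant of the transported field -/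

variable {w : HybVec d}

theorem IsDefinite.abs_integral_le (hY : IsDefinite m Y) (hg : ContinuousOn g (hull Y))
    (h : ∀ x ∈ hull Y, |f x| ≤ g x) :
    |∫ x in hull Y, f x ∂m| ≤ ∫ x in hull Y, g x ∂m := by
  rw [← norm_eq_abs]
  exact norm_integral_le_of_norm_le (hY.integrableOn hg)
    (ae_restrict_of_forall_mem (measurableSet_hull Y) h)

theorem sum_abs_mul_sum_abs_le (a b : Fin d → ℝ) :
    (∑ j, |a j|) * ∑ i, |b i| ≤ d / 2 * (∑ j, a j ^ 2 + ∑ i, b i ^ 2) := by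
  have h : ∀ a : Fin d → ℝ, (∑ j, |a j|) ^ 2 ≤ d * ∑ j, a j ^ 2 := fun a => by
    simpa using sq_sum_le_card_mul_sum_sq (s := Finset.univ) (f := fun j => |a j|)
  nlinarith [h a, h b, sq_nonneg ((∑ j, |a j|) - ∑ i, |b i|)]

theorem abs_sum_mul_le {a b : Fin d → ℝ} {L : ℝ} (h : ∀ j, |b j| ≤ L) :
    |∑ j, a j * b j| ≤ L * ∑ j, |a j| := by
  rw [mul_sum]
  refine (abs_sum_le_sum_abs _ _).trans (sum_le_sum fun j _ => ?_)
  rw [abs_mul, mul_comm]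
  exact mul_le_mul_of_nonneg_right (h j) (abs_nonneg _)

theorem coeff_le {A W Z P Q : ℝ} (hA : 0 ≤ A) (hW : 0 ≤ W) (hZ : 0 ≤ Z) (hP : 0 ≤ P)
    (hQ : 0 ≤ Q) : W + Z + (A * W + Q + 4 * (A * Z)) ≤ (3 + 4 * A) * ((W + P) + (Z + Q)) := by
  nlinarith [mul_nonneg hA hW, mul_nonneg hA hZ, mul_nonneg hA hP, mul_nonneg hA hQ]

/-- The gradients of the element components of `v` are bounded by `L`, and the differences between
face and element components by `L` times the diameter. -/
structure LipBound (M : Mesh Ω) (v : HybVec d) (L : ℝ) : Prop where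
  elem : ∀ T ∈ M.elems, ∀ x ∈ hull T, ∀ i j, |pd T j (v.1 T i) x| ≤ L
  face : ∀ T ∈ M.elems, ∀ F ∈ facesOf T, ∀ x ∈ hull F, ∀ i,
    |v.2 F i x - v.1 T i x| ≤ diam T * L

/-- A factor `diam T` gained on the face differences pays for the discrete trace inequalities. -/
theorem exists_tForm_bound (d k : ℕ) (hd : 0 < d) (σ : ℝ) (hσ : 0 < σ) : ∃ C, 0 < C ∧
    ∀ (Ω : Set (Pt d)) (M : Mesh Ω), M.IsRegular σ → ∀ w v z, MemU M k w → MemU M k v →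
    MemU M k z → ∀ L, 0 ≤ L → LipBound M v L →
    |tForm M w v z| ≤ C * L * (inner0 M w w + inner0 M z z) := by
  obtain ⟨C, hC, htr⟩ := exists_trace_bound d (k + 1) hd
  have hd' : (1 : ℝ) ≤ d := by exact_mod_cast hd
  refine ⟨d * (3 + 4 * (d + 1) * (C * σ)), by positivity, fun Ω M hM w v z hw hv hz L hL hb => ?_⟩
  rw [inner0, inner0, ← sum_add_distrib, mul_sum]
  refine (abs_sum_le_sum_abs _ _).trans (sum_le_sum fun T hT => ?_)
  have hs := isSimplex hT
  obtain ⟨c, ρ, hρ, hball, hdiam⟩ := hM T hT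
  have hw' := hw.isLocal hd hT
  have hv' := hv.isLocal hd hT
  have hz' := hz.isLocal hd hT
  have hh : 0 < diam T := hs.diam_pos hd
  have csq : ∀ {u}, IsLocal k T u → ContinuousOn (fun x => ∑ i, u.1 T i x ^ 2) (hull T) :=
    fun hu => continuousOn_finsetSum _ fun i _ => (hu.continuousOn i).pow 2
  set W := intT T (fun x => ∑ i, w.1 T i x ^ 2) with hW
  set Z := intT T (fun x => ∑ i, z.1 T i x ^ 2) with hZ
  have hW0 : 0 ≤ W := integral_nonneg fun x => sum_nonneg fun i _ => sq_nonneg _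
  have hZ0 : 0 ≤ Z := integral_nonneg fun x => sum_nonneg fun i _ => sq_nonneg _
  -- the volume term
  have h1 : |intT T (fun x => ∑ i, (∑ j, w.1 T j x * pd T j (v.1 T i) x) * z.1 T i x)| ≤
      L * d * (W + Z) := by
    refine (hs.isDefinite.abs_integral_le (g := fun x => L * d * (∑ i, w.1 T i x ^ 2 +
      ∑ i, z.1 T i x ^ 2)) (((csq hw').add (csq hz')).const_mul _) fun x hx => ?_).trans ?_
    · have e1 : |∑ i, (∑ j, w.1 T j x * pd T j (v.1 T i) x) * z.1 T i x| ≤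
          (L * ∑ j, |w.1 T j x|) * ∑ i, |z.1 T i x| := by
        simp only [mul_comm _ (z.1 T _ x)]
        exact abs_sum_mul_le fun i => abs_sum_mul_le fun j => hb.elem T hT x hx i j
      have e2 := sum_abs_mul_sum_abs_le (fun j => w.1 T j x) (fun i => z.1 T i x)
      have e3 : 0 ≤ ∑ i, w.1 T i x ^ 2 + ∑ i, z.1 T i x ^ 2 := by positivity
      refine e1.trans ?_
      rw [mul_assoc, mul_assoc]
      refine mul_le_mul_of_nonneg_left (e2.trans ?_) hL
      nlinarith
    · rw [integral_const_mul, integral_add (integrableOn_hull (csq hw'))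
        (integrableOn_hull (csq hz'))]; rfl
  have htrace : ∀ {u}, MemU M k u → ∀ F ∈ facesOf T, diam T * intF F (fun x => ∑ i, u.1 T i x ^ 2) ≤
      C * σ * intT T (fun x => ∑ i, u.1 T i x ^ 2) := by
    intro u hu F hF
    have hu' := hu.isLocal hd hT
    obtain ⟨R, hR, hRe⟩ := hu'.elem_eq
    have i1 : ∀ i, IntegrableOn (fun x => u.1 T i x ^ 2) (hull F) μHE[d - 1] := fun i =>
      (hs.isDefinite_face hd hF).integrableOn
        (((hu'.continuousOn i).mono (hull_face_subset hF)).pow 2)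
    have i2 : ∀ i, IntegrableOn (fun x => u.1 T i x ^ 2) (hull T) := fun i =>
      integrableOn_hull ((hu'.continuousOn i).pow 2)
    rw [intF, integral_finsetSum _ fun i _ => i1 i, intT, integral_finsetSum _ fun i _ => i2 i,
      mul_sum, mul_sum]
    refine sum_le_sum fun i _ => ?_
    have e1 := htr T hs c ρ hρ hball F hF _ (hR.isPoly i)
    have e2 : intF F (fun x => R i x ^ 2) = ∫ x in hull F, u.1 T i x ^ 2 ∂μHE[d - 1] :=
      intF_congr fun x hx => by simp [hRe, hull_face_subset hF hx]
    have e3 : intT T (fun x => R i x ^ 2) = ∫ x in hull T, u.1 T i x ^ 2 :=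
      intT_congr fun x hx => by simp [hRe, hx]
    rw [← e2, ← e3]
    have e4 : 0 ≤ intT T (fun x => R i x ^ 2) := integral_nonneg fun x => sq_nonneg _
    calc _ ≤ diam T * (C * ρ⁻¹ * intT T (fun x => R i x ^ 2)) := by gcongr
      _ = C * (diam T / ρ) * intT T (fun x => R i x ^ 2) := by ring
      _ ≤ _ := by gcongr; exact (div_le_iff₀ hρ).2 hdiam
  -- the face terms
  have h2 : ∀ F ∈ facesOf T, |intF F (fun x => (∑ j, w.1 T j x * normal T F j) *
      ∑ i, (v.2 F i x - v.1 T i x) * (z.2 F i x + z.1 T i x))| ≤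
      L * d * (C * σ * W + diam T * intF F (fun x => ∑ i, (z.2 F i x - z.1 T i x) *
        (z.2 F i x - z.1 T i x)) + 4 * (C * σ * Z)) := by
    intro F hF
    have hdef := hs.isDefinite_face hd hF
    have cw := (csq hw').mono (hull_face_subset hF)
    have cz := (csq hz').mono (hull_face_subset hF)
    have cj : ContinuousOn (fun x => ∑ i, (z.2 F i x - z.1 T i x) * (z.2 F i x - z.1 T i x))
        (hull F) := continuousOn_finsetSum _ fun i _ =>
      (hz'.continuousOn_jump hF i).mul (hz'.continuousOn_jump hF i)
    have hn : ∀ j, |normal T F j| ≤ 1 := by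
      obtain ⟨a, ha, rfl⟩ := hs.exists_erase hF
      intro j
      rw [← hs.norm_normal hd ha, ← norm_eq_abs]
      exact PiLp.norm_apply_le _ j
    refine (hdef.abs_integral_le (g := fun x => L * d * diam T * (∑ i, w.1 T i x ^ 2 +
      (∑ i, (z.2 F i x - z.1 T i x) * (z.2 F i x - z.1 T i x)) + 4 * ∑ i, z.1 T i x ^ 2))
      (((cw.add cj).add (cz.const_mul 4)).const_mul _) fun x hx => ?_).trans ?_
    · have e1 : |∑ j, w.1 T j x * normal T F j| ≤ ∑ j, |w.1 T j x| := by
        simpa using abs_sum_mul_le (a := fun j => w.1 T j x) hn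
      have e2 : |∑ i, (v.2 F i x - v.1 T i x) * (z.2 F i x + z.1 T i x)| ≤
          (diam T * L) * ∑ i, |z.2 F i x + z.1 T i x| := by
        simp only [mul_comm _ (z.2 F _ x + _)]
        exact abs_sum_mul_le fun i => hb.face T hT F hF x hx i
      have e3 := sum_abs_mul_sum_abs_le (fun j => w.1 T j x) (fun i => z.2 F i x + z.1 T i x)
      have e4 : ∑ i, (z.2 F i x + z.1 T i x) ^ 2 ≤ 2 * (∑ i, (z.2 F i x - z.1 T i x) *
          (z.2 F i x - z.1 T i x)) + 2 * (4 * ∑ i, z.1 T i x ^ 2) := by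
        simp only [mul_sum, ← sum_add_distrib]
        exact sum_le_sum fun i _ => by nlinarith [sq_nonneg (z.2 F i x - 3 * z.1 T i x)]
      have e5 : 0 ≤ ∑ i, w.1 T i x ^ 2 := sum_nonneg fun i _ => sq_nonneg _
      rw [abs_mul]
      calc _ ≤ (∑ j, |w.1 T j x|) * ((diam T * L) * ∑ i, |z.2 F i x + z.1 T i x|) := by gcongr
        _ = (diam T * L) * ((∑ j, |w.1 T j x|) * ∑ i, |z.2 F i x + z.1 T i x|) := by ring
        _ ≤ (diam T * L) * (d * (∑ i, w.1 T i x ^ 2 + (∑ i, (z.2 F i x - z.1 T i x) *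
            (z.2 F i x - z.1 T i x)) + 4 * ∑ i, z.1 T i x ^ 2)) := by
          refine mul_le_mul_of_nonneg_left (e3.trans ?_) (by positivity)
          nlinarith
        _ = _ := by ring
    · have i1 := hdef.integrableOn cw
      have i2 := hdef.integrableOn cj
      have i3 := (hdef.integrableOn cz).const_mul 4
      rw [integral_const_mul, integral_add (i1.fun_add i2) i3, integral_add i1 i2, integral_const_mul]
      have := htrace hw F hF
      have := htrace hz F hF
      simp only [intF] at *
      rw [mul_assoc]
      refine mul_le_mul_of_nonneg_left ?_ (by positivity)
      nlinarith
  have h3 := sum_le_sum h2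
  rw [← mul_sum, sum_add_distrib, sum_add_distrib, sum_const,
    sum_const, hs.card_facesOf, ← mul_sum, nsmul_eq_mul, nsmul_eq_mul] at h3
  have h4 := (abs_sum_le_sum_abs _ _).trans h3
  set J : HybVec d → ℝ := fun u => ∑ F ∈ facesOf T, intF F (fun x => ∑ i, (u.2 F i x - u.1 T i x) *
        (u.2 F i x - u.1 T i x)) with hJ
  have hJ0 : ∀ u, 0 ≤ J u := fun u => sum_nonneg fun F _ => integral_nonneg fun x =>
    sum_nonneg fun i _ => mul_self_nonneg _
  have hWe : intT T (fun x => ∑ i, w.1 T i x * w.1 T i x) = W := by simp only [hW, sq]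
  have hZe : intT T (fun x => ∑ i, z.1 T i x * z.1 T i x) = Z := by simp only [hZ, sq]
  rw [hWe, hZe]
  have hJw := hJ0 w
  have hJz := hJ0 z
  change _ ≤ _ * ((W + diam T * J w) + (Z + diam T * J z))
  push_cast at h4
  refine (abs_add_le _ _).trans ((add_le_add h1 (?_ : _ ≤ L * d * ((d + 1) * (C * σ * W) +
    diam T * J z + (d + 1) * (4 * (C * σ * Z))))).trans ?_)
  · rw [abs_mul, abs_of_nonneg (by norm_num : (0 : ℝ) ≤ 1 / 2)]
    refine le_trans ?_ h4
    linarith [abs_nonneg (∑ F ∈ facesOf T, intF F (fun x => (∑ j, w.1 T j x * normal T F j) *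
      ∑ i, (v.2 F i x - v.1 T i x) * (z.2 F i x + z.1 T i x)))]
  · refine le_trans (le_of_eq ?_) ((mul_le_mul_of_nonneg_left (coeff_le
      (by positivity : 0 ≤ (d + 1) * (C * σ)) hW0 hZ0 (by positivity : 0 ≤ diam T * J w)
      (by positivity : 0 ≤ diam T * J z)) (by positivity : 0 ≤ L * d)).trans (le_of_eq ?_)) <;> ring

/-! ### Topology of the mesh -/

theorem volume_hull_eq_zero {s : Finset (Pt d)} (hs : AffineIndependent ℝ ((↑) : s → Pt d))
    (hc : s.card ≠ d + 1) : volume (hull s) = 0 := by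
  refine measure_mono_null (convexHull_subset_affineSpan _) (Measure.addHaar_affineSubspace _ _ ?_)
  have := hs.affineSpan_eq_top_iff_card_eq_finrank_add_one
  rw [Subtype.range_coe_subtype, Fintype.card_coe, finrank_euclideanSpace_fin] at this
  exact fun h => hc (this.1 h)

/-- The elements cover the closure of the domain. -/
theorem Mesh.closure_eq (hΩ : IsOpen Ω) : closure Ω = ⋃ T ∈ M.elems, hull T := by
  have hcl : IsClosed (⋃ T ∈ M.elems, hull T) :=
    isClosed_biUnion_finset fun T _ => (isCompact_hull T).isClosed
  have hsp : ∀ s ∈ M.complex.faces, hull s ⊆ closure Ω := fun s hs =>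
    M.space_eq ▸ M.complex.convexHull_subset_space hs
  refine subset_antisymm (closure_minimal ?_ hcl)
    (iUnion₂_subset fun T hT => hsp T (mem_elems.1 hT).1)
  rw [← sdiff_eq_empty, ← (hΩ.sdiff hcl).measure_eq_zero_iff volume]
  refine measure_mono_null (t := ⋃ s ∈ M.finite.toFinset \ M.elems, hull s) ?_
    ((measure_biUnion_null_iff (countable_toSet _)).2 fun s hs => ?_)
  · rintro x ⟨hx, hx'⟩
    have := M.space_eq.symm ▸ subset_closure hx
    obtain ⟨s, hs, hxs⟩ := M.complex.mem_space_iff.1 this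
    refine mem_iUnion₂.2 ⟨s, Finset.mem_sdiff.2 ⟨by simpa using hs, fun h => hx' ?_⟩, hxs⟩
    exact mem_iUnion₂.2 ⟨s, h, hxs⟩
  · obtain ⟨h1, h2⟩ := Finset.mem_sdiff.1 hs
    have h1 : s ∈ M.complex.faces := by simpa using h1
    exact volume_hull_eq_zero (M.complex.indep h1) fun h => h2 (mem_elems.2 ⟨h1, h⟩)

theorem volume_closure_diff (hΩ : IsConvexPolytopalDomain Ω) :
    (closure Ω : Set (Pt d)) =ᵐ[volume] Ω :=
  closure_ae_eq_of_null_frontier (hΩ.convex.addHaar_frontier volume)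

theorem Mesh.hull_subset (hΩ : IsOpen Ω) (hT : T ∈ M.elems) : hull T ⊆ closure Ω := by
  rw [Mesh.closure_eq (M := M) hΩ]; exact subset_biUnion_of_mem (u := hull) hT

theorem Mesh.sum_intT (hΩ : IsConvexPolytopalDomain Ω) (hf : Integrable f) :
    ∑ T ∈ M.elems, intT T f = ∫ x in Ω, f x := by
  have hU : closure Ω = ⋃ T : M.elems, hull T.1 := by
    rw [Mesh.closure_eq (M := M) hΩ.isOpen, iUnion_subtype]
  have := integral_iUnion_ae (μ := volume) (f := f) (s := fun T : M.elems => hull T.1)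
    (fun T => (measurableSet_hull T.1).nullMeasurableSet) (fun T T' h => ?_) hf.integrableOn
  · rw [← setIntegral_congr_set (volume_closure_diff hΩ), hU, this, tsum_fintype,
      ← sum_coe_sort M.elems]
    rfl
  have h1 := mem_elems.1 T.2
  have h2 := mem_elems.1 T'.2
  classical
  refine measure_mono_null (M.complex.inter_subset_convexHull h1.1 h2.1) ?_
  rw [← Finset.coe_inter]
  refine volume_hull_eq_zero ((M.complex.indep h1.1).mono
    (Finset.coe_subset.2 Finset.inter_subset_left)) fun hc => h (Subtype.ext ?_)
  exact (Finset.eq_of_subset_of_card_le Finset.inter_subset_left (by rw [hc, h1.2])).symm.trans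
    (Finset.eq_of_subset_of_card_le Finset.inter_subset_right (by rw [hc, h2.2]))

/-- A simplex of the mesh that contains a point of the relative interior of `F` contains `F`. -/
theorem Mesh.subset_of_pos (hF : F ∈ M.complex.faces) {s : Finset (Pt d)}
    (hs : s ∈ M.complex.faces) {w : Pt d → ℝ} (hw : ∀ y ∈ F, 0 < w y) (h1 : ∑ y ∈ F, w y = 1)
    (h : ∑ y ∈ F, w y • y ∈ hull s) : F ⊆ s := by
  classical
  intro a ha
  by_contra has
  have hx : ∑ y ∈ F, w y • y ∈ hull F :=
    Finset.mem_convexHull'.2 ⟨w, fun y hy => (hw y hy).le, h1, rfl⟩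
  have := M.complex.inter_subset_convexHull hF hs ⟨hx, h⟩
  rw [← Finset.coe_inter] at this
  obtain ⟨v, -, hv1, hv⟩ := Finset.mem_convexHull'.1 this
  set v' : Pt d → ℝ := fun y => if y ∈ F ∩ s then v y else 0 with hv'
  have e1 : ∑ y ∈ F, v' y = 1 := by
    rw [← hv1, sum_ite_mem, Finset.inter_eq_right.2 Finset.inter_subset_left]
  have e2 : ∑ y ∈ F, v' y • y = ∑ y ∈ F, w y • y := by
    simp only [hv', ite_smul, zero_smul]
    rw [← hv, sum_ite_mem, Finset.inter_eq_right.2 Finset.inter_subset_left]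
  have := affineIndependent_iff.1 (M.complex.indep hF) Finset.univ (fun y => w y - v' y)
    (by rw [sum_sub_distrib, sum_coe_sort F, sum_coe_sort F, h1, e1, sub_self])
    (by simp only [sub_smul]
        rw [sum_sub_distrib, sum_coe_sort F (fun y => w y • y),
          sum_coe_sort F (fun y => v' y • y), e2, sub_self]) ⟨a, ha⟩ (Finset.mem_univ _)
  simp only [hv', Finset.mem_inter, ha, has, and_false, if_false, sub_zero] at this
  exact (hw a ha).ne' this

theorem Mesh.exists_elem (hΩ : IsOpen Ω) (hF : F ∈ M.faces) : ∃ T ∈ M.elems, F ∈ facesOf T := by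
  obtain ⟨h1, h2⟩ := Mesh.mem_faces.1 hF
  have hne : (F.card : ℝ) ≠ 0 := by
    exact_mod_cast (card_pos.2 (M.complex.nonempty_of_mem_faces h1)).ne'
  have hsum : ∑ y ∈ F, ((F.card : ℝ)⁻¹) = 1 := by simp [hne]
  have hpos : ∀ y ∈ F, 0 < (F.card : ℝ)⁻¹ := fun _ _ => inv_pos.2
    (lt_of_le_of_ne (Nat.cast_nonneg _) hne.symm)
  have hx : ∑ y ∈ F, ((F.card : ℝ)⁻¹) • y ∈ closure Ω := M.space_eq ▸
    M.complex.convexHull_subset_space h1 (Finset.mem_convexHull'.2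
      ⟨_, fun y hy => (hpos y hy).le, hsum, rfl⟩)
  rw [Mesh.closure_eq (M := M) hΩ, mem_iUnion₂] at hx
  obtain ⟨T, hT, hxT⟩ := hx
  exact ⟨T, hT, mem_powersetCard.2 ⟨Mesh.subset_of_pos h1 (mem_elems.1 hT).1 hpos hsum hxT, h2⟩⟩

theorem integral_pderiv_eq_zero (h1 : ContDiff ℝ 1 φ) (h2 : HasCompactSupport φ)
    (i : Fin d) : ∫ x, pderiv i φ x = 0 := by
  have hc : Continuous (pderiv i φ) := (h1.continuous_fderiv one_ne_zero).clm_apply continuous_const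
  simpa [pderiv] using integral_mul_fderiv_eq_neg_fderiv_mul_of_integrable (μ := volume)
    (f := fun _ : Pt d => (1 : ℝ)) (g := φ) (v := e i) (by simp)
    (by simpa using! hc.integrable_of_hasCompactSupport (h2.fderiv_apply (𝕜 := ℝ) (e i)))
    (by simpa using h1.continuous.integrable_of_hasCompactSupport h2)
    (fun x _ => differentiableAt_const _) (fun x _ => h1.differentiable one_ne_zero x)

open Classical in
/-- The outer normals of the two elements that share an interior face are opposite. -/
theorem Mesh.sum_normal_eq_zero (hd : 0 < d) (hΩ : IsConvexPolytopalDomain Ω) (hF : F ∈ M.faces)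
    (hFb : ¬ hull F ⊆ frontier Ω) (i : Fin d) :
    ∑ T ∈ M.elems, (if F ∈ facesOf T then normal T F i else 0) = 0 := by
  obtain ⟨h1, h2⟩ := Mesh.mem_faces.1 hF
  obtain ⟨y, hyF, hyb⟩ := not_subset.1 hFb
  have hyΩ : y ∈ Ω := by
    by_contra hy
    exact hyb ⟨M.space_eq ▸ M.complex.convexHull_subset_space h1 hyF,
      by rwa [hΩ.isOpen.interior_eq]⟩
  -- a point of the relative interior of the face, close to `y`
  obtain ⟨w, hw0, hw1, rfl⟩ := Finset.mem_convexHull'.1 hyF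
  obtain ⟨v, hv0, hv1, hvΩ⟩ : ∃ v : Pt d → ℝ, (∀ y ∈ F, 0 < v y) ∧ ∑ y ∈ F, v y = 1 ∧
      ∑ y ∈ F, v y • y ∈ Ω := by
    have hc : Continuous fun t : ℝ => ∑ y ∈ F,
      ((1 - t) * w y + t * (F.card : ℝ)⁻¹) • y := by fun_prop
    have h0 : ∀ᶠ t in 𝓝[>] (0 : ℝ), ∑ y ∈ F, ((1 - t) * w y + t * (F.card : ℝ)⁻¹) • y ∈ Ω :=
      (hc.tendsto 0).mono_left nhdsWithin_le_nhds |>.eventually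
        (hΩ.isOpen.mem_nhds (by simpa using hyΩ))
    obtain ⟨t, ht, ht0, ht1⟩ := (h0.and (Ioo_mem_nhdsGT one_pos)).exists
    have hcard : (0 : ℝ) < F.card := by
      exact_mod_cast card_pos.2 (M.complex.nonempty_of_mem_faces h1)
    refine ⟨_, fun y hy => ?_, ?_, ht⟩
    · have := hw0 y hy
      have : 0 < t * (F.card : ℝ)⁻¹ := by positivity
      nlinarith
    · rw [sum_add_distrib, ← mul_sum, hw1]
      simp
      field_simp; ring
  set x := ∑ y ∈ F, v y • y
  have hxF : x ∈ hull F := Finset.mem_convexHull'.2 ⟨v, fun y hy => (hv0 y hy).le, hv1, rfl⟩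
  -- a bump function near that point, which vanishes on the other faces
  have hU : Ω \ ⋃ F' ∈ M.faces.erase F, hull F' ∈ 𝓝 x := by
    refine (hΩ.isOpen.sdiff (isClosed_biUnion_finset fun F' _ =>
      (isCompact_hull F').isClosed)).mem_nhds ⟨hvΩ, fun h => ?_⟩
    obtain ⟨F', hF', hx⟩ := mem_iUnion₂.1 h
    obtain ⟨hne, hF'⟩ := mem_erase.1 hF'
    have h3 := Mesh.mem_faces.1 hF'
    exact hne (Finset.eq_of_subset_of_card_le (Mesh.subset_of_pos h1 h3.1 hv0 hv1 hx)
      (by rw [h2, h3.2])).symm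
  obtain ⟨φ, hφ1, hφ2, hφ3, hφ4, hφ5⟩ := exists_contDiff_tsupport_subset (n := 1) hU
  have hφc : ContDiff ℝ 1 φ := hφ3
  have hz : ∀ z, z ∉ Ω \ ⋃ F' ∈ M.faces.erase F, hull F' → φ z = 0 := fun z hz =>
    image_eq_zero_of_notMem_tsupport fun h => hz (hφ1 h)
  have hzd : ∀ z, z ∉ Ω → pderiv i φ z = 0 := fun z hz => by
    rw [pderiv, image_eq_zero_of_notMem_tsupport fun h => hz (hφ1 (tsupport_fderiv_subset ℝ h)).1]
    rfl
  have hint : Integrable (pderiv i φ) :=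
    ((hφc.continuous_fderiv one_ne_zero).clm_apply continuous_const).integrable_of_hasCompactSupport
      (hφ2.fderiv_apply (𝕜 := ℝ) (e i))
  have hsum := Mesh.sum_intT (M := M) hΩ hint
  rw [setIntegral_eq_integral_of_forall_compl_eq_zero fun z hz => hzd z hz,
    integral_pderiv_eq_zero hφc hφ2 i] at hsum
  have e1 : ∀ T ∈ M.elems, intT T (pderiv i φ) = ∑ F' ∈ facesOf T, normal T F' i * intF F' φ := by
    intro T hT
    have hs := isSimplex hT
    rw [hs.sum_facesOf, ← sum_congr rfl fun a _ => by rw [← inner_e]]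
    exact hs.integral_fderiv hd (e i) hφc
  rw [sum_congr rfl e1, sum_facesOf_elems hd, sum_eq_single F] at hsum
  · simp only [← ite_zero_mul, ← sum_mul] at hsum
    refine (mul_eq_zero.1 hsum).resolve_right fun h0 => ?_
    obtain ⟨T, hT, hFT⟩ := exists_elem hΩ.isOpen hF
    obtain ⟨a, ha, rfl⟩ := (isSimplex hT).exists_erase hFT
    have := (isSimplex hT).eq_zero_of_intF hd ha hφc.continuous.continuousOn
      (fun z _ => (hφ4 ⟨z, rfl⟩).1) h0 x hxF
    exact one_ne_zero (hφ5.symm.trans this)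
  · intro F' hF' hne
    have : intF F' φ = 0 := by
      rw [intF_congr (g := fun _ => 0) fun z hz' => hz z fun h => h.2
        (mem_iUnion₂.2 ⟨F', mem_erase.2 ⟨hne, hF'⟩, hz'⟩)]
      simp [intF]
    simp [this]
  · exact fun h => absurd hF h

/-! ### Traces of functions in `H¹₀` -/

variable {w : H1 Ω}

theorem finite_restrict (hΩ : IsConvexPolytopalDomain Ω) : IsFiniteMeasure (volume.restrict Ω) :=
  ⟨by simpa using hΩ.bounded.measure_lt_top⟩

theorem memLp_of_continuous {Y : Set (Pt d)} (hm : m Y ≠ ⊤)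
    (hY : Bornology.IsBounded Y) (hY' : MeasurableSet Y) (hs : Continuous s) :
    MemLp s 2 (m.restrict Y) := by
  have : IsFiniteMeasure (m.restrict Y) := ⟨by simpa using hm.lt_top⟩
  obtain ⟨B, hB⟩ := hY.isCompact_closure.exists_bound_of_continuousOn hs.continuousOn
  exact MemLp.of_bound hs.aestronglyMeasurable B
    (ae_restrict_of_forall_mem hY' fun x hx => hB x (subset_closure hx))

theorem exists_clm_integral (o : Option (Fin d)) (hs : MemLp s 2 (volume.restrict Ω)) :
    ∃ m : H1 Ω →L[ℝ] ℝ, ∀ w, m w = ∫ x in Ω, w.1 o x * s x := by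
  refine ⟨(innerSL ℝ hs.toLp).comp ((PiLp.proj 2 _ o).comp (H1 Ω).subtypeL), fun w => ?_⟩
  change inner ℝ hs.toLp (w.1 o) = _
  rw [L2.inner_def]
  refine integral_congr_ae ?_
  filter_upwards [hs.coeFn_toLp] with x hx
  rw [hx]
  rfl

theorem Mesh.hull_ae_le (hΩ : IsConvexPolytopalDomain Ω) (hT : T ∈ M.elems) : hull T ≤ᵐ[volume] Ω :=
  (Mesh.hull_subset (M := M) hΩ.isOpen hT).eventuallyLE.trans (volume_closure_diff hΩ).le

theorem Mesh.restrict_le (hΩ : IsConvexPolytopalDomain Ω) (hT : T ∈ M.elems) :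
    volume.restrict (hull T) ≤ volume.restrict Ω :=
  Measure.restrict_mono_ae (Mesh.hull_ae_le hΩ hT)

theorem Mesh.integral_indicator (hΩ : IsConvexPolytopalDomain Ω) (hT : T ∈ M.elems)
    (f : Pt d → ℝ) : ∫ x in Ω, (hull T).indicator f x = intT T f := by
  rw [setIntegral_indicator (measurableSet_hull T)]
  exact setIntegral_congr_set (Filter.EventuallyEq.symm (by
    filter_upwards [Mesh.hull_ae_le hΩ hT] with x hx
    exact propext ⟨fun h => ⟨hx h, h⟩, fun h => h.2⟩))

theorem exists_clm_intT (hΩ : IsConvexPolytopalDomain Ω) (hT : T ∈ M.elems) (o : Option (Fin d))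
    (hs : Continuous s) : ∃ m : H1 Ω →L[ℝ] ℝ, ∀ w, m w = intT T (fun x => w.1 o x * s x) := by
  have h := (memLp_of_continuous (m := volume) hΩ.bounded.measure_lt_top.ne hΩ.bounded
    hΩ.isOpen.measurableSet hs).indicator (measurableSet_hull T)
  obtain ⟨m, hm⟩ := exists_clm_integral o h
  refine ⟨m, fun w => ?_⟩
  simp only [hm, ← indicator_mul_right (hull T) (fun x => w.1 o x)]
  exact Mesh.integral_indicator hΩ hT _

/-- `v ∈ H¹(Ω)` is the class of the test function `φ`. -/
def IsClassOf (v : H1 Ω) (φ : Pt d → ℝ) : Prop :=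
  IsTest Ω φ ∧ val v =ᵐ[volume.restrict Ω] φ ∧ ∀ j, grad v j =ᵐ[volume.restrict Ω] pderiv j φ

theorem IsH10.clm_eq_zero (m : H1 Ω →L[ℝ] ℝ) (h : ∀ v φ, IsClassOf v φ → m v = 0)
    (hw : IsH10 w) : m w = 0 :=
  closure_minimal (s := {v : H1 Ω | ∃ φ : Pt d → ℝ, IsTest Ω φ ∧
    val v =ᵐ[volume.restrict Ω] φ ∧ ∀ j, grad v j =ᵐ[volume.restrict Ω] pderiv j φ})
      (fun v ⟨φ, hφ⟩ => h v φ hφ) (isClosed_eq m.continuous continuous_const) hw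

/-- The integral of `f s` over the face opposite to `a`, for a function `f` with gradient `g`,
written as an integral over `T`. -/
def IsSimplex.faceVal (hT : IsSimplex T) (a : Pt d) (s f : Pt d → ℝ) (g : Fin d → Pt d → ℝ) : ℝ :=
  ‖hT.grad a‖ * (intT T (fun x => f x * (d * s x + fderiv ℝ s x (x - a))) +
    ∑ j, intT T (fun x => g j x * (s x * (x j - a j))))

theorem continuous_coord (j : Fin d) : Continuous fun x : Pt d => x j :=
  (EuclideanSpace.proj (𝕜 := ℝ) j).continuous

theorem continuous_fderiv_sub (hs : ContDiff ℝ 1 s) (a : Pt d) :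
    Continuous fun x => fderiv ℝ s x (x - a) :=
  (hs.continuous_fderiv one_ne_zero).clm_apply (continuous_id.sub continuous_const)

theorem continuous_pderiv (hs : ContDiff ℝ 1 s) (j : Fin d) : Continuous (pderiv j s) :=
  (hs.continuous_fderiv one_ne_zero).clm_apply continuous_const

theorem IsSimplex.intF_eq_faceVal (hT : IsSimplex T) (hd : 0 < d) (ha : a ∈ T)
    (hφ : ContDiff ℝ 1 φ) (hs : ContDiff ℝ 1 s) :
    intF (T.erase a) (fun x => φ x * s x) = hT.faceVal a s φ fun j => pderiv j φ := by
  have hv : volume.real (hull T) ≠ 0 := hT.volume_pos.ne'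
  rw [hT.intF_eq_cone hd ha (hφ.mul hs), cone, faceVal, mul_assoc, mul_inv_cancel_left₀ hv]
  congr 1
  have e : ∀ x, (d : ℝ) * (φ x * s x) + fderiv ℝ (fun x => φ x * s x) x (x - a) =
      φ x * (d * s x + fderiv ℝ s x (x - a)) + ∑ j, pderiv j φ x * (s x * (x j - a j)) := by
    intro x
    rw [fderiv_fun_mul (hφ.differentiable one_ne_zero x) (hs.differentiable one_ne_zero x)]
    simp only [_root_.add_apply, _root_.smul_apply, smul_eq_mul]
    rw [sum_mul_e φ x (x - a), mul_sum, mul_add, ← add_assoc]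
    congr 1
    · ring
    · exact sum_congr rfl fun j _ => by simp only [PiLp.sub_apply]; ring
  have i2 : ∀ j : Fin d, IntegrableOn (fun x => pderiv j φ x * (s x * (x j - a j))) (hull T) :=
    fun j => integrableOn_hull ((continuous_pderiv hφ j).mul
      (hs.continuous.mul ((continuous_coord j).sub continuous_const))).continuousOn
  have i1 : IntegrableOn (fun x => φ x * (d * s x + fderiv ℝ s x (x - a))) (hull T) :=
    integrableOn_hull (hφ.continuous.mul ((continuous_const.mul hs.continuous).add
      (continuous_fderiv_sub hs a))).continuousOn
  simp only [intT, e]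
  rw [integral_add i1 (integrable_finsetSum _ fun j _ => i2 j),
    integral_finsetSum _ fun j _ => i2 j]

theorem exists_clm_faceVal (hΩ : IsConvexPolytopalDomain Ω) (hT : T ∈ M.elems)
    (hs : ContDiff ℝ 1 s) (a : Pt d) : ∃ m : H1 Ω →L[ℝ] ℝ, ∀ w,
      m w = (isSimplex hT).faceVal a s (val w) fun j => grad w j := by
  obtain ⟨m, hm⟩ := exists_clm_intT hΩ hT none ((continuous_const.mul hs.continuous).add
    (continuous_fderiv_sub hs a))
  choose n hn using fun j : Fin d => exists_clm_intT hΩ hT (some j)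
    (hs.continuous.mul ((continuous_coord j).sub (continuous_const (y := a j))))
  refine ⟨‖(isSimplex hT).grad a‖ • (m + ∑ j, n j), fun w => ?_⟩
  simp only [_root_.smul_apply, _root_.add_apply, _root_.sum_apply, hm, hn, smul_eq_mul]
  rfl

theorem intF_classOf (hΩ : IsConvexPolytopalDomain Ω) (hd : 0 < d) (hT : T ∈ M.elems)
    (ha : a ∈ T) (hs : ContDiff ℝ 1 s) {v : H1 Ω} (h : IsClassOf v φ) :
    (isSimplex hT).faceVal a s (val v) (fun j => grad v j) =
      intF (T.erase a) (fun x => φ x * s x) := by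
  rw [(isSimplex hT).intF_eq_faceVal hd ha (contDiff_one h.1.1) hs, faceVal, faceVal]
  have hle := (Measure.absolutelyContinuous_of_le (Mesh.restrict_le hΩ hT)).ae_le
  congr 2
  · refine integral_congr_ae ?_
    filter_upwards [hle h.2.1] with x hx
    rw [hx]
  · refine sum_congr rfl fun j _ => integral_congr_ae ?_
    filter_upwards [hle (h.2.2 j)] with x hx
    rw [hx]

/-- The functions `φ n` and their derivatives converge weakly to `w` on `T`. -/
def WeakConv (T : Finset (Pt d)) (φ : ℕ → Pt d → ℝ) (w : H1 Ω) : Prop :=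
  ∀ s : Pt d → ℝ, Continuous s →
    Tendsto (fun n => intT T (fun x => φ n x * s x)) atTop (𝓝 (intT T (fun x => val w x * s x))) ∧
    ∀ j, Tendsto (fun n => intT T (fun x => pderiv j (φ n) x * s x)) atTop
      (𝓝 (intT T (fun x => grad w j x * s x)))

theorem WeakConv.tendsto_intF {φ : ℕ → Pt d → ℝ} (h : WeakConv T φ w) (hT : IsSimplex T)
    (hd : 0 < d) (ha : a ∈ T) (hφ : ∀ n, ContDiff ℝ ∞ (φ n)) (hs : ContDiff ℝ 1 s) :
    Tendsto (fun n => intF (T.erase a) (fun x => φ n x * s x)) atTop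
      (𝓝 (hT.faceVal a s (val w) fun j => grad w j)) := by
  simp only [fun n => hT.intF_eq_faceVal hd ha (contDiff_one (hφ n)) hs]
  refine (((h _ ?_).1.add (tendsto_finsetSum _ fun j _ => (h _ ?_).2 j)).const_mul _)
  · exact (continuous_const.mul hs.continuous).add (continuous_fderiv_sub hs a)
  · exact hs.continuous.mul ((continuous_coord j).sub continuous_const)

theorem tendsto_integral_mul {f : ℕ → Pt d → ℝ}
    (hf : ∀ n, MemLp (f n) 2 m) (hg : MemLp g 2 m) (hs : MemLp s 2 m)
    (h : Tendsto (fun n => eLpNorm (fun x => f n x - g x) 2 m) atTop (𝓝 0)) :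
    Tendsto (fun n => ∫ x, f n x * s x ∂m) atTop (𝓝 (∫ x, g x * s x ∂m)) := by
  have h1 : Tendsto (fun n => (hf n).toLp) atTop (𝓝 hg.toLp) :=
    (Lp.tendsto_Lp_iff_tendsto_eLpNorm'' _ _ _ _).2 h
  have h2 : ∀ {f : Pt d → ℝ} (hf : MemLp f 2 m), inner ℝ hs.toLp hf.toLp = ∫ x, f x * s x ∂m := by
    intro f hf
    rw [L2.inner_def]
    refine integral_congr_ae ?_
    filter_upwards [hs.coeFn_toLp, hf.coeFn_toLp] with x hx hx'
    rw [hx, hx']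
    rfl
  simp only [← h2 hg, ← h2 (hf _)]
  exact (innerSL ℝ hs.toLp).continuous.continuousAt.tendsto.comp h1

theorem IsTrace.intF_eq (hΩ : IsConvexPolytopalDomain Ω) (hd : 0 < d) (hT : T ∈ M.elems)
    (ha : a ∈ T) (hs : ContDiff ℝ 1 s) (h : IsTrace (T.erase a) w g) :
    intF (T.erase a) (fun x => g x * s x) =
      (isSimplex hT).faceVal a s (val w) fun j => grad w j := by
  obtain ⟨hg, φ, hφ, h0, h1, h2⟩ := h
  have hTs := isSimplex hT
  have hle := Mesh.restrict_le hΩ hT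
  have hc : ∀ {s : Pt d → ℝ}, Continuous s → MemLp s 2 (volume.restrict (hull T)) := fun hs =>
    memLp_of_continuous (isCompact_hull T).measure_lt_top.ne (isCompact_hull T).isBounded
      (measurableSet_hull T) hs
  have hcF : ∀ {s : Pt d → ℝ}, Continuous s →
      MemLp s 2 (μHE[d - 1].restrict (hull (T.erase a))) := fun hs =>
    memLp_of_continuous (hTs.face_lt_top hd ha).ne (isCompact_hull _).isBounded
      (measurableSet_hull _) hs
  have hsq : ∀ {f : ℕ → Pt d → ℝ}, Tendsto (fun n => eLpNorm (f n) 2 (volume.restrict Ω)) atTop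
      (𝓝 0) → Tendsto (fun n => eLpNorm (f n) 2 (volume.restrict (hull T))) atTop (𝓝 0) :=
    fun h => tendsto_of_tendsto_of_tendsto_of_le_of_le tendsto_const_nhds h (fun _ => zero_le)
      fun n => eLpNorm_mono_measure _ hle
  refine tendsto_nhds_unique (tendsto_integral_mul (fun n => hcF (hφ n).continuous) hg
    (hcF hs.continuous) h2) (WeakConv.tendsto_intF (fun s hs => ⟨?_, fun j => ?_⟩) hTs hd ha hφ hs)
  · exact tendsto_integral_mul (fun n => hc (hφ n).continuous)
      ((Lp.memLp _).mono_measure hle) (hc hs) (hsq h0)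
  · exact tendsto_integral_mul (fun n => hc (continuous_pderiv (contDiff_one (hφ n)) j))
      ((Lp.memLp _).mono_measure hle) (hc hs) (hsq (h1 j))

theorem norm_sq_H1 (v : H1 Ω) :
    ‖v‖ ^ 2 = (∫ x in Ω, val v x ^ 2) + ∑ j, ∫ x in Ω, grad v j x ^ 2 := by
  have h : ∀ f : L2 Ω, ‖f‖ ^ 2 = ∫ x in Ω, f x ^ 2 := fun f => by
    rw [← real_inner_self_eq_norm_sq, L2.inner_def]
    exact integral_congr_ae (Eventually.of_forall fun x => (sq (f x)).symm)
  rw [Submodule.coe_norm, PiLp.norm_sq_eq_of_L2, Fintype.sum_option, h]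
  simp only [h]
  rfl

/-- The face integral is that of a divergence over the cone with apex `a`. -/
theorem trace_inequality (hΩ : IsConvexPolytopalDomain Ω) (hd : 0 < d) (hT : T ∈ M.elems)
    (ha : a ∈ T) : ∃ C : ℝ, 0 ≤ C ∧ ∀ v φ, IsClassOf (Ω := Ω) v φ →
      intF (T.erase a) (fun x => φ x ^ 2) ≤ C * ‖v‖ ^ 2 := by
  have hTs := isSimplex hT
  have hD : 0 ≤ diam T := Metric.diam_nonneg
  refine ⟨‖hTs.grad a‖ * (d + d * diam T + diam T), by positivity, fun v φ h => ?_⟩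
  have hφ : ContDiff ℝ 1 φ := contDiff_one h.1.1
  have hv : volume.real (hull T) ≠ 0 := hTs.volume_pos.ne'
  have hφ2 : ContDiff ℝ 1 fun x => φ x ^ 2 := hφ.pow 2
  rw [hTs.intF_eq_cone hd ha hφ2, cone, mul_assoc ‖_‖, mul_inv_cancel_left₀ hv, mul_assoc ‖_‖]
  refine mul_le_mul_of_nonneg_left ?_ (norm_nonneg _)
  set K : ℝ := d + d * diam T + diam T
  have cP : ∀ j, Continuous fun x => pderiv j φ x ^ 2 := fun j => (continuous_pderiv hφ j).pow 2
  have hL : ∀ {s : Pt d → ℝ}, Continuous s → IntegrableOn s Ω := fun hs =>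
    (hs.continuousOn.integrableOn_compact hΩ.bounded.isCompact_closure).mono_set subset_closure
  have cS : Continuous fun x => φ x ^ 2 + ∑ j, pderiv j φ x ^ 2 :=
    (hφ.continuous.pow 2).add (continuous_finsetSum _ fun j _ => cP j)
  have e : ‖v‖ ^ 2 = ∫ x in Ω, (φ x ^ 2 + ∑ j, pderiv j φ x ^ 2) := by
    have i1 : IntegrableOn (fun x => φ x ^ 2) Ω := hL (hφ.continuous.pow 2)
    rw [norm_sq_H1, integral_add i1
      (integrable_finsetSum _ fun j _ => hL (cP j)), integral_finsetSum _ fun j _ => hL (cP j)]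
    congr 1
    · exact integral_congr_ae (by filter_upwards [h.2.1] with x hx; rw [hx])
    · exact sum_congr rfl fun j _ =>
        integral_congr_ae (by filter_upwards [h.2.2 j] with x hx; rw [hx])
  rw [e, ← integral_const_mul]
  have hK : 0 ≤ K := by positivity
  refine le_trans (setIntegral_mono_on (integrableOn_hull ((continuous_const.mul
    hφ2.continuous).add (continuous_fderiv_sub hφ2 a)).continuousOn)
      (integrableOn_hull (continuous_const.mul cS).continuousOn)
        (measurableSet_hull T) fun x hx => ?_)
          (integral_mono_measure (Mesh.restrict_le hΩ hT) (Eventually.of_forall fun x =>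
        mul_nonneg hK (add_nonneg (sq_nonneg _) (sum_nonneg fun j _ => sq_nonneg _)))
      (hL (continuous_const.mul cS)))
  have e1 : fderiv ℝ (fun x => φ x ^ 2) x (x - a) = ∑ j, 2 * φ x *
    ((x j - a j) * pderiv j φ x) := by
    rw [fderiv_fun_pow 2 (hφ.differentiable one_ne_zero x), ← mul_sum]
    rw [_root_.smul_apply, sum_mul_e φ x (x - a)]
    simp
  have e2 : ∀ j, 2 * φ x * ((x j - a j) * pderiv j φ x) ≤
      diam T * φ x ^ 2 + diam T * pderiv j φ x ^ 2 := by
    intro j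
    have h1 : |x j - a j| ≤ diam T := by
      have := (PiLp.norm_apply_le (x - a) j).trans (dist_le_diam hx (vertex_mem_hull ha))
      simpa using this
    have h2 := abs_le.1 h1
    nlinarith [sq_nonneg (φ x - pderiv j φ x), sq_nonneg (φ x + pderiv j φ x)]
  rw [e1]
  refine (add_le_add le_rfl (sum_le_sum fun j _ => e2 j)).trans ?_
  rw [sum_add_distrib, ← mul_sum, sum_const, card_univ, Fintype.card_fin, nsmul_eq_mul]
  have h3 : 0 ≤ ∑ j, pderiv j φ x ^ 2 := sum_nonneg fun j _ => sq_nonneg _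
  change _ ≤ (d + d * diam T + diam T) * (φ x ^ 2 + ∑ j, pderiv j φ x ^ 2)
  rw [← mul_sum]
  nlinarith [mul_nonneg (Nat.cast_nonneg (α := ℝ) d) h3, mul_nonneg hD (sq_nonneg (φ x)),
    mul_nonneg (mul_nonneg (Nat.cast_nonneg (α := ℝ) d) hD) h3]

theorem IsClassOf.sub {v v' : H1 Ω} {φ' : Pt d → ℝ} (h : IsClassOf v φ) (h' : IsClassOf v' φ') :
    IsClassOf (v - v') fun x => φ x - φ' x := by
  refine ⟨⟨h.1.1.sub h'.1.1, h.1.2.1.sub h'.1.2.1, (tsupport_sub _ _).trans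
    (union_subset h.1.2.2 h'.1.2.2)⟩, ?_, fun j => ?_⟩
  · filter_upwards [Lp.coeFn_sub (val v) (val v'), h.2.1, h'.2.1] with x h1 h2 h3
    rw [show val (v - v') = val v - val v' from rfl, h1, Pi.sub_apply, h2, h3]
  · filter_upwards [Lp.coeFn_sub (grad v j) (grad v' j), h.2.2 j, h'.2.2 j] with x h1 h2 h3
    rw [show grad (v - v') j = grad v j - grad v' j from rfl, h1, Pi.sub_apply, h2, h3]
    simp only [pderiv]
    rw [fderiv_fun_sub (h.1.1.differentiable (by simp) x) (h'.1.1.differentiable (by simp) x)]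
    rfl

theorem eLpNorm_sub_tendsto {f : ℕ → Lp ℝ 2 m} {g : Lp ℝ 2 m}
    (h : Tendsto f atTop (𝓝 g)) {φ : ℕ → Pt d → ℝ} (hφ : ∀ n, f n =ᵐ[m] φ n) :
    Tendsto (fun n => eLpNorm (fun x => φ n x - g x) 2 m) atTop (𝓝 0) := by
  refine ((Lp.tendsto_Lp_iff_tendsto_eLpNorm' f g).1 h).congr fun n => eLpNorm_congr_ae ?_
  filter_upwards [hφ n] with x hx
  rw [Pi.sub_apply, hx]

/-- Functions in `H¹₀(Ω)` have a trace on the mesh faces, by the trace inequality. -/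
theorem IsH10.isTrace_trace (hw : IsH10 w) (hΩ : IsConvexPolytopalDomain Ω) (hd : 0 < d)
    (hT : T ∈ M.elems) (ha : a ∈ T) :
    IsTrace (T.erase a) w (trace (T.erase a) w) := by
  refine Classical.epsilon_spec (p := fun g => IsTrace (T.erase a) w g) ?_
  obtain ⟨v, hv, hvw⟩ := mem_closure_iff_seq_limit.1 hw
  choose φ hφ using hv
  change ∀ n, IsClassOf (v n) (φ n) at hφ
  have hTs := isSimplex hT
  set m := (μHE[d - 1] : Measure (Pt d)).restrict (hull (T.erase a))
  have hm : ∀ {s : Pt d → ℝ}, Continuous s → MemLp s 2 m := fun hs =>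
    memLp_of_continuous (hTs.face_lt_top hd ha).ne (isCompact_hull _).isBounded
      (measurableSet_hull _) hs
  obtain ⟨C, hC, hCb⟩ := trace_inequality hΩ hd hT ha
  have hcau : CauchySeq fun n => (hm (hφ n).1.1.continuous).toLp := by
    refine Metric.cauchySeq_iff.2 fun ε hε => ?_
    obtain ⟨N, hN⟩ := Metric.cauchySeq_iff.1 hvw.cauchySeq (ε / (sqrt C + 1)) (by positivity)
    refine ⟨N, fun n hn n' hn' => ?_⟩
    have h1 := hCb _ _ ((hφ n).sub (hφ n'))
    have h2 := hN n hn n' hn'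
    have hc := ((hφ n).1.1.continuous.sub (hφ n').1.1.continuous)
    have h3 : ‖(hm hc).toLp‖ ^ 2 = intF (T.erase a) (fun x => (φ n x - φ n' x) ^ 2) := by
      rw [← real_inner_self_eq_norm_sq, L2.inner_def]
      refine integral_congr_ae ?_
      filter_upwards [(hm hc).coeFn_toLp] with x hx
      rw [hx]
      exact (sq _).symm
    rw [dist_eq_norm] at h2 ⊢
    rw [← MemLp.toLp_sub]
    have h4 : ‖(hm hc).toLp‖ ≤ sqrt C * ‖v n - v n'‖ := by
      refine abs_le_of_sq_le_sq' ?_ (by positivity) |>.2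
      rw [mul_pow, Real.sq_sqrt hC, h3]
      exact h1
    calc _ ≤ sqrt C * ‖v n - v n'‖ := h4
      _ ≤ (sqrt C + 1) * ‖v n - v n'‖ := by nlinarith [norm_nonneg (v n - v n')]
      _ < (sqrt C + 1) * (ε / (sqrt C + 1)) := by gcongr
      _ = ε := by field_simp
  obtain ⟨g, hg⟩ := cauchySeq_tendsto_of_complete hcau
  have hcomp : ∀ o, Tendsto (fun n => (v n).1 o) atTop (𝓝 (w.1 o)) := fun o =>
    (((PiLp.proj (𝕜 := ℝ) 2 (fun _ : Option (Fin d) => L2 Ω) o).comp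
      (H1 Ω).subtypeL).continuous.tendsto w).comp hvw
  exact ⟨g, Lp.memLp g, φ, fun n => (hφ n).1.1, eLpNorm_sub_tendsto (hcomp none) fun n => (hφ n).2.1,
    fun j => eLpNorm_sub_tendsto (hcomp (some j)) fun n => (hφ n).2.2 j,
    eLpNorm_sub_tendsto hg fun n => (hm (hφ n).1.1.continuous).coeFn_toLp⟩

theorem IsH10.intF_trace (hw : IsH10 w) (hΩ : IsConvexPolytopalDomain Ω) (hd : 0 < d)
    (hT : T ∈ M.elems) (ha : a ∈ T) (hs : ContDiff ℝ 1 s) :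
    intF (T.erase a) (fun x => trace (T.erase a) w x * s x) =
      (isSimplex hT).faceVal a s (val w) fun j => grad w j :=
  (hw.isTrace_trace hΩ hd hT ha).intF_eq hΩ hd hT ha hs

theorem IsH10.intF_trace_eq_zero (hw : IsH10 w) (hΩ : IsConvexPolytopalDomain Ω) (hd : 0 < d)
    (hT : T ∈ M.elems) (hF : F ∈ facesOf T) (hFb : hull F ⊆ frontier Ω) (hs : ContDiff ℝ 1 s) :
    intF F (fun x => trace F w x * s x) = 0 := by
  obtain ⟨a, ha, rfl⟩ := (isSimplex hT).exists_erase hF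
  rw [hw.intF_trace hΩ hd hT ha hs]
  obtain ⟨m, hm⟩ := exists_clm_faceVal hΩ hT hs a
  rw [← hm]
  refine hw.clm_eq_zero m fun v φ h => ?_
  rw [hm, intF_classOf hΩ hd hT ha hs h, intF]
  refine (setIntegral_congr_fun (measurableSet_hull _) fun x hx => ?_).trans (integral_zero _ _)
  have : φ x = 0 := image_eq_zero_of_notMem_tsupport fun hx' =>
    (hΩ.isOpen.frontier_eq ▸ hFb hx : x ∈ closure Ω \ Ω).2 (h.1.2.2 hx')
  simp [this]

/-- Integration by parts on an element, for functions in `H¹₀(Ω)`. -/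
theorem IsH10.intT_grad_mul (hw : IsH10 w) (hΩ : IsConvexPolytopalDomain Ω) (hd : 0 < d)
    (hT : T ∈ M.elems) (hs : ContDiff ℝ 1 s) (i : Fin d) :
    intT T (fun x => grad w i x * s x) = - intT T (fun x => val w x * pderiv i s x) +
      ∑ F ∈ facesOf T, normal T F i * intF F (fun x => trace F w x * s x) := by
  have hTs := isSimplex hT
  obtain ⟨m1, hm1⟩ := exists_clm_intT hΩ hT (some i) hs.continuous
  obtain ⟨m2, hm2⟩ := exists_clm_intT hΩ hT none (continuous_pderiv hs i)
  choose m3 hm3 using fun F : facesOf T => hTs.exists_erase F.2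
  choose n hn using fun F : facesOf T => exists_clm_faceVal hΩ hT hs (m3 F)
  have key : ∀ F : facesOf T, intF F.1 (fun x => trace F.1 w x * s x) = n F w := fun F => by
    obtain ⟨ha, he⟩ := hm3 F
    rw [hn, ← hw.intF_trace hΩ hd hT ha hs]
    simp only [← he]
  have h := hw.clm_eq_zero (m1 + m2 - ∑ F : facesOf T, normal T F.1 i • n F) fun v φ h => ?_
  · rw [← sum_coe_sort (facesOf T)]
    simp only [key]
    simp only [_root_.sub_apply, _root_.add_apply, hm1, hm2,
      _root_.sum_apply, _root_.smul_apply, smul_eq_mul] at h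
    change intT T (fun x => grad w i x * s x) + intT T
      (fun x => val w x * pderiv i s x) - _ = 0 at h
    linarith
  have hle := (Measure.absolutelyContinuous_of_le (Mesh.restrict_le hΩ hT)).ae_le
  have hφ : ContDiff ℝ 1 φ := contDiff_one h.1.1
  have e1 : m1 v = intT T (fun x => pderiv i φ x * s x) := by
    rw [hm1]
    exact integral_congr_ae
      (by filter_upwards [hle (h.2.2 i)] with x hx; exact congrArg (· * s x) hx)
  have e2 : m2 v = intT T (fun x => φ x * pderiv i s x) := by
    rw [hm2]
    exact integral_congr_ae (by filter_upwards [hle h.2.1] with x hx; exact congrArg (· * _) hx)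
  have e3 : ∀ F : facesOf T, n F v = intF F.1 (fun x => φ x * s x) := fun F => by
    rw [hn, intF_classOf hΩ hd hT (hm3 F).1 hs h, ← (hm3 F).2]
  simp only [_root_.sub_apply, _root_.add_apply,
    _root_.sum_apply, _root_.smul_apply, smul_eq_mul, e1, e2, e3]
  have e4 := hTs.integral_fderiv hd (e i) (hφ.mul hs)
  simp only [inner_e] at e4
  rw [sum_coe_sort (facesOf T) fun F => normal T F i * intF F fun x => φ x * s x,
    hTs.sum_facesOf, ← e4, sub_eq_zero]
  refine (hTs.intT_eq_add ((continuous_pderiv hφ i).mul hs.continuous).continuousOn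
      (hφ.continuous.mul (continuous_pderiv hs i)).continuousOn fun x _ => ?_).symm
  rw [fderiv_fun_mul (hφ.differentiable one_ne_zero x) (hs.differentiable one_ne_zero x)]
  simp only [_root_.add_apply, _root_.smul_apply, smul_eq_mul]
  exact (add_comm _ _).trans (congrArg (· + _) (mul_comm _ _))

/-! ### The interpolator on `H¹₀` -/

variable {u : Fin d → H1 Ω}

theorem IsPoly.pderiv_mem_pred (hf : IsPoly k f) (j : Fin d) : pderiv j f ∈ PolyPred d k := by
  refine mem_polyPred.2 ⟨hf.pderiv_pred j, fun hk => ?_⟩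
  obtain ⟨c, rfl⟩ := IsPoly.induction (C := fun m f => m = 0 → ∃ c, f = fun _ => c)
    (fun _ c _ => ⟨c, rfl⟩) (fun m f g hf hg h => by
      obtain ⟨a, rfl⟩ := hf h
      obtain ⟨b, rfl⟩ := hg h
      exact ⟨a + b, rfl⟩) (fun m i f _ _ h => absurd h (by omega)) hf hk
  exact funext fun x => pderiv_const c j x

theorem Mesh.exists_erase_eq (hΩ : IsOpen Ω) (hF : F ∈ M.faces) :
    ∃ T ∈ M.elems, ∃ a ∈ T, T.erase a = F := by
  obtain ⟨T, hT, hFT⟩ := exists_elem hΩ hF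
  exact ⟨T, hT, (isSimplex hT).exists_erase hFT⟩

theorem Mesh.isDefinite_face (hd : 0 < d) (hΩ : IsOpen Ω) (hF : F ∈ M.faces) :
    IsDefinite μHE[d - 1] F := by
  obtain ⟨T, hT, hFT⟩ := exists_elem hΩ hF
  exact (isSimplex hT).isDefinite_face hd hFT

theorem IsH10.integrableOn_trace {w : H1 Ω} (hw : IsH10 w) (hΩ : IsConvexPolytopalDomain Ω)
    (hd : 0 < d) (hF : F ∈ M.faces) : IntegrableOn (trace F w) (hull F) μHE[d - 1] := by
  obtain ⟨T, hT, a, ha, rfl⟩ := Mesh.exists_erase_eq hΩ.isOpen hF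
  have : IsFiniteMeasure ((μHE[d - 1] : Measure (Pt d)).restrict (hull (T.erase a))) :=
    ⟨by simpa using (isSimplex hT).face_lt_top hd ha⟩
  exact (hw.isTrace_trace hΩ hd hT ha).1.integrable one_le_two

theorem integrableOn_hull_L2 (hΩ : IsConvexPolytopalDomain Ω) (hT : T ∈ M.elems) (f : L2 Ω) :
    IntegrableOn f (hull T) := by
  have : IsFiniteMeasure (volume.restrict (hull T)) :=
    ⟨by simpa using (isCompact_hull T).measure_lt_top⟩
  exact ((Lp.memLp f).mono_measure (Mesh.restrict_le hΩ hT)).integrable one_le_two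

theorem isData_trace (hu : ∀ i, IsH10 (u i)) (hΩ : IsConvexPolytopalDomain Ω) (hd : 0 < d)
    (hT : T ∈ M.elems) : IsData T (fun i => val (u i)) (fun F i => trace F (u i)) :=
  ⟨fun i => integrableOn_hull_L2 hΩ hT _, fun _ hF i => (hu i).integrableOn_trace (M := M) hΩ hd
    (mem_faces_of_facesOf hd hT hF)⟩

theorem interp_elem (hu : ∀ i, IsH10 (u i)) (hΩ : IsConvexPolytopalDomain Ω) (hd : 0 < d)
    (hT : T ∈ M.elems) : ∃ R, RTField d k R ∧
      HasMoments k T R (fun i => val (u i)) (fun F i => trace F (u i)) ∧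
      (interp M k u).1 T = fun i => (hull T).indicator (R i) := by
  simp only [interp, if_pos hT]
  exact (isSimplex hT).rtnInterp_spec hd (isData_trace hu hΩ hd hT)

theorem interp_face (hu : ∀ i, IsH10 (u i)) (hΩ : IsConvexPolytopalDomain Ω) (hd : 0 < d)
    (hF : F ∈ M.faces) (i : Fin d) : ∃ p, IsPoly k p ∧ (interp M k u).2 F i = (hull F).indicator p ∧
      ∀ z, IsPoly k z → intF F (fun x => p x * z x) = intF F (fun x => trace F (u i) x * z x) := by
  simp only [interp, if_pos hF]
  exact (Mesh.isDefinite_face hd hΩ.isOpen hF).exists_projF k ((hu i).integrableOn_trace hΩ hd hF)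

theorem interp_memU0 (hu : ∀ i, IsH10 (u i)) (hΩ : IsConvexPolytopalDomain Ω) (hd : 0 < d) :
    MemU0 M k (interp M k u) := by
  refine ⟨⟨fun T hT => ?_, fun F hF => ?_, fun T hT => if_neg hT, fun F hF => if_neg hF⟩,
    fun F hF hb => funext fun i => ?_⟩
  · obtain ⟨R, hR, -, he⟩ := interp_elem (k := k) hu hΩ hd hT
    exact mem_RTN.2 ⟨R, hR, he⟩
  · choose p hp he _ using interp_face (k := k) hu hΩ hd hF
    exact mem_PolyVec.2 ⟨p, hp, funext he⟩
  · obtain ⟨p, hp, he, hm⟩ := interp_face (k := k) hu hΩ hd hF i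
    refine (Mesh.isDefinite_face hd hΩ.isOpen hF).proj_unique (he ▸ mem_Poly.2 ⟨p, hp, rfl⟩)
      (Submodule.zero_mem (Poly (k : ℤ) F)) fun s hs => ?_
    obtain ⟨T, hT, hFT⟩ := exists_elem hΩ.isOpen hF
    obtain ⟨z, hz, rfl⟩ := mem_Poly.1 hs
    have := (hm z hz).trans ((hu i).intF_trace_eq_zero hΩ hd hT hFT hb
      (contDiff_one (IsPoly.contDiff (m := k) hz)))
    rw [← intF, ← intF, intF_congr (g := fun x => p x * z x) fun x hx => by simp [he, hx], this]
    simp [intF]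

theorem IsDefinite.exists_moment (hY : IsDefinite m Y)
    (L : U0 M k →ₗ[ℝ] (Pt d → ℝ)) (hL : ∀ v, ContinuousOn (L v) (hull Y))
    (hs : Continuous s) : ∃ l : U0 M k →ₗ[ℝ] ℝ, ∀ v, l v = ∫ x in hull Y, L v x * s x ∂m :=
  ⟨{  toFun := fun v => ∫ x in hull Y, L v x * s x ∂m
      map_add' := fun v w => hY.integral_eq_add ((hL v).mul hs.continuousOn)
        ((hL w).mul hs.continuousOn) fun x _ => by simp [add_mul]
      map_smul' := fun c v => integral_eq_smul fun x _ => by simp [mul_assoc] }, fun _ => rfl⟩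

/-- The element component `i` on `T`, as a linear map. -/
def elemMap (M : Mesh Ω) (k : ℕ) (T : Finset (Pt d)) (i : Fin d) : U0 M k →ₗ[ℝ] (Pt d → ℝ) :=
  (LinearMap.proj i ∘ₗ LinearMap.proj T) ∘ₗ LinearMap.fst ℝ _ _ ∘ₗ (U0 M k).subtype

/-- The face component `i` on `F`, as a linear map. -/
def faceMap (M : Mesh Ω) (k : ℕ) (F : Finset (Pt d)) (i : Fin d) : U0 M k →ₗ[ℝ] (Pt d → ℝ) :=
  (LinearMap.proj i ∘ₗ LinearMap.proj F) ∘ₗ LinearMap.snd ℝ _ _ ∘ₗ (U0 M k).subtype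

theorem MemU.continuousOn_face (hv : MemU M k v) (hF : F ∈ M.faces) (i : Fin d) :
    ContinuousOn (v.2 F i) (hull F) := by
  obtain ⟨P, hP, he⟩ := mem_PolyVec.1 (hv.face F hF)
  exact (hP i).continuous.continuousOn.congr fun x hx => by simp [he, hx]

theorem intF_sum_normal
    {g : Fin d → Pt d → ℝ} (hg : ∀ i, IntegrableOn (g i) (hull F) μHE[d - 1]) {z : Pt d → ℝ}
    (hz : Continuous z) : intF F (fun x => (∑ i, g i x * normal T F i) * z x) =
      ∑ i, normal T F i * intF F (fun x => g i x * z x) := by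
  simp only [intF, sum_mul, ← integral_const_mul]
  rw [← integral_finsetSum]
  · exact integral_congr_ae (Eventually.of_forall fun x => sum_congr rfl fun i _ => by ring)
  · exact fun i _ => ((hg i).mul_continuousOn hz.continuousOn (isCompact_hull F)).const_mul _

/-- The linear functional `l` on the discrete space pulls back to a bounded functional by the
interpolator. -/
def IsPullback (M : Mesh Ω) (k : ℕ) (l : U0 M k →ₗ[ℝ] ℝ) : Prop :=
  ∃ m : (Fin d → H1 Ω) →L[ℝ] ℝ, ∀ u, (∀ i, IsH10 (u i)) →
    ∀ v : U0 M k, v.1 = interp M k u → l v = m u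

/-- In finite dimension, a space of functionals that separates points contains all functionals. -/
theorem mem_of_separating {V : Type*} [AddCommGroup V] [Module ℝ V] [FiniteDimensional ℝ V]
    (P : Submodule ℝ (Module.Dual ℝ V)) (h : ∀ v, (∀ l ∈ P, l v = 0) → v = 0)
    (l : Module.Dual ℝ V) : l ∈ P := by
  have h0 : P.dualCoannihilator = ⊥ := (Submodule.eq_bot_iff _).2 fun v hv =>
    h v (Submodule.mem_dualCoannihilator v |>.1 hv)
  have h1 : P = ⊤ := by
    rw [← Subspace.dualCoannihilator_dualAnnihilator_eq (W := P), h0, Submodule.dualAnnihilator_bot]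
  exact h1 ▸ Submodule.mem_top

theorem exists_clm_elem (hΩ : IsConvexPolytopalDomain Ω) (hT : T ∈ M.elems) (i : Fin d)
    {z : Pt d → ℝ} (hz : Continuous z) : ∃ m : (Fin d → H1 Ω) →L[ℝ] ℝ, ∀ u,
      m u = intT T (fun x => val (u i) x * z x) := by
  obtain ⟨m, hm⟩ := exists_clm_intT hΩ hT none hz
  exact ⟨m.comp (ContinuousLinearMap.proj i), fun u => hm (u i)⟩

theorem exists_clm_face (hΩ : IsConvexPolytopalDomain Ω) (hd : 0 < d) (hF : F ∈ M.faces) (i : Fin d)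
    {z : Pt d → ℝ} (hz : IsPoly k z) : ∃ m : (Fin d → H1 Ω) →L[ℝ] ℝ, ∀ u, (∀ i, IsH10 (u i)) →
      m u = intF F (fun x => trace F (u i) x * z x) := by
  obtain ⟨T, hT, a, ha, rfl⟩ := Mesh.exists_erase_eq hΩ.isOpen hF
  have hz' : ContDiff ℝ 1 z := contDiff_one hz.contDiff
  obtain ⟨m, hm⟩ := exists_clm_faceVal hΩ hT hz' a
  exact ⟨m.comp (ContinuousLinearMap.proj i), fun u hu =>
    (hm (u i)).trans ((hu i).intF_trace hΩ hd hT ha hz').symm⟩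

theorem exists_pullback_elem (hΩ : IsConvexPolytopalDomain Ω) (hd : 0 < d) (hT : T ∈ M.elems)
    (i : Fin d) {z : Pt d → ℝ} (hz : z ∈ PolyPred d k) :
    ∃ l : U0 M k →ₗ[ℝ] ℝ, IsPullback M k l ∧
      ∀ v, l v = intT T (fun x => v.1.1 T i x * z x) := by
  have hzc := (IsPoly.of_pred hz).continuous
  obtain ⟨l, hl⟩ := (isSimplex hT).isDefinite.exists_moment (elemMap M k T i)
    (fun v => continuousOn_of_mem_RTN (v.2.1.elem T hT) i) hzc
  obtain ⟨m, hm⟩ := exists_clm_elem hΩ hT i hzc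
  refine ⟨l, ⟨m, fun u hu v hv => ?_⟩, hl⟩
  obtain ⟨R, hR, hm1, he⟩ := interp_elem (k := k) hu hΩ hd hT
  have h1 : l v = intT T (fun x => v.1.1 T i x * z x) := hl v
  rw [h1, hm, ← hm1.elem i z hz, hv]
  exact intT_congr fun x hx => by simp only [he, indicator_of_mem hx]

theorem exists_pullback_normal (hΩ : IsConvexPolytopalDomain Ω) (hd : 0 < d) (hT : T ∈ M.elems)
    (hF : F ∈ facesOf T) {z : Pt d → ℝ} (hz : IsPoly k z) :
    ∃ l : U0 M k →ₗ[ℝ] ℝ, IsPullback M k l ∧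
      ∀ v, l v = intF F (fun x => (∑ i, v.1.1 T i x * normal T F i) * z x) := by
  have hFm := mem_faces_of_facesOf hd hT hF
  have hS : ∀ (v : U0 M k) x, (∑ i, normal T F i • elemMap M k T i) v x =
      ∑ i, v.1.1 T i x * normal T F i := fun v x => by
    simp [elemMap, LinearMap.sum_apply, mul_comm]
  obtain ⟨l, hl⟩ := ((isSimplex hT).isDefinite_face hd hF).exists_moment
    (∑ i, normal T F i • elemMap M k T i) (fun v => by
      rw [funext (hS v)]
      exact continuousOn_finsetSum _ fun i _ => ((continuousOn_of_mem_RTN (v.2.1.elem T hT) i).mono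
          (hull_face_subset hF)).mul continuousOn_const) hz.continuous
  simp only [hS] at hl
  choose m hm using fun i => exists_clm_face hΩ hd hFm i hz
  refine ⟨l, ⟨∑ i, normal T F i • m i, fun u hu v hv => ?_⟩, hl⟩
  obtain ⟨R, hR, hm1, he⟩ := interp_elem (k := k) hu hΩ hd hT
  have h1 : l v = intF F (fun x => (∑ i, v.1.1 T i x * normal T F i) * z x) := hl v
  rw [h1]
  simp only [_root_.sum_apply, _root_.smul_apply, smul_eq_mul, hm _ u hu]
  rw [← intF_sum_normal (fun i => (hu i).integrableOn_trace hΩ hd hFm) hz.continuous,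
    ← hm1.face F hF z hz, hv]
  exact intF_congr fun x hx => by simp only [he, indicator_of_mem (hull_face_subset hF hx)]

theorem exists_pullback_face (hΩ : IsConvexPolytopalDomain Ω) (hd : 0 < d) (hF : F ∈ M.faces)
    (i : Fin d) {z : Pt d → ℝ} (hz : IsPoly k z) :
    ∃ l : U0 M k →ₗ[ℝ] ℝ, IsPullback M k l ∧
      ∀ v, l v = intF F (fun x => v.1.2 F i x * z x) := by
  obtain ⟨l, hl⟩ := (Mesh.isDefinite_face hd hΩ.isOpen hF).exists_moment (faceMap M k F i)
      (fun v => v.2.1.continuousOn_face hF i) hz.continuous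
  obtain ⟨m, hm⟩ := exists_clm_face hΩ hd hF i hz
  refine ⟨l, ⟨m, fun u hu v hv => ?_⟩, hl⟩
  obtain ⟨p, hp, he, hm1⟩ := interp_face (k := k) hu hΩ hd hF i
  have h1 : l v = intF F (fun x => v.1.2 F i x * z x) := hl v
  rw [h1, hm u hu, ← hm1 z hz, hv]
  exact intF_congr fun x hx => by rw [he, indicator_of_mem hx]

/-- All linear functionals on the discrete space pull back to bounded functionals: this holds for
the defining moments, which separate the elements of the discrete space. -/
theorem isPullback (hΩ : IsConvexPolytopalDomain Ω) (hd : 0 < d) (l : U0 M k →ₗ[ℝ] ℝ) :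
    IsPullback M k l := by
  let P : Submodule ℝ (Module.Dual ℝ (U0 M k)) :=
    { carrier := {l | IsPullback M k l}
      zero_mem' := ⟨0, fun _ _ _ _ => rfl⟩
      add_mem' := fun ⟨m, hm⟩ ⟨n, hn⟩ => ⟨m + n, fun u hu v hv =>
        congrArg₂ (· + ·) (hm u hu v hv) (hn u hu v hv)⟩
      smul_mem' := fun c _ ⟨m, hm⟩ => ⟨c • m, fun u hu v hv => congrArg (c * ·) (hm u hu v hv)⟩ }
  refine mem_of_separating P (fun v hv => ?_) l
  have hv : ∀ l, IsPullback M k l → l v = 0 := hv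
  refine Subtype.ext (Prod.ext (funext fun T => ?_) (funext fun F => ?_))
  · by_cases hT : T ∈ M.elems
    swap
    · exact v.2.1.elem_zero T hT
    obtain ⟨R, hR, he⟩ := (v.2.1.isLocal hd hT).elem_eq
    have hR0 : RTField d k (0 : Fin d → Pt d → ℝ) :=
      ⟨0, 0, fun _ => Submodule.zero_mem (PolyFun d k), Submodule.zero_mem (PolyFun d k), by
        ext; simp⟩
    have hm0 : HasMoments k T R 0 0 := by
      refine ⟨fun i z hz => ?_, fun F hF z hz => ?_⟩
      · obtain ⟨l, h1, h2⟩ := exists_pullback_elem hΩ hd hT i hz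
        rw [intT_congr (g := fun x => v.1.1 T i x * z x) fun x hx => by
          simp only [he, indicator_of_mem hx], ← h2, hv l h1]
        simp [intT]
      · obtain ⟨l, h1, h2⟩ := exists_pullback_normal hΩ hd hT hF hz
        rw [intF_congr (g := fun x => (∑ i, v.1.1 T i x * normal T F i) * z x) fun x hx => by
          simp only [he, indicator_of_mem (hull_face_subset hF hx)], ← h2, hv l h1]
        simp [intF]
    have h0 := hm0.unique (isSimplex hT) hd hR hR0 ⟨fun _ _ _ => rfl, fun _ _ _ _ => rfl⟩
    refine he.trans (funext fun i => funext fun x => ?_)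
    by_cases hx : x ∈ hull T
    · exact (indicator_of_mem hx _).trans (h0 i x hx)
    · exact indicator_of_notMem hx _
  · by_cases hF : F ∈ M.faces
    swap
    · exact v.2.1.face_zero F hF
    refine funext fun i => (Mesh.isDefinite_face hd hΩ.isOpen hF).proj_unique
      (v.2.1.face F hF i (Set.mem_univ i)) (Submodule.zero_mem (Poly (k : ℤ) F)) fun s hs => ?_
    obtain ⟨z, hz, rfl⟩ := mem_Poly.1 hs
    obtain ⟨l, h1, h2⟩ := exists_pullback_face hΩ hd hF i hz
    rw [← intF, ← intF, intF_congr (g := fun x => v.1.2 F i x * z x) fun x hx => by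
      rw [indicator_of_mem hx], ← h2, hv l h1]
    simp [intF]

/-- The interpolator preserves zero divergence. -/
theorem BForm_interp_eq_zero (hu : ∀ i, IsH10 (u i)) (hΩ : IsConvexPolytopalDomain Ω) (hd : 0 < d)
    (hdiv : ∀ q : L2 Ω, IsL20 q → BCont u q = 0) {q : HybScal d} (hq : MemP0 M k q) :
    BForm M k (interp M k u) q = 0 := by
  classical
  have hI := interp_memU0 (k := k) (M := M) hu hΩ hd
  rw [BForm_eq hd hI.1 hq.1, sum_add_distrib]
  have hpc : ∀ {p : Pt d → ℝ}, IsPoly k p → ContDiff ℝ 1 p := fun h => contDiff_one h.contDiff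
  have h1 : ∀ T ∈ M.elems, intT T (fun x => q.1 T x * ∑ i, pd T i ((interp M k u).1 T i) x) =
      intT T (fun x => div u x * q.1 T x) := by
    intro T hT
    have hTs := isSimplex hT
    obtain ⟨p, hp, hpe⟩ := mem_Poly.1 (hq.1.elem T hT)
    have hp : IsPoly k p := hp
    obtain ⟨R, hR, hm, he⟩ := interp_elem (k := k) hu hΩ hd hT
    have hRc : ∀ i, ContDiff ℝ 1 (R i) := fun i => contDiff_one (hR.isPoly i).contDiff
    have e1 := hTs.intT_div_mul hd hRc (hpc hp)
    have e2 : intT T (fun x => ∑ i, R i x * pderiv i p x) =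
        ∑ i, intT T (fun x => val (u i) x * pderiv i p x) := by
      simp only [fun i => (hm.elem i _ (hp.pderiv_mem_pred i)).symm]
      exact integral_finsetSum _ fun i _ => integrableOn_hull
        ((hRc i).continuous.mul (continuous_pderiv (hpc hp) i)).continuousOn
    have e3 : ∀ F ∈ facesOf T, intF F (fun x => p x * ∑ i, R i x * normal T F i) =
        ∑ i, normal T F i * intF F (fun x => trace F (u i) x * p x) := fun F hF => by
      rw [← intF_sum_normal (fun i => (hu i).integrableOn_trace hΩ hd
            (mem_faces_of_facesOf hd hT hF)) hp.continuous, ← hm.face F hF p hp]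
      exact intF_congr fun x _ => mul_comm _ _
    have e4 : intT T (fun x => div u x * q.1 T x) = ∑ i, intT T
      (fun x => grad (u i) i x * p x) := by
      rw [intT_congr (g := fun x => ∑ i, grad (u i) i x * p x) fun x hx => by
        simp [div, hpe, hx, sum_mul]]
      exact integral_finsetSum _ fun i _ => (integrableOn_hull_L2 hΩ hT _).mul_continuousOn
        hp.continuous.continuousOn (isCompact_hull T)
    have e5 : intT T (fun x => q.1 T x * ∑ i, pd T i ((interp M k u).1 T i) x) =
        intT T (fun x => p x * ∑ i, pderiv i (R i) x) := intT_congr fun x hx => by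
      simp only [he, hpe, indicator_of_mem hx]
      exact congrArg (p x * ·) (sum_congr rfl fun i _ =>
        pd_indicator hTs ((hRc i).differentiable one_ne_zero) i hx)
    rw [e4, sum_congr rfl fun i _ => (hu i).intT_grad_mul hΩ hd hT (hpc hp) i,
      sum_add_distrib, sum_neg_distrib, ← e2, e5, e1, sum_congr rfl e3,
      sum_comm]
    ring
  have h2 : ∑ T ∈ M.elems, intT T (fun x => div u x * q.1 T x) = 0 := by
    have hQ : ∀ T ∈ M.elems, MemLp (q.1 T) 2 (volume.restrict Ω) := fun T hT => by
      obtain ⟨p, hp, hpe⟩ := mem_Poly.1 (hq.1.elem T hT)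
      rw [hpe]
      exact (memLp_of_continuous (m := volume) hΩ.bounded.measure_lt_top.ne hΩ.bounded
        hΩ.isOpen.measurableSet (IsPoly.continuous (m := k) hp)).indicator (measurableSet_hull T)
    have hind : ∀ T ∈ M.elems, ∀ x, q.1 T x = (hull T).indicator (q.1 T) x := fun T hT x => by
      obtain ⟨p, hp, hpe⟩ := mem_Poly.1 (hq.1.elem T hT)
      by_cases hx : x ∈ hull T <;> simp [hpe, hx]
    have hS := memLp_finsetSum M.elems hQ
    have hfin := finite_restrict hΩ
    have hQ0 : IsL20 hS.toLp := by
      rw [IsL20, integral_congr_ae hS.coeFn_toLp, integral_finsetSum _ fun T hT =>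
        (hQ T hT).integrable one_le_two, ← hq.2]
      exact sum_congr rfl fun T hT => by rw [← Mesh.integral_indicator hΩ hT, ← funext (hind T hT)]
    have hB := hdiv _ hQ0
    have hdL : MemLp (div u) 2 (volume.restrict Ω) := memLp_finsetSum _ fun i _ => Lp.memLp _
    have e : ∫ x in Ω, div u x * (hS.toLp : L2 Ω) x = ∫ x in Ω, ∑ T ∈ M.elems, div u x * q.1 T x :=
      integral_congr_ae (by
        filter_upwards [hS.coeFn_toLp] with x hx
        rw [hx, mul_sum])
    have i1 : ∀ T ∈ M.elems, IntegrableOn (fun x => div u x * q.1 T x) Ω := fun T hT =>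
      hdL.integrable_mul (hQ T hT)
    rw [BCont, neg_eq_zero, e, integral_finsetSum _ i1] at hB
    rw [← hB]
    refine sum_congr rfl fun T hT => ?_
    rw [← Mesh.integral_indicator hΩ hT]
    refine congrArg (fun f : Pt d → ℝ => ∫ x in Ω, f x) (funext fun x => ?_)
    rw [indicator_mul_right, ← hind T hT x]
  rw [sum_neg_distrib, sum_congr rfl h1, h2, neg_zero, zero_add]
  have h3 : ∀ T ∈ M.elems, ∀ F ∈ facesOf T,
      intF F (fun x => q.2 F x * ∑ i, (interp M k u).1 T i x * normal T F i) =
        ∑ i, normal T F i * intF F (fun x => trace F (u i) x * q.2 F x) := by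
    intro T hT F hF
    obtain ⟨p, hp, hpe⟩ := mem_Poly.1 (hq.1.face F (mem_faces_of_facesOf hd hT hF))
    have hp : IsPoly k p := hp
    obtain ⟨R, hR, hm, he⟩ := interp_elem (k := k) hu hΩ hd hT
    have e : ∀ i, intF F (fun x => trace F (u i) x * q.2 F x) =
        intF F (fun x => trace F (u i) x * p x) := fun i => intF_congr fun x hx => by simp [hpe, hx]
    simp only [e]
    rw [← intF_sum_normal (fun i => (hu i).integrableOn_trace hΩ hd
            (mem_faces_of_facesOf hd hT hF)) hp.continuous, ← hm.face F hF p hp]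
    exact intF_congr fun x hx => by simp [hpe, he, hx, hull_face_subset hF hx, mul_comm]
  rw [sum_congr rfl fun T hT => sum_congr rfl (h3 T hT), sum_facesOf_elems hd]
  refine sum_eq_zero fun F hF => ?_
  by_cases hb : hull F ⊆ frontier Ω
  · obtain ⟨T, hT, hFT⟩ := exists_elem hΩ.isOpen hF
    obtain ⟨p, hp, hpe⟩ := mem_Poly.1 (hq.1.face F hF)
    have e : ∀ i, intF F (fun x => trace F (u i) x * q.2 F x) = 0 := fun i => by
      rw [intF_congr (g := fun x => trace F (u i) x * p x) fun x hx => by simp [hpe, hx]]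
      exact (hu i).intF_trace_eq_zero hΩ hd hT hFT hb (hpc hp)
    simp [e]
  · have : ∀ T, (if F ∈ facesOf T then
        ∑ i, normal T F i * intF F (fun x => trace F (u i) x * q.2 F x) else 0) =
        ∑ i, (if F ∈ facesOf T then normal T F i else 0) *
          intF F (fun x => trace F (u i) x * q.2 F x) := fun T => by split_ifs <;> simp
    simp only [this]
    rw [sum_comm]
    simp only [← sum_mul]
    exact sum_eq_zero fun i _ => by rw [Mesh.sum_normal_eq_zero hd hΩ hF hb i, zero_mul]

/-! ### Mollification and interpolation of Lipschitz fields -/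

/-- A sequence of mollifiers. -/
def bump (d n : ℕ) : ContDiffBump (0 : Pt d) where
  rIn := 1 / (n + 1)
  rOut := 2 / (n + 1)
  rIn_pos := by positivity
  rIn_lt_rOut := by gcongr; norm_num

theorem tendsto_rOut (d : ℕ) : Tendsto (fun n => (bump d n).rOut) atTop (𝓝 0) := by
  have := (tendsto_one_div_add_atTop_nhds_zero_nat (𝕜 := ℝ)).const_mul 2
  simpa [bump, div_eq_mul_inv] using this

/-- The normalized mollifier. -/
def rho (d n : ℕ) : Pt d → ℝ := (bump d n).normed volume

theorem contDiff_rho (n : ℕ) : ContDiff ℝ ∞ (rho d n) := (bump d n).contDiff_normed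

theorem contDiff_rho_sub (n : ℕ) (x : Pt d) : ContDiff ℝ ∞ fun y => rho d n (x - y) :=
  (contDiff_rho n).comp (contDiff_const.sub contDiff_id)

theorem pderiv_rho_sub (n : ℕ) (x y : Pt d) (j : Fin d) :
    pderiv j (fun y => rho d n (x - y)) y = - pderiv j (rho d n) (x - y) := by
  have h := (((contDiff_rho n).differentiable (by simp) (x - y)).hasFDerivAt.comp y
    ((hasFDerivAt_id y).const_sub x)).fderiv
  have e : (rho d n ∘ fun y => x - y) = fun y => rho d n (x - y) := rfl
  simp only [pderiv]
  rw [← e]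
  refine (congrArg (fun l : Pt d →L[ℝ] ℝ => l (MHD.e j)) h).trans ?_
  simp

/-- The mollification of `g`. -/
def moll (n : ℕ) (g : Pt d → ℝ) (x : Pt d) : ℝ := ∫ y, rho d n (x - y) * g y

theorem moll_eq (n : ℕ) (g : Pt d → ℝ) :
    moll n g = convolution (rho d n) g (ContinuousLinearMap.lsmul ℝ ℝ) volume :=
  funext fun x => by rw [convolution_lsmul_swap]; rfl

theorem contDiff_moll (hg : LocallyIntegrable g) (n : ℕ) : ContDiff ℝ ∞ (moll n g) := by
  rw [moll_eq]
  exact (bump d n).hasCompactSupport_normed.contDiff_convolution_left _ (contDiff_rho n) hg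

theorem pderiv_moll (hg : LocallyIntegrable g) (n : ℕ) (j : Fin d) (x : Pt d) :
    pderiv j (moll n g) x = ∫ y, pderiv j (rho d n) (x - y) * g y := by
  have hcs : HasCompactSupport (rho d n) := (bump d n).hasCompactSupport_normed
  have h1 : ContDiff ℝ 1 (rho d n) := contDiff_one (contDiff_rho n)
  have h := (hcs.hasFDerivAt_convolution_left (ContinuousLinearMap.lsmul ℝ ℝ) h1 hg x).fderiv
  have hi : Integrable fun t => ((ContinuousLinearMap.lsmul ℝ ℝ).precompL (Pt d))
      (fderiv ℝ (rho d n) t) (g (x - t)) :=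
        (hcs.fderiv (𝕜 := ℝ)).convolutionExists_left _ (h1.continuous_fderiv one_ne_zero) hg x
  simp only [pderiv]
  rw [moll_eq, h, convolution, ContinuousLinearMap.integral_apply hi,
    ← integral_sub_left_eq_self _ volume x]
  simp

theorem abs_integral_rho_le {B : ℝ} {S : Set (Pt d)} (hB : 0 ≤ B)
    (hg : ∀ᵐ x ∂volume.restrict S, |g x| ≤ B) (n : ℕ) (x : Pt d) :
    |∫ y in S, rho d n (x - y) * g y| ≤ B := by
  have h0 : ∀ y, 0 ≤ rho d n y := fun y => (bump d n).nonneg_normed y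
  have hi : Integrable fun y => rho d n (x - y) * B :=
    ((bump d n).integrable_normed.comp_sub_left x).mul_const B
  rw [← norm_eq_abs]
  refine (norm_integral_le_of_norm_le hi.restrict ?_).trans
    ((setIntegral_le_integral hi (Eventually.of_forall fun y => mul_nonneg (h0 _) hB)).trans ?_)
  · filter_upwards [hg] with y hy
    rw [norm_mul, norm_of_nonneg (h0 _)]
    exact mul_le_mul_of_nonneg_left hy (h0 _)
  · rw [integral_mul_const, integral_sub_left_eq_self (rho d n) volume x]
    exact (congrArg (· * B) (bump d n).integral_normed).le.trans (one_mul B).le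

theorem ae_tendsto_moll (hg : LocallyIntegrable g) :
    ∀ᵐ x, Tendsto (fun n => moll n g x) atTop (𝓝 (g x)) := by
  refine (ContDiffBump.ae_convolution_tendsto_right_of_locallyIntegrable (K := 2) (tendsto_rOut d)
    (Eventually.of_forall fun n => by simp [bump, div_eq_mul_inv]) hg).mono
    fun x hx => ?_
  simp only [moll_eq]
  exact hx

theorem IsTest.memLp_continuous (hΩ : IsConvexPolytopalDomain Ω)
    (hs : Continuous s) : MemLp s 2 (volume.restrict Ω) :=
  memLp_of_continuous hΩ.bounded.measure_lt_top.ne hΩ.bounded hΩ.isOpen.measurableSet hs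

theorem IsTest.integral_mul_pderiv (hΩ : IsConvexPolytopalDomain Ω)
    (h : IsTest Ω φ) (hs : ContDiff ℝ 1 s) (j : Fin d) :
    ∫ x in Ω, φ x * pderiv j s x = - ∫ x in Ω, pderiv j φ x * s x := by
  have hφ : ContDiff ℝ 1 φ := contDiff_one h.1
  have h0 := integral_pderiv_eq_zero (hφ.mul hs) h.2.1.mul_right j
  have e : pderiv j (fun x => φ x * s x) = fun x => pderiv j φ x * s x + φ x * pderiv j s x :=
    funext fun x =>
      (pderiv_mul (hφ.differentiable one_ne_zero) (hs.differentiable one_ne_zero) j x).trans (by ring)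
  have i1 : IntegrableOn (fun x => pderiv j φ x * s x) Ω :=
    (memLp_continuous hΩ (continuous_pderiv hφ j)).integrable_mul
    (memLp_continuous hΩ hs.continuous)
  have i2 : IntegrableOn (fun x => φ x * pderiv j s x) Ω :=
    (memLp_continuous hΩ hφ.continuous).integrable_mul
    (memLp_continuous hΩ (continuous_pderiv hs j))
  rw [e, ← setIntegral_eq_integral_of_forall_compl_eq_zero (s := Ω), integral_add i1 i2] at h0
  · linarith
  · intro x hx
    have hx' : x ∉ tsupport φ := fun h' => hx (h.2.2 h')
    have e2 : pderiv j φ x = 0 := by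
      rw [pderiv, show fderiv ℝ φ x = 0 from
        image_eq_zero_of_notMem_tsupport fun h' => hx' (tsupport_fderiv_subset ℝ h')]
      rfl
    rw [e2, image_eq_zero_of_notMem_tsupport hx', zero_mul, zero_mul, add_zero]

theorem IsH10.integral_mul_pderiv {w : H1 Ω} (hw : IsH10 w) (hΩ : IsConvexPolytopalDomain Ω)
    (hs : ContDiff ℝ 1 s) (j : Fin d) :
    ∫ x in Ω, val w x * pderiv j s x = - ∫ x in Ω, grad w j x * s x := by
  obtain ⟨m, hm⟩ := exists_clm_integral (Ω := Ω) none
    (IsTest.memLp_continuous hΩ (continuous_pderiv hs j))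
  obtain ⟨n, hn⟩ := exists_clm_integral (Ω := Ω) (some j) (IsTest.memLp_continuous hΩ hs.continuous)
  have := hw.clm_eq_zero (m + n) fun v φ h => ?_
  · have h1 : m w + n w = 0 := this
    rw [hm, hn] at h1
    exact eq_neg_of_add_eq_zero_left h1
  change m v + n v = 0
  rw [hm, hn, ← eq_neg_iff_add_eq_zero]
  refine Eq.trans ?_ ((IsTest.integral_mul_pderiv hΩ h.1 hs j).trans (congrArg Neg.neg ?_))
  · exact integral_congr_ae (by filter_upwards [h.2.1] with x hx; exact congrArg (· * _) hx)
  · exact integral_congr_ae (by filter_upwards [h.2.2 j] with x hx; exact congrArg (· * _) hx.symm)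

theorem integrable_indicator_L2 (hΩ : IsConvexPolytopalDomain Ω) (f : L2 Ω) :
    Integrable (Ω.indicator f) := by
  have := finite_restrict hΩ
  exact (integrable_indicator_iff hΩ.isOpen.measurableSet).2 ((Lp.memLp f).integrable one_le_two)

theorem moll_indicator (hΩ : IsOpen Ω) (f : Pt d → ℝ) (n : ℕ) (x : Pt d) :
    moll n (Ω.indicator f) x = ∫ y in Ω, rho d n (x - y) * f y := by
  rw [moll, ← integral_indicator hΩ.measurableSet]
  simp only [indicator_mul_right]

/-- Functions in `H¹₀(Ω)` with bounded gradient are weak limits of smooth functions whose gradient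
obeys the same bound: mollifications of the extension by zero. -/
theorem IsH10.exists_weakConv {w : H1 Ω} (hw : IsH10 w) (hΩ : IsConvexPolytopalDomain Ω) {B L : ℝ}
    (hB0 : 0 ≤ B) (hL0 : 0 ≤ L) (hB : ∀ᵐ x ∂volume.restrict Ω, |val w x| ≤ B)
    (hL : ∀ j, ∀ᵐ x ∂volume.restrict Ω, |grad w j x| ≤ L) :
    ∃ φ : ℕ → Pt d → ℝ, (∀ n, ContDiff ℝ ∞ (φ n)) ∧ (∀ n j x, |pderiv j (φ n) x| ≤ L) ∧
      ∀ T ∈ M.elems, WeakConv T φ w := by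
  have hloc : ∀ f : L2 Ω, LocallyIntegrable (Ω.indicator f) := fun f =>
    (integrable_indicator_L2 hΩ f).locallyIntegrable
  have hD : ∀ n j, pderiv j (moll n (Ω.indicator (val w))) = moll n (Ω.indicator (grad w j)) := by
    intro n j
    ext x
    have h1 := hw.integral_mul_pderiv hΩ (contDiff_one (contDiff_rho_sub n x)) j
    simp only [pderiv_rho_sub, mul_neg, integral_neg, neg_inj] at h1
    rw [pderiv_moll (hloc _), moll_indicator hΩ.isOpen]
    simp only [mul_comm (rho d n _), ← h1]
    rw [← integral_indicator hΩ.isOpen.measurableSet]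
    refine congrArg (fun f : Pt d → ℝ => ∫ x, f x) (funext fun y => ?_)
    by_cases hy : y ∈ Ω <;> simp [hy, mul_comm]
  refine ⟨fun n => moll n (Ω.indicator (val w)), fun n => contDiff_moll (hloc _) n,
    fun n j x => ?_, fun T hT => ?_⟩
  · rw [hD, moll_indicator hΩ.isOpen]
    exact abs_integral_rho_le hL0 (hL j) n x
  have key : ∀ (f : L2 Ω) (C : ℝ), 0 ≤ C → (∀ᵐ x ∂volume.restrict Ω, |f x| ≤ C) →
      ∀ s : Pt d → ℝ, Continuous s →
      Tendsto (fun n => intT T (fun x => moll n (Ω.indicator f) x * s x)) atTop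
        (𝓝 (intT T (fun x => f x * s x))) := by
    intro f C hC hf s hs
    refine tendsto_integral_of_dominated_convergence (fun x => C * |s x|) (fun n =>
      ((contDiff_moll (hloc f) n).continuous.mul hs).aestronglyMeasurable)
      (integrableOn_hull (continuous_const.mul hs.abs).continuousOn) (fun n =>
        Eventually.of_forall fun x => ?_) ?_
    · rw [norm_mul, moll_indicator hΩ.isOpen]
      exact mul_le_mul_of_nonneg_right (abs_integral_rho_le hC hf n x) (norm_nonneg _)
    · filter_upwards [ae_restrict_of_ae (ae_tendsto_moll (hloc f)),
        ae_restrict_of_ae (Mesh.hull_ae_le (M := M) hΩ hT),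
        ae_restrict_mem (measurableSet_hull T)] with x h1 h2 h3
      rw [indicator_of_mem (h2 h3)] at h1
      exact h1.mul_const _
  refine fun s hs => ⟨key _ B hB0 hB s hs, fun j => ?_⟩
  simp only [hD]
  exact key _ L hL0 (hL j) s hs

/-- The interpolate of a Lipschitz field has bounded gradients, and face components that are close
to the element components. -/
theorem exists_lipBound_interp (d k : ℕ) (hd : 0 < d) (σ : ℝ) (hσ : 0 < σ) : ∃ C, 0 < C ∧
    ∀ (Ω : Set (Pt d)) (M : Mesh Ω), IsConvexPolytopalDomain Ω → M.IsRegular σ →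
    ∀ u : Fin d → H1 Ω, (∀ i, IsH10 (u i)) → ∀ B L, 0 ≤ B → 0 ≤ L →
      (∀ i, ∀ᵐ x ∂volume.restrict Ω, |val (u i) x| ≤ B) →
        (∀ i j, ∀ᵐ x ∂volume.restrict Ω, |grad (u i) j x| ≤ L) →
    LipBound M (interp M k u) (C * L) := by
  obtain ⟨C₀, hC₀, hst⟩ := exists_interp_stab d k hd
  refine ⟨C₀ * σ * σ * d + (C₀ + C₀ * σ) * d + 1, by positivity,
    fun Ω M hΩ hM u hu B L hB0 hL0 hB hL => ?_⟩
  have main : ∀ T ∈ M.elems, (∀ x ∈ hull T, ∀ i j, |pd T j ((interp M k u).1 T i) x| ≤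
      (C₀ * σ * σ * d) * L) ∧ ∀ F ∈ facesOf T, ∀ x ∈ hull F, ∀ i,
      |(interp M k u).2 F i x - (interp M k u).1 T i x| ≤
        diam T * (((C₀ + C₀ * σ) * d) * L) := by
    intro T hT
    have hTs := isSimplex hT
    have hh := hTs.diam_pos hd
    obtain ⟨b, ρ, hρ, hb, hr⟩ := hM T hT
    have hrat : diam T / ρ ≤ σ := (div_le_iff₀ hρ).2 hr
    obtain ⟨R, hR, hm, he⟩ := interp_elem (k := k) hu hΩ hd hT
    choose φ hφ hφL hφw using fun i => (hu i).exists_weakConv (M := M) hΩ hB0 hL0 (hB i) (hL i)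
    set m := d * L * diam T with hmdef
    have hm0 : 0 ≤ m := by positivity
    have havg : avgT T (fun _ => (1 : ℝ)) = 1 := by simp [avg, hTs.volume_pos.ne']
    have hφc : ∀ i n, ∀ x ∈ hull T, |φ i n x - avgT T (φ i n)| ≤ m := fun i n x hx => by
      have h1 := hTs.isDefinite.moments_close (f := φ i n) (c := φ i n x) (D := m)
        (hφ i n).continuous
        (fun y hy => (Convex.abs_sub_le_of_pderiv (convex_hull T) ((hφ i n).differentiable (by simp))
          (fun x _ j => hφL i n j x) hy hx).trans
          (mul_le_mul_of_nonneg_left (dist_le_diam hy hx) (by positivity)))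
        (z := fun _ => 1) continuous_const (B := 1) (by simp)
      simp only [mul_one, havg] at h1
      rwa [abs_sub_comm] at h1
    have hT1 : ∀ i z, Continuous z → Tendsto (fun n => avgT T (fun x => φ i n x * z x)) atTop
        (𝓝 (avgT T (fun x => val (u i) x * z x))) := fun i z hz =>
      ((hφw i T hT z hz).1).const_mul _
    have hc : ∀ i, Tendsto (fun n => avgT T (φ i n)) atTop (𝓝 (avgT T (val (u i)))) := fun i => by
      simpa using hT1 i (fun _ => 1) continuous_const
    obtain ⟨h1, h2, h3⟩ := hst T hTs b ρ hρ hb R _ _ hR (isData_trace hu hΩ hd hT) hm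
      (fun i => avgT T (val (u i))) m hm0
      (fun i z hz B hB => le_of_tendsto (((hT1 i z (IsPoly.of_pred hz).continuous).sub
        ((hc i).mul_const _)).abs) (Eventually.of_forall fun n =>
        hTs.isDefinite.moments_close (hφ i n).continuous (hφc i n)
          (IsPoly.of_pred hz).continuous hB))
      (fun F hF i z hz B hB => by
        obtain ⟨a, ha, rfl⟩ := hTs.exists_erase hF
        have hz' : ContDiff ℝ 1 z := contDiff_one hz.contDiff
        have hlim := (hφw i T hT).tendsto_intF hTs hd ha (hφ i) hz'
        rw [← (hu i).intF_trace hΩ hd hT ha hz'] at hlim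
        exact le_of_tendsto ((hlim.const_mul _).sub ((hc i).mul_const _)).abs
          (Eventually.of_forall fun n => (hTs.isDefinite_face hd hF).moments_close (hφ i n).continuous
            (fun x hx => hφc i n x (hull_face_subset hF hx)) hz.continuous hB))
    refine ⟨fun x hx i j => ?_, fun F hF x hx i => ?_⟩
    · rw [he, pd_indicator hTs ((hR.isPoly i).differentiable) j hx]
      refine (h2 i j x hx).trans ?_
      have e : C₀ * (diam T / ρ) * ρ⁻¹ * m = C₀ * (diam T / ρ) * (diam T / ρ) * d * L := by
        rw [hmdef]; field_simp
      rw [e]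
      gcongr
    · obtain ⟨p, hp, hpe, hpm⟩ := interp_face (k := k) hu hΩ hd (mem_faces_of_facesOf hd hT hF) i
      have g1 := h3 F hF i p hp hpm x hx
      have g2 := h1 i x (hull_face_subset hF hx)
      rw [hpe, he, indicator_of_mem hx]
      simp only [indicator_of_mem (hull_face_subset hF hx)]
      have e : p x - R i x = (p x - avgT T (val (u i))) - (R i x - avgT T (val (u i))) := by ring
      rw [e]
      refine (abs_sub _ _).trans ((add_le_add g1 g2).trans ?_)
      have : C₀ * (diam T / ρ) * m ≤ C₀ * σ * m := by gcongr
      rw [hmdef] at this ⊢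
      nlinarith
  refine ⟨fun T hT x hx i j => ((main T hT).1 x hx i j).trans ?_,
    fun T hT F hF x hx i => ((main T hT).2 F hF x hx i).trans ?_⟩
  · have : 0 ≤ (C₀ + C₀ * σ) * d := by positivity
    gcongr
    linarith
  · have : 0 ≤ C₀ * σ * σ * d := by positivity
    have h0 : 0 ≤ diam T := Metric.diam_nonneg
    gcongr
    linarith

/-! ### The strong form of the equations and the pressure -/

open IsTest

theorem exists_isClassOf (hΩ : IsConvexPolytopalDomain Ω) (h : IsTest Ω φ) :
    ∃ v : H1 Ω, IsClassOf v φ := by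
  have h1 := h.memLp (volume.restrict Ω)
  have h2 := fun j => h.memLp_pderiv j (volume.restrict Ω)
  refine ⟨⟨WithLp.toLp 2 fun o => o.elim h1.toLp fun j => (h2 j).toLp, fun j s hs => ?_⟩,
    h, h1.coeFn_toLp, fun j => (h2 j).coeFn_toLp⟩
  refine Eq.trans ?_ ((integral_mul_pderiv hΩ h (contDiff_one hs.1) j).trans (congrArg Neg.neg ?_))
  · exact integral_congr_ae (by filter_upwards [h1.coeFn_toLp] with x hx; exact congrArg (· * _) hx)
  · exact integral_congr_ae (by
      filter_upwards [(h2 j).coeFn_toLp] with x hx; exact congrArg (· * _) hx.symm)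

theorem moll_eq_zero {S : Set (Pt d)} (hg : ∀ x ∉ S, g x = 0) {n : ℕ}
    (h : moll n g x ≠ 0) : ∃ y ∈ S, ‖x - y‖ < (bump d n).rOut := by
  by_contra! hc
  refine h (integral_eq_zero_of_ae (Eventually.of_forall fun y => ?_))
  by_cases hy : y ∈ S
  · have : x - y ∉ Function.support (rho d n) := by
      rw [rho, (bump d n).support_normed_eq, mem_ball_zero_iff, not_lt]
      exact hc y hy
    simp [Function.notMem_support.1 this]
  · simp [hg y hy]

theorem MemU.integrable_elem (hd : 0 < d) (hz : MemU M k z) (hT : T ∈ M.elems) (i : Fin d) :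
    Integrable (z.1 T i) := by
  obtain ⟨R, hR, he⟩ := (hz.isLocal hd hT).elem_eq
  rw [he]
  exact (integrableOn_hull (hR.continuous i).continuousOn).integrable_indicator
    (measurableSet_hull T)

theorem MemU.exists_bound (hd : 0 < d) (hz : MemU M k z) :
    ∃ B, 0 ≤ B ∧ ∀ i x, |broken M z i x| ≤ B := by
  have h : ∀ T ∈ M.elems, ∀ i, ∃ B, 0 ≤ B ∧ ∀ x, |z.1 T i x| ≤ B := fun T hT i => by
    obtain ⟨R, hR, he⟩ := (hz.isLocal hd hT).elem_eq
    obtain ⟨B, hB⟩ := (isCompact_hull T).exists_bound_of_continuousOn (hR.continuous i).continuousOn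
    refine ⟨max B 0, le_max_right _ _, fun x => ?_⟩
    by_cases hx : x ∈ hull T
    · simpa [he, hx] using Or.inl (hB x hx)
    · simp [he, hx]
  choose! B hB0 hB using h
  refine ⟨∑ i, ∑ T ∈ M.elems, B T i, sum_nonneg fun i _ => sum_nonneg fun T hT =>
    hB0 T hT i, fun i x => (abs_sum_le_sum_abs _ _).trans
      ((sum_le_sum fun T hT => hB T hT i x).trans ?_)⟩
  exact single_le_sum (f := fun i => ∑ T ∈ M.elems, B T i)
    (fun i _ => sum_nonneg fun T hT => hB0 T hT i) (Finset.mem_univ i)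

theorem MemU.integrable_broken (hd : 0 < d) (hz : MemU M k z) (i : Fin d) :
    Integrable (broken M z i) :=
  integrable_finsetSum M.elems fun _ hT => hz.integrable_elem hd hT i

theorem MemU.memLp_broken (hd : 0 < d) (hz : MemU M k z) (hΩ : IsConvexPolytopalDomain Ω)
    (i : Fin d) : MemLp (broken M z i) 2 (volume.restrict Ω) := by
  have := finite_restrict hΩ
  obtain ⟨B, -, hB⟩ := hz.exists_bound hd
  exact MemLp.of_bound (hz.integrable_broken hd i).aestronglyMeasurable.restrict B
    (Eventually.of_forall fun x => hB i x)

theorem Mesh.ae_notMem_frontier (M : Mesh Ω) : ∀ᵐ x, ∀ T ∈ M.elems, x ∉ frontier (hull T) :=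
  (ae_ball_iff (countable_toSet _)).2 fun T _ =>
    measure_eq_zero_iff_ae_notMem.1 (Convex.addHaar_frontier volume (convex_hull T))

theorem MemU.ae_continuousAt (hd : 0 < d) (hz : MemU M k z) :
    ∀ᵐ x, ∀ i, ContinuousAt (broken M z i) x := by
  filter_upwards [M.ae_notMem_frontier] with x hx i
  refine tendsto_finsetSum M.elems fun T hT => ?_
  obtain ⟨R, hR, he⟩ := (hz.isLocal hd hT).elem_eq
  rw [he]
  exact (hR.continuous i).continuousOn.continuousAt_indicator (hx T hT)

/-- The extension by zero of a discrete divergence-free field is weakly divergence-free. -/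
theorem IsDivFree.integral_broken (hd : 0 < d) (hz : MemU M k z) (h : IsDivFree M z)
    (hs : ContDiff ℝ 1 s) (hB : ∃ B, ∀ i x, |pderiv i s x| ≤ B) :
    ∑ i, ∫ x, broken M z i x * pderiv i s x = 0 := by
  obtain ⟨B, hB⟩ := hB
  have hi : ∀ i, ∀ T ∈ M.elems, Integrable fun x => z.1 T i x * pderiv i s x := fun i T hT =>
    (hz.integrable_elem hd hT i).mul_bdd (continuous_pderiv hs i).aestronglyMeasurable
      (Eventually.of_forall (hB i))
  have e1 : ∀ i, ∫ x, broken M z i x * pderiv i s x =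
      ∑ T ∈ M.elems, intT T (fun x => z.1 T i x * pderiv i s x) := fun i => by
    simp only [broken, sum_mul]
    rw [integral_finsetSum _ fun T hT => hi i T hT]
    refine sum_congr rfl fun T hT => (setIntegral_eq_integral_of_forall_compl_eq_zero
      fun x hx => ?_).symm
    obtain ⟨R, hR, he⟩ := (hz.isLocal hd hT).elem_eq
    simp [he, hx]
  rw [sum_congr rfl fun i _ => e1 i, sum_comm,
    ← sum_intF_flux_eq_zero hd hz h fun _ _ => hs.continuous.continuousOn]
  refine sum_congr rfl fun T hT => ?_
  have e2 := hz.intT_mul_grad hd hT hs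
  rw [intT_congr (f := fun x => s x * ∑ i, pd T i (z.1 T i) x) (g := fun _ => 0) fun x hx => by
    rw [h.elem T hT x hx, mul_zero], show intT T (fun _ => 0) = 0 by simp [intT], neg_zero,
    zero_add] at e2
  rw [← e2]
  exact (integral_finsetSum _ fun i _ => (hi i T hT).integrableOn).symm

theorem broken_eq_zero (hd : 0 < d) (hz : MemU M k z) (hΩ : IsOpen Ω) (i : Fin d)
    (hx : x ∉ closure Ω) : broken M z i x = 0 := by
  refine sum_eq_zero fun T hT => ?_
  obtain ⟨R, hR, he⟩ := (hz.isLocal hd hT).elem_eq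
  have hx' : x ∉ hull T := fun h => hx (Mesh.hull_subset (M := M) hΩ hT h)
  simp [he, hx']

theorem pderiv_comp_affine (hφ : Differentiable ℝ φ) (c : ℝ) (b : Pt d) (j : Fin d)
    (x : Pt d) : pderiv j (fun x => φ (c • x + b)) x = c * pderiv j φ (c • x + b) := by
  have h := ((hφ (c • x + b)).hasFDerivAt.comp x
    (((hasFDerivAt_id x).const_smul c).add_const b)).fderiv
  refine (congrArg (fun l : Pt d →L[ℝ] ℝ => l (e j)) h).trans ?_
  simp [pderiv]

/-- Gradients are orthogonal to discrete divergence-free fields, which are limits of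
divergence-free test fields: dilate the extension by zero into the domain, and mollify. -/
theorem IsDivFree.integral_grad_mul (hd : 0 < d) (hΩ : IsConvexPolytopalDomain Ω)
    (hz : MemU M k z) (h : IsDivFree M z) (P : H1 Ω) :
    ∫ x in Ω, ∑ i, grad P i x * broken M z i x = 0 := by
  obtain ⟨x₀, hx₀⟩ := hΩ.nonempty
  obtain ⟨B, hB0, hB⟩ := hz.exists_bound hd
  have hloc := fun i => (hz.integrable_broken hd i).locallyIntegrable
  set l : ℕ → ℝ := fun m => 1 + 1 / (m + 1) with hl
  have hl1 : ∀ m, 1 < l m := fun m => lt_add_of_pos_right _ (by positivity)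
  have hl0 : ∀ m, 0 < l m := fun m => one_pos.trans (hl1 m)
  set A : ℕ → Pt d → Pt d := fun m x => l m • x + (x₀ - l m • x₀) with hA
  set K : ℕ → Set (Pt d) := fun m => (fun y => y + (1 - (l m)⁻¹) • (x₀ - y)) '' closure Ω
  have hKc : ∀ m, IsCompact (K m) := fun m => hΩ.bounded.isCompact_closure.image (by fun_prop)
  have hKΩ : ∀ m, K m ⊆ Ω := by
    rintro m _ ⟨y, hy, rfl⟩
    have h1 := inv_lt_one_of_one_lt₀ (hl1 m)
    have := hΩ.convex.add_smul_sub_mem_interior' hy (hΩ.isOpen.interior_eq.symm ▸ hx₀)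
      (t := 1 - (l m)⁻¹) ⟨by linarith, by linarith [inv_pos.2 (hl0 m)]⟩
    rwa [hΩ.isOpen.interior_eq] at this
  choose δ hδ hδΩ using fun m => (hKc m).exists_cthickening_subset_open hΩ.isOpen (hKΩ m)
  have hN : ∀ m : ℕ, ∃ n, m ≤ n ∧ (bump d n).rOut ≤ δ m := fun m =>
    ((eventually_ge_atTop m).and ((tendsto_rOut d).eventually_le_const (hδ m))).exists
  choose N hNm hN using hN
  set ψ : ℕ → Fin d → Pt d → ℝ := fun m i x => moll (N m) (broken M z i) (A m x) with hψ
  have hψt : ∀ m i, IsTest Ω (ψ m i) := by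
    intro m i
    have hs : Function.support (ψ m i) ⊆ Metric.cthickening (δ m) (K m) := fun x hx => by
      obtain ⟨y, hy, hxy⟩ := moll_eq_zero (fun y => broken_eq_zero hd hz hΩ.isOpen i) hx
      refine Metric.mem_cthickening_of_dist_le _ _ _ _ ⟨y, hy, rfl⟩ ?_
      have e : x - (y + (1 - (l m)⁻¹) • (x₀ - y)) = (l m)⁻¹ • (A m x - y) := by
        have : x = (l m)⁻¹ • l m • x := by rw [inv_smul_smul₀ (hl0 m).ne']
        simp only [hA, smul_sub, smul_add, inv_smul_smul₀ (hl0 m).ne', sub_smul, one_smul]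
        abel
      rw [dist_eq_norm]
      simp only [e]
      rw [norm_smul, norm_of_nonneg (inv_pos.2 (hl0 m)).le]
      calc _ ≤ 1 * ‖A m x - y‖ := by gcongr; exact (inv_lt_one_of_one_lt₀ (hl1 m)).le
        _ ≤ δ m := by rw [one_mul]; exact hxy.le.trans (hN m)
    exact ⟨(contDiff_moll (hloc i) _).comp (by fun_prop),
      HasCompactSupport.of_support_subset_isCompact (hKc m).cthickening hs,
      (closure_minimal hs Metric.isClosed_cthickening).trans (hδΩ m)⟩
  have hdiv : ∀ m x, ∑ i, pderiv i (ψ m i) x = 0 := by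
    intro m x
    have h1 : ContDiff ℝ 1 fun y => rho d (N m) (A m x - y) := contDiff_one (contDiff_rho_sub _ _)
    have hb : ∃ B, ∀ i y, |pderiv i (fun y => rho d (N m) (A m x - y)) y| ≤ B := by
      have hc := ((contDiff_rho (d := d) (N m)).continuous_fderiv (by simp))
      obtain ⟨C, hC⟩ := hc.bounded_above_of_compact_support
        ((bump d (N m)).hasCompactSupport_normed.fderiv (𝕜 := ℝ))
      refine ⟨C, fun i y => ?_⟩
      rw [pderiv_rho_sub, abs_neg]
      refine ((fderiv ℝ (rho d (N m)) (A m x - y)).le_opNorm (e i)).trans ?_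
      simpa [e] using hC (A m x - y)
    have h2 := h.integral_broken hd hz h1 hb
    simp only [pderiv_rho_sub] at h2
    simp only [hψ, hA, pderiv_comp_affine ((contDiff_moll (hloc _) _).differentiable (by simp)),
      pderiv_moll (hloc _), ← mul_sum]
    rw [mul_eq_zero]
    right
    rw [← neg_eq_zero, ← sum_neg_distrib, ← h2]
    refine sum_congr rfl fun i _ => ?_
    rw [← integral_neg]
    exact congrArg (fun f : Pt d → ℝ => ∫ x, f x) (funext fun y => by ring)
  have hI : ∀ (i : Fin d) {φ : Pt d → ℝ}, MemLp φ 2 (volume.restrict Ω) →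
      IntegrableOn (fun x => grad P i x * φ x) Ω := fun i _ hφ => (Lp.memLp _).integrable_mul hφ
  have h0 : ∀ m, ∫ x in Ω, ∑ i, grad P i x * ψ m i x = 0 := by
    intro m
    have i2 : ∀ i, IntegrableOn (fun x => val P x * pderiv i (ψ m i) x) Ω := fun i =>
      (Lp.memLp _).integrable_mul ((hψt m i).memLp_pderiv i _)
    have e1 : ∀ i, ∫ x in Ω, grad P i x * ψ m i x = - ∫ x in Ω, val P x * pderiv i (ψ m i) x :=
      fun i => (neg_eq_iff_eq_neg.2 (P.2 i _ (hψt m i))).symm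
    rw [integral_finsetSum _ fun i _ => hI i ((hψt m i).memLp _), sum_congr rfl fun i _ => e1 i,
      sum_neg_distrib, ← integral_finsetSum _ fun i _ => i2 i]
    simp [← mul_sum, hdiv]
  refine tendsto_nhds_unique (f := fun m => ∫ x in Ω, ∑ i, grad P i x * ψ m i x) (l := atTop) ?_
    (by simp [h0])
  refine tendsto_integral_of_dominated_convergence (fun x => ∑ i, |grad P i x| * B) (fun m =>
    (integrable_finsetSum _ fun i _ => hI i ((hψt m i).memLp _)).aestronglyMeasurable)
    (integrable_finsetSum _ fun i _ => ?_) (fun m => Eventually.of_forall fun x => ?_) ?_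
  · have := finite_restrict hΩ
    exact ((Lp.memLp _).integrable one_le_two).abs.mul_const B
  · refine (norm_sum_le _ _).trans (sum_le_sum fun i _ => ?_)
    rw [norm_mul]
    refine mul_le_mul_of_nonneg_left ?_ (abs_nonneg _)
    have := abs_integral_rho_le (S := univ) hB0 (Eventually.of_forall (hB i)) (N m) (A m x)
    rwa [Measure.restrict_univ] at this
  · filter_upwards [ae_restrict_of_ae (hz.ae_continuousAt hd)] with x hx
    refine tendsto_finsetSum _ fun i _ => Tendsto.const_mul _ ?_
    have hAx : Tendsto (fun m => A m x) atTop (𝓝 x) := by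
      have h1 : Tendsto l atTop (𝓝 1) := by
        simpa [hl] using (tendsto_one_div_add_atTop_nhds_zero_nat (𝕜 := ℝ)).const_add 1
      have h2 := (h1.smul_const x).add ((tendsto_const_nhds (x := x₀)).sub (h1.smul_const x₀))
      simpa using h2
    simp only [hψ, moll_eq]
    refine ContDiffBump.convolution_tendsto_right (φ := fun m => bump d (N m))
      (g := fun _ => broken M z i) ((tendsto_rOut d).comp (tendsto_atTop_mono hNm tendsto_id))
      (Eventually.of_forall fun _ => (hz.integrable_broken hd i).aestronglyMeasurable)
      ((hx i).tendsto.comp tendsto_snd) hAx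

theorem setIntegral_of_tsupport {U : Set (Pt d)} (hU : U ⊆ Ω)
    (h : tsupport φ ⊆ U) : ∫ x in Ω, f x * φ x = ∫ x in U, f x * φ x := by
  have h1 : ∀ V : Set (Pt d), U ⊆ V → ∫ x in V, f x * φ x = ∫ x, f x * φ x := fun V hV =>
    setIntegral_eq_integral_of_forall_compl_eq_zero fun x hx => by
      rw [image_eq_zero_of_notMem_tsupport fun h' => hx (hV (h h')), mul_zero]
  rw [h1 Ω hU, h1 U Subset.rfl]

set_option maxHeartbeats 800000 in
/-- The strong form of the equations in the elements. -/
theorem strong_form (hΩ : IsConvexPolytopalDomain Ω) {G : Fin d → Pt d → ℝ}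
    (hG : ∀ i, MemLp (G i) 2 (volume.restrict Ω)) {ν : ℝ} {u : Fin d → H1 Ω} {P : H1 Ω}
    (hw : ∀ v : Fin d → H1 Ω, (∀ i, IsH10 (v i)) →
      (∫ x in Ω, ∑ i, G i x * val (v i) x) + ν * aCont u v + BCont v (val P) = 0)
        (hH : ∀ i, ∃ H, IsBrokenHess M (u i) H) (i : Fin d) :
    ∀ᵐ x ∂volume.restrict Ω, G i x - ν * lap M (u i) x + grad P i x = 0 := by
  have hfin := finite_restrict hΩ
  have hsub : ∀ T ∈ M.elems, interior (hull T) ⊆ Ω := fun T hT => by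
    rw [← (hΩ.isOpen.interior_eq), ← hΩ.convex.interior_closure_eq_interior_of_nonempty_interior
      (hΩ.isOpen.interior_eq.symm ▸ hΩ.nonempty)]
    exact interior_mono (Mesh.hull_subset (M := M) hΩ.isOpen hT)
  set H := Classical.epsilon fun H : Fin d → Fin d → L2 Ω => IsBrokenHess M (u i) H with hHdef
  have hHs : IsBrokenHess M (u i) H := Classical.epsilon_spec (hH i)
  have hlap : lap M (u i) = ∑ j, H j j := rfl
  set f : Pt d → ℝ := fun x => G i x - ν * lap M (u i) x + grad P i x with hf
  have hf2 : MemLp f 2 (volume.restrict Ω) := ((hG i).sub ((Lp.memLp _).const_mul ν)).add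
    (Lp.memLp _)
  have key : ∀ T ∈ M.elems, ∀ᵐ x, x ∈ interior (hull T) → f x = 0 := by
    intro T hT
    have hle : volume.restrict (interior (hull T)) ≤ volume.restrict Ω :=
      Measure.restrict_mono (hsub T hT) le_rfl
    refine isOpen_interior.ae_eq_zero_of_integral_contDiff_smul_eq_zero
      (IntegrableOn.locallyIntegrableOn ((hf2.integrable one_le_two).mono_measure hle))
      fun φ h1 h2 h3 => ?_
    have hφ : IsTest Ω φ := ⟨h1, h2, h3.trans (hsub T hT)⟩
    obtain ⟨v, hv⟩ := exists_isClassOf hΩ hφ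
    have hv0 : IsH10 v := subset_closure ⟨φ, hv⟩
    have h0 := hw (Pi.single i v) fun i' => by
      by_cases hi : i' = i
      · subst hi; simpa using hv0
      · rw [Pi.single_eq_of_ne hi]
        exact subset_closure ⟨0, ⟨contDiff_const, HasCompactSupport.zero, by simp⟩,
          Lp.coeFn_zero _ _ _, fun j => (Lp.coeFn_zero _ _ _).trans (by
            filter_upwards with x; simp [pderiv])⟩
    have hs : ∀ᵐ x ∂volume.restrict Ω, ∀ i',
        val ((Pi.single i v : Fin d → H1 Ω) i') x = (if i' = i then φ x else 0) ∧
        ∀ j, grad ((Pi.single i v : Fin d → H1 Ω) i') j x = if i' = i then pderiv j φ x else 0 := by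
      have z : ∀ o : Option (Fin d), ∀ᵐ x ∂volume.restrict Ω, ((0 : H1 Ω).1 o : L2 Ω) x = 0 :=
        fun o => Lp.coeFn_zero _ _ _
      filter_upwards [ae_all_iff.2 z, hv.2.1, ae_all_iff.2 hv.2.2] with x hz h1 h2 i'
      by_cases h : i' = i
      · subst h; simpa using ⟨h1, h2⟩
      · rw [Pi.single_eq_of_ne h, if_neg h]
        exact ⟨hz none, fun j => (hz (some j)).trans (if_neg h).symm⟩
    have e1 : ∫ x in Ω, ∑ i', G i' x * val ((Pi.single i v : Fin d → H1 Ω) i') x =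
        ∫ x in Ω, G i x * φ x := integral_congr_ae (by
      filter_upwards [hs] with x hx; simp [(hx _).1])
    have e2 : aCont u (Pi.single i v) = ∑ j, ∫ x in Ω, grad (u i) j x * pderiv j φ x := by
      have ij : ∀ j, IntegrableOn (fun x => grad (u i) j x * pderiv j φ x) Ω := fun j =>
        (Lp.memLp _).integrable_mul (hφ.memLp_pderiv j _)
      rw [← integral_finsetSum _ fun j _ => ij j]
      refine integral_congr_ae ?_
      filter_upwards [hs] with x hx
      rw [sum_comm]
      simp [(hx _).2]
    have e3 : BCont (Pi.single i v) (val P) = ∫ x in Ω, grad P i x * φ x := by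
      have e4 : ∫ x in Ω, div (Pi.single i v : Fin d → H1 Ω) x * val P x =
          ∫ x in Ω, val P x * pderiv i φ x := integral_congr_ae (by
        filter_upwards [hs] with x hx; simp [div, (hx _).2, mul_comm])
      rw [BCont, e4]
      exact neg_eq_iff_eq_neg.2 (P.2 i φ hφ)
    have e5 : ∑ j, ∫ x in Ω, grad (u i) j x * pderiv j φ x = - ∫ x in Ω, lap M (u i) x * φ x := by
      have hj : ∀ j, ∫ x in Ω, grad
        (u i) j x * pderiv j φ x = - ∫ x in Ω, H j j x * φ x := fun j => by
        have h4 : tsupport (pderiv j φ) ⊆ interior (hull T) :=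
          (tsupport_fderiv_apply_subset ℝ (e j)).trans h3
        rw [setIntegral_of_tsupport (hsub T hT) h4, setIntegral_of_tsupport (hsub T hT) h3]
        exact hHs T hT j j φ ⟨h1, h2, h3⟩
      have ij : ∀ j, IntegrableOn (fun x => H j j x * φ x) Ω := fun j =>
        (Lp.memLp _).integrable_mul (hφ.memLp _)
      rw [sum_congr rfl fun j _ => hj j, sum_neg_distrib,
        ← integral_finsetSum _ fun j _ => ij j, hlap]
      refine congrArg Neg.neg (integral_congr_ae ?_)
      filter_upwards [Lp.coeFn_finsetSum Finset.univ fun j => H j j] with x hx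
      rw [hx, Finset.sum_apply, sum_mul]
    rw [e1, e2, e3, e5] at h0
    have i1 : IntegrableOn (fun x => G i x * φ x) Ω := (hG i).integrable_mul (hφ.memLp _)
    have i2 : IntegrableOn (fun x => ν * (lap M (u i) x * φ x)) Ω :=
      ((Lp.memLp _).integrable_mul (hφ.memLp _)).const_mul ν
    have i3 : IntegrableOn (fun x => grad P i x * φ x) Ω := (Lp.memLp _).integrable_mul (hφ.memLp _)
    have e6 : ∫ x, φ x • f x = ∫ x in Ω, (G i x * φ x - ν * (lap M (u i) x * φ x) +
        grad P i x * φ x) := by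
      rw [← setIntegral_eq_integral_of_forall_compl_eq_zero (s := Ω) fun x hx => by
        rw [image_eq_zero_of_notMem_tsupport fun h' => hx (hφ.2.2 h'), zero_smul]]
      exact congrArg (fun f : Pt d → ℝ => ∫ x in Ω, f x) (funext fun x => by
        simp only [hf, smul_eq_mul]; ring)
    have i12 : IntegrableOn (fun x => G i x * φ x - ν * (lap M (u i) x * φ x)) Ω := i1.sub i2
    rw [e6, integral_add i12 i3, integral_sub i1 i2, integral_const_mul, ← h0]
    ring
  have hall := (ae_ball_iff (countable_toSet M.elems)).2 key
  filter_upwards [ae_restrict_of_ae hall, ae_restrict_of_ae M.ae_notMem_frontier,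
    ae_restrict_mem hΩ.isOpen.measurableSet] with x h1 h2 h3
  have h4 : x ∈ ⋃ T ∈ M.elems, hull T := Mesh.closure_eq (M := M) hΩ.isOpen ▸ subset_closure h3
  obtain ⟨T, hT, hx⟩ := mem_iUnion₂.1 h4
  refine h1 T hT (by_contra fun h => h2 T hT ⟨subset_closure hx, h⟩)

/-- Discrete divergence-free fields can be used as test functions in the equations: the pressure
disappears. -/
theorem IsDivFree.weak_form (hd : 0 < d) (hΩ : IsConvexPolytopalDomain Ω) (hz : MemU M k z)
    (h : IsDivFree M z) {G : Fin d → Pt d → ℝ} (hG : ∀ i, MemLp (G i) 2 (volume.restrict Ω))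
    {ν : ℝ} {u : Fin d → H1 Ω} {P : H1 Ω} (hw : ∀ v : Fin d → H1 Ω, (∀ i, IsH10 (v i)) →
      (∫ x in Ω, ∑ i, G i x * val (v i) x) + ν * aCont u v + BCont v (val P) = 0)
        (hH : ∀ i, ∃ H, IsBrokenHess M (u i) H) :
    ∫ x in Ω, ∑ i, G i x * broken M z i x = ν * ∫ x in Ω, ∑ i, lap M (u i) x * broken M z i x := by
  have hi : ∀ {G : Fin d → Pt d → ℝ}, (∀ i, MemLp (G i) 2 (volume.restrict Ω)) →
      IntegrableOn (fun x => ∑ i, G i x * broken M z i x) Ω := fun hG =>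
    integrable_finsetSum _ fun i _ => (hG i).integrable_mul (hz.memLp_broken hd hΩ i)
  have i2 : IntegrableOn (fun x => ν * ∑ i, lap M (u i) x * broken M z i x) Ω :=
    (hi fun i => Lp.memLp (lap M (u i))).const_mul ν
  have i3 : IntegrableOn (fun x => ∑ i, grad P i x * broken M z i x) Ω := hi fun i => Lp.memLp _
  have i12 : IntegrableOn (fun x => ∑ i, G i x * broken M z i x -
      ν * ∑ i, lap M (u i) x * broken M z i x) Ω := (hi hG).sub i2
  have e : ∫ x in Ω, (∑ i, G i x * broken M z i x - ν * ∑ i, lap M (u i) x * broken M z i x +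
      ∑ i, grad P i x * broken M z i x) = 0 := by
    refine integral_eq_zero_of_ae ?_
    filter_upwards [ae_all_iff.2 (strong_form hΩ hG hw hH)] with x hx
    simp only [Pi.zero_apply, mul_sum, ← sum_sub_distrib, ← sum_add_distrib]
    exact sum_eq_zero fun i _ => by linear_combination broken M z i x * hx i
  rw [integral_add i12 i3, integral_sub (hi hG) i2, integral_const_mul,
    h.integral_grad_mul hd hΩ hz P, add_zero] at e
  exact sub_eq_zero.1 e

/-! ### A Grönwall inequality with an integrable coefficient -/

section Gronwall

variable {T : ℝ}

theorem absolutelyContinuous_exp_neg {Φ : ℝ → ℝ} {a b : ℝ}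
    (h : AbsolutelyContinuousOnInterval Φ a b)
    (h0 : ∀ x ∈ uIcc a b, 0 ≤ Φ x) :
    AbsolutelyContinuousOnInterval (fun x => exp (-Φ x)) a b := by
  have key : ∀ {p q : ℝ}, 0 ≤ p → 0 ≤ q → |exp (-p) - exp (-q)| ≤ |p - q| := by
    intro p q hp hq
    wlog hpq : p ≤ q generalizing p q
    · rw [abs_sub_comm, abs_sub_comm p]; exact this hq hp (le_of_not_ge hpq)
    rw [abs_of_nonneg (sub_nonneg.2 (exp_le_exp.2 (neg_le_neg hpq))), abs_sub_comm,
      abs_of_nonneg (sub_nonneg.2 hpq)]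
    have h1 := Real.add_one_le_exp (p - q)
    have h2 : exp (-q) = exp (-p) * exp (p - q) := by rw [← exp_add]; ring_nf
    have h3 : exp (-p) ≤ 1 := exp_le_one_iff.2 (by linarith)
    rw [h2]
    nlinarith [exp_pos (-p)]
  refine squeeze_zero' (Eventually.of_forall fun E => sum_nonneg fun _ _ => dist_nonneg) ?_ h
  refine eventually_inf_principal.2 (Eventually.of_forall fun E hE => sum_le_sum fun i hi => ?_)
  exact key (h0 _ (hE.1 i hi).1) (h0 _ (hE.1 i hi).2)

/-- The coefficient `Λ` is only integrable, and `E` need not be measurable. -/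
theorem gronwall (hT : 0 < T) {y Λ D E : ℝ → ℝ} (hy : ContDiffOn ℝ 1 y (Icc 0 T)) (hy0 : y 0 = 0)
    (hyn : ∀ t ∈ Icc 0 T, 0 ≤ y t)
    (hΛ : IntervalIntegrable Λ volume 0 T) (hΛ0 : ∀ t, 0 ≤ Λ t) (hD : ContinuousOn D (Ioc 0 T))
    (hD0 : ∀ t ∈ Ioc 0 T, 0 ≤ D t) (hE : ∀ᵐ t ∂volume.restrict (Ioo 0 T),
      derivWithin y (Icc 0 T) t + D t ≤ |E t| + Λ t * y t)
        (hfin : ∫⁻ t in Ioc 0 T, ofReal |E t| ≠ ⊤) : (∀ t ∈ Icc 0 T, y t ≤ exp (∫ s in 0..T, Λ s) *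
      (∫⁻ t in Ioc 0 T, ofReal |E t|).toReal) ∧
    ∫⁻ t in Ioc 0 T, ofReal (D t) ≤ ofReal (exp (∫ s in 0..T, Λ s) *
      (∫⁻ t in Ioc 0 T, ofReal |E t|).toReal) := by
  set A := (∫⁻ t in Ioc 0 T, ofReal |E t|).toReal
  set Φ : ℝ → ℝ := fun x => ∫ s in 0..x, Λ s with hΦ
  set ψ : ℝ → ℝ := fun x => exp (-Φ x) with hψ
  have hu : uIcc 0 T = Icc 0 T := uIcc_of_le hT.le
  have hΦ0 : ∀ x ∈ Icc 0 T, 0 ≤ Φ x := fun x hx =>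
    intervalIntegral.integral_nonneg hx.1 fun s _ => hΛ0 s
  have hΦT : ∀ x ∈ Icc 0 T, Φ x ≤ Φ T := fun x hx =>
    intervalIntegral.integral_mono_interval le_rfl hx.1 hx.2 (Eventually.of_forall hΛ0) hΛ
  have hψ1 : ∀ x ∈ Icc 0 T, ψ x ≤ 1 := fun x hx => exp_le_one_iff.2 (by linarith [hΦ0 x hx])
  have hψe : ∀ x, exp (Φ x) * ψ x = 1 := fun x => by rw [← exp_add]; simp
  have hψac : AbsolutelyContinuousOnInterval ψ 0 T := absolutelyContinuous_exp_neg
    (hΛ.absolutelyContinuousOnInterval_intervalIntegral (by simp)) (hu ▸ hΦ0)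
  have hP := hψac.fun_mul (ContDiffOn.absolutelyContinuousOnInterval (hu ▸ hy))
  set P : ℝ → ℝ := fun x => ψ x * y x with hPdef
  set h : ℝ → ℝ := deriv P with hh
  have hFTC : ∀ t ∈ Icc 0 T, ∫ s in 0..t, h s = ψ t * y t := fun t ht => by
    rw [(hP.mono (uIcc_subset_uIcc (by simp) (hu ▸ ht))).integral_deriv_eq_sub]
    simp [hPdef, hy0]
  have hhi : IntegrableOn h (Ioc 0 T) :=
    (intervalIntegrable_iff_integrableOn_Ioc_of_le hT.le).1 hP.intervalIntegrable_deriv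
  have hae : ∀ᵐ t ∂volume.restrict (Ioc 0 T), h t + ψ t * D t ≤ |E t| := by
    rw [← restrict_Ioo_eq_restrict_Ioc]
    filter_upwards [hE, ae_restrict_of_ae hΛ.ae_hasDerivAt_integral, ae_restrict_mem measurableSet_Ioo]
      with t h1 h2 h3
    have ht : t ∈ Icc 0 T := Ioo_subset_Icc_self h3
    have d1 : HasDerivAt Φ (Λ t) t := h2 (hu ▸ ht) 0 (by simp)
    have d2 : HasDerivAt y (derivWithin y (Icc 0 T) t) t :=
      ((hy.differentiableOn one_ne_zero t ht).hasDerivWithinAt).hasDerivAt (Icc_mem_nhds h3.1 h3.2)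
    have d3 : h t = _ := (d1.neg.exp.mul d2).deriv
    have hp : 0 < ψ t := exp_pos _
    have : h t = ψ t * (derivWithin y (Icc 0 T) t - Λ t * y t) := by
      rw [d3]; simp only [hψ, Pi.neg_apply]; ring
    rw [this]
    nlinarith [hψ1 t ht, abs_nonneg (E t)]
  have hDm : AEStronglyMeasurable (fun t => ψ t * D t) (volume.restrict (Ioc 0 T)) :=
    (((hu ▸ hψac.continuousOn).mono Ioc_subset_Icc_self).mul hD).aestronglyMeasurable measurableSet_Ioc
  have hD0' : ∀ᵐ t ∂volume.restrict (Ioc 0 T), 0 ≤ ψ t * D t := by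
    filter_upwards [ae_restrict_mem measurableSet_Ioc] with t ht
    exact mul_nonneg (exp_pos _).le (hD0 t ht)
  have hDi : IntegrableOn (fun t => ψ t * D t) (Ioc 0 T) := by
    refine ⟨hDm, (hasFiniteIntegral_iff_ofReal hD0').2 ?_⟩
    have h1 : ∫⁻ t in Ioc 0 T, ofReal (ψ t * D t) ≤
        ∫⁻ t in Ioc 0 T, (‖h t‖ₑ + ofReal |E t|) := lintegral_mono_ae (by
      filter_upwards [hae] with t ht
      rw [Real.enorm_eq_ofReal_abs, ← ofReal_add (abs_nonneg _) (abs_nonneg _)]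
      exact ofReal_le_ofReal (by linarith [neg_abs_le (h t)]))
    rw [lintegral_add_left' hhi.1.enorm] at h1
    exact h1.trans_lt (ENNReal.add_lt_top.2 ⟨hhi.2, hfin.lt_top⟩)
  have hsub : ∀ t ∈ Icc 0 T, volume.restrict (Ioc 0 t) ≤ volume.restrict (Ioc 0 T) := fun t ht =>
    Measure.restrict_mono (Ioc_subset_Ioc_right ht.2) le_rfl
  have hA : ∀ t ∈ Icc 0 T, 0 ≤ ∫ s in 0..t, ψ s * D s := fun t ht => by
    rw [intervalIntegral.integral_of_le ht.1]
    exact integral_nonneg_of_ae (hD0'.filter_mono (ae_mono (hsub t ht)))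
  have hb : ∀ t ∈ Icc 0 T, ψ t * y t + ∫ s in 0..t, ψ s * D s ≤ A := by
    intro t ht
    have ih : IntegrableOn h (Ioc 0 t) := hhi.mono_set (Ioc_subset_Ioc_right ht.2)
    have iD : IntegrableOn (fun t => ψ t * D t) (Ioc 0 t) := hDi.mono_set
      (Ioc_subset_Ioc_right ht.2)
    rw [← hFTC t ht, intervalIntegral.integral_of_le ht.1, intervalIntegral.integral_of_le ht.1,
      ← integral_add ih iD]
    refine (integral_mono_ae (ih.add iD) (ih.add iD).pos_part
      (Eventually.of_forall fun s => le_max_left _ 0)).trans ?_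
    rw [integral_eq_lintegral_of_nonneg_ae (Eventually.of_forall fun s => le_max_right _ 0)
      (ih.add iD).pos_part.aestronglyMeasurable]
    refine ENNReal.toReal_mono hfin
      ((lintegral_mono' (hsub t ht) le_rfl).trans (lintegral_mono_ae ?_))
    filter_upwards [hae] with s hs
    exact ofReal_le_ofReal (max_le hs (abs_nonneg _))
  refine ⟨fun t ht => ?_, ?_⟩
  · have h1 : y t = exp (Φ t) * (ψ t * y t) := by rw [← mul_assoc, hψe, one_mul]
    have h2 : ψ t * y t ≤ A := by linarith [hb t ht, hA t ht]
    rw [h1]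
    exact (mul_le_mul_of_nonneg_left h2 (exp_pos _).le).trans
      (mul_le_mul_of_nonneg_right (exp_le_exp.2 (hΦT t ht)) toReal_nonneg)
  · have hT' : T ∈ Icc 0 T := ⟨hT.le, le_rfl⟩
    have h1 : ∫⁻ t in Ioc 0 T, ofReal (D t) ≤
        ∫⁻ t in Ioc 0 T, ofReal (exp (Φ T)) * ofReal (ψ t * D t) :=
      setLIntegral_mono' measurableSet_Ioc fun t ht => by
        rw [← ofReal_mul (exp_pos _).le]
        refine ofReal_le_ofReal ?_
        have h2 : D t = exp (Φ t) * (ψ t * D t) := by rw [← mul_assoc, hψe, one_mul]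
        rw (occs := .pos [1]) [h2]
        exact mul_le_mul_of_nonneg_right (exp_le_exp.2 (hΦT t (Ioc_subset_Icc_self ht)))
          (mul_nonneg (exp_pos _).le (hD0 t ht))
    rw [lintegral_const_mul' _ _ ofReal_ne_top,
      ← ofReal_integral_eq_lintegral_ofReal hDi hD0', ← ofReal_mul (exp_pos _).le] at h1
    refine h1.trans (ofReal_le_ofReal (mul_le_mul_of_nonneg_left ?_ (exp_pos _).le))
    have h3 := hb T hT'
    rw [intervalIntegral.integral_of_le hT.le] at h3
    have h4 : 0 ≤ ψ T * y T := mul_nonneg (exp_pos _).le (hyn T hT')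
    linarith

end Gronwall

/-! ### Time regularity of discrete fields -/

section TimeRegularity

variable {tF : ℝ} {v w : ℝ → HybVec d}

/-- The discrete field `v` is given by the `C¹` coordinates `c` in a fixed basis. -/
structure HasCoord (M : Mesh Ω) (k : ℕ) (tF : ℝ) (v : ℝ → HybVec d)
    (c : Fin (Module.finrank ℝ (U0 M k)) → ℝ → ℝ) : Prop where
  contDiffOn : ∀ n, ContDiffOn ℝ 1 (c n) (Icc 0 tF)
  eq : ∀ t ∈ Icc 0 tF, v t = (∑ n, c n t • Module.finBasis ℝ (U0 M k) n : U0 M k)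

theorem exists_hasCoord (hv : ∀ t ∈ Icc 0 tF, MemU0 M k (v t))
    (h : ∀ l : U0 M k →ₗ[ℝ] ℝ, ∃ g : ℝ → ℝ, ContDiffOn ℝ 1 g (Icc 0 tF) ∧
      ∀ t ∈ Icc 0 tF, ∀ V : U0 M k, V.1 = v t → l V = g t) : ∃ c, HasCoord M k tF v c := by
  choose c hc he using fun n => h ((Module.finBasis ℝ (U0 M k)).coord n)
  refine ⟨c, hc, fun t ht => ?_⟩
  have h1 := (Module.finBasis ℝ (U0 M k)).sum_repr ⟨v t, hv t ht⟩
  refine (congrArg Subtype.val (h1.symm.trans (sum_congr rfl fun n _ => ?_)) :)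
  exact congrArg (· • _) (he n t ht ⟨v t, hv t ht⟩ rfl)

/-- Traces enter only through `isPullback`, by functionals bounded on `H¹₀`. -/
theorem exists_hasCoord_interp (hΩ : IsConvexPolytopalDomain Ω) (hd : 0 < d) {u : ℝ → Fin d → H1 Ω}
    (hu : ContDiffOn ℝ 1 u (Icc 0 tF)) (h0 : ∀ t ∈ Icc 0 tF, ∀ i, IsH10 (u t i)) :
    ∃ c, HasCoord M k tF (fun t => interp M k (u t)) c :=
  exists_hasCoord (fun t ht => interp_memU0 (h0 t ht) hΩ hd) fun l => by
    obtain ⟨m, hm⟩ := isPullback hΩ hd l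
    exact ⟨m ∘ u, hu.continuousLinearMap_comp m, fun t ht V hV => hm _ (h0 t ht) V hV⟩

theorem IsC1.exists_hasCoord (hv : IsC1 tF v) (h0 : ∀ t ∈ Icc 0 tF, MemU0 M k (v t)) :
    ∃ c, HasCoord M k tF v c := by
  refine MHD.exists_hasCoord h0 fun l => ?_
  let P : Submodule ℝ (Module.Dual ℝ (U0 M k)) :=
    { carrier := {l | ∃ g : ℝ → ℝ, ContDiffOn ℝ 1 g (Icc 0 tF) ∧
        ∀ t ∈ Icc 0 tF, ∀ V : U0 M k, V.1 = v t → l V = g t}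
      zero_mem' := ⟨0, contDiffOn_const, fun _ _ _ _ => rfl⟩
      add_mem' := fun ⟨g, hg, h⟩ ⟨g', hg', h'⟩ => ⟨g + g', hg.add hg', fun t ht V hV =>
        congrArg₂ (· + ·) (h t ht V hV) (h' t ht V hV)⟩
      smul_mem' := fun c _ ⟨g, hg, h⟩ => ⟨c • g, contDiffOn_const.smul hg, fun t ht V hV =>
        congrArg (c * ·) (h t ht V hV)⟩ }
  refine mem_of_separating P (fun V hV => Subtype.ext (Prod.ext ?_ ?_)) l
  · exact funext fun T => funext fun i => funext fun x => hV (LinearMap.proj x ∘ₗ elemMap M k T i)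
      ⟨_, hv.1 T i x, fun t _ V hV => by rw [← hV]; rfl⟩
  · exact funext fun F => funext fun i => funext fun x => hV (LinearMap.proj x ∘ₗ faceMap M k F i)
      ⟨_, hv.2 F i x, fun t _ V hV => by rw [← hV]; rfl⟩

variable {c c' : Fin (Module.finrank ℝ (U0 M k)) → ℝ → ℝ}

theorem HasCoord.sub (h : HasCoord M k tF v c) (h' : HasCoord M k tF w c') :
    HasCoord M k tF (fun t => v t - w t) (fun n t => c n t - c' n t) where
  contDiffOn n := (h.contDiffOn n).sub (h'.contDiffOn n)
  eq t ht := by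
    rw [h.eq t ht, h'.eq t ht, sum_congr rfl fun n _ => sub_smul (c n t) (c' n t)
      (Module.finBasis ℝ (U0 M k) n), sum_sub_distrib]
    rfl

theorem HasCoord.hdt_eq (h : HasCoord M k tF v c) {t : ℝ} (ht : t ∈ Icc 0 tF) (htF : 0 < tF) :
    hdt tF v t = (∑ n, derivWithin (c n) (Icc 0 tF) t • Module.finBasis ℝ (U0 M k) n : U0 M k) := by
  have key : ∀ (p : U0 M k →ₗ[ℝ] ℝ) (f : ℝ → ℝ), (∀ s ∈ Icc 0 tF, ∀ V : U0 M k, V.1 = v s →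
      f s = p V) → derivWithin f (Icc 0 tF) t =
      p (∑ n, derivWithin (c n) (Icc 0 tF) t • Module.finBasis ℝ (U0 M k) n) := by
    intro p f hf
    have h1 : ∀ s ∈ Icc 0 tF, f s = ∑ n, c n s * p (Module.finBasis ℝ (U0 M k) n) := fun s hs => by
      rw [hf s hs _ (h.eq s hs).symm]; simp
    have h2 : HasDerivWithinAt (fun s => ∑ n, c n s * p (Module.finBasis ℝ (U0 M k) n))
        (∑ n, derivWithin (c n) (Icc 0 tF) t * p (Module.finBasis ℝ (U0 M k) n)) (Icc 0 tF) t :=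
      HasDerivWithinAt.fun_sum fun n _ =>
        (((h.contDiffOn n).differentiableOn one_ne_zero t ht).hasDerivWithinAt).mul_const _
    rw [(h2.congr h1 (h1 t ht)).derivWithin (uniqueDiffOn_Icc htF t ht)]
    simp
  refine Prod.ext (funext fun T => funext fun i => funext fun x => ?_)
    (funext fun F => funext fun i => funext fun x => ?_)
  · exact key (LinearMap.proj x ∘ₗ elemMap M k T i)
      (fun s => (v s).1 T i x) fun s _ V hV => by rw [← hV]; rfl
  · exact key (LinearMap.proj x ∘ₗ faceMap M k F i)
      (fun s => (v s).2 F i x) fun s _ V hV => by rw [← hV]; rfl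

theorem HasCoord.memU_hdt (h : HasCoord M k tF v c) {t : ℝ} (ht : t ∈ Icc 0 tF) (htF : 0 < tF) :
    MemU M k (hdt tF v t) := by
  rw [h.hdt_eq ht htF]
  exact (Subtype.prop (_ : U0 M k)).1

theorem HasCoord.hdt_sub (h : HasCoord M k tF v c) (h' : HasCoord M k tF w c') {t : ℝ}
    (ht : t ∈ Icc 0 tF) (htF : 0 < tF) :
    hdt tF v t = hdt tF (fun t => v t - w t) t + hdt tF w t := by
  rw [h.hdt_eq ht htF, h'.hdt_eq ht htF, (h.sub h').hdt_eq ht htF, ← Submodule.coe_add,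
    ← sum_add_distrib]
  refine congrArg Subtype.val (sum_congr rfl fun n _ => ?_)
  have e : derivWithin (fun t => c n t - c' n t) (Icc 0 tF) t =
      derivWithin (c n) (Icc 0 tF) t - derivWithin (c' n) (Icc 0 tF) t :=
    derivWithin_fun_sub ((h.contDiffOn n).differentiableOn one_ne_zero t ht)
      ((h'.contDiffOn n).differentiableOn one_ne_zero t ht)
  rw [e, ← add_smul, sub_add_cancel]

theorem HasCoord.genForm_eq (h : HasCoord M k tF v c) (hd : 0 < d) (α β γ : Finset (Pt d) → ℝ)
    {t : ℝ} (ht : t ∈ Icc 0 tF) : genForm M α β γ (v t) (v t) =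
      ∑ n, c n t * ∑ m, c m t * genForm M α β γ (Module.finBasis ℝ (U0 M k) n).1
        (Module.finBasis ℝ (U0 M k) m).1 := by
  rw [h.eq t ht]
  change genBilin M k α β γ hd _ _ = _
  simp only [map_sum, map_smul, LinearMap.sum_apply, LinearMap.smul_apply, smul_eq_mul]
  refine sum_congr rfl fun n _ => congrArg _ (sum_congr rfl fun m _ => congrArg _ ?_)
  exact genForm_comm _ _

theorem HasCoord.contDiffOn_inner0 (h : HasCoord M k tF v c) (hd : 0 < d) :
    ContDiffOn ℝ 1 (fun t => inner0 M (v t) (v t)) (Icc 0 tF) := by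
  have h1 := h.contDiffOn
  refine ContDiffOn.congr ?_ fun t ht => (inner0_eq_genForm _ _).trans (h.genForm_eq hd _ _ _ ht)
  fun_prop

theorem HasCoord.derivWithin_inner0 (h : HasCoord M k tF v c) (hd : 0 < d) {t : ℝ}
    (ht : t ∈ Icc 0 tF) (htF : 0 < tF) :
    derivWithin (fun t => inner0 M (v t) (v t)) (Icc 0 tF) t = 2 * inner0 M (hdt tF v t) (v t) := by
  have hc := fun n => ((h.contDiffOn n).differentiableOn one_ne_zero t ht).hasDerivWithinAt
  have h1 := HasDerivWithinAt.fun_sum (u := Finset.univ) fun n _ => (hc n).mul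
    (HasDerivWithinAt.fun_sum (u := Finset.univ) fun m _ => (hc m).mul_const
      (genForm M (fun _ => 1) (fun _ => 0) diam (Module.finBasis ℝ (U0 M k) n).1
        (Module.finBasis ℝ (U0 M k) m).1))
  have h2 := (h1.congr (fun s hs => (inner0_eq_genForm _ _).trans (h.genForm_eq hd _ _ _ hs))
    ((inner0_eq_genForm _ _).trans (h.genForm_eq hd _ _ _ ht))).derivWithin
      (uniqueDiffOn_Icc htF t ht)
  rw [h2, h.hdt_eq ht htF, h.eq t ht, inner0_eq_genForm]
  change _ = 2 * genBilin M k _ _ _ hd _ _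
  simp only [map_sum, map_smul, LinearMap.sum_apply, LinearMap.smul_apply, smul_eq_mul,
    sum_add_distrib]
  rw [two_mul]
  refine congrArg₂ (· + ·) ?_ (sum_congr rfl fun n _ => congrArg _
    (sum_congr rfl fun m _ => congrArg _ (genForm_comm _ _)))
  simp only [mul_sum]
  rw [sum_comm]
  exact sum_congr rfl fun n _ => sum_congr rfl fun m _ => mul_left_comm _ _ _

theorem HasCoord.continuousOn_norm1sq (h : HasCoord M k tF v c) (hd : 0 < d) :
    ContinuousOn (fun t => norm1sq M (v t)) (Icc 0 tF) := by
  have h1 := fun n => (h.contDiffOn n).continuousOn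
  refine ContinuousOn.congr ?_ fun t ht => (norm1sq_eq_genForm _).trans (h.genForm_eq hd _ _ _ ht)
  fun_prop

theorem HasCoord.continuousOn_jForm (h : HasCoord M k tF v c) (hd : 0 < d)
    {α : ℝ → Finset (Pt d) → ℝ} (hα : IsUpwind M tF α) :
    ContinuousOn (fun t => jForm M (α t) (v t) (v t)) (Ioc 0 tF) := by
  have h1 := fun n => (h.contDiffOn n).continuousOn.mono Ioc_subset_Icc_self
  refine ContinuousOn.congr ?_ fun t ht => (jForm_eq_genForm _ _ _).trans
    (h.genForm_eq hd _ _ _ (Ioc_subset_Icc_self ht))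
  refine continuousOn_finsetSum _ fun n _ => (h1 n).mul (continuousOn_finsetSum _ fun m _ =>
    (h1 m).mul ?_)
  simp only [← jForm_eq_genForm, jForm]
  exact continuousOn_finsetSum _ fun T hT => (hα T hT).1.mul continuousOn_const

end TimeRegularity

/-! ### Essential bounds of the solutions -/

variable {tF : ℝ} {u : ℝ → Fin d → H1 Ω}

theorem tendsto_eLpNorm_coord {v : ℕ → Fin d → H1 Ω} {w : Fin d → H1 Ω}
    (h : Tendsto v atTop (𝓝 w)) (i j : Fin d) : Tendsto (fun n => eLpNorm
      (fun x => grad (v n i) j x - grad (w i) j x) 2 (volume.restrict Ω)) atTop (𝓝 0) := by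
  have hc : Continuous fun v : Fin d → H1 Ω => grad (v i) j :=
    (PiLp.continuous_apply 2 _ (some j)).comp (continuous_subtype_val.comp (continuous_apply i))
  refine ((Lp.tendsto_Lp_iff_tendsto_eLpNorm' _ _).1 ((hc.tendsto w).comp h)).congr fun n => ?_
  rfl

theorem lowerSemicontinuous_semiW1inf :
    LowerSemicontinuous (semiW1inf : (Fin d → H1 Ω) → ℝ≥0∞) := by
  refine lowerSemicontinuous_iff_isClosed_preimage.2 fun c => IsSeqClosed.isClosed fun v w hv h => ?_
  have hm : ∀ v : Fin d → H1 Ω, AEStronglyMeasurable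
      (fun x => sqrt (∑ i, ∑ j, (grad (v i) j x) ^ 2)) (volume.restrict Ω) := fun v =>
    Real.continuous_sqrt.comp_aestronglyMeasurable (Finset.aestronglyMeasurable_fun_sum _ fun i _ =>
      Finset.aestronglyMeasurable_fun_sum _ fun j _ =>
        (Lp.aestronglyMeasurable (grad (v i) j)).pow 2)
  set g : ℕ → Fin d × Fin d → Pt d → ℝ := fun n p x => ‖grad (v n p.1) p.2 x - grad (w p.1) p.2 x‖
  have hg : ∀ n p, AEStronglyMeasurable (g n p) (volume.restrict Ω) := fun n p =>
    ((Lp.aestronglyMeasurable (grad (v n p.1) p.2)).sub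
      (Lp.aestronglyMeasurable (grad (w p.1) p.2))).norm
  have h0 : Tendsto (fun n => eLpNorm (∑ p, g n p) 2 (volume.restrict Ω)) atTop (𝓝 0) := by
    refine tendsto_of_tendsto_of_tendsto_of_le_of_le tendsto_const_nhds
      (h := fun n => ∑ p, eLpNorm (g n p) 2 (volume.restrict Ω)) ?_
      (fun _ => bot_le) fun n => eLpNorm_sum_le (fun p _ => hg n p) one_le_two
    have h2 : ∀ p, Tendsto (fun n => eLpNorm (g n p) 2 (volume.restrict Ω)) atTop
      (𝓝 0) := fun p => by
      have h3 := tendsto_eLpNorm_coord h p.1 p.2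
      simp only [← eLpNorm_norm (fun x => grad (v _ p.1) p.2 x - grad (w p.1) p.2 x)] at h3
      exact h3
    have h4 := tendsto_finsetSum Finset.univ fun p _ => h2 p
    rwa [sum_const_zero] at h4
  have h1 : TendstoInMeasure (volume.restrict Ω) (fun n => ∑ p, g n p) atTop 0 :=
    tendstoInMeasure_of_tendsto_eLpNorm two_ne_zero
      (fun n => Finset.aestronglyMeasurable_sum _ fun p _ => hg n p)
      aestronglyMeasurable_zero (by simpa using h0)
  obtain ⟨ns, -, hns⟩ := h1.exists_seq_tendsto_ae
  refine (Lp.eLpNorm_lim_le_liminf_eLpNorm (f := fun n x =>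
    sqrt (∑ i, ∑ j, (grad (v (ns n) i) j x) ^ 2)) (fun n => hm _) _ ?_).trans
      (liminf_le_of_frequently_le' (Frequently.of_forall fun n => hv (ns n)))
  filter_upwards [hns] with x hx
  refine (Real.continuous_sqrt.tendsto _).comp (tendsto_finsetSum _ fun i _ =>
    tendsto_finsetSum _ fun j _ => Tendsto.pow ?_ 2)
  refine tendsto_iff_norm_sub_tendsto_zero.2
    (squeeze_zero (fun _ => norm_nonneg _) (fun n => ?_) hx)
  rw [Finset.sum_apply]
  exact single_le_sum (f := fun p => g (ns n) p x) (fun _ _ => abs_nonneg _)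
    (Finset.mem_univ (i, j))

/-- The seminorm is measurable in time since it is lower semicontinuous. -/
theorem MemL1W1inf.intervalIntegrable (h : MemL1W1inf tF u) (hu : ContinuousOn u (Icc 0 tF))
    (htF : 0 < tF) : IntervalIntegrable (fun t => (semiW1inf (u t)).toReal) volume 0 tF := by
  rw [intervalIntegrable_iff_integrableOn_Ioc_of_le htF.le, IntegrableOn, ← restrict_Ioo_eq_restrict_Ioc]
  refine integrable_toReal_of_lintegral_ne_top ?_ ?_
  · have h1 : Continuous fun t => u (projIcc 0 tF htF.le t) :=
      (continuousOn_iff_continuous_domRestrict.1 hu).comp continuous_projIcc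
    refine (lowerSemicontinuous_semiW1inf.comp h1).measurable.aemeasurable.congr ?_
    filter_upwards [ae_restrict_mem measurableSet_Ioo] with t ht
    simp only [Function.comp, projIcc_of_mem _ (Ioo_subset_Icc_self ht)]
  · exact ((lintegral_mono fun t => le_add_self).trans_lt h.2).ne

theorem MemL1W1inf.ae_bound (h : MemL1W1inf tF u) : ∀ᵐ t ∂volume.restrict (Ioo 0 tF),
    (∃ B, 0 ≤ B ∧ ∀ i, ∀ᵐ x ∂volume.restrict Ω, |val (u t i) x| ≤ B) ∧
    ∀ i j, ∀ᵐ x ∂volume.restrict Ω, |grad (u t i) j x| ≤ (semiW1inf (u t)).toReal := by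
  filter_upwards [ae_lt_top' h.1 h.2.ne] with t ht
  have h1 := (ENNReal.add_lt_top.1 ht)
  have key : ∀ {F : Pt d → ℝ}, (∀ x, 0 ≤ F x) → eLpNorm F ∞ (volume.restrict Ω) < ⊤ →
      ∀ᵐ x ∂volume.restrict Ω, F x ≤ (eLpNorm F ∞ (volume.restrict Ω)).toReal := by
    intro F hF hfin
    filter_upwards [ae_le_eLpNormEssSup (f := F)] with x hx
    rw [← eLpNorm_exponent_top] at hx
    have := ENNReal.toReal_mono hfin.ne hx
    rwa [toReal_enorm, norm_of_nonneg (hF x)] at this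
  refine ⟨⟨_, toReal_nonneg (a := eLpNorm (fun x => sqrt (∑ i, (val (u t i) x) ^ 2)) ∞
    (volume.restrict Ω)), fun i => ?_⟩, fun i j => ?_⟩
  · filter_upwards [key (fun _ => Real.sqrt_nonneg _) h1.1] with x hx
    exact (Real.abs_le_sqrt (single_le_sum (f := fun i => (val (u t i) x) ^ 2)
      (fun _ _ => sq_nonneg _) (Finset.mem_univ i))).trans hx
  · filter_upwards [key (fun _ => Real.sqrt_nonneg _) h1.2] with x hx
    exact (Real.abs_le_sqrt ((single_le_sum (f := fun j => (grad (u t i) j x) ^ 2)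
      (fun _ _ => sq_nonneg _) (Finset.mem_univ j)).trans (single_le_sum
        (f := fun i => ∑ j, (grad (u t i) j x) ^ 2)
        (fun _ _ => sum_nonneg fun _ _ => sq_nonneg _) (Finset.mem_univ i)))).trans hx

/-! ### The error equation -/

theorem memLp_conv {a w : Fin d → H1 Ω} (ha : ∃ B, 0 ≤ B ∧ ∀ i, ∀ᵐ x ∂volume.restrict Ω,
    |val (a i) x| ≤ B) (i : Fin d) :
    MemLp (fun x => ∑ j, val (a j) x * grad (w i) j x) 2 (volume.restrict Ω) := by
  obtain ⟨B, -, hB⟩ := ha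
  refine memLp_finsetSum _ fun j _ => MemLp.of_le_mul (c := B) (Lp.memLp (grad (w i) j))
    ((Lp.aestronglyMeasurable _).mul (Lp.aestronglyMeasurable _)) ?_
  filter_upwards [hB j] with x hx
  rw [norm_mul]
  exact mul_le_mul_of_nonneg_right hx (norm_nonneg _)

theorem integral_sum_combine {A₁ A₂ A₃ A₄ V : Fin d → Pt d → ℝ}
    (h₁ : ∀ i, MemLp (A₁ i) 2 (volume.restrict Ω)) (h₂ : ∀ i, MemLp (A₂ i) 2 (volume.restrict Ω))
    (h₃ : ∀ i, MemLp (A₃ i) 2 (volume.restrict Ω)) (h₄ : ∀ i, MemLp (A₄ i) 2 (volume.restrict Ω))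
    (hV : ∀ i, MemLp (V i) 2 (volume.restrict Ω)) :
    ∫ x in Ω, ∑ i, (A₁ i x + A₂ i x - A₃ i x - A₄ i x) * V i x =
      (∫ x in Ω, ∑ i, A₁ i x * V i x) + (∫ x in Ω, ∑ i, A₂ i x * V i x)
      - (∫ x in Ω, ∑ i, A₃ i x * V i x) - ∫ x in Ω, ∑ i, A₄ i x * V i x := by
  have hi : ∀ {G : Fin d → Pt d → ℝ}, (∀ i, MemLp (G i) 2 (volume.restrict Ω)) →
      IntegrableOn (fun x => ∑ i, G i x * V i x) Ω := fun hG =>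
    integrable_finsetSum _ fun i _ => (hG i).integrable_mul (hV i)
  have i12 : IntegrableOn (fun x => ∑ i, A₁ i x * V i x + ∑ i, A₂ i x * V i x) Ω :=
    (hi h₁).add (hi h₂)
  have i123 : IntegrableOn (fun x => ∑ i, A₁ i x * V i x + ∑ i, A₂ i x * V i x -
    ∑ i, A₃ i x * V i x) Ω := i12.sub (hi h₃)
  rw [← integral_add (hi h₁) (hi h₂), ← integral_sub i12 (hi h₃), ← integral_sub i123 (hi h₄)]
  refine congrArg (fun f : Pt d → ℝ => ∫ x in Ω, f x) (funext fun x => ?_)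
  rw [← sum_add_distrib, ← sum_sub_distrib, ← sum_sub_distrib]
  exact sum_congr rfl fun i _ => by ring

/-- The pressure term of the weak equation has no counterpart here. -/
theorem IsDivFree.weak_form_combine (hd : 0 < d) (hΩ : IsConvexPolytopalDomain Ω) (hz : MemU M k z)
    (h : IsDivFree M z) {A₁ A₂ A₃ A₄ : Fin d → Pt d → ℝ} {w : Fin d → H1 Ω} {P : H1 Ω} {ν : ℝ}
    (h₁ : ∀ i, MemLp (A₁ i) 2 (volume.restrict Ω)) (h₂ : ∀ i, MemLp (A₂ i) 2 (volume.restrict Ω))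
    (h₃ : ∀ i, MemLp (A₃ i) 2 (volume.restrict Ω)) (h₄ : ∀ i, MemLp (A₄ i) 2 (volume.restrict Ω))
    (hw : ∀ v : Fin d → H1 Ω, (∀ i, IsH10 (v i)) →
      (∫ x in Ω, ∑ i, A₁ i x * val (v i) x) + ν * aCont w v + (∫ x in Ω, ∑ i, A₂ i x * val (v i) x)
      - (∫ x in Ω, ∑ i, A₃ i x * val (v i) x) + BCont v (val P)
      = ∫ x in Ω, ∑ i, A₄ i x * val (v i) x) (hH : ∀ i, ∃ H, IsBrokenHess M (w i) H) :
          (∫ x in Ω, ∑ i, A₁ i x * broken M z i x) - ν * (∫ x in Ω, ∑ i, lap M (w i) x * broken M z i x)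
      + (∫ x in Ω, ∑ i, A₂ i x * broken M z i x) - (∫ x in Ω, ∑ i, A₃ i x * broken M z i x)
      = ∫ x in Ω, ∑ i, A₄ i x * broken M z i x := by
  have hG : ∀ i, MemLp (fun x => A₁ i x + A₂ i x - A₃ i x - A₄ i x) 2 (volume.restrict Ω) :=
    fun i => (((h₁ i).add (h₂ i)).sub (h₃ i)).sub (h₄ i)
  have h1 := h.weak_form (ν := ν) (u := w) (P := P) hd hΩ hz hG (fun v hv => by
    rw [integral_sum_combine h₁ h₂ h₃ h₄ fun i => Lp.memLp (val (v i))]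
    linear_combination hw v hv) hH
  rw [integral_sum_combine h₁ h₂ h₃ h₄ fun i => hz.memLp_broken hd hΩ i] at h1
  linear_combination h1

/-- The exact solution, tested with a discrete divergence-free field. -/
theorem IsDivFree.residual_eq (hd : 0 < d) (hΩ : IsConvexPolytopalDomain Ω) (hz : MemU M k z)
    (h : IsDivFree M z) {D a₁ w₁ a₂ w₂ w : Fin d → H1 Ω} {f : Fin d → L2 Ω} {q : L2 Ω} {ν : ℝ}
    (hq : ∃ P : H1 Ω, val P = q)
    (h₁ : ∃ B, 0 ≤ B ∧ ∀ i, ∀ᵐ x ∂volume.restrict Ω, |val (a₁ i) x| ≤ B)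
    (h₂ : ∃ B, 0 ≤ B ∧ ∀ i, ∀ᵐ x ∂volume.restrict Ω, |val (a₂ i) x| ≤ B)
    (hw : ∀ v : Fin d → H1 Ω, (∀ i, IsH10 (v i)) →
      (∫ x in Ω, ∑ i, val (D i) x * val (v i) x) + ν * aCont w v + tCont a₁ w₁ v - tCont a₂ w₂ v
        + BCont v q = ∫ x in Ω, ∑ i, f i x * val (v i) x) (hH : ∀ i, ∃ H, IsBrokenHess M (w i) H) :
            (∫ x in Ω, ∑ i, val (D i) x * broken M z i x)
      - ν * (∫ x in Ω, ∑ i, lap M (w i) x * broken M z i x)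
      + (∫ x in Ω, ∑ i, (∑ j, val (a₁ j) x * grad (w₁ i) j x) * broken M z i x)
      - (∫ x in Ω, ∑ i, (∑ j, val (a₂ j) x * grad (w₂ i) j x) * broken M z i x)
      = ∫ x in Ω, ∑ i, f i x * broken M z i x := by
  obtain ⟨P, rfl⟩ := hq
  exact h.weak_form_combine hd hΩ hz (fun i => Lp.memLp (val (D i))) (memLp_conv h₁) (memLp_conv h₂)
    (fun i => Lp.memLp (f i)) hw hH

variable {I J e f : HybVec d}

theorem tForm_add_add (hd : 0 < d) (hI : MemU0 M k I) (he : MemU0 M k e) (hJ : MemU M k J)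
    (hf : MemU M k f) (hz : MemU M k z) :
    tForm M (I + e) (J + f) z = tForm M I J z + tForm M (I + e) f z + tForm M e J z := by
  rw [tForm_add_mid hd ((U0 M k).add_mem hI he).1 hJ hf hz, tForm_add_left hd hI.1 he.1 hJ hz]
  ring

/-- The convective terms of the error equation. -/
theorem convective_identity (hd : 0 < d) (hI : MemU0 M k I) (he : MemU0 M k e) (hJ : MemU0 M k J)
    (hf : MemU0 M k f) (h1 : IsDivFree M (I + e)) (h2 : IsDivFree M (J + f)) :
    tForm M (I + e) (I + e) e - tForm M I I e - (tForm M (J + f) (J + f) e - tForm M J J e)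
      + (tForm M (I + e) (J + f) f - tForm M I J f) - (tForm M (J + f) (I + e) f - tForm M J I f)
      = tForm M e I e - tForm M f J e + tForm M e J f - tForm M f I f := by
  have h3 := ((U0 M k).add_mem hI he).1
  have h4 := ((U0 M k).add_mem hJ hf).1
  rw [tForm_add_add hd hI he hI.1 he.1 he.1, tForm_add_add hd hJ hf hJ.1 hf.1 he.1,
    tForm_add_add hd hI he hJ.1 hf.1 hf.1, tForm_add_add hd hJ hf hI.1 he.1 hf.1]
  linarith [tForm_antisymm hd h3 h1 he.1 he.1, tForm_antisymm hd h3 h1 hf.1 hf.1,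
    tForm_antisymm hd h4 h2 he.1 hf.1]

theorem BForm_add (hd : 0 < d) (hI : MemU M k I) (he : MemU M k e) {q : HybScal d}
    (hq : MemP M k q) : BForm M k (I + e) q = BForm M k I q + BForm M k e q := by
  have hIe : ∀ T ∈ M.elems, (I + e).1 T ∈ RTN ((k : ℤ) + 1) T := fun T hT =>
    Submodule.add_mem _ (hI.elem T hT) (he.elem T hT)
  simp only [BForm, ← sum_add_distrib]
  refine sum_congr rfl fun T hT => ?_
  have hs := isSimplex hT
  have hqF := fun F hF => hq.face F (mem_faces_of_facesOf hd hT hF)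
  rw [hs.pgrad_spec hd (hq.elem T hT) hqF (hIe T hT), hs.pgrad_spec hd (hq.elem T hT) hqF
    (hI.elem T hT), hs.pgrad_spec hd (hq.elem T hT) hqF (he.elem T hT)]
  exact (pgradRHS hs hd k (hq.elem T hT) hqF).map_add ⟨_, hI.elem T hT⟩ ⟨_, he.elem T hT⟩

theorem inner0_add (hd : 0 < d) (hI : MemU M k I) (he : MemU M k e) (hz : MemU M k z) :
    inner0 M (I + e) z = inner0 M I z + inner0 M e z := by
  simp only [inner0_eq_genForm, genForm_add hd hI he hz]

theorem jForm_add (hd : 0 < d) (α : Finset (Pt d) → ℝ) (hI : MemU M k I) (he : MemU M k e)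
    (hz : MemU M k z) : jForm M α (I + e) z = jForm M α I z + jForm M α e z := by
  simp only [jForm_eq_genForm, genForm_add hd hI he hz]

variable {S : Finset (Pt d) → LinearMap.BilinForm ℝ (HybVec d)} {tF ν μ : ℝ}
  {β γ : ℝ → Finset (Pt d) → ℝ} {f g : ℝ → Fin d → L2 Ω} {u₀ b₀ : Fin d → H1 Ω}
  {u b : ℝ → Fin d → H1 Ω} {p r : ℝ → L2 Ω} {uh bh : ℝ → HybVec d} {ph rh : ℝ → HybScal d}

/-- The error equation, tested with the error. -/
theorem errGlobal_eq (hd : 0 < d) (hΩ : IsConvexPolytopalDomain Ω) (htF : 0 < tF)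
    (hs : IsWeakSolution tF ν μ f g u₀ b₀ u b p r)
    (hh : IsDiscreteSolution M k S tF ν μ β γ f g u₀ b₀ uh bh ph rh) {t : ℝ} (ht : t ∈ Ioc 0 tF)
    (hp : ∃ P : H1 Ω, val P = p t) (hr : ∃ P : H1 Ω, val P = r t)
    (hu : ∃ B, 0 ≤ B ∧ ∀ i, ∀ᵐ x ∂volume.restrict Ω, |val (u t i) x| ≤ B)
    (hb : ∃ B, 0 ≤ B ∧ ∀ i, ∀ᵐ x ∂volume.restrict Ω, |val (b t i) x| ≤ B)
    (hHu : ∀ i, ∃ H, IsBrokenHess M (u t i) H) (hHb : ∀ i, ∃ H, IsBrokenHess M (b t i) H)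
    {e f : HybVec d} (he : e = err M k uh u t) (hf : f = err M k bh b t) :
    errGlobal M k S tF ν μ β γ u b t e f =
      inner0 M (hdt tF (err M k uh u) t) e + inner0 M (hdt tF (err M k bh b) t) f
      + ν * aForm M k S e e + μ * aForm M k S f f + jForm M (β t) e e + jForm M (γ t) f f
      + (tForm M e (interp M k (u t)) e - tForm M f (interp M k (b t)) e
        + tForm M e (interp M k (b t)) f - tForm M f (interp M k (u t)) f) := by
  have ht' := Ioc_subset_Icc_self ht
  have hI := interp_memU0 (M := M) (k := k) (hs.zero_u t ht') hΩ hd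
  have hJ := interp_memU0 (M := M) (k := k) (hs.zero_b t ht') hΩ hd
  have he0 : MemU0 M k e := he ▸ (U0 M k).sub_mem (hh.mem_u t ht') hI
  have hf0 : MemU0 M k f := hf ▸ (U0 M k).sub_mem (hh.mem_b t ht') hJ
  have hue : uh t = interp M k (u t) + e := by rw [he, err]; abel
  have hbe : bh t = interp M k (b t) + f := by rw [hf, err]; abel
  have hBe : ∀ q, MemP0 M k q → BForm M k e q = 0 := fun q hq => by
    have h1 := hh.mass t ht q hq
    rwa [hue, BForm_add hd hI.1 he0.1 hq.1, BForm_interp_eq_zero (hs.zero_u t ht') hΩ hd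
      (hs.mass t ht) hq, zero_add] at h1
  have hBf : ∀ q, MemP0 M k q → BForm M k f q = 0 := fun q hq => by
    have h1 := hh.gauge t ht q hq
    rwa [hbe, BForm_add hd hJ.1 hf0.1 hq.1, BForm_interp_eq_zero (hs.zero_b t ht') hΩ hd
      (hs.gauge t ht) hq, zero_add] at h1
  have hed := isDivFree_of_BForm hd he0.1 hBe
  have hfd := isDivFree_of_BForm hd hf0.1 hBf
  have hud := isDivFree_of_BForm hd (hh.mem_u t ht').1 (hh.mass t ht)
  have hbd := isDivFree_of_BForm hd (hh.mem_b t ht').1 (hh.gauge t ht)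
  have c1 := hed.residual_eq hd hΩ he0.1 hp hu hb (hs.momentum t ht) hHu
  have c2 := hfd.residual_eq hd hΩ hf0.1 hr hu hb (hs.magnetic t ht) hHb
  have d1 := hh.momentum t ht e he0
  have d2 := hh.magnetic t ht f hf0
  rw [hBe _ (hh.mem_p t ht)] at d1
  rw [hBf _ (hh.mem_r t ht)] at d2
  obtain ⟨c, hc⟩ := hh.c1_u.exists_hasCoord hh.mem_u
  obtain ⟨c', hc'⟩ := exists_hasCoord_interp (M := M) (k := k) hΩ hd hs.c1_u hs.zero_u
  obtain ⟨a, ha⟩ := hh.c1_b.exists_hasCoord hh.mem_b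
  obtain ⟨a', ha'⟩ := exists_hasCoord_interp (M := M) (k := k) hΩ hd hs.c1_b hs.zero_b
  have m1 := (hc.sub hc').memU_hdt ht' htF
  have m2 := (ha.sub ha').memU_hdt ht' htF
  rw [hc.hdt_sub hc' ht' htF, inner0_add hd m1 (hc'.memU_hdt ht' htF) he0.1, hue,
    aForm_add hd S hI.1 he0.1 he0.1, jForm_add hd _ hI.1 he0.1 he0.1] at d1
  rw [ha.hdt_sub ha' ht' htF, inner0_add hd m2 (ha'.memU_hdt ht' htF) hf0.1, hbe,
    aForm_add hd S hJ.1 hf0.1 hf0.1, jForm_add hd _ hJ.1 hf0.1 hf0.1] at d2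
  rw [hue] at hud d2
  rw [hbe] at hbd d1
  have key := convective_identity hd hI he0 hJ hf0 hud hbd
  simp only [errGlobal, errTime, errDiff, errConv]
  rw [show err M k uh u = fun t => uh t - interp M k (u t) from rfl,
    show err M k bh b = fun t => bh t - interp M k (b t) from rfl]
  linear_combination c1 + c2 - d1 - d2 + key

/-! ### The error estimate -/

/-- The factor `c` is the coercivity constant of the diffusion form. -/
theorem energy_le {T c : ℝ} (hT : 0 < T) (hc : 0 < c) {y₁ y₂ n₁ n₂ Λ E : ℝ → ℝ}
    (hy₁ : ContDiffOn ℝ 1 y₁ (Icc 0 T)) (hy₂ : ContDiffOn ℝ 1 y₂ (Icc 0 T)) (h₁ : ∀ t, 0 ≤ y₁ t)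
    (h₂ : ∀ t, 0 ≤ y₂ t) (h0 : y₁ 0 + y₂ 0 = 0) (hn₁ : ContinuousOn n₁ (Ioc 0 T))
    (hn₂ : ContinuousOn n₂ (Ioc 0 T)) (hn₁0 : ∀ t ∈ Ioc 0 T, 0 ≤ n₁ t)
    (hn₂0 : ∀ t ∈ Ioc 0 T, 0 ≤ n₂ t) (hΛ : IntervalIntegrable Λ volume 0 T) (hΛ0 : ∀ t, 0 ≤ Λ t)
    (h : ∀ᵐ t ∂volume.restrict (Ioo 0 T), derivWithin (fun t => y₁ t + y₂ t) (Icc 0 T) t +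
      2 / c * (n₁ t + n₂ t) ≤ |2 * E t| + Λ t * (y₁ t + y₂ t)) :
        (⨆ t ∈ Icc 0 T, ofReal (y₁ t)) + (∫⁻ t in Ioc 0 T, ofReal (n₁ t)) +
          (⨆ t ∈ Icc 0 T, ofReal (y₂ t)) + ∫⁻ t in Ioc 0 T, ofReal (n₂ t) ≤
    ofReal ((4 + 2 * c) * exp (∫ t in 0..T, Λ t)) *
      ∫⁻ t in Ioc 0 T, ofReal |E t| := by
  by_cases hfin : ∫⁻ t in Ioc 0 T, ofReal |E t| = ⊤
  · rw [hfin, ENNReal.mul_top (ENNReal.ofReal_pos.2 (by positivity)).ne']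
    exact le_top
  have h2 : ∫⁻ t in Ioc 0 T, ofReal |2 * E t| = 2 * ∫⁻ t in Ioc 0 T, ofReal |E t| := by
    rw [← lintegral_const_mul' _ _ ENNReal.ofNat_ne_top]
    refine lintegral_congr fun t => ?_
    rw [abs_mul, ofReal_mul (abs_nonneg _)]
    simp
  obtain ⟨hy, hD⟩ := gronwall hT (hy₁.add hy₂) h0 (fun t _ => add_nonneg (h₁ t) (h₂ t)) hΛ hΛ0
    ((hn₁.add hn₂).const_smul (2 / c)) (fun t ht => mul_nonneg (by positivity)
      (add_nonneg (hn₁0 t ht) (hn₂0 t ht))) h (h2 ▸ ENNReal.mul_ne_top ENNReal.ofNat_ne_top hfin)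
  rw [h2, ENNReal.toReal_mul, ENNReal.toReal_ofNat] at hy hD
  set A := (∫⁻ t in Ioc 0 T, ofReal |E t|).toReal with hA
  have hA0 : 0 ≤ A := toReal_nonneg
  set X := exp (∫ t in 0..T, Λ t) * (2 * A) with hX
  have hX0 : 0 ≤ X := by positivity
  have hsup : ∀ y : ℝ → ℝ, (∀ t, y t ≤ y₁ t + y₂ t) →
      ⨆ t ∈ Icc 0 T, ofReal (y t) ≤ ofReal X := fun y hy' =>
    iSup₂_le fun t ht => ofReal_le_ofReal ((hy' t).trans (hy t ht))
  have hint : ∀ n : ℝ → ℝ, (∀ t ∈ Ioc 0 T, n t ≤ n₁ t + n₂ t) →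
      ∫⁻ t in Ioc 0 T, ofReal (n t) ≤ ofReal (c / 2 * X) := fun n hn => by
    rw [ofReal_mul (by positivity)]
    refine le_trans ?_ (mul_le_mul_right hD _)
    rw [← lintegral_const_mul' _ _ ofReal_ne_top]
    refine setLIntegral_mono' measurableSet_Ioc fun t ht => ?_
    rw [← ofReal_mul (by positivity)]
    refine ofReal_le_ofReal ((hn t ht).trans (le_of_eq ?_))
    change n₁ t + n₂ t = c / 2 * (2 / c * (n₁ t + n₂ t))
    field_simp
  calc _ ≤ ofReal X + ofReal (c / 2 * X) + ofReal X +
        ofReal (c / 2 * X) := add_le_add (add_le_add (add_le_add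
          (hsup y₁ fun t => by linarith [h₂ t]) (hint n₁ fun t ht => by linarith [hn₂0 t ht]))
          (hsup y₂ fun t => by linarith [h₁ t])) (hint n₂ fun t ht => by linarith [hn₁0 t ht])
    _ = ofReal ((4 + 2 * c) * exp (∫ t in 0..T, Λ t)) * ofReal A := by
      rw [← ofReal_add hX0 (by positivity), ← ofReal_add (by positivity) hX0,
        ← ofReal_add (by positivity) (by positivity), ← ofReal_mul (by positivity)]
      congr 1
      rw [hX]; ring
    _ = _ := by rw [hA, ENNReal.ofReal_toReal hfin]

theorem inner0_self_nonneg (v : HybVec d) : 0 ≤ inner0 M v v := by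
  rw [inner0_eq_genForm]
  exact genForm_nonneg (fun _ _ => zero_le_one) (fun _ _ => le_rfl)
    (fun _ _ => Metric.diam_nonneg) v

theorem jForm_self_nonneg {α : Finset (Pt d) → ℝ}
    (hα : ∀ T ∈ M.elems, 0 ≤ α T) (v : HybVec d) : 0 ≤ jForm M α v v := by
  rw [jForm_eq_genForm]
  exact genForm_nonneg (fun _ _ => le_rfl) (fun _ _ => le_rfl) hα v

theorem norm1sq_nonneg (v : HybVec d) : 0 ≤ norm1sq M v := by
  rw [norm1sq_eq_genForm]
  exact genForm_nonneg (fun _ _ => le_rfl) (fun _ _ => zero_le_one)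
    (fun _ _ => inv_nonneg.2 Metric.diam_nonneg) v

/-- The rate `K` may be enlarged, so that one rate serves both dimensions. -/
theorem exists_error_bound (d k : ℕ) (hd : 0 < d) (σ : ℝ) (hσ : 0 < σ) :
    ∃ K₀ : ℝ, 0 < K₀ ∧ ∀ K : ℝ, K₀ ≤ K → ∀ η : ℝ, 1 ≤ η → ∃ C : ℝ, 0 < C ∧
    ∀ Ω : Set (Pt d), IsConvexPolytopalDomain Ω → ∀ tF : ℝ, 0 < tF →
    ∀ M : Mesh Ω, M.IsRegular σ →
    ∀ S : Finset (Pt d) → LinearMap.BilinForm ℝ (HybVec d), IsStabilization M k η S →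
    ∀ ν μ : ℝ, 0 < ν → 0 < μ →
    ∀ β γ : ℝ → Finset (Pt d) → ℝ, IsUpwind M tF β → IsUpwind M tF γ →
    ∀ (f g : ℝ → Fin d → L2 Ω) (u₀ b₀ : Fin d → H1 Ω) (u b : ℝ → Fin d → H1 Ω) (p r : ℝ → L2 Ω),
    IsWeakSolution tF ν μ f g u₀ b₀ u b p r →
    MemL1W1inf tF u → MemL1W1inf tF b → MemL2H2 M tF u → MemL2H2 M tF b →
    MemL2H1 tF p → MemL2H1 tF r →
    ∀ (uh bh : ℝ → HybVec d) (ph rh : ℝ → HybScal d),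
    IsDiscreteSolution M k S tF ν μ β γ f g u₀ b₀ uh bh ph rh →
    energySq M tF ν μ β γ (err M k uh u) (err M k bh b) ≤ ofReal (C * exp (K *
        ∫ t in (0 : ℝ)..tF, ((semiW1inf (u t)).toReal + (semiW1inf (b t)).toReal))) *
      ∫⁻ t in Ioc 0 tF, ofReal |errGlobal M k S tF ν μ β γ u b t
          (err M k uh u t) (err M k bh b t)| := by
  obtain ⟨Ct, hCt, ht⟩ := exists_tForm_bound d k hd σ hσ
  obtain ⟨Cl, hCl, hl⟩ := exists_lipBound_interp d k hd σ hσ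
  refine ⟨4 * (Ct * Cl), by positivity, fun K hK η hη => ?_⟩
  obtain ⟨Ca, hCa, ha⟩ := exists_aForm_coercive d k hd σ hσ η hη
  refine ⟨4 + 2 * (Ca + 1), by positivity, ?_⟩
  intro Ω hΩ tF htF M hM S hS ν μ hν hμ β γ hβ hγ f g u₀ b₀ u b p r hs hu hb hHu hHb hp hr uh bh
    ph rh hh
  have hK0 : 0 ≤ K := le_trans (by positivity) hK
  obtain ⟨c, hc⟩ := hh.c1_u.exists_hasCoord hh.mem_u
  obtain ⟨c', hc'⟩ := exists_hasCoord_interp (M := M) (k := k) hΩ hd hs.c1_u hs.zero_u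
  obtain ⟨a, hca⟩ := hh.c1_b.exists_hasCoord hh.mem_b
  obtain ⟨a', hca'⟩ := exists_hasCoord_interp (M := M) (k := k) hΩ hd hs.c1_b hs.zero_b
  have hce : HasCoord M k tF (err M k uh u) _ := hc.sub hc'
  have hcf : HasCoord M k tF (err M k bh b) _ := hca.sub hca'
  have iΛ := (hu.intervalIntegrable hs.c1_u.continuousOn htF).add
    (hb.intervalIntegrable hs.c1_b.continuousOn htF)
  have e0 : err M k uh u 0 = 0 := by rw [err, hh.init_u, hs.init_u, sub_self]
  have f0 : err M k bh b 0 = 0 := by rw [err, hh.init_b, hs.init_b, sub_self]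
  have z0 : inner0 M (0 : HybVec d) 0 = 0 := by simp [inner0, intT, intF]
  have hn : ∀ {v c α κ}, HasCoord M k tF v c → IsUpwind M tF α → 0 < κ →
      ContinuousOn (fun t => κ * norm1sq M (v t) + jForm M (α t) (v t) (v t)) (Ioc 0 tF) ∧
      ∀ t ∈ Ioc 0 tF, 0 ≤ κ * norm1sq M (v t) + jForm M (α t) (v t) (v t) := fun hv hα hκ =>
    ⟨(continuousOn_const.mul ((hv.continuousOn_norm1sq hd).mono Ioc_subset_Icc_self)).add
      (hv.continuousOn_jForm hd hα), fun t ht => add_nonneg (mul_nonneg hκ.le (norm1sq_nonneg _))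
        (jForm_self_nonneg (fun T hT => ((hα T hT).2 t ht).le) _)⟩
  rw [← intervalIntegral.integral_const_mul]
  refine energy_le (Λ := fun t => K *
      ((semiW1inf (u t)).toReal + (semiW1inf (b t)).toReal)) htF (by positivity)
        (hce.contDiffOn_inner0 hd) (hcf.contDiffOn_inner0 hd) (fun _ => inner0_self_nonneg _)
          (fun _ => inner0_self_nonneg _) (by simp [e0, f0, z0]) (hn hce hβ hν).1 (hn hcf hγ hμ).1
            (hn hce hβ hν).2 (hn hcf hγ hμ).2 (iΛ.const_mul _)
              (fun t => mul_nonneg hK0 (by positivity)) ?_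
  obtain ⟨Hu, -, hHu⟩ := hHu
  obtain ⟨Hb, -, hHb⟩ := hHb
  obtain ⟨P, -, hP⟩ := hp
  obtain ⟨R, -, hR⟩ := hr
  filter_upwards [hu.ae_bound, hb.ae_bound, hHu, hHb, hP, hR, ae_restrict_mem measurableSet_Ioo]
    with t hu hb hHu hHb hP hR ht0
  have ht1 := Ioo_subset_Ioc_self ht0
  have ht2 := Ioc_subset_Icc_self ht1
  rw [derivWithin_fun_add ((hce.contDiffOn_inner0 hd).differentiableOn one_ne_zero t ht2)
    ((hcf.contDiffOn_inner0 hd).differentiableOn one_ne_zero t ht2),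
    hce.derivWithin_inner0 hd ht2 htF, hcf.derivWithin_inner0 hd ht2 htF]
  have hE := errGlobal_eq hd hΩ htF hs hh ht1 ⟨_, hP⟩ ⟨_, hR⟩ hu.1 hb.1 (fun i => ⟨_, hHu i⟩)
    (fun i => ⟨_, hHb i⟩) rfl rfl
  have hI := (interp_memU0 (M := M) (k := k) (hs.zero_u t ht2) hΩ hd).1
  have hJ := (interp_memU0 (M := M) (k := k) (hs.zero_b t ht2) hΩ hd).1
  have he : MemU M k (err M k uh u t) := hce.eq t ht2 ▸ (Subtype.prop (_ : U0 M k)).1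
  have hf : MemU M k (err M k bh b t) := hcf.eq t ht2 ▸ (Subtype.prop (_ : U0 M k)).1
  obtain ⟨⟨Bu, hBu0, hBu⟩, hLu⟩ := hu
  obtain ⟨⟨Bb, hBb0, hBb⟩, hLb⟩ := hb
  have lu := hl Ω M hΩ hM _ (hs.zero_u t ht2) Bu _ hBu0 toReal_nonneg hBu hLu
  have lb := hl Ω M hΩ hM _ (hs.zero_b t ht2) Bb _ hBb0 toReal_nonneg hBb hLb
  set e := err M k uh u t
  set f := err M k bh b t
  set su := (semiW1inf (u t)).toReal with hsu
  set sb := (semiW1inf (b t)).toReal with hsb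
  have hsu0 : 0 ≤ Cl * su := mul_nonneg hCl.le toReal_nonneg
  have hsb0 : 0 ≤ Cl * sb := mul_nonneg hCl.le toReal_nonneg
  have t1 := ht Ω M hM e _ e he hI he _ hsu0 lu
  have t2 := ht Ω M hM f _ e hf hJ he _ hsb0 lb
  have t3 := ht Ω M hM e _ f he hJ hf _ hsb0 lb
  have t4 := ht Ω M hM f _ f hf hI hf _ hsu0 lu
  have key : ∀ {v κ}, MemU M k v → 0 < κ → κ * norm1sq M v ≤ (Ca + 1) * (κ * aForm M k S v v) := by
    intro v κ hv hκ
    have h1 := ha Ω M hM S hS v hv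
    have h2 : 0 ≤ aForm M k S v v := nonneg_of_mul_nonneg_right ((norm1sq_nonneg v).trans h1) hCa
    nlinarith
  have kj : ∀ {x : ℝ}, 0 ≤ x → x ≤ (Ca + 1) * x := fun hx => by nlinarith
  have a1 := key he hν
  have a2 := key hf hμ
  have j1 := kj (jForm_self_nonneg (M := M) (fun T hT => ((hβ T hT).2 t ht1).le) e)
  have j2 := kj (jForm_self_nonneg (M := M) (fun T hT => ((hγ T hT).2 t ht1).le) f)
  have hD : 2 / (Ca + 1) * (ν * norm1sq M e + jForm M (β t) e e +
      (μ * norm1sq M f + jForm M (γ t) f f)) ≤ 2 * (ν * aForm M k S e e + jForm M (β t) e e +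
      (μ * aForm M k S f f + jForm M (γ t) f f)) := by
    rw [div_mul_eq_mul_div, div_le_iff₀ (by positivity)]
    linarith
  have hab := le_abs_self (2 * errGlobal M k S tF ν μ β γ u b t e f)
  have hΛ : 4 * (Ct * Cl) * ((su + sb) * (inner0 M e e + inner0 M f f)) ≤
      K * ((su + sb) * (inner0 M e e + inner0 M f f)) :=
    mul_le_mul_of_nonneg_right hK (mul_nonneg (add_nonneg toReal_nonneg
      toReal_nonneg) (add_nonneg (inner0_self_nonneg _) (inner0_self_nonneg _)))
  rw [abs_le] at t1 t2 t3 t4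
  refine (add_le_add_right hD _).trans ?_
  linarith

end MHD

end

theorem theorem2 (k : ℕ) (σ : ℝ) (hσ : 0 < σ) :
    ∃ CK : ℝ, 0 < CK ∧
    ∀ d : ℕ, d = 2 ∨ d = 3 →
    ∀ Ω : Set (Pt d), IsConvexPolytopalDomain Ω →
    ∀ tF : ℝ, 0 < tF →
    ∀ η : ℝ, 1 ≤ η →
    ∃ C : ℝ, 0 < C ∧
    ∀ M : Mesh Ω, M.IsRegular σ →
    ∀ S : Finset (Pt d) → LinearMap.BilinForm ℝ (HybVec d), IsStabilization M k η S →
    ∀ ν μ : ℝ, 0 < ν → 0 < μ →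
    ∀ β γ : ℝ → Finset (Pt d) → ℝ, IsUpwind M tF β → IsUpwind M tF γ →
    ∀ f g : ℝ → Fin d → L2 Ω, IsSource tF f g →
    ∀ (u₀ b₀ : Fin d → H1 Ω) (u b : ℝ → Fin d → H1 Ω) (p r : ℝ → L2 Ω),
    IsWeakSolution tF ν μ f g u₀ b₀ u b p r →
    MemL1W1inf tF u → MemL1W1inf tF b →
    MemL2H2 M tF u → MemL2H2 M tF b →
    MemL2H1 tF p → MemL2H1 tF r →
    ∀ (uh bh : ℝ → HybVec d) (ph rh : ℝ → HybScal d),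
    IsDiscreteSolution M k S tF ν μ β γ f g u₀ b₀ uh bh ph rh →
    energySq M tF ν μ β γ (err M k uh u) (err M k bh b) ≤
      ENNReal.ofReal (C * Real.exp (CK *
        ∫ t in (0 : ℝ)..tF, ((semiW1inf (u t)).toReal + (semiW1inf (b t)).toReal))) *
      ∫⁻ t in Ioc 0 tF,
        ENNReal.ofReal |errGlobal M k S tF ν μ β γ u b t
          (err M k uh u t) (err M k bh b t)| := by
  obtain ⟨K₂, h₂, H₂⟩ := exists_error_bound 2 k two_pos σ hσ
  obtain ⟨K₃, -, H₃⟩ := exists_error_bound 3 k three_pos σ hσ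
  refine ⟨max K₂ K₃, lt_max_of_lt_left h₂, ?_⟩
  rintro d (rfl | rfl) Ω hΩ tF htF η hη
  · obtain ⟨C, hC, h⟩ := H₂ _ (le_max_left K₂ K₃) η hη
    exact ⟨C, hC, fun M hM S hS ν μ hν hμ β γ hβ hγ f g _ =>
      h Ω hΩ tF htF M hM S hS ν μ hν hμ β γ hβ hγ f g⟩
  · obtain ⟨C, hC, h⟩ := H₃ _ (le_max_right K₂ K₃) η hη
    exact ⟨C, hC, fun M hM S hS ν μ hν hμ β γ hβ hγ f g _ =>
      h Ω hΩ tF htF M hM S hS ν μ hν hμ β γ hβ hγ f g⟩
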